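/- Let $M\ge 2$, and consider a broadcast channel with $M$ transmit antennas, $K=M$ single-antenna users and transmit power $P>0$. The channel vectors $\mathbf h_1,\dots,\mathbf h_K\in\mathbb C^M$ have i.i.d. circularly symmetric complex Gaussian entries of zero mean and unit variance. For a feedback rate sharing strategy $\mathbf b=[b_1,\dots,b_K]$ of non-negative integers, user $k$ has a random codebook $\mathcal W_k$ of $2^{b_k}$ isotropic unit vectors in $\mathbb C^M$ (all codewords and channel vectors independent) and feeds back $\hat{\mathbf h}_k=\arg\max_{\mathbf w\in\mathcal W_k}|\mathbf h_k^\dagger\mathbf w|^2$. The zero-forcing precoding vector $\mathbf v_k$ is the normalized $k$th column of $\hat{\mathbf H}^{-1}$, where $\hat{\mathbf H}=[\hat{\mathbf h}_1,\dots,\hat{\mathbf h}_K]^\dagger$. The average sum rate is $$\mathcal R(P,\mathbf b)=\sum_{k=1}^K\mathbb E\left[\log_2\left(1+\frac{\frac PM|\mathbf h_k^\dagger\mathbf v_k|^2}{1+\sum_{i\ne k}\frac PM|\mathbf h_k^\dagger\mathbf v_i|^2}\right)\right].$$ Then all these expectations are finite, and for every strategy $\mathbf b$ the limit $\mathcal R(\infty,\mathbf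 b)=\lim_{P\to\infty}\mathcal R(P,\mathbf b)$ exists and is finite. Moreover, for every positive integer $\bar b$, among all strategies with $\sum_{k=1}^K b_k=K\bar b$, in the high SNR region (that is, with respect to $\mathcal R(\infty,\cdot)$) allocating the whole feedback amount $K\bar b$ to a single user, whichever user it is, is optimal, and allocating $b_k=\bar b$ to every user is worst: $$\mathcal R(\infty,[\bar b,\dots,\bar b])\le\mathcal R(\infty,\mathbf b)\le\mathcal R(\infty,[0,\dots,0,K\bar b,0,\dots,0]).$$ -/

import Mathlib

open MeasureTheory ProbabilityTheory Filter Topology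
open scoped Matrix

noncomputable section

namespace FeedbackSharing

/-- The circularly symmetric complex Gaussian law with mean zero and unit variance:
independent real and imaginary parts, each real Gaussian with mean `0` and variance `1/2`. -/
def complexGaussian : Measure ℂ :=
  ((gaussianReal 0 (1 / 2)).prod (gaussianReal 0 (1 / 2))).map
    (fun p : ℝ × ℝ => (⟨p.1, p.2⟩ : ℂ))

/-- The law of a channel vector: `M` i.i.d. standard complex Gaussian entries. -/
def channelLaw (M : ℕ) : Measure (Fin M → ℂ) :=
  Measure.pi fun _ => complexGaussian

/-- The Euclidean norm on `ℂ^M`. -/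
def l2norm {M : ℕ} (v : Fin M → ℂ) : ℝ :=
  Real.sqrt (∑ i, ‖v i‖ ^ 2)

/-- `v / ‖v‖` (and `0` for `v = 0`). -/
def direction {M : ℕ} (v : Fin M → ℂ) : Fin M → ℂ :=
  fun i => v i / (l2norm v : ℂ)

/-- The law of an isotropic (uniformly distributed) unit vector of `ℂ^M`, obtained as the
direction of a standard complex Gaussian vector. -/
def isotropicLaw (M : ℕ) : Measure (Fin M → ℂ) :=
  (channelLaw M).map direction

/-- `|x† y|²`. -/
def gain {M : ℕ} (x y : Fin M → ℂ) : ℝ :=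
  ‖star x ⬝ᵥ y‖ ^ 2

/-- The outcomes of one channel realization under the strategy `b`: the channel vectors of the
`M` users, and for each user `k` a codebook of `2 ^ b k` vectors. -/
abbrev Outcome (M : ℕ) (b : Fin M → ℕ) : Type :=
  (Fin M → Fin M → ℂ) × ((k : Fin M) → Fin (2 ^ b k) → Fin M → ℂ)

/-- The joint law: all channel vectors and all codewords are independent, the channel vectors
are standard complex Gaussian, and the codewords are isotropic unit vectors. -/
def outcomeLaw (M : ℕ) (b : Fin M → ℕ) : Measure (Outcome M b) :=
  (Measure.pi fun _ : Fin M => channelLaw M).prod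
    (Measure.pi fun k : Fin M => Measure.pi fun _ : Fin (2 ^ b k) => isotropicLaw M)

theorem exists_best {M n : ℕ} (h : Fin M → ℂ) (w : Fin (2 ^ n) → Fin M → ℂ) :
    ∃ j, ∀ i, gain h (w i) ≤ gain h (w j) :=
  Finite.exists_max fun i => gain h (w i)

open Classical in
/-- The quantized channel: the codeword `w` maximizing `|h† w|²` (the first one, if there are
several; ties have probability zero when `M ≥ 2`). -/
def quantize {M n : ℕ} (h : Fin M → ℂ) (w : Fin (2 ^ n) → Fin M → ℂ) : Fin M → ℂ :=
  w (Fin.find (fun j => ∀ i, gain h (w i) ≤ gain h (w j)) (exists_best h w))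

/-- The quantized channel matrix `Ĥ`, whose `k`th row is `ĥ_k†`. -/
def quantizedMatrix {M : ℕ} {b : Fin M → ℕ} (ω : Outcome M b) : Matrix (Fin M) (Fin M) ℂ :=
  Matrix.of fun k => star (quantize (ω.1 k) (ω.2 k))

/-- The zero-forcing precoding vector of user `k`: the normalized `k`th column of `Ĥ⁻¹`. -/
def precoder {M : ℕ} {b : Fin M → ℕ} (ω : Outcome M b) (k : Fin M) : Fin M → ℂ :=
  direction fun i => (quantizedMatrix ω)⁻¹ i k

/-- The instantaneous rate (bits per channel use) of user `k` at transmit power `P`. -/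
def instRate {M : ℕ} {b : Fin M → ℕ} (P : ℝ) (k : Fin M) (ω : Outcome M b) : ℝ :=
  Real.logb 2 (1 + P / M * gain (ω.1 k) (precoder ω k) /
    (1 + ∑ i ∈ Finset.univ.erase k, P / M * gain (ω.1 k) (precoder ω i)))

/-- The average sum rate `R(P, b)`. -/
def sumRate (M : ℕ) (P : ℝ) (b : Fin M → ℕ) : ℝ :=
  ∑ k, ∫ ω, instRate P k ω ∂(outcomeLaw M b)

end FeedbackSharing

end

noncomputable section

namespace FeedbackSharing

/-! ### Unitary invariance of the Gaussian and isotropic laws. -/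

section

open WithLp

/-! At infinite power user `k` is left with the rate `log (1 + S / I)`, signal over interference.
Quantizing an isotropic channel with an isotropic codebook returns an isotropic vector
(`map_quantize`). The other users therefore enter the rate of user `k` only through independent
isotropic directions, and its mean limiting rate is a function of `b k` alone, the same function `φ`
for every user (`lintegral_limitRate_eq`, `bitsRate_eq`). The limiting sum rate is `∑ φ (b k)`, and
both inequalities follow once `φ` is a convex sequence: superadditivity of `φ - φ 0` favours a
single user, a supporting line at the mean makes the equal split worst (`optimal_sharing_of_core`).
The limit itself is dominated convergence, with the limiting rate as dominating function; that rate
is integrable because `gain ^ (-1/2)` is.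

Convexity of `φ`. Put `d = M - 1`. The squared sine `a` of the angle between the channel and one
codeword has distribution function `a ^ d`, so `x = -log (1 - a ^ d)` is a standard exponential, and
for the best of `2 ^ n` codewords it is exponential of rate `2 ^ n`. If `G x` is the mean rate at
that error, then `φ n` is proportional to `∫ G (x / 2 ^ n) exp (-x) dx`, and it is enough to show `2
G (2r) ≤ G r + G (4r)` for each `r` (`exponentRate_doubling`).

A channel at error `a` is a combination of its quantized vector and an orthogonal error direction
with free phase. Averaging over the phase by Jensen's formula (`circleAverage_log_quadratic`) turns
`G x` into `E log (X / T)`, where `X` is the larger root of a quadratic depending on `Q = (1 - a) /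
a`, on the signal coefficients `A₀ = sigPar`, `A₁ = sigPerp` and on the leaked interference `T =
leak`. As a function of `Q` the root is convex. Its tangent at the middle point reduces the claim to
`E log (Q x + y)` for one random shift `y` between `T / A₀` and `(A₁ + T) ^ 2 / (A₀ T)`
(`largeRoot_tangent`, `lintegral_log_largeRoot_doubling`). Two differentiations in `log x` leave the
moment inequality `0 ≤ E (κ W - W ^ 2)` with `W = 1 / (1 - a + a y)` and `κ = growth d x ≥ 1 + (d /
2) a ^ d / (1 - a ^ d)` (`integral_growth_mul_weight_sub_nonneg`).

The moment inequality is pointwise for `d = 1`. For `d ≥ 2`, after a monotonicity reduction for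
small `a`, the integrand is minorized by a multiple of `1 / (p + q y)` minus a multiple of an
inverse power of an affine function of `T / A₀`. The first mean is bounded below by a harmonic-mean
argument weighted with `A₀` (`le_integral_inv_affine`). The second is bounded above by Laplace
transforms: given the beams, the error direction may be taken Gaussian in `ℂ ^ d`
(`lintegral_stat_eq_gaussian`), and the Laplace transform of the interference form is at most `1 /
(1 + t S + t ^ 2 E)`, with `S = d` its trace and `E` half the sum of the squared sines between
ordered pairs of interfering beams. The mixed moments of `A₀` and `1 / E` are controlled by
resampling two users in adapted coordinates (`Adapted.gain_le`). What remains is polynomial: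
`CubicMargin` for `d ≥ 3`, and a version with second inverse moments for `d = 2`. -/

instance : IsProbabilityMeasure complexGaussian :=
  Measure.isProbabilityMeasure_map (by
    refine Measurable.aemeasurable ?_
    exact Complex.measurableEquivRealProd.symm.measurable)

instance (M : ℕ) : IsProbabilityMeasure (channelLaw M) := by
  unfold channelLaw; infer_instance

lemma measurable_l2norm (M : ℕ) : Measurable (l2norm : (Fin M → ℂ) → ℝ) := by
  unfold l2norm; fun_prop

lemma measurable_direction (M : ℕ) : Measurable (direction : (Fin M → ℂ) → Fin M → ℂ) := by
  unfold direction
  refine measurable_pi_lambda _ fun i => ?_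
  exact (measurable_pi_apply i).div (Complex.measurable_ofReal.comp (measurable_l2norm M))

instance (M : ℕ) : IsProbabilityMeasure (isotropicLaw M) :=
  Measure.isProbabilityMeasure_map (measurable_direction M).aemeasurable

lemma l2norm_eq_norm {M : ℕ} (v : Fin M → ℂ) : l2norm v = ‖toLp 2 v‖ := by
  rw [EuclideanSpace.norm_eq]; rfl

lemma star_dotProduct_eq_inner {M : ℕ} (x y : Fin M → ℂ) :
    star x ⬝ᵥ y = inner ℂ (toLp 2 x) (toLp 2 y) := by
  rw [EuclideanSpace.inner_eq_star_dotProduct, dotProduct_comm]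

lemma gain_eq_inner {M : ℕ} (x y : Fin M → ℂ) :
    gain x y = ‖inner ℂ (toLp 2 x) (toLp 2 y)‖ ^ 2 := by
  rw [gain, star_dotProduct_eq_inner]

/-- The action of a unitary matrix on a vector. -/
abbrev rot {M : ℕ} (U : Matrix.unitaryGroup (Fin M) ℂ) (x : Fin M → ℂ) : Fin M → ℂ :=
  (U : Matrix (Fin M) (Fin M) ℂ) *ᵥ x

lemma star_rot_dotProduct_rot {M : ℕ} (U : Matrix.unitaryGroup (Fin M) ℂ) (x y : Fin M → ℂ) :
    star (rot U x) ⬝ᵥ rot U y = star x ⬝ᵥ y := by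
  rw [rot, rot, Matrix.star_mulVec, Matrix.dotProduct_mulVec, Matrix.vecMul_vecMul]
  have : (U : Matrix (Fin M) (Fin M) ℂ)ᴴ * U = 1 := Matrix.UnitaryGroup.star_mul_self U
  rw [this, Matrix.vecMul_one]

lemma gain_rot {M : ℕ} (U : Matrix.unitaryGroup (Fin M) ℂ) (x y : Fin M → ℂ) :
    gain (rot U x) (rot U y) = gain x y := by
  rw [gain, gain, star_rot_dotProduct_rot]

lemma l2norm_sq {M : ℕ} (x : Fin M → ℂ) : l2norm x ^ 2 = ∑ i, ‖x i‖ ^ 2 := by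
  rw [l2norm, Real.sq_sqrt (by positivity)]

lemma star_dotProduct_self {M : ℕ} (x : Fin M → ℂ) : star x ⬝ᵥ x = ((l2norm x ^ 2 : ℝ) : ℂ) := by
  rw [l2norm_sq, dotProduct]
  push_cast
  refine Finset.sum_congr rfl fun i _ => ?_
  rw [Pi.star_apply, RCLike.star_def, Complex.conj_mul']

lemma l2norm_nonneg {M : ℕ} (x : Fin M → ℂ) : 0 ≤ l2norm x := Real.sqrt_nonneg _

lemma l2norm_rot {M : ℕ} (U : Matrix.unitaryGroup (Fin M) ℂ) (x : Fin M → ℂ) :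
    l2norm (rot U x) = l2norm x := by
  have h := star_rot_dotProduct_rot U x x
  rw [star_dotProduct_self, star_dotProduct_self] at h
  exact (sq_eq_sq₀ (l2norm_nonneg _) (l2norm_nonneg _)).1 (by exact_mod_cast h)

lemma direction_eq_smul {M : ℕ} (x : Fin M → ℂ) : direction x = ((l2norm x : ℂ))⁻¹ • x := by
  ext i; simp [direction, div_eq_inv_mul]

lemma direction_rot {M : ℕ} (U : Matrix.unitaryGroup (Fin M) ℂ) (x : Fin M → ℂ) :
    direction (rot U x) = rot U (direction x) := by
  rw [direction_eq_smul, direction_eq_smul, l2norm_rot]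
  simp only [rot, Matrix.mulVec_smul]

lemma measurable_rot {M : ℕ} (U : Matrix.unitaryGroup (Fin M) ℂ) :
    Measurable (rot U) := by
  refine measurable_pi_lambda _ fun i => ?_
  simp only [rot, Matrix.mulVec, dotProduct]
  fun_prop

/-- Each real part has variance `1/2`, which contributes the factor `1/4` in the exponent. The
result depends on `t` only through its modulus, the source of all the invariance below. -/
lemma charFun_complexGaussian (t : ℂ) :
    charFun complexGaussian t = Complex.exp (-(‖t‖ ^ 2 : ℝ) / 4) := by
  rw [charFun_apply, complexGaussian, integral_map]
  · have h : ∀ p : ℝ × ℝ, Complex.exp (((inner ℝ (⟨p.1, p.2⟩ : ℂ) t : ℝ) : ℂ) * Complex.I)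
        = Complex.exp (t.re * p.1 * Complex.I) * Complex.exp (t.im * p.2 * Complex.I) := by
      intro p
      rw [← Complex.exp_add]
      congr 1
      simp only [Complex.inner, Complex.mul_re, Complex.conj_re, Complex.conj_im]
      push_cast; ring
    simp_rw [h]
    rw [integral_prod_mul (fun x : ℝ => Complex.exp (t.re * x * Complex.I))
      (fun y : ℝ => Complex.exp (t.im * y * Complex.I)), ← charFun_apply_real,
      ← charFun_apply_real, charFun_gaussianReal, charFun_gaussianReal, ← Complex.exp_add]
    congr 1
    rw [Complex.sq_norm, Complex.normSq_apply]
    push_cast; ring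
  · exact Complex.measurableEquivRealProd.symm.measurable.aemeasurable
  · fun_prop

lemma charFun_channelLaw (M : ℕ) (t : EuclideanSpace ℂ (Fin M)) :
    charFun ((channelLaw M).map (toLp 2)) t = Complex.exp (-(‖t‖ ^ 2 : ℝ) / 4) := by
  rw [channelLaw, charFun_pi]
  simp_rw [charFun_complexGaussian]
  rw [← Complex.exp_sum, EuclideanSpace.norm_sq_eq]
  congr 1
  push_cast
  rw [← Finset.sum_div, Finset.sum_neg_distrib]

/-- The characteristic function depends only on the Euclidean norm of its argument, and moving `U`
across the inner product preserves that norm; a finite measure is determined by its characteristic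
function. -/
theorem channelLaw_map_rot {M : ℕ} (U : Matrix.unitaryGroup (Fin M) ℂ) :
    (channelLaw M).map (rot U) = channelLaw M := by
  have hm : Measurable (toLp 2 : (Fin M → ℂ) → EuclideanSpace ℂ (Fin M)) := by fun_prop
  have hm' : Measurable (ofLp : EuclideanSpace ℂ (Fin M) → Fin M → ℂ) := by fun_prop
  suffices h : ((channelLaw M).map (rot U)).map (toLp 2) = (channelLaw M).map (toLp 2) by
    have := congrArg (Measure.map (ofLp : EuclideanSpace ℂ (Fin M) → Fin M → ℂ)) h
    rw [Measure.map_map hm' hm, Measure.map_map hm' hm] at this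
    simpa [Function.comp_def] using this
  have := (inferInstance : IsProbabilityMeasure ((channelLaw M)))
  have h1 : IsProbabilityMeasure ((channelLaw M).map (rot U)) :=
    Measure.isProbabilityMeasure_map (measurable_rot U).aemeasurable
  have h2 : IsProbabilityMeasure (((channelLaw M).map (rot U)).map (toLp 2 : _ → EuclideanSpace ℂ (Fin M))) :=
    Measure.isProbabilityMeasure_map hm.aemeasurable
  have h3 : IsProbabilityMeasure ((channelLaw M).map (toLp 2 : _ → EuclideanSpace ℂ (Fin M))) :=
    Measure.isProbabilityMeasure_map hm.aemeasurable
  apply Measure.ext_of_charFun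
  ext t
  rw [charFun_channelLaw, Measure.map_map hm (measurable_rot U), charFun_apply,
    integral_map (hm.comp (measurable_rot U)).aemeasurable (by fun_prop)]
  set s : Fin M → ℂ := rot U⁻¹ (ofLp t) with hs
  have hrot : rot U s = ofLp t := by
    rw [hs, rot, rot, Matrix.mulVec_mulVec]
    have : (U : Matrix (Fin M) (Fin M) ℂ) * ((U⁻¹ : Matrix.unitaryGroup (Fin M) ℂ) : Matrix _ _ ℂ) = 1 := by
      simp
    rw [this, Matrix.one_mulVec]
  have key : ∀ x : Fin M → ℂ, (inner ℝ ((toLp 2 ∘ rot U) x : EuclideanSpace ℂ (Fin M)) t : ℝ)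
      = inner ℝ (toLp 2 x : EuclideanSpace ℂ (Fin M)) (toLp 2 s) := by
    intro x
    have e1 : ∀ a b : EuclideanSpace ℂ (Fin M), (inner ℝ a b : ℝ) = (inner ℂ a b : ℂ).re := by
      intro a b
      simp [PiLp.inner_apply, Complex.inner, Complex.re_sum]
    rw [e1, e1, Function.comp_apply]
    have : t = toLp 2 (rot U s) := by rw [hrot]
    rw [this, ← star_dotProduct_eq_inner, ← star_dotProduct_eq_inner, star_rot_dotProduct_rot]
  simp_rw [key]
  rw [← integral_map (φ := (toLp 2 : (Fin M → ℂ) → EuclideanSpace ℂ (Fin M)))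
    (f := fun y => Complex.exp (((inner ℝ y (toLp 2 s) : ℝ) : ℂ) * Complex.I))
    hm.aemeasurable (by fun_prop), ← charFun_apply, charFun_channelLaw]
  congr 4
  rw [← l2norm_eq_norm, hs, l2norm_rot, l2norm_eq_norm]

theorem isotropicLaw_map_rot {M : ℕ} (U : Matrix.unitaryGroup (Fin M) ℂ) :
    (isotropicLaw M).map (rot U) = isotropicLaw M := by
  rw [isotropicLaw, Measure.map_map (measurable_rot U) (measurable_direction M)]
  conv_rhs => rw [← channelLaw_map_rot U, Measure.map_map (measurable_direction M) (measurable_rot U)]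
  congr 1
  ext x : 1
  exact (direction_rot U x).symm

/-- Orthonormal pairs can be moved to the first two basis vectors by a unitary matrix. -/
lemma exists_rot_eq_pair {M : ℕ} (i j : Fin M) (hij : i ≠ j) (x y : Fin M → ℂ)
    (hx : l2norm x = 1) (hy : l2norm y = 1) (hxy : star x ⬝ᵥ y = 0) :
    ∃ U : Matrix.unitaryGroup (Fin M) ℂ, rot U (Pi.single i 1) = x ∧ rot U (Pi.single j 1) = y := by
  classical
  set v : Fin M → EuclideanSpace ℂ (Fin M) := fun k => if k = i then toLp 2 x else toLp 2 y with hv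
  have hn : Orthonormal ℂ (({i, j} : Set (Fin M)).domRestrict v) := by
    rw [orthonormal_iff_ite]
    have nx : ‖toLp 2 x‖ = 1 := by rw [← l2norm_eq_norm, hx]
    have ny : ‖toLp 2 y‖ = 1 := by rw [← l2norm_eq_norm, hy]
    have hxy' : inner ℂ (toLp 2 x) (toLp 2 y) = (0 : ℂ) := by
      rw [← star_dotProduct_eq_inner, hxy]
    have hyx' : inner ℂ (toLp 2 y) (toLp 2 x) = (0 : ℂ) := by
      rw [← inner_conj_symm, hxy', map_zero]
    rintro ⟨a, ha⟩ ⟨b, hb⟩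
    simp only [Set.domRestrict_apply, hv, Subtype.mk.injEq]
    rcases ha with rfl | rfl <;> rcases hb with rfl | rfl <;>
      simp [hij, hij.symm, nx, ny, hxy', hyx']
  obtain ⟨b, hb⟩ := hn.exists_orthonormalBasis_extension_of_card_eq (by simp)
  have hU := (EuclideanSpace.basisFun (Fin M) ℂ).toMatrix_orthonormalBasis_mem_unitary b
  refine ⟨⟨_, hU⟩, ?_, ?_⟩
  · have := hb i (by simp)
    ext k
    have e := congrArg (fun z : EuclideanSpace ℂ (Fin M) => z k) this
    simpa [rot, hv, Module.Basis.toMatrix_apply] using e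
  · have := hb j (by simp)
    ext k
    have e := congrArg (fun z : EuclideanSpace ℂ (Fin M) => z k) this
    simpa [rot, hv, Module.Basis.toMatrix_apply, hij.symm] using e

end

/-! ### Density and radial law of the complex Gaussian. -/

section

lemma complexGaussian_eq_withDensity :
    complexGaussian = (volume : Measure ℂ).withDensity
      (fun z => ENNReal.ofReal (Real.pi⁻¹ * Real.exp (-‖z‖ ^ 2))) := by
  have hv : ((1 : NNReal) / 2) ≠ 0 := by norm_num
  have hm : MeasurePreserving (Complex.measurableEquivRealProd.symm) (volume : Measure (ℝ × ℝ))
      (volume : Measure ℂ) := Complex.volume_preserving_equiv_real_prod.symm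
  ext s hs
  have hms : Measurable (fun p : ℝ × ℝ => (⟨p.1, p.2⟩ : ℂ)) :=
    Complex.measurableEquivRealProd.symm.measurable
  rw [complexGaussian, Measure.map_apply hms hs, gaussianReal_of_var_ne_zero _ hv,
    prod_withDensity (measurable_gaussianPDF _ _) (measurable_gaussianPDF _ _),
    withDensity_apply _ (hms hs), withDensity_apply _ hs,
    ← hm.setLIntegral_comp_preimage hs (by fun_prop)]
  refine lintegral_congr fun p => ?_
  rw [gaussianPDF, gaussianPDF, ← ENNReal.ofReal_mul (gaussianPDFReal_nonneg _ _ _)]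
  congr 1
  have : ‖Complex.measurableEquivRealProd.symm p‖ ^ 2 = p.1 ^ 2 + p.2 ^ 2 := by
    rw [Complex.sq_norm, Complex.normSq_apply]
    show p.1 * p.1 + p.2 * p.2 = _
    ring
  rw [this, gaussianPDFReal, gaussianPDFReal]
  have e1 : (2 * Real.pi * ((1 / 2 : NNReal) : ℝ)) = Real.pi := by push_cast; ring
  have e2 : (2 * ((1 / 2 : NNReal) : ℝ)) = 1 := by push_cast; ring
  rw [e1, e2, sub_zero, sub_zero, neg_add, Real.exp_add, div_one, div_one]
  have : (√Real.pi)⁻¹ * (√Real.pi)⁻¹ = Real.pi⁻¹ := by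
    rw [← mul_inv, Real.mul_self_sqrt Real.pi_pos.le]
  rw [← this]; ring

/-- Polar coordinates followed by the substitution `x = r ^ 2`: the squared modulus is a standard
exponential variable. -/
lemma lintegral_normSq_complexGaussian (f : ℝ → ENNReal) (hf : Measurable f) :
    ∫⁻ z, f (‖z‖ ^ 2) ∂complexGaussian =
      ∫⁻ x in Set.Ioi (0 : ℝ), f x * ENNReal.ofReal (Real.exp (-x)) := by
  rw [complexGaussian_eq_withDensity, lintegral_withDensity_eq_lintegral_mul _ (by fun_prop)
    (by fun_prop)]
  simp only [Pi.mul_apply]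
  rw [← Complex.lintegral_comp_polarCoord_symm]
  have e : ∀ p ∈ polarCoord.target, ENNReal.ofReal p.1 • (ENNReal.ofReal (Real.pi⁻¹ *
      Real.exp (-‖Complex.polarCoord.symm p‖ ^ 2)) * f (‖Complex.polarCoord.symm p‖ ^ 2))
      = ENNReal.ofReal (p.1 * Real.pi⁻¹ * Real.exp (-p.1 ^ 2)) * f (p.1 ^ 2) := by
    rintro p hp
    have hp1 : 0 < p.1 := hp.1
    rw [Complex.norm_polarCoord_symm, sq_abs, smul_eq_mul, ← mul_assoc, ← ENNReal.ofReal_mul hp1.le,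
      ← mul_assoc]
  rw [setLIntegral_congr_fun polarCoord.open_target.measurableSet e, polarCoord_target,
    Measure.volume_eq_prod, ← Measure.prod_restrict, lintegral_prod _ (by fun_prop)]
  simp only [lintegral_const, Measure.restrict_apply MeasurableSet.univ, Set.univ_inter,
    Real.volume_Ioo]
  have e3 : ∀ x ∈ Set.Ioi (0:ℝ), f x * ENNReal.ofReal (Real.exp (-x)) =
      f x * ENNReal.ofReal (Real.exp (-x)) := fun _ _ => rfl
  have himg : (fun x : ℝ => x ^ 2) '' Set.Ioi 0 = Set.Ioi 0 := by
    ext y; constructor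
    · rintro ⟨x, hx, rfl⟩; exact pow_pos (show (0:ℝ) < x from hx) 2
    · intro hy; exact ⟨√y, Real.sqrt_pos.2 hy, Real.sq_sqrt (le_of_lt hy)⟩
  conv_rhs => rw [← himg]
  rw [lintegral_image_eq_lintegral_abs_deriv_mul measurableSet_Ioi
    (f' := fun x => 2 * x) (fun x _ => by simpa using (hasDerivAt_pow 2 x).hasDerivWithinAt)
    (fun x hx y hy h => by
      exact (sq_eq_sq₀ (le_of_lt hx) (le_of_lt hy)).1 h)]
  refine setLIntegral_congr_fun measurableSet_Ioi fun x hx => ?_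
  have hx' : (0:ℝ) < x := hx
  rw [abs_of_pos (by positivity : (0:ℝ) < 2 * x), mul_comm (f (x ^ 2)), ← mul_assoc,
    ← ENNReal.ofReal_mul (by positivity), mul_right_comm, ← ENNReal.ofReal_mul (by positivity)]
  congr 2
  have := Real.pi_ne_zero
  field_simp
  ring

end

/-! ### Zero-forcing precoders and the high-SNR rate. -/

section

/-- The zero-forcing precoder of user `k` for the quantized channels `w`. -/
def zeroForcing {M : ℕ} (w : Fin M → Fin M → ℂ) (k : Fin M) : Fin M → ℂ :=
  direction fun i => (Matrix.of fun j => star (w j) : Matrix (Fin M) (Fin M) ℂ)⁻¹ i k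

/-- Rotating all rows multiplies the channel matrix by `Uᴴ` on the right, hence its inverse by `U`
on the left. This holds for singular frames too, where both sides vanish. -/
lemma zeroForcing_rot {M : ℕ} (U : Matrix.unitaryGroup (Fin M) ℂ) (w : Fin M → Fin M → ℂ)
    (k : Fin M) : zeroForcing (fun j => rot U (w j)) k = rot U (zeroForcing w k) := by
  rw [zeroForcing, zeroForcing, ← direction_rot]
  congr 1
  have h1 : (Matrix.of fun j => star (rot U (w j)) : Matrix (Fin M) (Fin M) ℂ)
      = (Matrix.of fun j => star (w j)) * (U : Matrix (Fin M) (Fin M) ℂ)ᴴ := by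
    ext i j
    simp only [rot, Matrix.star_mulVec, Matrix.of_apply, Matrix.mul_apply, Matrix.vecMul,
      dotProduct]
  have h2 : ((U : Matrix (Fin M) (Fin M) ℂ)ᴴ)⁻¹ = U :=
    Matrix.inv_eq_right_inv (Matrix.UnitaryGroup.star_mul_self U)
  rw [h1, Matrix.mul_inv_rev, h2]
  rfl

@[fun_prop]
lemma measurable_zeroForcing (M : ℕ) (k : Fin M) :
    Measurable (fun w : Fin M → Fin M → ℂ => zeroForcing w k) := by
  refine (measurable_direction M).comp (measurable_pi_lambda _ fun i => ?_)
  have hc : Continuous fun w : Fin M → Fin M → ℂ =>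
      (Matrix.of fun j => star (w j) : Matrix (Fin M) (Fin M) ℂ) := by
    refine continuous_matrix fun i j => ?_
    simp only [Matrix.of_apply, Pi.star_apply]
    fun_prop
  simp only [Matrix.inv_def, Ring.inverse_eq_inv', Matrix.smul_apply, smul_eq_mul]
  refine Measurable.mul hc.matrix_det.measurable.inv ?_
  exact ((continuous_apply k).comp ((continuous_apply i).comp hc.matrix_adjugate)).measurable

lemma gain_nonneg {M : ℕ} (x y : Fin M → ℂ) : 0 ≤ gain x y := by unfold gain; positivity

@[fun_prop]
lemma measurable_gain {α : Type*} [MeasurableSpace α] {M : ℕ} {f g : α → Fin M → ℂ}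
    (hf : Measurable f) (hg : Measurable g) : Measurable (fun a => gain (f a) (g a)) := by
  simp only [FeedbackSharing.gain, dotProduct, Pi.star_apply]
  fun_prop

lemma gain_smul_left {M : ℕ} (c : ℂ) (x y : Fin M → ℂ) :
    gain (c • x) y = ‖c‖ ^ 2 * gain x y := by
  rw [gain, gain, star_smul, smul_dotProduct, smul_eq_mul, norm_mul, mul_pow, norm_star]

lemma gain_smul_right {M : ℕ} (c : ℂ) (x y : Fin M → ℂ) :
    gain x (c • y) = ‖c‖ ^ 2 * gain x y := by
  rw [gain, gain, dotProduct_smul, smul_eq_mul, norm_mul, mul_pow]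

/-- The interference power at a user with channel `h` other than user `k`'s own signal. -/
def interference {M : ℕ} (k : Fin M) (h : Fin M → ℂ) (w : Fin M → Fin M → ℂ) : ℝ :=
  ∑ i ∈ Finset.univ.erase k, gain h (zeroForcing w i)

lemma interference_nonneg {M : ℕ} (k : Fin M) (h : Fin M → ℂ) (w : Fin M → Fin M → ℂ) :
    0 ≤ interference k h w := Finset.sum_nonneg fun _ _ => gain_nonneg _ _

/-- The high-SNR rate (in nats) of user `k`. -/
def limitRate {M : ℕ} (k : Fin M) (h : Fin M → ℂ) (w : Fin M → Fin M → ℂ) : ℝ :=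
  Real.log (1 + gain h (zeroForcing w k) / interference k h w)

lemma limitRate_nonneg {M : ℕ} (k : Fin M) (h : Fin M → ℂ) (w : Fin M → Fin M → ℂ) :
    0 ≤ limitRate k h w := by
  refine Real.log_nonneg ?_
  have := div_nonneg (gain_nonneg h (zeroForcing w k)) (interference_nonneg k h w)
  linarith

@[fun_prop]
lemma measurable_limitRate {α : Type*} [MeasurableSpace α] {M : ℕ} {k : Fin M}
    {f : α → Fin M → ℂ} {g : α → Fin M → Fin M → ℂ} (hf : Measurable f) (hg : Measurable g) :
    Measurable (fun a => limitRate k (f a) (g a)) := by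
  have h1 : ∀ i, Measurable (fun a => FeedbackSharing.gain (f a) (zeroForcing (g a) i)) := fun i =>
    measurable_gain hf ((measurable_zeroForcing M i).comp hg)
  simp only [FeedbackSharing.limitRate, interference]
  fun_prop

lemma limitRate_rot {M : ℕ} (U : Matrix.unitaryGroup (Fin M) ℂ) (k : Fin M) (h : Fin M → ℂ)
    (w : Fin M → Fin M → ℂ) :
    limitRate k (rot U h) (fun j => rot U (w j)) = limitRate k h w := by
  simp only [limitRate, interference, zeroForcing_rot, gain_rot]

lemma limitRate_smul {M : ℕ} (c : ℂ) (hc : c ≠ 0) (k : Fin M) (h : Fin M → ℂ)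
    (w : Fin M → Fin M → ℂ) : limitRate k (c • h) w = limitRate k h w := by
  have : ‖c‖ ^ 2 ≠ 0 := by simpa using hc
  simp only [limitRate, interference, gain_smul_left, ← Finset.mul_sum]
  rw [mul_div_mul_left _ _ this]

/-- Unless it vanishes, the precoder is a unit vector. -/
lemma l2norm_direction {M : ℕ} (v : Fin M → ℂ) (hv : v ≠ 0) : l2norm (direction v) = 1 := by
  rw [l2norm_eq_norm, direction_eq_smul, WithLp.toLp_smul, norm_smul, l2norm_eq_norm]
  have : ‖WithLp.toLp 2 v‖ ≠ 0 := by simpa using hv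
  simp [this]

/-- A singular matrix has inverse `0` by convention, and the direction of `0` is `0`; degenerate
frames thus carry rate zero instead of needing exclusion. -/
lemma zeroForcing_of_det_eq_zero {M : ℕ} (w : Fin M → Fin M → ℂ) (k : Fin M)
    (hd : (Matrix.of fun j => star (w j) : Matrix (Fin M) (Fin M) ℂ).det = 0) :
    zeroForcing w k = 0 := by
  have : (Matrix.of fun j => star (w j) : Matrix (Fin M) (Fin M) ℂ)⁻¹ = 0 :=
    Matrix.nonsing_inv_apply_not_isUnit _ (by simpa using hd)
  rw [zeroForcing, this]
  ext i; simp [direction]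

lemma l2norm_zeroForcing {M : ℕ} (w : Fin M → Fin M → ℂ) (k : Fin M)
    (hd : (Matrix.of fun j => star (w j) : Matrix (Fin M) (Fin M) ℂ).det ≠ 0) :
    l2norm (zeroForcing w k) = 1 := by
  refine l2norm_direction _ fun h0 => ?_
  have h1 := Matrix.mul_nonsing_inv (Matrix.of fun j => star (w j) : Matrix (Fin M) (Fin M) ℂ)
    (by simpa using hd)
  have h2 := congrFun (congrFun h1 k) k
  rw [Matrix.mul_apply, Matrix.one_apply_eq] at h2
  simp only [fun i => congrFun h0 i, Pi.zero_apply, mul_zero, Finset.sum_const_zero] at h2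
  exact zero_ne_one h2

/-- Zero forcing: the precoder of user `k` is orthogonal to the other quantized channels. -/
lemma star_dotProduct_zeroForcing {M : ℕ} (w : Fin M → Fin M → ℂ) {j k : Fin M} (hjk : j ≠ k) :
    star (w j) ⬝ᵥ zeroForcing w k = 0 := by
  by_cases hd : (Matrix.of fun j => star (w j) : Matrix (Fin M) (Fin M) ℂ).det = 0
  · rw [zeroForcing_of_det_eq_zero w k hd, dotProduct_zero]
  · have h1 := Matrix.mul_nonsing_inv (Matrix.of fun j => star (w j) : Matrix (Fin M) (Fin M) ℂ)
      (by simpa using hd)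
    have h2 := congrFun (congrFun h1 j) k
    rw [Matrix.mul_apply, Matrix.one_apply_ne hjk] at h2
    rw [zeroForcing, direction_eq_smul, dotProduct_smul]
    simp only [Matrix.of_apply] at h2
    rw [show star (w j) ⬝ᵥ (fun i => (Matrix.of fun j => star (w j))⁻¹ i k) = 0 from h2, smul_zero]

end

/-! ### Product measures and the angle between an isotropic vector and a fixed one. -/

section

open scoped ENNReal

lemma lintegral_pi_prod {ι : Type*} [Fintype ι] {E : Type*} [MeasurableSpace E]
    (μ : ι → Measure E) [∀ i, IsProbabilityMeasure (μ i)] (f : ι → E → ℝ≥0∞)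
    (hf : ∀ i, Measurable (f i)) :
    ∫⁻ x, ∏ i, f i (x i) ∂(Measure.pi μ) = ∏ i, ∫⁻ x, f i x ∂(μ i) := by
  have h := iIndepFun_pi (μ := μ) (X := fun i => f i) (fun i => (hf i).aemeasurable)
  have h2 := lintegral_prod_eq_prod_lintegral_of_indepFun Finset.univ _ h
    (fun i => (hf i).comp (measurable_pi_apply i))
  rw [h2]
  refine Finset.prod_congr rfl fun i _ => ?_
  exact (measurePreserving_eval μ i).lintegral_comp (hf i)

/-- Resampling one coordinate of a product measure. -/
lemma lintegral_pi_update {ι : Type*} [Fintype ι] [DecidableEq ι] {E : ι → Type*}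
    [∀ i, MeasurableSpace (E i)] (μ : ∀ i, Measure (E i)) [∀ i, IsProbabilityMeasure (μ i)]
    (k : ι) (f : (∀ i, E i) → ℝ≥0∞) (hf : Measurable f) :
    ∫⁻ x, f x ∂(Measure.pi μ) =
      ∫⁻ x, ∫⁻ z, f (Function.update x k z) ∂(μ k) ∂(Measure.pi μ) := by
  have hg : Measurable fun x => ∫⁻ z, f (Function.update x k z) ∂(μ k) :=
    Measurable.lintegral_prod_right' (f := fun p : (∀ i, E i) × E k => f (Function.update p.1 k p.2))
      (hf.comp measurable_update')
  have x0 : ∀ i, E i := fun i => (nonempty_of_isProbabilityMeasure (μ i)).some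
  rw [lintegral_eq_lmarginal_univ (μ := μ) x0, lintegral_eq_lmarginal_univ (μ := μ) x0,
    lmarginal_erase' _ hf (Finset.mem_univ k), lmarginal_erase' _ hg (Finset.mem_univ k)]
  congr 1
  ext x
  simp

lemma lintegral_exp_neg_Ioi {c : ℝ} (hc : 0 < c) :
    ∫⁻ x in Set.Ioi (0 : ℝ), ENNReal.ofReal (Real.exp (-(c * x))) = ENNReal.ofReal (1 / c) := by
  have h1 := integral_exp_mul_Ioi (a := -c) (by linarith) 0
  have h2 := integrableOn_exp_mul_Ioi (a := -c) (by linarith) 0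
  simp only [mul_zero, Real.exp_zero] at h1
  rw [← ofReal_integral_eq_lintegral_ofReal, show (fun x : ℝ => Real.exp (-(c * x)))
    = fun x => Real.exp (-c * x) by ext; ring_nf, h1]
  · congr 1; field_simp
  · simpa [neg_mul, IntegrableOn] using h2
  · exact ae_of_all _ fun x => (Real.exp_pos _).le

lemma lintegral_exp_neg_normSq {c : ℝ} (hc : 0 ≤ c) :
    ∫⁻ z, ENNReal.ofReal (Real.exp (-(c * ‖z‖ ^ 2))) ∂complexGaussian
      = ENNReal.ofReal (1 / (1 + c)) := by
  rw [lintegral_normSq_complexGaussian (fun t => ENNReal.ofReal (Real.exp (-(c * t)))) (by fun_prop),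
    ← lintegral_exp_neg_Ioi (by linarith : 0 < 1 + c)]
  refine lintegral_congr fun x => ?_
  rw [← ENNReal.ofReal_mul (Real.exp_pos _).le, ← Real.exp_add]
  ring_nf

/-- The Laplace transform of a diagonal quadratic form in independent exponentials `‖x i‖ ^ 2`.
Every moment bound on interference below starts from it. -/
lemma lintegral_exp_neg_sum_channelLaw {M : ℕ} (c : Fin M → ℝ) (hc : ∀ i, 0 ≤ c i) :
    ∫⁻ x, ENNReal.ofReal (Real.exp (-∑ i, c i * ‖x i‖ ^ 2)) ∂(channelLaw M)
      = ENNReal.ofReal (∏ i, (1 / (1 + c i))) := by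
  have h := lintegral_pi_prod (fun _ : Fin M => complexGaussian)
    (fun i z => ENNReal.ofReal (Real.exp (-(c i * ‖z‖ ^ 2)))) (fun i => by fun_prop)
  simp_rw [lintegral_exp_neg_normSq (hc _)] at h
  rw [ENNReal.ofReal_prod_of_nonneg (fun i _ => by have := hc i; positivity), ← h, channelLaw]
  refine lintegral_congr fun x => ?_
  rw [← ENNReal.ofReal_prod_of_nonneg (fun i _ => (Real.exp_pos _).le), ← Real.exp_sum]
  simp

lemma complexGaussian_ae_ne_zero : ∀ᵐ z ∂complexGaussian, z ≠ 0 := by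
  rw [complexGaussian_eq_withDensity]
  exact (withDensity_absolutelyContinuous _ _).ae_le (Measure.ae_ne volume 0)

/-- The exponential tail of `|z|²`. -/
lemma complexGaussian_tail {t : ℝ} (ht : 0 ≤ t) :
    complexGaussian {z | t ≤ ‖z‖ ^ 2} = ENNReal.ofReal (Real.exp (-t)) := by
  have h := lintegral_normSq_complexGaussian (Set.indicator (Set.Ici t) 1)
    (measurable_one.indicator measurableSet_Ici)
  have h1 : ∫⁻ z, (Set.indicator (Set.Ici t) (1 : ℝ → ℝ≥0∞)) (‖z‖ ^ 2) ∂complexGaussian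
      = complexGaussian {z | t ≤ ‖z‖ ^ 2} := by
    rw [← lintegral_indicator_one (measurableSet_le (by fun_prop) (by fun_prop))]
    rfl
  rw [← h1, h]
  have h2 : ∀ x : ℝ, (Set.indicator (Set.Ici t) (1 : ℝ → ℝ≥0∞)) x * ENNReal.ofReal (Real.exp (-x))
      = Set.indicator (Set.Ici t) (fun x => ENNReal.ofReal (Real.exp (-x))) x := fun x => by
    by_cases hx : x ∈ Set.Ici t <;> simp [hx]
  simp_rw [h2]
  rw [lintegral_indicator measurableSet_Ici, Measure.restrict_restrict measurableSet_Ici,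
    setLIntegral_congr (t := Set.Ioi t)]
  · rw [← ofReal_integral_eq_lintegral_ofReal (integrableOn_exp_neg_Ioi t)
      (ae_of_all _ fun x => (Real.exp_pos _).le), integral_exp_neg_Ioi]
  · have : (Set.Ici t ∩ Set.Ioi 0 : Set ℝ) =ᵐ[volume] (Set.Ici t ∩ Set.Ici 0 : Set ℝ) :=
      (ae_eq_refl _).inter Ioi_ae_eq_Ici
    refine this.trans ?_
    rw [Set.Ici_inter_Ici, sup_eq_left.2 ht]
    exact Ioi_ae_eq_Ici.symm

lemma l2norm_single {M : ℕ} (k : Fin M) : l2norm (Pi.single k 1 : Fin M → ℂ) = 1 := by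
  rw [l2norm, Real.sqrt_eq_one]
  rw [Finset.sum_eq_single k] <;> simp +contextual

lemma gain_single_left {M : ℕ} (k : Fin M) (x : Fin M → ℂ) :
    gain (Pi.single k 1) x = ‖x k‖ ^ 2 := by
  rw [gain, ← Pi.single_star, star_one, single_one_dotProduct]

lemma gain_comm {M : ℕ} (x y : Fin M → ℂ) : gain x y = gain y x := by
  rw [gain_eq_inner, gain_eq_inner, norm_inner_symm]

/-- An orthonormal family can be obtained from basis vectors by a unitary matrix. -/
lemma exists_rot_eq_of_orthonormal {M : ℕ} (S : Set (Fin M)) (x : Fin M → Fin M → ℂ)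
    (hx : ∀ i ∈ S, ∀ j ∈ S, star (x i) ⬝ᵥ x j = if i = j then 1 else 0) :
    ∃ U : Matrix.unitaryGroup (Fin M) ℂ, ∀ i ∈ S, rot U (Pi.single i 1) = x i := by
  classical
  set v : Fin M → EuclideanSpace ℂ (Fin M) := fun k => WithLp.toLp 2 (x k) with hv
  have hn : Orthonormal ℂ (S.domRestrict v) := by
    rw [orthonormal_iff_ite]
    rintro ⟨a, ha⟩ ⟨b, hb⟩
    simp only [Set.domRestrict_apply, hv, Subtype.mk.injEq]
    rw [← star_dotProduct_eq_inner, hx a ha b hb]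
  obtain ⟨b, hb⟩ := hn.exists_orthonormalBasis_extension_of_card_eq (by simp)
  have hU := (EuclideanSpace.basisFun (Fin M) ℂ).toMatrix_orthonormalBasis_mem_unitary b
  refine ⟨⟨_, hU⟩, fun i hi => ?_⟩
  have := hb i hi
  ext k
  have e := congrArg (fun z : EuclideanSpace ℂ (Fin M) => z k) this
  simpa [rot, hv, Module.Basis.toMatrix_apply] using e

lemma exists_rot_eq {M : ℕ} (i : Fin M) (x : Fin M → ℂ) (hx : l2norm x = 1) :
    ∃ U : Matrix.unitaryGroup (Fin M) ℂ, rot U (Pi.single i 1) = x := by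
  obtain ⟨U, hU⟩ := exists_rot_eq_of_orthonormal {i} (fun _ => x) (fun a ha b hb => by
    rw [Set.mem_singleton_iff] at ha hb
    rw [if_pos (ha.trans hb.symm), star_dotProduct_self, hx]; norm_num)
  exact ⟨U, hU i rfl⟩

lemma l2norm_pos_iff {M : ℕ} (x : Fin M → ℂ) : 0 < l2norm x ↔ x ≠ 0 := by
  rw [l2norm_eq_norm, norm_pos_iff]; simp

lemma channelLaw_ae_coord_ne_zero {M : ℕ} (k : Fin M) : ∀ᵐ x ∂(channelLaw M), x k ≠ 0 :=
  (measurePreserving_eval (fun _ : Fin M => complexGaussian) k).quasiMeasurePreserving.ae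
    complexGaussian_ae_ne_zero

lemma channelLaw_ae_ne_zero {M : ℕ} (k : Fin M) : ∀ᵐ x ∂(channelLaw M), x ≠ 0 := by
  filter_upwards [channelLaw_ae_coord_ne_zero k] with x hx h0
  exact hx (by rw [h0]; rfl)

lemma isotropicLaw_ae_l2norm {M : ℕ} (k : Fin M) : ∀ᵐ x ∂(isotropicLaw M), l2norm x = 1 := by
  rw [isotropicLaw]
  refine (ae_map_iff (measurable_direction M).aemeasurable
    ((measurable_l2norm M) (measurableSet_singleton 1))).2 ?_
  filter_upwards [channelLaw_ae_ne_zero k] with x hx using l2norm_direction x hx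

/-- The squared sine of the angle between an isotropic vector and a fixed unit vector `y` has
distribution function `t ^ (M - 1)`. -/
lemma isotropicLaw_sin_sq_le {M : ℕ} (k : Fin M) (y : Fin M → ℂ) (hy : l2norm y = 1) {t : ℝ}
    (ht0 : 0 < t) (ht1 : t ≤ 1) :
    isotropicLaw M {x | 1 - gain y x ≤ t} = ENNReal.ofReal (t ^ (M - 1)) := by
  obtain ⟨U, hU⟩ := exists_rot_eq k y hy
  have hms : MeasurableSet {x : Fin M → ℂ | 1 - gain y x ≤ t} :=
    measurableSet_le (by fun_prop) (by fun_prop)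
  have hms' : MeasurableSet {x : Fin M → ℂ | 1 - ‖x k‖ ^ 2 ≤ t} :=
    measurableSet_le (by fun_prop) (by fun_prop)
  have e1 : isotropicLaw M {x | 1 - gain y x ≤ t} = isotropicLaw M {x | 1 - ‖x k‖ ^ 2 ≤ t} := by
    conv_lhs => rw [← isotropicLaw_map_rot U]
    rw [Measure.map_apply (measurable_rot U) hms]
    congr 1; ext x
    simp only [Set.preimage_ofPred_eq, Set.mem_ofPred_eq, ← hU, gain_rot, gain_single_left]
  -- For the direction of a Gaussian `x`, the event says that `‖x k‖ ^ 2` is at least `c` times the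
  -- squared norm of the other coordinates.
  set c : ℝ := (1 - t) / t with hc
  have hc0 : 0 ≤ c := div_nonneg (by linarith) ht0.le
  have e2 : isotropicLaw M {x | 1 - ‖x k‖ ^ 2 ≤ t}
      = channelLaw M {x | ∑ i ∈ Finset.univ.erase k, c * ‖x i‖ ^ 2 ≤ ‖x k‖ ^ 2} := by
    rw [isotropicLaw, Measure.map_apply (measurable_direction M) hms']
    refine measure_congr ?_
    filter_upwards [channelLaw_ae_ne_zero k] with x hx
    have hp := (l2norm_pos_iff x).2 hx
    have hn : ‖direction x k‖ ^ 2 = ‖x k‖ ^ 2 / l2norm x ^ 2 := by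
      simp [direction, div_pow]
    have hs := l2norm_sq x
    rw [← Finset.add_sum_erase _ _ (Finset.mem_univ k)] at hs
    refine propext ?_
    change (1 - ‖direction x k‖ ^ 2 ≤ t) ↔ _ ≤ _
    rw [hn, ← Finset.mul_sum, hc, div_mul_eq_mul_div, div_le_iff₀ ht0, sub_le_comm,
      le_div_iff₀ (by positivity), hs]
    constructor <;> intro h <;> nlinarith
  have hmm : MeasurableSet {x : Fin M → ℂ | ∑ i ∈ Finset.univ.erase k, c * ‖x i‖ ^ 2 ≤ ‖x k‖ ^ 2} :=
    measurableSet_le (by fun_prop) (by fun_prop)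
  have hupd : ∀ (x : Fin M → ℂ) (z : ℂ), ∑ i ∈ Finset.univ.erase k, c * ‖Function.update x k z i‖ ^ 2
      = ∑ i ∈ Finset.univ.erase k, c * ‖x i‖ ^ 2 := fun x z =>
    Finset.sum_congr rfl fun i hi => by rw [Function.update_of_ne (Finset.ne_of_mem_erase hi)]
  -- Given the other coordinates, the exponential tail of `‖x k‖ ^ 2` turns the probability into a
  -- Laplace transform with `M - 1` factors `1 / (1 + c) = t`.
  have hprod : ∏ i : Fin M, (1 / (1 + if i = k then 0 else c)) = t ^ (M - 1) := by
    rw [← Finset.mul_prod_erase _ _ (Finset.mem_univ k), if_pos rfl, Finset.prod_congr rfl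
      (g := fun _ => t) fun i hi => ?_, Finset.prod_const, Finset.card_erase_of_mem (Finset.mem_univ k)]
    · simp
    · rw [if_neg (Finset.ne_of_mem_erase hi), hc]
      have := ht0.ne'
      field_simp; ring
  rw [e1, e2, ← lintegral_indicator_one hmm, channelLaw,
    lintegral_pi_update _ k _ (measurable_one.indicator hmm), ← hprod,
    ← lintegral_exp_neg_sum_channelLaw _ (fun i => by split_ifs <;> simp [hc0]), channelLaw]
  refine lintegral_congr fun x => ?_
  have : ∀ z : ℂ, ({x : Fin M → ℂ | ∑ i ∈ Finset.univ.erase k, c * ‖x i‖ ^ 2 ≤ ‖x k‖ ^ 2}.indicator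
      (1 : (Fin M → ℂ) → ℝ≥0∞) (Function.update x k z)) =
      {z : ℂ | ∑ i ∈ Finset.univ.erase k, c * ‖x i‖ ^ 2 ≤ ‖z‖ ^ 2}.indicator 1 z := fun z => by
    simp only [Set.indicator_apply, Set.mem_ofPred_eq, hupd, Function.update_self, Pi.one_apply]
  simp_rw [this]
  rw [lintegral_indicator_one (measurableSet_le (by fun_prop) (by fun_prop)),
    complexGaussian_tail (Finset.sum_nonneg fun i _ => by positivity),
    ← Finset.add_sum_erase _ _ (Finset.mem_univ k)]
  congr 3
  rw [if_pos rfl, zero_mul, zero_add]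
  exact Finset.sum_congr rfl fun i hi => by rw [if_neg (Finset.ne_of_mem_erase hi)]

end

/-! ### The quantization error of one codeword and of the best of several. -/

section

open scoped ENNReal

lemma gain_le_one {M : ℕ} (x y : Fin M → ℂ) (hx : l2norm x = 1) (hy : l2norm y = 1) :
    gain x y ≤ 1 := by
  rw [gain_eq_inner]
  rw [l2norm_eq_norm] at hx hy
  have := norm_inner_le_norm (𝕜 := ℂ) (WithLp.toLp 2 x) (WithLp.toLp 2 y)
  rw [hx, hy] at this
  have h0 := norm_nonneg (inner ℂ (WithLp.toLp 2 x) (WithLp.toLp 2 y))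
  nlinarith

/-- The law on `[0, 1]` with distribution function `t ^ d`. -/
def powLaw (d : ℕ) : Measure ℝ :=
  (volume.restrict (Set.Ioc 0 1)).withDensity fun t => ENNReal.ofReal (d * t ^ (d - 1))

lemma powLaw_Iic {d : ℕ} (hd : 1 ≤ d) {t : ℝ} (h0 : 0 ≤ t) (h1 : t ≤ 1) :
    powLaw d (Set.Iic t) = ENNReal.ofReal (t ^ d) := by
  rw [powLaw, withDensity_apply _ measurableSet_Iic, Measure.restrict_restrict measurableSet_Iic]
  have : (Set.Iic t ∩ Set.Ioc 0 1 : Set ℝ) = Set.Ioc 0 t := by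
    ext x; constructor
    · rintro ⟨a, b, c⟩; exact ⟨b, a⟩
    · rintro ⟨a, b⟩; exact ⟨b, a, le_trans b h1⟩
  rw [this, ← ofReal_integral_eq_lintegral_ofReal]
  · rw [← intervalIntegral.integral_of_le h0, intervalIntegral.integral_const_mul, integral_pow]
    have e : d - 1 + 1 = d := by omega
    have e' : ((d - 1 : ℕ) : ℝ) + 1 = d := by exact_mod_cast e
    rw [e, e', zero_pow (by omega)]
    have : (d : ℝ) ≠ 0 := by positivity
    congr 1; field_simp; ring
  · exact (Continuous.integrableOn_Icc (by fun_prop)).mono_set Set.Ioc_subset_Icc_self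
  · refine (ae_restrict_iff' measurableSet_Ioc).2 (ae_of_all _ fun x hx => ?_)
    have := hx.1.le
    positivity

lemma powLaw_Iic_of_neg {d : ℕ} {t : ℝ} (h0 : t ≤ 0) : powLaw d (Set.Iic t) = 0 := by
  rw [powLaw, withDensity_apply _ measurableSet_Iic, Measure.restrict_restrict measurableSet_Iic]
  have : (Set.Iic t ∩ Set.Ioc 0 1 : Set ℝ) = ∅ := by
    ext x; simp only [Set.mem_inter_iff, Set.mem_Iic, Set.mem_Ioc, Set.mem_empty_iff_false,
      iff_false]; intro h; linarith [h.1, h.2.1]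
  simp [this]

lemma powLaw_Iic_of_ge {d : ℕ} (hd : 1 ≤ d) {t : ℝ} (h1 : 1 ≤ t) : powLaw d (Set.Iic t) = 1 := by
  have h := powLaw_Iic hd zero_le_one le_rfl
  rw [one_pow, ENNReal.ofReal_one] at h
  rw [← h, powLaw, withDensity_apply _ measurableSet_Iic, Measure.restrict_restrict measurableSet_Iic,
    withDensity_apply _ measurableSet_Iic, Measure.restrict_restrict measurableSet_Iic]
  congr 2
  ext x; simp only [Set.mem_inter_iff, Set.mem_Iic, Set.mem_Ioc]
  constructor <;> intro h <;> refine ⟨by linarith [h.2.2], h.2⟩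

/-- The squared sine of the angle between an isotropic vector and a unit vector. -/
theorem isotropicLaw_map_sin_sq {M : ℕ} (hM : 2 ≤ M) (y : Fin M → ℂ) (hy : l2norm y = 1) :
    (isotropicLaw M).map (fun x => 1 - gain y x) = powLaw (M - 1) := by
  have k : Fin M := ⟨0, by omega⟩
  have hm : Measurable fun x : Fin M → ℂ => 1 - gain y x := by fun_prop
  have hd : 1 ≤ M - 1 := by omega
  have : IsProbabilityMeasure ((isotropicLaw M).map (fun x => 1 - gain y x)) :=
    Measure.isProbabilityMeasure_map hm.aemeasurable
  refine Measure.ext_of_Iic _ _ fun t => ?_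
  rw [Measure.map_apply hm measurableSet_Iic]
  have hs : ∀ t, (fun x : Fin M → ℂ => 1 - gain y x) ⁻¹' Set.Iic t = {x | 1 - gain y x ≤ t} :=
    fun _ => rfl
  have key : ∀ {t : ℝ}, 0 < t → t ≤ 1 →
      isotropicLaw M {x | 1 - gain y x ≤ t} = ENNReal.ofReal (t ^ (M - 1)) :=
    isotropicLaw_sin_sq_le k y hy
  rw [hs]
  rcases le_or_gt t 0 with h0 | h0
  · rw [powLaw_Iic_of_neg h0]
    -- The distribution function was computed only at positive arguments; the value at `0` comes
    -- from letting them tend to `0`, which uses `M - 1 ≠ 0`.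
    have hle : ∀ n : ℕ, isotropicLaw M {x | 1 - gain y x ≤ t} ≤
        ENNReal.ofReal ((1 / ((n : ℝ) + 1)) ^ (M - 1)) := fun n => by
      rw [← key (by positivity) (by rw [div_le_one (by positivity)]; linarith [n.cast_nonneg (α := ℝ)])]
      refine measure_mono fun x hx => ?_
      have : (0 : ℝ) < 1 / ((n : ℝ) + 1) := by positivity
      simp only [Set.mem_ofPred_eq] at hx ⊢
      linarith
    have hlim : Tendsto (fun n : ℕ => ENNReal.ofReal ((1 / ((n : ℝ) + 1)) ^ (M - 1))) atTop (𝓝 0) := by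
      have := (tendsto_one_div_add_atTop_nhds_zero_nat (𝕜 := ℝ)).pow (M - 1)
      rw [zero_pow (by omega)] at this
      simpa using ENNReal.tendsto_ofReal this
    exact le_antisymm (ge_of_tendsto' hlim hle) bot_le
  · rcases le_or_gt t 1 with h1 | h1
    · rw [powLaw_Iic hd h0.le h1, key h0 h1]
    · rw [powLaw_Iic_of_ge hd h1.le]
      refine le_antisymm prob_le_one ?_
      calc (1 : ℝ≥0∞) = isotropicLaw M {x | 1 - gain y x ≤ 1} := by rw [key one_pos le_rfl]; simp
        _ ≤ _ := measure_mono fun x hx => by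
          simp only [Set.mem_ofPred_eq] at hx ⊢; linarith

/-- The integration variable is the squared sine `t`, so the gain appears as `1 - t`. This form
serves all one-vector moments. -/
lemma lintegral_isotropicLaw_gain {M : ℕ} (hM : 2 ≤ M) (y : Fin M → ℂ) (hy : l2norm y = 1)
    (f : ℝ → ℝ≥0∞) (hf : Measurable f) :
    ∫⁻ x, f (gain y x) ∂(isotropicLaw M) =
      ∫⁻ t in Set.Ioc (0 : ℝ) 1, f (1 - t) * ENNReal.ofReal ((M - 1 : ℕ) * t ^ (M - 1 - 1)) := by
  have h : ∫⁻ x, f (gain y x) ∂(isotropicLaw M)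
      = ∫⁻ t, f (1 - t) ∂((isotropicLaw M).map (fun x => 1 - gain y x)) := by
    rw [lintegral_map (by fun_prop) (by fun_prop)]
    simp
  rw [h, isotropicLaw_map_sin_sq hM y hy, powLaw, lintegral_withDensity_eq_lintegral_mul _
    (by fun_prop) (by fun_prop)]
  exact lintegral_congr fun t => mul_comm _ _

/-- The coordinate in which the quantization error becomes exponential. -/
def errorExponent (d : ℕ) (a : ℝ) : ℝ := -Real.log (1 - a ^ d)

/-- The best of `n` isotropic codewords: in exponential coordinates the quantization error is
exponential with parameter `n`. -/
theorem pi_isotropicLaw_exponent_gt {M : ℕ} (hM : 2 ≤ M) (n : ℕ) (y : Fin M → ℂ)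
    (hy : l2norm y = 1) {r : ℝ} (hr : 0 ≤ r) :
    (Measure.pi fun _ : Fin n => isotropicLaw M)
      {w | ∀ i, r < errorExponent (M - 1) (1 - gain y (w i))} =
      ENNReal.ofReal (Real.exp (-(n * r))) := by
  have k : Fin M := ⟨0, by omega⟩
  have hm : Measurable fun x : Fin M → ℂ => 1 - gain y x := by fun_prop
  have hset : {w : Fin n → Fin M → ℂ | ∀ i, r < errorExponent (M - 1) (1 - gain y (w i))}
      = Set.univ.pi fun _ => {x | r < errorExponent (M - 1) (1 - gain y x)} := by
    ext w; simp
  rw [hset, Measure.pi_pi, Finset.prod_const, Finset.card_univ, Fintype.card_fin]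
  have h1 : isotropicLaw M {x | r < errorExponent (M - 1) (1 - gain y x)}
      = ENNReal.ofReal (Real.exp (-r)) := by
    have hexp : Real.exp (-r) ≤ 1 := Real.exp_le_one_iff.2 (by linarith)
    -- The squared sine whose exponential coordinate is `r`, so that `s ^ (M - 1) = 1 - exp (-r)`.
    set s : ℝ := (1 - Real.exp (-r)) ^ ((1 : ℝ) / ((M - 1 : ℕ) : ℝ)) with hs
    have hd : ((M - 1 : ℕ) : ℝ) ≠ 0 := by
      have : M - 1 ≠ 0 := by clear * - hM; omega
      exact_mod_cast this
    have hd1 : 1 ≤ M - 1 := by clear * - hM; omega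
    have hd0 : M - 1 ≠ 0 := by clear * - hM; omega
    have hs0 : 0 ≤ s := Real.rpow_nonneg (by linarith) _
    have hsd : s ^ (M - 1) = 1 - Real.exp (-r) := by
      rw [← Real.rpow_natCast, ← Real.rpow_mul (by linarith), one_div_mul_cancel hd, Real.rpow_one]
    have hs1 : s ≤ 1 := by
      refine (pow_le_one_iff_of_nonneg hs0 hd0).1 ?_
      rw [hsd]; linarith [Real.exp_pos (-r)]
    have hc : isotropicLaw M {x | 1 - gain y x ≤ s} = ENNReal.ofReal (s ^ (M - 1)) := by
      have := congrArg (fun μ => μ (Set.Iic s)) (isotropicLaw_map_sin_sq hM y hy)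
      simp only [Measure.map_apply hm measurableSet_Iic] at this
      rw [powLaw_Iic hd1 hs0 hs1] at this
      exact this
    have hne : isotropicLaw M {x | 1 - gain y x = 1} = 0 := by
      have h0 := congrArg (fun μ => μ {1}) (isotropicLaw_map_sin_sq hM y hy)
      simp only [Measure.map_apply hm (measurableSet_singleton 1)] at h0
      have h2 : powLaw (M - 1) {1} = 0 := by
        refine withDensity_absolutelyContinuous _ _ ?_
        simp
      rw [h2] at h0
      exact h0
    have hae : {x : Fin M → ℂ | r < errorExponent (M - 1) (1 - gain y x)}
        =ᵐ[isotropicLaw M] ({x | 1 - gain y x ≤ s}ᶜ : Set (Fin M → ℂ)) := by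
      have hne' : ∀ᵐ x ∂(isotropicLaw M), ¬ (1 - gain y x = 1) := by
        rw [ae_iff]; simpa using hne
      filter_upwards [hne', isotropicLaw_ae_l2norm k] with x hx hx1
      have g1 := gain_le_one y x hy hx1
      have g0 := gain_nonneg y x
      have g2 : 1 - gain y x < 1 := lt_of_le_of_ne (by linarith) hx
      have g3 : (1 - gain y x) ^ (M - 1) < 1 := pow_lt_one₀ (by linarith) g2 hd0
      refine propext ?_
      change r < errorExponent (M - 1) (1 - gain y x) ↔ ¬ (1 - gain y x ≤ s)
      rw [errorExponent, not_le, lt_neg, Real.log_lt_iff_lt_exp (by linarith), sub_lt_comm, ← hsd]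
      exact pow_lt_pow_iff_left₀ hs0 (by linarith) hd0
    rw [measure_congr hae, prob_compl_eq_one_sub (s := {x | 1 - gain y x ≤ s}) (measurableSet_le hm measurable_const), hc, hsd,
      ← ENNReal.ofReal_one, ← ENNReal.ofReal_sub _ (by linarith)]
    congr 1; ring
  rw [h1, ← ENNReal.ofReal_pow (Real.exp_pos _).le, ← Real.exp_nat_mul]
  congr 2; ring

end

/-! ### The quantizer: equivariance, isotropy of its output, independence of the users. -/

section

open scoped ENNReal

/-- Pairing the coordinates of two product measures gives a product measure. -/
lemma map_prod_pi {ι : Type*} [Fintype ι] {A B : ι → Type*} [∀ i, MeasurableSpace (A i)]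
    [∀ i, MeasurableSpace (B i)] (μ : ∀ i, Measure (A i)) (ν : ∀ i, Measure (B i))
    [∀ i, IsProbabilityMeasure (μ i)] [∀ i, IsProbabilityMeasure (ν i)] :
    ((Measure.pi μ).prod (Measure.pi ν)).map (fun p i => (p.1 i, p.2 i)) =
      Measure.pi fun i => (μ i).prod (ν i) := by
  have hm : Measurable (fun (p : (∀ i, A i) × (∀ i, B i)) i => (p.1 i, p.2 i)) :=
    measurable_pi_lambda _ fun i => by fun_prop
  refine (Measure.pi_eq_generateFrom (C := fun i => Set.image2 (· ×ˢ ·) {s : Set (A i) | MeasurableSet s}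
    {t : Set (B i) | MeasurableSet t}) (fun i => generateFrom_prod) (fun i => isPiSystem_prod) (fun i => ?_)
    fun s hs => ?_).symm
  · exact ⟨fun _ => Set.univ, fun _ => ⟨Set.univ, MeasurableSet.univ, Set.univ, MeasurableSet.univ,
      Set.univ_prod_univ⟩, fun _ => measure_lt_top _ _, Set.iUnion_const _⟩
  · choose a ha b hb hab using hs
    simp only at hab
    have hsm : MeasurableSet (Set.univ.pi s) := MeasurableSet.univ_pi fun i => by
      rw [← hab i]; exact (ha i).prod (hb i)
    rw [Measure.map_apply hm hsm]
    have : (fun (p : (∀ i, A i) × (∀ i, B i)) i => (p.1 i, p.2 i)) ⁻¹' (Set.univ.pi s)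
        = (Set.univ.pi a) ×ˢ (Set.univ.pi b) := by
      ext p
      simp only [← hab, Set.mem_preimage, Set.mem_pi, Set.mem_univ, Set.mem_prod, true_imp_iff]
      exact forall_and
    rw [this, Measure.prod_prod, Measure.pi_pi, Measure.pi_pi, ← Finset.prod_mul_distrib]
    exact Finset.prod_congr rfl fun i _ => by rw [← hab i, Measure.prod_prod]

/-- The law of a codebook of `n` codewords. -/
def codebookLaw (M n : ℕ) : Measure (Fin n → Fin M → ℂ) := Measure.pi fun _ => isotropicLaw M

instance (M n : ℕ) : IsProbabilityMeasure (codebookLaw M n) := by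
  unfold codebookLaw; infer_instance

open Classical in
/-- The index of the codeword chosen by the quantizer. -/
def bestIndex {M n : ℕ} (h : Fin M → ℂ) (w : Fin (2 ^ n) → Fin M → ℂ) : Fin (2 ^ n) :=
  Fin.find (fun j => ∀ i, gain h (w i) ≤ gain h (w j)) (exists_best h w)

lemma quantize_eq {M n : ℕ} (h : Fin M → ℂ) (w : Fin (2 ^ n) → Fin M → ℂ) :
    quantize h w = w (bestIndex h w) := rfl

lemma gain_le_quantize {M n : ℕ} (h : Fin M → ℂ) (w : Fin (2 ^ n) → Fin M → ℂ) (i : Fin (2 ^ n)) :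
    gain h (w i) ≤ gain h (quantize h w) := by
  classical
  exact Fin.find_spec (exists_best h w) i

lemma bestIndex_eq_iff {M n : ℕ} (h : Fin M → ℂ) (w : Fin (2 ^ n) → Fin M → ℂ) (j : Fin (2 ^ n)) :
    bestIndex h w = j ↔ (∀ i, gain h (w i) ≤ gain h (w j)) ∧
      ∀ l < j, ¬ ∀ i, gain h (w i) ≤ gain h (w l) := by
  classical
  exact Fin.find_eq_iff _

lemma measurableSet_bestIndex {M n : ℕ} (j : Fin (2 ^ n)) :
    MeasurableSet {p : (Fin M → ℂ) × (Fin (2 ^ n) → Fin M → ℂ) | bestIndex p.1 p.2 = j} := by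
  have h1 : ∀ l : Fin (2 ^ n), MeasurableSet {p : (Fin M → ℂ) × (Fin (2 ^ n) → Fin M → ℂ) |
      ∀ i, gain p.1 (p.2 i) ≤ gain p.1 (p.2 l)} := fun l => by
    simp only [Set.ofPred_forall]
    exact MeasurableSet.iInter fun i => measurableSet_le (by fun_prop) (by fun_prop)
  simp only [bestIndex_eq_iff]
  refine (h1 j).inter ?_
  have : {p : (Fin M → ℂ) × (Fin (2 ^ n) → Fin M → ℂ) |
      ∀ l < j, ¬ ∀ i, gain p.1 (p.2 i) ≤ gain p.1 (p.2 l)} = ⋂ l, ⋂ (_ : l < j),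
      {p | ∀ i, gain p.1 (p.2 i) ≤ gain p.1 (p.2 l)}ᶜ := by ext p; simp
  change MeasurableSet {p : (Fin M → ℂ) × (Fin (2 ^ n) → Fin M → ℂ) |
      ∀ l < j, ¬ ∀ i, gain p.1 (p.2 i) ≤ gain p.1 (p.2 l)}
  rw [this]
  exact MeasurableSet.iInter fun l => MeasurableSet.iInter fun _ => (h1 l).compl

lemma measurable_bestIndex {M n : ℕ} :
    Measurable (fun p : (Fin M → ℂ) × (Fin (2 ^ n) → Fin M → ℂ) => bestIndex p.1 p.2) :=
  measurable_to_countable' fun j => measurableSet_bestIndex j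

@[fun_prop]
lemma measurable_quantize {M n : ℕ} :
    Measurable (fun p : (Fin M → ℂ) × (Fin (2 ^ n) → Fin M → ℂ) => quantize p.1 p.2) := by
  have h2 : Measurable (fun q : (Fin (2 ^ n) → Fin M → ℂ) × Fin (2 ^ n) => q.1 q.2) :=
    measurable_from_prod_countable_left fun j => measurable_pi_apply j
  exact h2.comp (measurable_snd.prodMk measurable_bestIndex)

lemma bestIndex_rot {M n : ℕ} (U : Matrix.unitaryGroup (Fin M) ℂ) (h : Fin M → ℂ)
    (w : Fin (2 ^ n) → Fin M → ℂ) : bestIndex (rot U h) (fun i => rot U (w i)) = bestIndex h w := by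
  rw [bestIndex_eq_iff]
  simp only [gain_rot]
  exact (bestIndex_eq_iff h w _).1 rfl

lemma pi_isotropicLaw_map_rot {ι : Type*} [Fintype ι] {M : ℕ}
    (U : Matrix.unitaryGroup (Fin M) ℂ) :
    (Measure.pi fun _ : ι => isotropicLaw M).map (fun w i => rot U (w i)) =
      Measure.pi fun _ : ι => isotropicLaw M := by
  rw [Measure.pi_map_pi (f := fun _ => rot U) fun i => (measurable_rot U).aemeasurable]
  simp_rw [isotropicLaw_map_rot]

/-- The indicator of the event that codeword `j` is chosen. -/
def chosen {M n : ℕ} (j : Fin (2 ^ n)) (h : Fin M → ℂ) (w : Fin (2 ^ n) → Fin M → ℂ) : ℝ≥0∞ :=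
  Set.indicator {p : (Fin M → ℂ) × (Fin (2 ^ n) → Fin M → ℂ) | bestIndex p.1 p.2 = j} 1 (h, w)

lemma chosen_eq {M n : ℕ} (j : Fin (2 ^ n)) (h : Fin M → ℂ) (w : Fin (2 ^ n) → Fin M → ℂ) :
    chosen j h w = if bestIndex h w = j then 1 else 0 := by
  simp [chosen, Set.indicator_apply]

lemma measurable_chosen {α : Type*} [MeasurableSpace α] {M n : ℕ} (j : Fin (2 ^ n))
    {f : α → Fin M → ℂ} {g : α → Fin (2 ^ n) → Fin M → ℂ} (hf : Measurable f) (hg : Measurable g) :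
    Measurable fun a => chosen j (f a) (g a) :=
  Measurable.comp (measurable_one.indicator (measurableSet_bestIndex j)) (hf.prodMk hg)

/-- The probability that codeword `j` is chosen when it has the value `x`. -/
def chosenProb {M n : ℕ} (j : Fin (2 ^ n)) (x : Fin M → ℂ) : ℝ≥0∞ :=
  ∫⁻ h, ∫⁻ w, chosen j h (Function.update w j x) ∂(codebookLaw M (2 ^ n)) ∂(channelLaw M)

lemma measurable_lintegral_chosen {M n : ℕ} (j : Fin (2 ^ n)) :
    Measurable fun r : (Fin M → ℂ) × (Fin M → ℂ) =>
      ∫⁻ w, chosen j r.1 (Function.update w j r.2) ∂(codebookLaw M (2 ^ n)) :=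
  Measurable.lintegral_prod_right' (f := fun q : ((Fin M → ℂ) × (Fin M → ℂ)) ×
    (Fin (2 ^ n) → Fin M → ℂ) => chosen j q.1.1 (Function.update q.2 j q.1.2))
    (measurable_chosen j (by fun_prop) (measurable_update'.comp
      (measurable_snd.prodMk (measurable_snd.comp measurable_fst))))

/-- Rotate the channel and all codewords together: their laws are invariant and the chosen index
does not change. Hence this probability is constant on the unit sphere. -/
lemma chosenProb_rot {M n : ℕ} (j : Fin (2 ^ n)) (x : Fin M → ℂ)
    (U : Matrix.unitaryGroup (Fin M) ℂ) : chosenProb j (rot U x) = chosenProb j x := by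
  have hm1 : Measurable fun h : Fin M → ℂ => ∫⁻ w, chosen j h (Function.update w j (rot U x))
      ∂(codebookLaw M (2 ^ n)) :=
    (measurable_lintegral_chosen j).comp
      (f := fun h => (h, rot U x)) (measurable_id.prodMk measurable_const)
  have hm2 : ∀ h : Fin M → ℂ, Measurable fun w : Fin (2 ^ n) → Fin M → ℂ =>
      chosen j h (Function.update w j (rot U x)) := fun h =>
    measurable_chosen j measurable_const measurable_update_left
  unfold chosenProb
  conv_lhs => rw [← channelLaw_map_rot U, lintegral_map hm1 (measurable_rot U)]
  refine lintegral_congr fun h => ?_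
  have hr : Measurable fun (w : Fin (2 ^ n) → Fin M → ℂ) i => rot U (w i) :=
    measurable_pi_lambda _ fun i => (measurable_rot U).comp (measurable_pi_apply i)
  conv_lhs => rw [codebookLaw, ← pi_isotropicLaw_map_rot U, lintegral_map (hm2 _) hr]
  refine lintegral_congr fun w => ?_
  have : Function.update (fun i => rot U (w i)) j (rot U x)
      = fun i => rot U (Function.update w j x i) := by
    ext i : 1
    by_cases hi : i = j
    · subst hi; simp
    · simp [hi]
  rw [this, chosen_eq, chosen_eq, bestIndex_rot]

lemma apply_quantize_eq_sum {M n : ℕ} (f : (Fin M → ℂ) → ℝ≥0∞) (h : Fin M → ℂ)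
    (w : Fin (2 ^ n) → Fin M → ℂ) : f (quantize h w) = ∑ j, f (w j) * chosen j h w := by
  rw [Finset.sum_eq_single (bestIndex h w)]
  · rw [chosen_eq, if_pos rfl, mul_one, quantize_eq]
  · intro j _ hj
    rw [chosen_eq, if_neg hj.symm, mul_zero]
  · intro hj
    exact absurd (Finset.mem_univ _) hj

/-- Resample codeword `j` as `x`. The conditional probability of its being chosen does not depend on
`x`, so it factors out; its value is read off at the basis vector `k`. -/
lemma lintegral_chosen {M : ℕ} (k : Fin M) {n : ℕ} (j : Fin (2 ^ n)) (f : (Fin M → ℂ) → ℝ≥0∞)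
    (hf : Measurable f) :
    ∫⁻ h, ∫⁻ w, f (w j) * chosen j h w ∂(codebookLaw M (2 ^ n)) ∂(channelLaw M)
      = chosenProb j (Pi.single k 1) * ∫⁻ x, f x ∂(isotropicLaw M) := by
  have h2 : ∀ h : Fin M → ℂ, ∫⁻ w, f (w j) * chosen j h w ∂(codebookLaw M (2 ^ n))
      = ∫⁻ x, f x * ∫⁻ w, chosen j h (Function.update w j x) ∂(codebookLaw M (2 ^ n))
        ∂(isotropicLaw M) := fun h => by
    have hm3 : Measurable fun r : (Fin (2 ^ n) → Fin M → ℂ) × (Fin M → ℂ) =>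
        chosen j h (Function.update r.1 j r.2) :=
      measurable_chosen j measurable_const measurable_update'
    have hm5 : Measurable fun w : Fin (2 ^ n) → Fin M → ℂ => f (w j) * chosen j h w :=
      (hf.comp (measurable_pi_apply j)).mul (measurable_chosen j measurable_const measurable_id)
    rw [codebookLaw, lintegral_pi_update _ j _ hm5]
    simp only [Function.update_self]
    rw [lintegral_lintegral_swap ((hf.comp measurable_snd).mul hm3).aemeasurable]
    refine lintegral_congr fun x => ?_
    exact lintegral_const_mul _ (measurable_chosen j measurable_const measurable_update_left)
  have hm4 := measurable_lintegral_chosen (M := M) j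
  simp_rw [h2]
  rw [lintegral_lintegral_swap ((hf.comp measurable_snd).mul hm4).aemeasurable]
  rw [← lintegral_const_mul _ hf]
  refine lintegral_congr_ae ?_
  filter_upwards [isotropicLaw_ae_l2norm k] with x hx
  obtain ⟨U, rfl⟩ := exists_rot_eq k x hx
  have hm6 : Measurable fun h : Fin M → ℂ => ∫⁻ w, chosen j h (Function.update w j
      (rot U (Pi.single k 1))) ∂(codebookLaw M (2 ^ n)) :=
    hm4.comp (f := fun h => (h, rot U (Pi.single k 1))) (measurable_id.prodMk measurable_const)
  rw [lintegral_const_mul _ hm6, mul_comm, ← chosenProb_rot j _ U, chosenProb]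

lemma lintegral_quantize {M : ℕ} (k : Fin M) (n : ℕ) (f : (Fin M → ℂ) → ℝ≥0∞) (hf : Measurable f) :
    ∫⁻ q, f (quantize q.1 q.2) ∂((channelLaw M).prod (codebookLaw M (2 ^ n)))
      = (∑ j : Fin (2 ^ n), chosenProb j (Pi.single k 1)) * ∫⁻ x, f x ∂(isotropicLaw M) := by
  have hfj : ∀ j : Fin (2 ^ n), Measurable fun q : ((Fin M → ℂ) × (Fin (2 ^ n) → Fin M → ℂ)) =>
    f (q.2 j) * chosen j q.1 q.2 := fun j =>
    (hf.comp ((measurable_pi_apply j).comp measurable_snd)).mul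
      (measurable_chosen j measurable_fst measurable_snd)
  simp only [apply_quantize_eq_sum f]
  rw [lintegral_finsetSum _ fun j _ => hfj j, Finset.sum_mul]
  refine Finset.sum_congr rfl fun j _ => ?_
  rw [lintegral_prod _ (hfj j).aemeasurable]
  exact lintegral_chosen k j f hf

/-- The quantized channel is isotropic. -/
theorem map_quantize {M : ℕ} (k : Fin M) (n : ℕ) :
    ((channelLaw M).prod (codebookLaw M (2 ^ n))).map (fun p => quantize p.1 p.2) =
      isotropicLaw M := by
  -- The total constant is never computed: testing with `f = 1` shows that it equals one.
  have hone := lintegral_quantize k n 1 measurable_one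
  simp only [Pi.one_apply, lintegral_const, measure_univ, mul_one] at hone
  refine Measure.ext_of_lintegral _ fun f hf => ?_
  rw [lintegral_map hf measurable_quantize, lintegral_quantize k n f hf, ← hone, one_mul]

/-- The law of the channel and the quantized channel of a user, and the outcomes of the quantized
channels of the other users. -/
theorem lintegral_outcomeLaw {M : ℕ} (b : Fin M → ℕ) (k : Fin M)
    (F : (Fin M → ℂ) → (Fin M → Fin M → ℂ) → ℝ≥0∞)
    (hF : Measurable fun p : (Fin M → ℂ) × (Fin M → Fin M → ℂ) => F p.1 p.2) :
    ∫⁻ ω, F (ω.1 k) (fun j => quantize (ω.1 j) (ω.2 j)) ∂(outcomeLaw M b) =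
      ∫⁻ q, ∫⁻ w, F q.1 (Function.update w k (quantize q.1 q.2))
        ∂(Measure.pi fun _ : Fin M => isotropicLaw M)
        ∂((channelLaw M).prod (codebookLaw M (2 ^ b k))) := by
  classical
  set ρ : Fin M → Measure ((Fin M → ℂ) × (Fin M → ℂ)) := fun j =>
    ((channelLaw M).prod (codebookLaw M (2 ^ b j))).map (fun p => (p.1, quantize p.1 p.2)) with hρ
  have hq : ∀ j, Measurable fun p : (Fin M → ℂ) × (Fin (2 ^ b j) → Fin M → ℂ) =>
      (p.1, quantize p.1 p.2) := fun j => measurable_fst.prodMk measurable_quantize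
  have hρp : ∀ j, IsProbabilityMeasure (ρ j) := fun j =>
    Measure.isProbabilityMeasure_map (hq j).aemeasurable
  have hpair : Measurable fun (ω : Outcome M b) (j : Fin M) => (ω.1 j, ω.2 j) :=
    measurable_pi_lambda _ fun j => by fun_prop
  have hcoord : Measurable fun (v : ∀ j : Fin M, (Fin M → ℂ) × (Fin (2 ^ b j) → Fin M → ℂ))
      (j : Fin M) => ((v j).1, quantize (v j).1 (v j).2) :=
    measurable_pi_lambda _ fun j => (hq j).comp (measurable_pi_apply j)
  -- The pairs (channel, quantized channel) are independent over the users. For `j ≠ k` only the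
  -- second component matters, and its marginal is isotropic.
  have hlaw : (outcomeLaw M b).map (fun ω j => (ω.1 j, quantize (ω.1 j) (ω.2 j)))
      = Measure.pi ρ := by
    rw [hρ, ← Measure.pi_map_pi (fun j => (hq j).aemeasurable)]
    have h2 := map_prod_pi (fun _ : Fin M => channelLaw M) (fun j => codebookLaw M (2 ^ b j))
    rw [← h2, Measure.map_map hcoord hpair]
    rfl
  have hFm : Measurable fun v : Fin M → (Fin M → ℂ) × (Fin M → ℂ) =>
      F (v k).1 (fun j => (v j).2) :=
    hF.comp (f := fun v : Fin M → (Fin M → ℂ) × (Fin M → ℂ) => ((v k).1, fun j => (v j).2))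
      (by fun_prop)
  have hsnd : (Measure.pi ρ).map (fun v j => (v j).2) = Measure.pi fun _ : Fin M => isotropicLaw M := by
    have : ∀ j, (ρ j).map Prod.snd = isotropicLaw M := fun j => by
      rw [hρ, Measure.map_map measurable_snd (hq j)]
      exact map_quantize k (b j)
    have hs : ∀ j, SigmaFinite ((ρ j).map Prod.snd) := fun j => by rw [this]; infer_instance
    rw [Measure.pi_map_pi (f := fun _ => Prod.snd) fun j => measurable_snd.aemeasurable]
    simp_rw [this]
  have hmap : Measurable (fun (ω : Outcome M b) j => (ω.1 j, quantize (ω.1 j) (ω.2 j))) :=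
    hcoord.comp hpair
  calc ∫⁻ ω, F (ω.1 k) (fun j => quantize (ω.1 j) (ω.2 j)) ∂(outcomeLaw M b)
      = ∫⁻ v, F (v k).1 (fun j => (v j).2) ∂(Measure.pi ρ) := by
        rw [← hlaw, lintegral_map hFm hmap]
    _ = ∫⁻ v, ∫⁻ z, F z.1 (Function.update (fun j => (v j).2) k z.2) ∂(ρ k) ∂(Measure.pi ρ) := by
        rw [lintegral_pi_update ρ k _ hFm]
        refine lintegral_congr fun v => lintegral_congr fun z => ?_
        have : (fun j => (Function.update v k z j).2) = Function.update (fun j => (v j).2) k z.2 := by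
          ext j : 1
          by_cases hj : j = k
          · subst hj; simp
          · simp [hj]
        rw [this, Function.update_self]
    _ = ∫⁻ w, ∫⁻ z, F z.1 (Function.update w k z.2) ∂(ρ k)
          ∂(Measure.pi fun _ : Fin M => isotropicLaw M) := by
        have hm : Measurable fun w : Fin M → Fin M → ℂ =>
            ∫⁻ z, F z.1 (Function.update w k z.2) ∂(ρ k) :=
          Measurable.lintegral_prod_right'
            (f := fun p : (Fin M → Fin M → ℂ) × ((Fin M → ℂ) × (Fin M → ℂ)) =>
              F p.2.1 (Function.update p.1 k p.2.2))
            (hF.comp (f := fun p : (Fin M → Fin M → ℂ) × ((Fin M → ℂ) × (Fin M → ℂ)) =>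
              (p.2.1, Function.update p.1 k p.2.2)) (by
                refine (by fun_prop : Measurable fun p : (Fin M → Fin M → ℂ) ×
                  ((Fin M → ℂ) × (Fin M → ℂ)) => p.2.1).prodMk ?_
                exact measurable_update'.comp (f := fun p : (Fin M → Fin M → ℂ) ×
                  ((Fin M → ℂ) × (Fin M → ℂ)) => (p.1, p.2.2)) (by fun_prop)))
        rw [← hsnd, lintegral_map hm (by fun_prop)]
    _ = _ := by
        have hm7 : Measurable fun p : (Fin M → Fin M → ℂ) × ((Fin M → ℂ) × (Fin M → ℂ)) =>
            F p.2.1 (Function.update p.1 k p.2.2) :=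
          hF.comp (f := fun p : (Fin M → Fin M → ℂ) × ((Fin M → ℂ) × (Fin M → ℂ)) =>
              (p.2.1, Function.update p.1 k p.2.2)) (by
                refine (by fun_prop : Measurable fun p : (Fin M → Fin M → ℂ) ×
                  ((Fin M → ℂ) × (Fin M → ℂ)) => p.2.1).prodMk ?_
                exact measurable_update'.comp (f := fun p : (Fin M → Fin M → ℂ) ×
                  ((Fin M → ℂ) × (Fin M → ℂ)) => (p.1, p.2.2)) (by fun_prop))
        rw [lintegral_lintegral_swap hm7.aemeasurable, hρ, lintegral_map _ (hq k)]
        exact Measurable.lintegral_prod_left' hm7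

end

/-! ### An integrable bound for the limiting rate. -/

section

open scoped ENNReal

lemma measurable_update_pair {ι : Type*} [DecidableEq ι] {E A : Type*} [MeasurableSpace E]
    [MeasurableSpace A] {k : ι} {f : A → ι → E} {g : A → E}
    (hf : Measurable f) (hg : Measurable g) : Measurable fun a => Function.update (f a) k (g a) :=
  measurable_update'.comp (f := fun a => (f a, g a)) (hf.prodMk hg)

/-- Expectations of functions of a channel and the quantized channels are bounded by the
expectations without quantization. -/
theorem lintegral_outcomeLaw_le {M : ℕ} (b : Fin M → ℕ) (k : Fin M)
    (F : (Fin M → ℂ) → (Fin M → Fin M → ℂ) → ℝ≥0∞)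
    (hF : Measurable fun p : (Fin M → ℂ) × (Fin M → Fin M → ℂ) => F p.1 p.2) :
    ∫⁻ ω, F (ω.1 k) (fun j => quantize (ω.1 j) (ω.2 j)) ∂(outcomeLaw M b) ≤
      2 ^ b k * ∫⁻ w, ∫⁻ h, F h w ∂(channelLaw M) ∂(Measure.pi fun _ : Fin M => isotropicLaw M) := by
  rw [lintegral_outcomeLaw b k F hF]
  set Fb : (Fin M → ℂ) → (Fin M → ℂ) → ℝ≥0∞ := fun h x => ∫⁻ w, F h (Function.update w k x)
    ∂(Measure.pi fun _ : Fin M => isotropicLaw M) with hFb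
  have hup : Measurable fun p : ((Fin M → ℂ) × (Fin M → ℂ)) × (Fin M → Fin M → ℂ) =>
      F p.1.1 (Function.update p.2 k p.1.2) :=
    hF.comp (f := fun p : ((Fin M → ℂ) × (Fin M → ℂ)) × (Fin M → Fin M → ℂ) =>
      (p.1.1, Function.update p.2 k p.1.2))
      ((by fun_prop : Measurable fun p : ((Fin M → ℂ) × (Fin M → ℂ)) × (Fin M → Fin M → ℂ) =>
        p.1.1).prodMk (measurable_update_pair (by fun_prop) (by fun_prop)))
  have hFbm : Measurable fun p : (Fin M → ℂ) × (Fin M → ℂ) => Fb p.1 p.2 :=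
    Measurable.lintegral_prod_right' hup
  -- The chosen codeword is one of `2 ^ b k`; bounding by the sum over all of them removes the
  -- dependence on the channel at the price of a finite factor.
  have hpt : ∀ q : (Fin M → ℂ) × (Fin (2 ^ b k) → Fin M → ℂ),
      Fb q.1 (quantize q.1 q.2) ≤ ∑ j, Fb q.1 (q.2 j) := fun q => by
    rw [quantize_eq]
    exact Finset.single_le_sum (f := fun j => Fb q.1 (q.2 j)) (fun _ _ => bot_le)
      (Finset.mem_univ _)
  have hj : ∀ j : Fin (2 ^ b k), Measurable fun q : (Fin M → ℂ) × (Fin (2 ^ b k) → Fin M → ℂ) =>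
      Fb q.1 (q.2 j) := fun j =>
    hFbm.comp (f := fun q : (Fin M → ℂ) × (Fin (2 ^ b k) → Fin M → ℂ) => (q.1, q.2 j)) (by fun_prop)
  calc _ ≤ ∫⁻ q, ∑ j, Fb q.1 (q.2 j) ∂((channelLaw M).prod (codebookLaw M (2 ^ b k))) :=
        lintegral_mono hpt
    _ = ∑ j : Fin (2 ^ b k), ∫⁻ h, ∫⁻ x, Fb h x ∂(isotropicLaw M) ∂(channelLaw M) := by
        rw [lintegral_finsetSum _ fun j _ => hj j]
        refine Finset.sum_congr rfl fun j _ => ?_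
        rw [lintegral_prod _ (hj j).aemeasurable]
        refine lintegral_congr fun h => ?_
        exact (measurePreserving_eval (fun _ : Fin (2 ^ b k) => isotropicLaw M) j).lintegral_comp
          (hFbm.comp (f := fun x => (h, x)) (by fun_prop))
    _ = 2 ^ b k * ∫⁻ h, ∫⁻ w, F h w ∂(Measure.pi fun _ : Fin M => isotropicLaw M)
          ∂(channelLaw M) := by
        rw [Finset.sum_const, Finset.card_univ, Fintype.card_fin, nsmul_eq_mul]
        push_cast
        congr 1
        refine lintegral_congr fun h => ?_
        rw [lintegral_pi_update (fun _ : Fin M => isotropicLaw M) k (fun w => F h w)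
          (hF.comp (f := fun w => (h, w)) (by fun_prop))]
        simp only [hFb]
        exact lintegral_lintegral_swap (hup.comp (f := fun p : (Fin M → ℂ) × (Fin M → Fin M → ℂ) =>
          ((h, p.1), p.2)) (by fun_prop)).aemeasurable
    _ = _ := by
        congr 1
        exact lintegral_lintegral_swap hF.aemeasurable

lemma gain_le_mul {M : ℕ} (x y : Fin M → ℂ) : gain x y ≤ l2norm x ^ 2 * l2norm y ^ 2 := by
  rw [gain_eq_inner, l2norm_eq_norm, l2norm_eq_norm, ← mul_pow]
  exact pow_le_pow_left₀ (norm_nonneg _) (norm_inner_le_norm _ _) 2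

lemma smul_direction {M : ℕ} (h : Fin M → ℂ) (hh : h ≠ 0) : (l2norm h : ℂ) • direction h = h := by
  have : (l2norm h : ℂ) ≠ 0 := by exact_mod_cast ((l2norm_pos_iff h).2 hh).ne'
  rw [direction_eq_smul, smul_smul, mul_inv_cancel₀ this, one_smul]

lemma gain_direction {M : ℕ} (h v : Fin M → ℂ) (hh : h ≠ 0) :
    gain (direction h) v = gain h v / l2norm h ^ 2 := by
  have hp := (l2norm_pos_iff h).2 hh
  rw [direction_eq_smul, gain_smul_left, norm_inv, Complex.norm_real, Real.norm_eq_abs, inv_pow,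
    sq_abs]
  field_simp

/-- The matrix of the quantized channels. -/
def frameDet {M : ℕ} (w : Fin M → Fin M → ℂ) : ℂ :=
  (Matrix.of fun j => star (w j) : Matrix (Fin M) (Fin M) ℂ).det

lemma measurable_frameDet {M : ℕ} : Measurable (frameDet (M := M)) := by
  have hc : Continuous fun w : Fin M → Fin M → ℂ =>
      (Matrix.of fun j => star (w j) : Matrix (Fin M) (Fin M) ℂ) := by
    refine continuous_matrix fun i j => ?_
    simp only [Matrix.of_apply, Pi.star_apply]
    fun_prop
  exact hc.matrix_det.measurable

lemma limitRate_of_frameDet_eq_zero {M : ℕ} (k : Fin M) (h : Fin M → ℂ) (w : Fin M → Fin M → ℂ)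
    (hd : frameDet w = 0) : limitRate k h w = 0 := by
  rw [limitRate, zeroForcing_of_det_eq_zero w k hd]
  simp [gain]

lemma log_one_add_le_two_sqrt {x : ℝ} (hx : 0 ≤ x) : Real.log (1 + x) ≤ 2 * √x := by
  have h1 : 1 + x ≤ (1 + √x) ^ 2 := by
    nlinarith [Real.sq_sqrt hx, Real.sqrt_nonneg x]
  calc Real.log (1 + x) ≤ Real.log ((1 + √x) ^ 2) := Real.log_le_log (by linarith) h1
    _ = 2 * Real.log (1 + √x) := by rw [Real.log_pow]; norm_num
    _ ≤ 2 * √x := by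
      have := Real.log_le_sub_one_of_pos (by positivity : 0 < 1 + √x)
      linarith

/-- A bound for the limiting rate by a function with finite expectation. -/
def rateBound {M : ℕ} (i : Fin M) (h : Fin M → ℂ) (w : Fin M → Fin M → ℂ) : ℝ≥0∞ :=
  Set.indicator {w | frameDet w ≠ 0}
    (fun w => 2 * ENNReal.ofReal (gain (direction h) (zeroForcing w i)) ^ (-(1 / 2) : ℝ)) w

lemma measurable_rateBound {M : ℕ} (i : Fin M) :
    Measurable fun p : (Fin M → ℂ) × (Fin M → Fin M → ℂ) => rateBound i p.1 p.2 := by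
  have hs : MeasurableSet {p : (Fin M → ℂ) × (Fin M → Fin M → ℂ) | frameDet p.2 ≠ 0} :=
    (measurable_frameDet.comp measurable_snd) (measurableSet_singleton (0 : ℂ)).compl
  have hg : Measurable fun p : (Fin M → ℂ) × (Fin M → Fin M → ℂ) =>
      gain (direction p.1) (zeroForcing p.2 i) :=
    measurable_gain ((measurable_direction M).comp measurable_fst)
      ((measurable_zeroForcing M i).comp measurable_snd)
  exact Measurable.indicator (f := fun p : (Fin M → ℂ) × (Fin M → Fin M → ℂ) =>
    2 * ENNReal.ofReal (gain (direction p.1) (zeroForcing p.2 i)) ^ (-(1 / 2) : ℝ))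
    ((hg.ennreal_ofReal.pow_const _).const_mul 2) hs

/-- The signal is at most the squared norm of `h`, and the interference is at least the term of a
single other user `i`. The ratio is thus at most an inverse gain, and `log (1 + x) ≤ 2 √x` makes it
integrable. -/
lemma limitRate_le_rateBound {M : ℕ} {k i : Fin M} (hik : i ≠ k) (h : Fin M → ℂ) (hh : h ≠ 0)
    (w : Fin M → Fin M → ℂ) : ENNReal.ofReal (limitRate k h w) ≤ rateBound i h w := by
  by_cases hd : frameDet w = 0
  · rw [limitRate_of_frameDet_eq_zero k h w hd]; simp
  · rw [rateBound, Set.indicator_of_mem (by exact hd)]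
    rcases (gain_nonneg (direction h) (zeroForcing w i)).eq_or_lt with h0 | h0
    · rw [← h0, ENNReal.ofReal_zero, ENNReal.zero_rpow_of_neg (by norm_num)]
      simp
    · have hp := (l2norm_pos_iff h).2 hh
      have hg := gain_direction h (zeroForcing w i) hh
      have hgp : 0 < gain h (zeroForcing w i) := by
        rw [hg] at h0
        by_contra hc
        exact absurd h0 (not_lt.2 (div_nonpos_of_nonpos_of_nonneg (not_lt.1 hc) (by positivity)))
      have hB : gain h (zeroForcing w i) ≤ interference k h w :=
        Finset.single_le_sum (f := fun i => gain h (zeroForcing w i)) (fun _ _ => gain_nonneg _ _)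
          (Finset.mem_erase.2 ⟨hik, Finset.mem_univ _⟩)
      have hA : gain h (zeroForcing w k) ≤ l2norm h ^ 2 := by
        have := gain_le_mul h (zeroForcing w k)
        rwa [l2norm_zeroForcing w k hd, one_pow, mul_one] at this
      have hle : gain h (zeroForcing w k) / interference k h w
          ≤ (gain (direction h) (zeroForcing w i))⁻¹ := by
        rw [hg, inv_div]
        exact div_le_div₀ (by positivity) hA hgp hB
      have h1 : limitRate k h w ≤ 2 * (gain (direction h) (zeroForcing w i)) ^ (-(1 / 2) : ℝ) := by
        rw [limitRate]
        refine (Real.log_le_log (by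
          have := div_nonneg (gain_nonneg h (zeroForcing w k)) (interference_nonneg k h w)
          linarith) (add_le_add le_rfl hle)).trans
          ((log_one_add_le_two_sqrt (by positivity)).trans_eq ?_)
        rw [Real.rpow_neg h0.le, ← Real.sqrt_eq_rpow, Real.sqrt_inv]
      rw [ENNReal.ofReal_rpow_of_pos h0]
      refine (ENNReal.ofReal_le_ofReal h1).trans_eq ?_
      rw [ENNReal.ofReal_mul (by norm_num)]
      simp

/-- The density of the squared sine is at most `M - 1` on `[0, 1]`, and `(1 - t) ^ (-1/2)` has
integral `2`. Besides integrability this yields later that gains are almost surely nonzero. -/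
lemma lintegral_gain_rpow_lt_top {M : ℕ} (hM : 2 ≤ M) (v : Fin M → ℂ) (hv : l2norm v = 1) :
    ∫⁻ x, ENNReal.ofReal (gain x v) ^ (-(1 / 2) : ℝ) ∂(isotropicLaw M) ≤
      ENNReal.ofReal (2 * (M - 1 : ℕ)) := by
  simp_rw [fun x => gain_comm x v]
  rw [lintegral_isotropicLaw_gain hM v hv (fun t => ENNReal.ofReal t ^ (-(1 / 2) : ℝ)) (by fun_prop)]
  have hint : IntervalIntegrable (fun t : ℝ => ((M - 1 : ℕ) : ℝ) * (1 - t) ^ (-(1 / 2) : ℝ)) volume 0 1 := by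
    have := (intervalIntegral.intervalIntegrable_rpow' (a := 0) (b := 1)
      (by norm_num : (-1 : ℝ) < -(1 / 2))).comp_sub_left 1
    simp only [sub_zero, sub_self] at this
    exact this.symm.const_mul _
  have hval : ∫ t in (0 : ℝ)..1, ((M - 1 : ℕ) : ℝ) * (1 - t) ^ (-(1 / 2) : ℝ) = 2 * (M - 1 : ℕ) := by
    rw [intervalIntegral.integral_const_mul, intervalIntegral.integral_comp_sub_left
      (fun t : ℝ => t ^ (-(1 / 2) : ℝ)), integral_rpow (Or.inl (by norm_num))]
    norm_num; ring
  rw [← hval, intervalIntegral.integral_of_le zero_le_one, ofReal_integral_eq_lintegral_ofReal hint.1]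
  · rw [← restrict_Ioo_eq_restrict_Ioc]
    refine setLIntegral_mono' measurableSet_Ioo fun t ht => ?_
    rw [ENNReal.ofReal_rpow_of_pos (by linarith [ht.2]), ← ENNReal.ofReal_mul
      (Real.rpow_nonneg (by linarith [ht.2]) _)]
    refine ENNReal.ofReal_le_ofReal ?_
    rw [mul_comm]
    refine mul_le_mul_of_nonneg_right ?_ (Real.rpow_nonneg (by linarith [ht.2]) _)
    exact mul_le_of_le_one_right (by positivity) (pow_le_one₀ ht.1.le ht.2.le)
  · refine (ae_restrict_iff' measurableSet_Ioc).2 (ae_of_all _ fun t ht => ?_)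
    exact mul_nonneg (by positivity) (Real.rpow_nonneg (by linarith [ht.2]) _)

lemma lintegral_rateBound_lt_top {M : ℕ} (hM : 2 ≤ M) (b : Fin M → ℕ) (k i : Fin M) :
    ∫⁻ ω, rateBound i (ω.1 k) (fun j => quantize (ω.1 j) (ω.2 j)) ∂(outcomeLaw M b) < ∞ := by
  refine (lintegral_outcomeLaw_le b k _ (measurable_rateBound i)).trans_lt ?_
  have : ∀ w, ∫⁻ h, rateBound i h w ∂(channelLaw M) ≤ 2 * ENNReal.ofReal (2 * (M - 1 : ℕ)) := by
    intro w
    by_cases hd : frameDet w = 0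
    · simp [rateBound, hd]
    · simp only [rateBound]
      simp_rw [Set.indicator_of_mem (show w ∈ {w | frameDet w ≠ 0} from hd)]
      have hm : Measurable fun x : Fin M → ℂ =>
          ENNReal.ofReal (gain x (zeroForcing w i)) ^ (-(1 / 2) : ℝ) :=
        (measurable_gain measurable_id measurable_const).ennreal_ofReal.pow_const _
      have hmd : Measurable fun h : Fin M → ℂ =>
          ENNReal.ofReal (gain (direction h) (zeroForcing w i)) ^ (-(1 / 2) : ℝ) :=
        hm.comp (measurable_direction M)
      rw [lintegral_const_mul _ hmd]
      gcongr
      refine le_trans (le_of_eq ?_) (lintegral_gain_rpow_lt_top hM _ (l2norm_zeroForcing w i hd))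
      rw [isotropicLaw, lintegral_map hm (measurable_direction M)]
  refine ENNReal.mul_lt_top (by simp) ((lintegral_mono this).trans_lt ?_)
  rw [lintegral_const, measure_univ, mul_one]
  exact ENNReal.mul_lt_top (by simp) ENNReal.ofReal_lt_top

end

/-! ### The high-SNR limit, and the rate as a function of the quantization error. -/

section

open scoped ENNReal

/-- The quantized channels of an outcome. -/
def quantized {M : ℕ} {b : Fin M → ℕ} (ω : Outcome M b) : Fin M → Fin M → ℂ :=
  fun j => quantize (ω.1 j) (ω.2 j)

lemma measurable_quantized {M : ℕ} {b : Fin M → ℕ} :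
    Measurable (quantized : Outcome M b → Fin M → Fin M → ℂ) :=
  measurable_pi_lambda _ fun j => measurable_quantize.comp
    (f := fun ω : Outcome M b => (ω.1 j, ω.2 j)) (by fun_prop)

lemma instRate_eq {M : ℕ} {b : Fin M → ℕ} (P : ℝ) (k : Fin M) (ω : Outcome M b) :
    instRate P k ω = Real.log (1 + P / M * gain (ω.1 k) (zeroForcing (quantized ω) k) /
      (1 + P / M * interference k (ω.1 k) (quantized ω))) / Real.log 2 := by
  rw [instRate, Real.logb, interference, Finset.mul_sum]
  rfl

lemma measurable_instRate {M : ℕ} {b : Fin M → ℕ} (P : ℝ) (k : Fin M) :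
    Measurable (fun ω : Outcome M b => instRate P k ω) := by
  have h0 : Measurable fun ω : Outcome M b => ω.1 k := by fun_prop
  have h1 : ∀ i, Measurable fun ω : Outcome M b => gain (ω.1 k) (zeroForcing (quantized ω) i) :=
    fun i => measurable_gain h0 ((measurable_zeroForcing M i).comp measurable_quantized)
  have h2 : Measurable fun ω : Outcome M b => interference k (ω.1 k) (quantized ω) :=
    Finset.measurable_fun_sum _ fun i _ => h1 i
  simp_rw [instRate_eq]
  exact (Real.measurable_log.comp ((((h1 k).const_mul _).div
    ((h2.const_mul _).const_add 1)).const_add 1)).div_const _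

lemma measurable_limitRate_quantized {M : ℕ} {b : Fin M → ℕ} (k : Fin M) :
    Measurable (fun ω : Outcome M b => limitRate k (ω.1 k) (quantized ω)) :=
  measurable_limitRate (by fun_prop) measurable_quantized

lemma outcomeLaw_ae_channel_ne_zero {M : ℕ} (b : Fin M → ℕ) (k : Fin M) :
    ∀ᵐ ω ∂(outcomeLaw M b), ω.1 k ≠ 0 := by
  have h1 : ∀ᵐ x ∂(Measure.pi fun _ : Fin M => channelLaw M), x k ≠ 0 :=
    (measurePreserving_eval (fun _ : Fin M => channelLaw M) k).quasiMeasurePreserving.ae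
      (channelLaw_ae_ne_zero k)
  exact Measure.quasiMeasurePreserving_fst.ae h1

lemma exists_ne_of_two_le {M : ℕ} (hM : 2 ≤ M) (k : Fin M) : ∃ i : Fin M, i ≠ k := by
  have : Nontrivial (Fin M) := Fin.nontrivial_iff_two_le.2 hM
  exact exists_ne k

lemma lintegral_limitRate_lt_top {M : ℕ} (hM : 2 ≤ M) (b : Fin M → ℕ) (k : Fin M) :
    ∫⁻ ω, ENNReal.ofReal (limitRate k (ω.1 k) (quantized ω)) ∂(outcomeLaw M b) < ∞ := by
  obtain ⟨i, hik⟩ := exists_ne_of_two_le hM k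
  refine lt_of_le_of_lt (lintegral_mono_ae ?_) (lintegral_rateBound_lt_top hM b k i)
  filter_upwards [outcomeLaw_ae_channel_ne_zero b k] with ω hω
  exact limitRate_le_rateBound hik _ hω _

lemma integrable_limitRate {M : ℕ} (hM : 2 ≤ M) (b : Fin M → ℕ) (k : Fin M) :
    Integrable (fun ω => limitRate k (ω.1 k) (quantized ω)) (outcomeLaw M b) := by
  refine ⟨(measurable_limitRate_quantized k).aestronglyMeasurable, ?_⟩
  rw [hasFiniteIntegral_iff_ofReal (ae_of_all _ fun ω => limitRate_nonneg _ _ _)]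
  exact lintegral_limitRate_lt_top hM b k

/-- Almost surely the signal vanishes or there is interference. -/
lemma ae_interference_pos {M : ℕ} (hM : 2 ≤ M) (b : Fin M → ℕ) (k : Fin M) :
    ∀ᵐ ω ∂(outcomeLaw M b), gain (ω.1 k) (zeroForcing (quantized ω) k) = 0 ∨
      0 < interference k (ω.1 k) (quantized ω) := by
  obtain ⟨i, hik⟩ := exists_ne_of_two_le hM k
  have hm : Measurable fun ω : Outcome M b => rateBound i (ω.1 k) (quantized ω) :=
    (measurable_rateBound i).comp (f := fun ω : Outcome M b => (ω.1 k, quantized ω))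
      ((by fun_prop : Measurable fun ω : Outcome M b => ω.1 k).prodMk measurable_quantized)
  filter_upwards [ae_lt_top hm (lintegral_rateBound_lt_top hM b k i).ne,
    outcomeLaw_ae_channel_ne_zero b k] with ω hω hne
  by_cases hd : frameDet (quantized ω) = 0
  · left
    rw [zeroForcing_of_det_eq_zero _ k hd]; simp [gain]
  · right
    rw [rateBound, Set.indicator_of_mem (by exact hd)] at hω
    have hB : gain (ω.1 k) (zeroForcing (quantized ω) i) ≤ interference k (ω.1 k) (quantized ω) :=
      Finset.single_le_sum (f := fun i => gain (ω.1 k) (zeroForcing (quantized ω) i))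
        (fun _ _ => gain_nonneg _ _) (Finset.mem_erase.2 ⟨hik, Finset.mem_univ _⟩)
    refine lt_of_lt_of_le ?_ hB
    -- A zero gain would make `rateBound` infinite, which its finite integral forbids almost surely.
    refine lt_of_le_of_ne (gain_nonneg _ _) fun h0 => ?_
    rw [gain_direction _ _ hne, ← h0, zero_div, ENNReal.ofReal_zero,
      ENNReal.zero_rpow_of_neg (by norm_num)] at hω
    simp at hω

/-- Dropping the noise only increases the ratio. The side condition excludes a positive signal
without interference, where the limiting ratio would be `0` by the convention `x / 0 = 0`. -/
lemma abs_instRate_le {M : ℕ} {b : Fin M → ℕ} {P : ℝ} (hP : 0 < P) (k : Fin M) (ω : Outcome M b)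
    (h : gain (ω.1 k) (zeroForcing (quantized ω) k) = 0 ∨
      0 < interference k (ω.1 k) (quantized ω)) :
    ‖instRate P k ω‖ ≤ limitRate k (ω.1 k) (quantized ω) / Real.log 2 := by
  have hM : 0 < (M : ℝ) := by exact_mod_cast k.pos
  have hA := gain_nonneg (ω.1 k) (zeroForcing (quantized ω) k)
  have hB := interference_nonneg k (ω.1 k) (quantized ω)
  have hl := Real.log_pos one_lt_two
  have hc : 0 < P / M := by positivity
  rw [instRate_eq, Real.norm_of_nonneg (div_nonneg (Real.log_nonneg (by
    have : 0 ≤ P / M * gain (ω.1 k) (zeroForcing (quantized ω) k) /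
      (1 + P / M * interference k (ω.1 k) (quantized ω)) := by positivity
    linarith)) hl.le), limitRate]
  refine div_le_div_of_nonneg_right (Real.log_le_log (by positivity) (add_le_add le_rfl ?_)) hl.le
  rcases h with h | h
  · rw [h]; simp
  · rw [div_le_div_iff₀ (by positivity) h]
    nlinarith

lemma tendsto_instRate {M : ℕ} {b : Fin M → ℕ} (k : Fin M) (ω : Outcome M b)
    (h : gain (ω.1 k) (zeroForcing (quantized ω) k) = 0 ∨
      0 < interference k (ω.1 k) (quantized ω)) :
    Tendsto (fun P => instRate P k ω) atTop
      (𝓝 (limitRate k (ω.1 k) (quantized ω) / Real.log 2)) := by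
  have hM : 0 < (M : ℝ) := by exact_mod_cast k.pos
  have hA := gain_nonneg (ω.1 k) (zeroForcing (quantized ω) k)
  simp_rw [instRate_eq]
  rcases h with h | h
  · simp [limitRate, h]
  · refine Tendsto.div_const ?_ _
    rw [limitRate]
    refine Tendsto.log ?_ (by positivity)
    refine Tendsto.const_add _ ?_
    have e : (fun P : ℝ => gain (ω.1 k) (zeroForcing (quantized ω) k) /
        ((P / M)⁻¹ + interference k (ω.1 k) (quantized ω))) =ᶠ[atTop]
        fun P : ℝ => P / M * gain (ω.1 k) (zeroForcing (quantized ω) k) /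
          (1 + P / M * interference k (ω.1 k) (quantized ω)) := by
      filter_upwards [eventually_gt_atTop 0] with P hP
      have : 0 < P / M := by positivity
      field_simp
    refine Tendsto.congr' e ?_
    refine Tendsto.div tendsto_const_nhds ?_ h.ne'
    have h3 : Tendsto (fun P : ℝ => (P / M)⁻¹) atTop (𝓝 0) :=
      (tendsto_id.atTop_div_const hM).inv_tendsto_atTop
    simpa using h3.add_const (interference k (ω.1 k) (quantized ω))

theorem integrable_instRate {M : ℕ} (hM : 2 ≤ M) (b : Fin M → ℕ) {P : ℝ} (hP : 0 < P) (k : Fin M) :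
    Integrable (fun ω => instRate P k ω) (outcomeLaw M b) := by
  refine ((integrable_limitRate hM b k).div_const (Real.log 2)).mono'
    (measurable_instRate P k).aestronglyMeasurable ?_
  filter_upwards [ae_interference_pos hM b k] with ω hω using abs_instRate_le hP k ω hω

theorem tendsto_sumRate {M : ℕ} (hM : 2 ≤ M) (b : Fin M → ℕ) :
    Tendsto (fun P : ℝ => sumRate M P b) atTop (𝓝 (∑ k, (∫ ω, limitRate k (ω.1 k) (quantized ω)
      ∂(outcomeLaw M b)) / Real.log 2)) := by
  unfold sumRate
  refine tendsto_finsetSum _ fun k _ => ?_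
  rw [← integral_div]
  refine tendsto_integral_filter_of_dominated_convergence
    (fun ω => limitRate k (ω.1 k) (quantized ω) / Real.log 2)
    (Eventually.of_forall fun P => (measurable_instRate P k).aestronglyMeasurable) ?_
    ((integrable_limitRate hM b k).div_const (Real.log 2)) ?_
  · filter_upwards [eventually_gt_atTop 0] with P hP
    filter_upwards [ae_interference_pos hM b k] with ω hω using abs_instRate_le hP k ω hω
  · filter_upwards [ae_interference_pos hM b k] with ω hω using tendsto_instRate k ω hω

/-- The unit vector at squared sine `a` from the `k`th basis vector, in the direction of the
`j`th. -/
def tilted {M : ℕ} (k j : Fin M) (a : ℝ) : Fin M → ℂ :=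
  ((√(1 - a) : ℝ) : ℂ) • Pi.single k 1 + ((√a : ℝ) : ℂ) • Pi.single j 1

/-- The mean limiting rate of a user whose quantization error is `a`. -/
def errorRate {M : ℕ} (k j : Fin M) (a : ℝ) : ℝ≥0∞ :=
  ∫⁻ w, ENNReal.ofReal (limitRate k (tilted k j a) (Function.update w k (Pi.single k 1)))
    ∂(Measure.pi fun _ : Fin M => isotropicLaw M)

lemma measurable_tilted {M : ℕ} (k j : Fin M) : Measurable (tilted k j) := by
  unfold tilted
  refine measurable_pi_lambda _ fun i => ?_
  simp only [Pi.add_apply, Pi.smul_apply, smul_eq_mul]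
  fun_prop

lemma measurable_errorRate {M : ℕ} (k j : Fin M) : Measurable (errorRate k j) :=
  Measurable.lintegral_prod_right' (f := fun p : ℝ × (Fin M → Fin M → ℂ) =>
    ENNReal.ofReal (limitRate k (tilted k j p.1) (Function.update p.2 k (Pi.single k 1))))
    (measurable_limitRate ((measurable_tilted k j).comp measurable_fst)
      (measurable_update_pair measurable_snd measurable_const)).ennreal_ofReal

lemma rot_add {M : ℕ} (U : Matrix.unitaryGroup (Fin M) ℂ) (x y : Fin M → ℂ) :
    rot U (x + y) = rot U x + rot U y := Matrix.mulVec_add _ _ _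

lemma rot_smul {M : ℕ} (U : Matrix.unitaryGroup (Fin M) ℂ) (c : ℂ) (x : Fin M → ℂ) :
    rot U (c • x) = c • rot U x := Matrix.mulVec_smul _ _ _

/-- Up to a nonzero scalar and a unitary map, a channel and its quantized vector are determined by
the angle between them. Split `h` into its part along `x` and the rest, and normalize the phase of
the first coefficient. -/
lemma exists_rot_tilted {M : ℕ} {k j : Fin M} (hjk : j ≠ k) (h x : Fin M → ℂ) (hh : h ≠ 0)
    (hx : l2norm x = 1) : ∃ (U : Matrix.unitaryGroup (Fin M) ℂ) (c : ℂ), c ≠ 0 ∧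
      rot U (Pi.single k 1) = x ∧ h = c • rot U (tilted k j (1 - gain (direction h) x)) := by
  have hp := (l2norm_pos_iff h).2 hh
  set α : ℂ := star x ⬝ᵥ h with hα
  set r : Fin M → ℂ := h - α • x with hr
  have hxx : star x ⬝ᵥ x = 1 := by rw [star_dotProduct_self, hx]; norm_num
  have hxr : star x ⬝ᵥ r = 0 := by
    rw [hr, dotProduct_sub, dotProduct_smul, hxx, ← hα]; simp
  have hgain : gain (direction h) x = ‖α‖ ^ 2 / l2norm h ^ 2 := by
    rw [gain_direction _ _ hh, gain_comm, gain]
  -- The phase of the component along `x`, pulled out of both components so that the remaining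
  -- coefficients are the real numbers used by `tilted`.
  set u : ℂ := if α = 0 then 1 else α / (‖α‖ : ℂ) with hu
  have hun : ‖u‖ = 1 := by
    rw [hu]; split_ifs with h0
    · simp
    · rw [norm_div, Complex.norm_real, norm_norm, div_self (norm_ne_zero_iff.2 h0)]
  have hu0 : u ≠ 0 := norm_ne_zero_iff.1 (by rw [hun]; norm_num)
  have huα : u * (‖α‖ : ℂ) = α := by
    rw [hu]; split_ifs with h0
    · simp [h0]
    · have : (‖α‖ : ℂ) ≠ 0 := by exact_mod_cast norm_ne_zero_iff.2 h0
      field_simp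
  have hsplit : l2norm h ^ 2 = ‖α‖ ^ 2 + l2norm r ^ 2 := by
    have e : h = α • x + r := by rw [hr]; abel
    have h1 := star_dotProduct_self h
    have hrx : star r ⬝ᵥ x = 0 := by
      rw [Matrix.star_dotProduct, hxr, star_zero]
    rw [e, star_add, add_dotProduct, dotProduct_add, dotProduct_add, star_smul, smul_dotProduct,
      smul_dotProduct, dotProduct_smul, dotProduct_smul, hxx, hxr, hrx, star_dotProduct_self,
      ← e] at h1
    have h2 : star α * α = ((‖α‖ ^ 2 : ℝ) : ℂ) := by
      rw [RCLike.star_def, Complex.conj_mul']; push_cast; rfl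
    simp only [smul_eq_mul, mul_one, mul_zero, add_zero, zero_add, h2] at h1
    exact_mod_cast h1.symm
  obtain ⟨y, hy1, hxy, hry⟩ : ∃ y : Fin M → ℂ, l2norm y = 1 ∧ star x ⬝ᵥ y = 0 ∧
      r = ((l2norm r : ℝ) : ℂ) • u • y := by
    -- When `h` is parallel to `x` the error direction is arbitrary; any unit vector orthogonal to
    -- `x` will do.
    by_cases h0 : r = 0
    · obtain ⟨U, hU⟩ := exists_rot_eq k x hx
      refine ⟨rot U (Pi.single j 1), by rw [l2norm_rot, l2norm_single], ?_, ?_⟩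
      · rw [← hU, star_rot_dotProduct_rot, ← Pi.single_star, star_one, single_one_dotProduct,
          Pi.single_eq_of_ne hjk.symm]
      · rw [h0]; simp [l2norm]
    · refine ⟨u⁻¹ • direction r, ?_, ?_, ?_⟩
      · have h1 := star_dotProduct_self (u⁻¹ • direction r)
        have h2 := l2norm_sq (u⁻¹ • direction r)
        have h3 := l2norm_sq (direction r)
        rw [l2norm_direction r h0] at h3
        simp only [Pi.smul_apply, norm_smul, norm_inv, hun, inv_one, one_mul] at h2
        rw [← h3] at h2
        exact (sq_eq_sq₀ (l2norm_nonneg _) zero_le_one).1 h2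
      · rw [direction_eq_smul, dotProduct_smul, dotProduct_smul, hxr]; simp
      · rw [smul_smul u, mul_inv_cancel₀ hu0, one_smul, smul_direction r h0]
  obtain ⟨U, hU1, hU2⟩ := exists_rot_eq_pair k j hjk.symm x y hx hy1 hxy
  refine ⟨U, (l2norm h : ℂ) * u, mul_ne_zero (by exact_mod_cast hp.ne') hu0, hU1, ?_⟩
  have s1 : √(1 - (1 - gain (direction h) x)) = ‖α‖ / l2norm h := by
    rw [hgain, sub_sub_cancel, ← div_pow, Real.sqrt_sq (by positivity)]
  have s2 : √(1 - gain (direction h) x) = l2norm r / l2norm h := by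
    rw [hgain, show 1 - ‖α‖ ^ 2 / l2norm h ^ 2 = (l2norm r / l2norm h) ^ 2 by
      field_simp; linarith, Real.sqrt_sq (div_nonneg (l2norm_nonneg _) hp.le)]
  have hpc : (l2norm h : ℂ) ≠ 0 := by exact_mod_cast hp.ne'
  rw [tilted, rot_add, rot_smul, rot_smul, hU1, hU2, s1, s2, smul_add, smul_smul, smul_smul]
  have e1 : (l2norm h : ℂ) * u * ((‖α‖ / l2norm h : ℝ) : ℂ) = α := by
    have : (l2norm h : ℂ) * u * ((‖α‖ / l2norm h : ℝ) : ℂ) = u * (‖α‖ : ℂ) := by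
      push_cast; field_simp
    rw [this, huα]
  have e2 : (l2norm h : ℂ) * u * ((l2norm r / l2norm h : ℝ) : ℂ) = (l2norm r : ℂ) * u := by
    push_cast; field_simp
  rw [e1, e2, mul_smul, ← hry, hr]; abel

/-- The mean rate given the channel and the quantized channel of a user depends only on the
quantization error. -/
theorem lintegral_limitRate_update {M : ℕ} {k j : Fin M} (hjk : j ≠ k) (h x : Fin M → ℂ)
    (hh : h ≠ 0) (hx : l2norm x = 1) :
    ∫⁻ w, ENNReal.ofReal (limitRate k h (Function.update w k x))
      ∂(Measure.pi fun _ : Fin M => isotropicLaw M) = errorRate k j (1 - gain (direction h) x) := by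
  obtain ⟨U, c, hc, hU, hhU⟩ := exists_rot_tilted hjk h x hh hx
  set a := 1 - gain (direction h) x
  have hm : Measurable fun w : Fin M → Fin M → ℂ =>
      ENNReal.ofReal (limitRate k h (Function.update w k x)) :=
    (measurable_limitRate measurable_const
      (measurable_update_pair measurable_id measurable_const)).ennreal_ofReal
  have hr : Measurable fun (w : Fin M → Fin M → ℂ) i => rot U (w i) :=
    measurable_pi_lambda _ fun i => (measurable_rot U).comp (measurable_pi_apply i)
  rw [← pi_isotropicLaw_map_rot U, lintegral_map hm hr, errorRate]
  refine lintegral_congr fun w => ?_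
  have : Function.update (fun i => rot U (w i)) k x
      = fun i => rot U (Function.update w k (Pi.single k 1) i) := by
    ext i : 1
    by_cases hi : i = k
    · subst hi; simp [hU]
    · simp [hi]
  rw [this, hhU, ← rot_smul, limitRate_rot, limitRate_smul c hc]

end

/-! ### The exponential coordinate of the quantization error. -/

section

open scoped ENNReal

/-- The quantization error as a function of its exponential coordinate. -/
def errorOf (d : ℕ) (x : ℝ) : ℝ := (1 - Real.exp (-x)) ^ ((1 : ℝ) / (d : ℝ))

lemma measurable_errorOf (d : ℕ) : Measurable (errorOf d) := by
  unfold errorOf; fun_prop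

lemma errorOf_errorExponent {d : ℕ} (hd : d ≠ 0) {a : ℝ} (h0 : 0 ≤ a) (h1 : a < 1) :
    errorOf d (errorExponent d a) = a := by
  have : a ^ d < 1 := pow_lt_one₀ h0 h1 hd
  rw [errorOf, errorExponent, neg_neg, Real.exp_log (by linarith), sub_sub_cancel, one_div,
    Real.pow_rpow_inv_natCast h0 hd]

lemma errorExponent_nonneg {d : ℕ} {a : ℝ} (h0 : 0 ≤ a) (h1 : a ≤ 1) : 0 ≤ errorExponent d a := by
  have h2 : a ^ d ≤ 1 := pow_le_one₀ h0 h1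
  have h3 : 0 ≤ a ^ d := pow_nonneg h0 d
  rw [errorExponent, neg_nonneg]
  exact Real.log_nonpos (by linarith) (by linarith)

lemma errorExponent_mono {d : ℕ} {a b : ℝ} (h0 : 0 ≤ a) (hab : a ≤ b) (h1 : b < 1) (hd : d ≠ 0) :
    errorExponent d a ≤ errorExponent d b := by
  have h2 : a ^ d ≤ b ^ d := pow_le_pow_left₀ h0 hab d
  have h3 : b ^ d < 1 := pow_lt_one₀ (h0.trans hab) h1 hd
  rw [errorExponent, errorExponent, neg_le_neg_iff]
  exact Real.log_le_log (by linarith) (by linarith)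

/-- In its exponential coordinate the quantization error with `n` codewords is exponential. -/
theorem codebookLaw_map_exponent {M : ℕ} (hM : 2 ≤ M) (n : ℕ) (h : Fin M → ℂ) (hh : h ≠ 0) :
    (codebookLaw M (2 ^ n)).map (fun w => errorExponent (M - 1) (1 - gain (direction h) (quantize h w)))
      = expMeasure (2 ^ n) := by
  have hy : l2norm (direction h) = 1 := l2norm_direction h hh
  have k : Fin M := ⟨0, by omega⟩
  have hd : M - 1 ≠ 0 := by omega
  have hq : Measurable fun w : Fin (2 ^ n) → Fin M → ℂ => quantize h w :=
    measurable_quantize.comp (f := fun w => (h, w)) (by fun_prop)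
  have hm : Measurable fun w : Fin (2 ^ n) → Fin M → ℂ =>
      errorExponent (M - 1) (1 - gain (direction h) (quantize h w)) := by
    have := measurable_gain (measurable_const (a := direction h)) hq
    unfold errorExponent; fun_prop
  have hpos : (0 : ℝ) < 2 ^ n := by positivity
  have : IsProbabilityMeasure (expMeasure (2 ^ n : ℝ)) := isProbabilityMeasure_expMeasure hpos
  have : IsProbabilityMeasure ((codebookLaw M (2 ^ n)).map
      (fun w => errorExponent (M - 1) (1 - gain (direction h) (quantize h w)))) :=
    Measure.isProbabilityMeasure_map hm.aemeasurable
  have hp := (l2norm_pos_iff h).2 hh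
  have hne : ∀ᵐ x ∂(isotropicLaw M), 1 - gain (direction h) x < 1 ∧ l2norm x = 1 := by
    have h0 := congrArg (fun μ => μ {1}) (isotropicLaw_map_sin_sq hM _ hy)
    simp only [Measure.map_apply (f := fun x => 1 - gain (direction h) x) (μ := isotropicLaw M)
      (by fun_prop) (measurableSet_singleton (1 : ℝ))] at h0
    have h2 : powLaw (M - 1) {1} = 0 := by
      refine withDensity_absolutelyContinuous _ _ ?_
      simp
    rw [h2] at h0
    have hne' : ∀ᵐ x ∂(isotropicLaw M), ¬ (1 - gain (direction h) x = 1) := by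
      rw [ae_iff]; simp only [not_not]; exact h0
    filter_upwards [hne', isotropicLaw_ae_l2norm k] with x hx h1
    exact ⟨lt_of_le_of_ne (by linarith [gain_nonneg (direction h) x]) hx, h1⟩
  have hall : ∀ᵐ w ∂(codebookLaw M (2 ^ n)), ∀ i, 1 - gain (direction h) (w i) < 1 ∧
      l2norm (w i) = 1 := by
    rw [ae_all_iff]
    exact fun i => (measurePreserving_eval (fun _ : Fin (2 ^ n) => isotropicLaw M)
      i).quasiMeasurePreserving.ae hne
  refine Measure.eq_of_cdf _ _ (StieltjesFunction.ext fun r => ?_)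
  rw [cdf_expMeasure_eq hpos, cdf_eq_real, map_measureReal_apply hm measurableSet_Iic]
  have hae : ((fun w : Fin (2 ^ n) → Fin M → ℂ => errorExponent (M - 1)
      (1 - gain (direction h) (quantize h w))) ⁻¹' Set.Iic r : Set (Fin (2 ^ n) → Fin M → ℂ))
      =ᵐ[codebookLaw M (2 ^ n)]
      ({w | ∀ i, r < errorExponent (M - 1) (1 - gain (direction h) (w i))}ᶜ :
        Set (Fin (2 ^ n) → Fin M → ℂ)) := by
    filter_upwards [hall] with w hw
    refine propext ?_
    change errorExponent (M - 1) (1 - gain (direction h) (quantize h w)) ≤ r ↔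
      ¬ ∀ i, r < errorExponent (M - 1) (1 - gain (direction h) (w i))
    rw [← not_lt, not_iff_not]
    constructor
    -- The quantizer maximizes the gain, hence minimizes the error: the coordinate of the best
    -- codeword exceeds `r` exactly when all of them do.
    · intro hr i
      refine hr.trans_le (errorExponent_mono ?_ ?_ (hw i).1 hd)
      · rw [quantize_eq]; linarith [gain_le_one _ _ hy (hw (bestIndex h w)).2]
      · have := gain_le_quantize h w i
        rw [gain_direction h _ hh, gain_direction h _ hh]
        have := div_le_div_of_nonneg_right this (sq_nonneg (l2norm h))
        linarith
    · intro hr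
      exact hr _
  rw [measureReal_congr hae]
  have hmset : MeasurableSet {w : Fin (2 ^ n) → Fin M → ℂ |
      ∀ i, r < errorExponent (M - 1) (1 - gain (direction h) (w i))} := by
    simp only [Set.ofPred_forall]
    refine MeasurableSet.iInter fun i => measurableSet_lt measurable_const ?_
    have : Measurable fun w : Fin (2 ^ n) → Fin M → ℂ => gain (direction h) (w i) := by fun_prop
    unfold errorExponent; fun_prop
  rw [probReal_compl_eq_one_sub hmset]
  split_ifs with hr
  · have := pi_isotropicLaw_exponent_gt hM (2 ^ n) (direction h) hy hr
    rw [measureReal_def, codebookLaw, this, ENNReal.toReal_ofReal (Real.exp_pos _).le]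
    push_cast; rfl
  · rw [sub_eq_zero, eq_comm, measureReal_def, ENNReal.toReal_eq_one_iff]
    refine le_antisymm prob_le_one ?_
    rw [← measure_univ (μ := codebookLaw M (2 ^ n))]
    refine measure_mono_ae ?_
    filter_upwards [hall] with w hw _ i
    refine (not_le.1 hr).trans_le (errorExponent_nonneg ?_ (hw i).1.le)
    linarith [gain_le_one _ _ hy (hw i).2]

/-- The mean limiting rate at a quantization error with exponential coordinate `x`. -/
def exponentRate {M : ℕ} (k j : Fin M) (x : ℝ) : ℝ≥0∞ := errorRate k j (errorOf (M - 1) x)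

lemma measurable_exponentRate {M : ℕ} (k j : Fin M) : Measurable (exponentRate k j) :=
  (measurable_errorRate k j).comp (measurable_errorOf _)

lemma expMeasure_one_map_div {r : ℝ} (hr : 0 < r) :
    (expMeasure 1).map (fun x => x / r) = expMeasure r := by
  have hm : Measurable fun x : ℝ => x / r := by fun_prop
  have := isProbabilityMeasure_expMeasure (r := 1) one_pos
  have := isProbabilityMeasure_expMeasure hr
  have : IsProbabilityMeasure ((expMeasure 1).map (fun x => x / r)) :=
    Measure.isProbabilityMeasure_map hm.aemeasurable
  refine Measure.eq_of_cdf _ _ (StieltjesFunction.ext fun x => ?_)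
  have hs : (fun x => x / r) ⁻¹' Set.Iic x = Set.Iic (x * r) := by
    ext y; simp [div_le_iff₀ hr]
  rw [cdf_eq_real, map_measureReal_apply hm measurableSet_Iic, hs, ← cdf_eq_real,
    cdf_expMeasure_eq one_pos, cdf_expMeasure_eq hr]
  simp only [one_mul, mul_comm x r, mul_nonneg_iff_of_pos_left hr]

lemma lintegral_expMeasure {r : ℝ} (hr : 0 < r) (f : ℝ → ℝ≥0∞) (hf : Measurable f) :
    ∫⁻ x, f x ∂(expMeasure r) =
      ∫⁻ x in Set.Ioi 0, f (x / r) * ENNReal.ofReal (Real.exp (-x)) := by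
  rw [← expMeasure_one_map_div hr, lintegral_map hf (by fun_prop)]
  change ∫⁻ x, f (x / r) ∂(volume.withDensity (exponentialPDF 1)) = _
  have hpdf : Measurable (exponentialPDF 1) := (measurable_exponentialPDFReal 1).ennreal_ofReal
  rw [lintegral_withDensity_eq_lintegral_mul _ hpdf (by fun_prop),
    ← Measure.restrict_congr_set Ioi_ae_eq_Ici.symm, ← lintegral_indicator measurableSet_Ici]
  refine lintegral_congr fun x => ?_
  rw [Pi.mul_apply, exponentialPDF_eq]
  by_cases hx : 0 ≤ x
  · rw [if_pos hx, Set.indicator_of_mem (by exact hx), mul_comm]; simp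
  · rw [if_neg hx, Set.indicator_of_notMem (by exact hx)]; simp

/-- Integrate out the other users, then the codebook given the channel. The outcome does not depend
on the channel, and rescaling the exponential of rate `2 ^ b k` moves the number of bits into the
argument of the rate. -/
theorem lintegral_limitRate_eq {M : ℕ} (hM : 2 ≤ M) (b : Fin M → ℕ) {k j : Fin M} (hjk : j ≠ k) :
    ∫⁻ ω, ENNReal.ofReal (limitRate k (ω.1 k) (quantized ω)) ∂(outcomeLaw M b) =
      ∫⁻ x in Set.Ioi 0, exponentRate k j (x / 2 ^ b k) * ENNReal.ofReal (Real.exp (-x)) := by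
  have hd : M - 1 ≠ 0 := by omega
  have h1 := lintegral_outcomeLaw b k (fun h w => ENNReal.ofReal (limitRate k h w))
    (measurable_limitRate measurable_fst measurable_snd).ennreal_ofReal
  have hup : Measurable fun p : ((Fin M → ℂ) × (Fin (2 ^ b k) → Fin M → ℂ)) =>
      ∫⁻ w, ENNReal.ofReal (limitRate k p.1 (Function.update w k (quantize p.1 p.2)))
        ∂(Measure.pi fun _ : Fin M => isotropicLaw M) := by
    refine Measurable.lintegral_prod_right' (f := fun p : ((Fin M → ℂ) × (Fin (2 ^ b k) → Fin M → ℂ)) ×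
      (Fin M → Fin M → ℂ) => ENNReal.ofReal (limitRate k p.1.1
        (Function.update p.2 k (quantize p.1.1 p.1.2)))) ?_
    exact (measurable_limitRate (measurable_fst.comp measurable_fst)
      (measurable_update_pair measurable_snd
        (measurable_quantize.comp measurable_fst))).ennreal_ofReal
  have h2 : ∀ᵐ h ∂(channelLaw M), ∫⁻ W, ∫⁻ w, ENNReal.ofReal (limitRate k h
      (Function.update w k (quantize h W))) ∂(Measure.pi fun _ : Fin M => isotropicLaw M)
      ∂(codebookLaw M (2 ^ b k)) = ∫⁻ x, exponentRate k j x ∂(expMeasure (2 ^ b k)) := by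
    filter_upwards [channelLaw_ae_ne_zero k] with h hh
    have hy : l2norm (direction h) = 1 := l2norm_direction h hh
    have hq : Measurable fun w : Fin (2 ^ b k) → Fin M → ℂ => quantize h w :=
      measurable_quantize.comp (f := fun w => (h, w)) (by fun_prop)
    have hm : Measurable fun w : Fin (2 ^ b k) → Fin M → ℂ =>
        errorExponent (M - 1) (1 - gain (direction h) (quantize h w)) := by
      have := measurable_gain (measurable_const (a := direction h)) hq
      unfold errorExponent; fun_prop
    rw [← codebookLaw_map_exponent hM (b k) h hh, lintegral_map (measurable_exponentRate k j) hm]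
    -- A nonzero gain means error strictly below `1`, where `errorOf` inverts `errorExponent`.
    have hunit : ∀ᵐ w ∂(codebookLaw M (2 ^ b k)), ∀ i, l2norm (w i) = 1 ∧
        gain (direction h) (w i) ≠ 0 := by
      suffices hone : ∀ᵐ x ∂(isotropicLaw M), l2norm x = 1 ∧ gain (direction h) x ≠ 0 from
        ae_all_iff.2 fun i => (measurePreserving_eval (fun _ : Fin (2 ^ b k) => isotropicLaw M)
          i).quasiMeasurePreserving.ae hone
      have hlt : ∫⁻ x, ENNReal.ofReal (gain x (direction h)) ^ (-(1 / 2) : ℝ) ∂(isotropicLaw M) < ∞ :=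
        (lintegral_gain_rpow_lt_top hM _ hy).trans_lt ENNReal.ofReal_lt_top
      filter_upwards [isotropicLaw_ae_l2norm k, ae_lt_top (((measurable_gain measurable_id
        measurable_const).ennreal_ofReal).pow_const _) hlt.ne] with x h1 h3
      refine ⟨h1, fun h0 => ?_⟩
      rw [id, gain_comm, h0, ENNReal.ofReal_zero, ENNReal.zero_rpow_of_neg (by norm_num)] at h3
      exact lt_irrefl _ h3
    refine lintegral_congr_ae ?_
    filter_upwards [hunit] with w hw
    have hw' := hw (bestIndex h w)
    rw [← quantize_eq h w] at hw'
    have g1 := gain_le_one _ _ hy hw'.1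
    have g0 := (gain_nonneg (direction h) (quantize h w)).lt_of_ne' hw'.2
    rw [lintegral_limitRate_update hjk h _ hh hw'.1, exponentRate,
      errorOf_errorExponent hd (by linarith) (by linarith)]
  have h3 : ∫⁻ x, exponentRate k j x ∂(expMeasure (2 ^ b k)) =
      ∫⁻ x in Set.Ioi 0, exponentRate k j (x / 2 ^ b k) * ENNReal.ofReal (Real.exp (-x)) :=
    lintegral_expMeasure (by positivity) _ (measurable_exponentRate k j)
  rw [show (∫⁻ ω, ENNReal.ofReal (limitRate k (ω.1 k) (quantized ω)) ∂(outcomeLaw M b)) = _ from h1,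
    lintegral_prod _ hup.aemeasurable, lintegral_congr_ae h2, lintegral_const, measure_univ, mul_one,
    h3]

end

/-! ### Symmetry between users, convex sequences, and reduction to the doubling inequality. -/

section

open scoped ENNReal

lemma zeroForcing_comp_perm {M : ℕ} (σ : Equiv.Perm (Fin M)) (w : Fin M → Fin M → ℂ) (i : Fin M) :
    zeroForcing (fun j => w (σ j)) i = zeroForcing w (σ i) := by
  have h : (Matrix.of fun j => star (w (σ j)) : Matrix (Fin M) (Fin M) ℂ)
      = (Matrix.of fun j => star (w j) : Matrix (Fin M) (Fin M) ℂ).submatrix σ (Equiv.refl _) := rfl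
  rw [zeroForcing, zeroForcing, h, Matrix.inv_submatrix_equiv]
  rfl

lemma limitRate_comp_perm {M : ℕ} (σ : Equiv.Perm (Fin M)) (h : Fin M → ℂ)
    (w : Fin M → Fin M → ℂ) (k : Fin M) :
    limitRate k h (fun j => w (σ j)) = limitRate (σ k) h w := by
  have hi : interference k h (fun j => w (σ j)) = interference (σ k) h w := by
    refine Finset.sum_equiv σ (fun i => by simp) fun i _ => ?_
    rw [zeroForcing_comp_perm]
  rw [limitRate, limitRate, hi, zeroForcing_comp_perm]

lemma pi_const_map_perm {ι : Type*} [Fintype ι] {E : Type*} [MeasurableSpace E] (μ : Measure E)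
    [IsProbabilityMeasure μ] (σ : Equiv.Perm ι) :
    (Measure.pi fun _ : ι => μ).map (fun w i => w (σ i)) = Measure.pi fun _ : ι => μ := by
  refine (Measure.pi_eq fun s hs => ?_).symm
  rw [Measure.map_apply (by fun_prop) (MeasurableSet.univ_pi hs)]
  have : (fun (w : ι → E) i => w (σ i)) ⁻¹' (Set.univ.pi s) = Set.univ.pi fun i => s (σ.symm i) := by
    ext w
    simp only [Set.mem_preimage, Set.mem_pi, Set.mem_univ, true_imp_iff]
    exact ⟨fun h i => by simpa using h (σ.symm i), fun h i => by simpa using h (σ i)⟩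
  rw [this, Measure.pi_pi]
  exact σ.symm.prod_comp fun i => μ (s i)

lemma tilted_ne {M : ℕ} {k j : Fin M} (hjk : j ≠ k) {a : ℝ} (h0 : 0 ≤ a) (h1 : a ≤ 1) :
    l2norm (tilted k j a) = 1 ∧ gain (tilted k j a) (Pi.single k 1) = 1 - a := by
  have c1 : tilted k j a k = ((√(1 - a) : ℝ) : ℂ) := by simp [tilted, hjk.symm]
  have c2 : tilted k j a j = ((√a : ℝ) : ℂ) := by simp [tilted, hjk]
  have c3 : ∀ i, i ≠ k → i ≠ j → tilted k j a i = 0 := fun i hi hj => by simp [tilted, hi, hj]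
  have e1 : ‖tilted k j a k‖ ^ 2 = 1 - a := by
    rw [c1, Complex.norm_real, Real.norm_eq_abs, sq_abs, Real.sq_sqrt (by linarith)]
  have e2 : ‖tilted k j a j‖ ^ 2 = a := by
    rw [c2, Complex.norm_real, Real.norm_eq_abs, sq_abs, Real.sq_sqrt h0]
  refine ⟨?_, by rw [gain_comm, gain_single_left, e1]⟩
  rw [l2norm, Real.sqrt_eq_one, ← Finset.add_sum_erase _ _ (Finset.mem_univ k),
    ← Finset.add_sum_erase _ _ (Finset.mem_erase.2 ⟨hjk, Finset.mem_univ j⟩), e1, e2,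
    Finset.sum_eq_zero fun i hi => ?_]
  · ring
  · simp only [Finset.mem_erase] at hi
    rw [c3 i hi.2.1 hi.1]; simp

lemma direction_of_l2norm {M : ℕ} (x : Fin M → ℂ) (hx : l2norm x = 1) : direction x = x := by
  rw [direction_eq_smul, hx]; simp

/-- The mean rate at a given quantization error is the same for all users. -/
theorem errorRate_eq {M : ℕ} {k j k' j' : Fin M} (hjk : j ≠ k) (hjk' : j' ≠ k') {a : ℝ}
    (h0 : 0 ≤ a) (h1 : a ≤ 1) : errorRate k' j' a = errorRate k j a := by
  obtain ⟨hn, hg⟩ := tilted_ne hjk' h0 h1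
  have hne : tilted k' j' a ≠ 0 := (l2norm_pos_iff _).1 (by rw [hn]; exact one_pos)
  have h2 := lintegral_limitRate_update hjk (tilted k' j' a) (Pi.single k' 1) hne (l2norm_single k')
  rw [direction_of_l2norm _ hn, hg, sub_sub_cancel] at h2
  rw [← h2, errorRate]
  set σ : Equiv.Perm (Fin M) := Equiv.swap k k' with hσ
  have hk : σ k = k' := Equiv.swap_apply_left _ _
  have hm : Measurable fun w : Fin M → Fin M → ℂ => ENNReal.ofReal
      (limitRate k (tilted k' j' a) (Function.update w k (Pi.single k' 1))) :=
    (measurable_limitRate measurable_const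
      (measurable_update_pair measurable_id measurable_const)).ennreal_ofReal
  conv_rhs => rw [← pi_const_map_perm (isotropicLaw M) σ, lintegral_map hm (by fun_prop)]
  refine lintegral_congr fun w => ?_
  rw [← hk, ← limitRate_comp_perm]
  congr 2
  ext i : 1
  by_cases hi : i = k
  · subst hi; simp
  · simp [hi]

lemma errorOf_mem {d : ℕ} {x : ℝ} (hx : 0 < x) (hd : d ≠ 0) : 0 < errorOf d x ∧ errorOf d x < 1 := by
  have h1 : Real.exp (-x) < 1 := by rw [Real.exp_lt_one_iff]; linarith
  have h2 := Real.exp_pos (-x)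
  have h3 : (0 : ℝ) < 1 / d := by positivity
  exact ⟨Real.rpow_pos_of_pos (by linarith) _, Real.rpow_lt_one (by linarith) (by linarith) h3⟩

/-- The mean limiting rate of a user (in nats) as a function of the number of feedback bits. -/
def bitsRate {M : ℕ} (k j : Fin M) (n : ℕ) : ℝ≥0∞ :=
  ∫⁻ x in Set.Ioi 0, exponentRate k j (x / 2 ^ n) * ENNReal.ofReal (Real.exp (-x))

lemma bitsRate_eq {M : ℕ} (hM : 2 ≤ M) {k j k' j' : Fin M} (hjk : j ≠ k) (hjk' : j' ≠ k') (n : ℕ) :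
    bitsRate k' j' n = bitsRate k j n := by
  refine setLIntegral_congr_fun measurableSet_Ioi fun x hx => ?_
  have hx' : 0 < x / 2 ^ n := div_pos hx (by positivity)
  obtain ⟨h0, h1⟩ := errorOf_mem hx' (d := M - 1) (by omega)
  simp only [exponentRate]
  rw [errorRate_eq hjk hjk' h0.le h1.le]

/-- The second difference in the number of bits is the integral of the doubling inequality at `r = x
/ 2 ^ (n + 2)`: one bit fewer doubles the argument. -/
theorem bitsRate_convex {M : ℕ} {k j : Fin M}
    (hcore : ∀ r : ℝ, 0 < r → 2 * exponentRate k j (2 * r) ≤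
      exponentRate k j r + exponentRate k j (4 * r)) (n : ℕ) :
    2 * bitsRate k j (n + 1) ≤ bitsRate k j (n + 2) + bitsRate k j n := by
  have hm : ∀ m : ℕ, Measurable fun x : ℝ => exponentRate k j (x / 2 ^ m) *
      ENNReal.ofReal (Real.exp (-x)) := fun m =>
    ((measurable_exponentRate k j).comp (by fun_prop)).mul (by fun_prop)
  rw [bitsRate, bitsRate, bitsRate, ← lintegral_const_mul _ (hm _), ← lintegral_add_left (hm _)]
  refine setLIntegral_mono' measurableSet_Ioi fun x hx => ?_
  have h := hcore (x / 2 ^ (n + 2)) (div_pos hx (by positivity))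
  rw [show 2 * (x / 2 ^ (n + 2)) = x / 2 ^ (n + 1) by rw [pow_succ 2 (n + 1)]; field_simp,
    show 4 * (x / 2 ^ (n + 2)) = x / 2 ^ n by rw [pow_add 2 n 2]; field_simp; norm_num [mul_comm]] at h
  rw [← mul_assoc, ← add_mul]
  gcongr

lemma convexSeq_step_mono {φ : ℕ → ℝ} (h : ∀ n, 2 * φ (n + 1) ≤ φ (n + 2) + φ n) :
    Monotone fun n => φ (n + 1) - φ n :=
  monotone_nat_of_le_succ fun n => by linarith [h n]

/-- Increments are nondecreasing, so the `n` increments starting from `m` dominate the first `n`.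
Iterated, this is the optimality of giving all bits to one user. -/
lemma convexSeq_superadditive {φ : ℕ → ℝ} (h : ∀ n, 2 * φ (n + 1) ≤ φ (n + 2) + φ n) (m n : ℕ) :
    φ m + φ n ≤ φ (m + n) + φ 0 := by
  induction n with
  | zero => simp
  | succ n ih =>
    have := convexSeq_step_mono h (Nat.le_add_left n m)
    simp only at this
    rw [← add_assoc]; linarith

/-- The forward increment at `m` is a subgradient there. Summed over users with mean `m`, the linear
term cancels, and the equal split is worst. -/
lemma convexSeq_supporting_line {φ : ℕ → ℝ} (h : ∀ n, 2 * φ (n + 1) ≤ φ (n + 2) + φ n) (m n : ℕ) :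
    φ m + ((n : ℝ) - m) * (φ (m + 1) - φ m) ≤ φ n := by
  rcases le_total m n with hmn | hmn
  · induction n, hmn using Nat.le_induction with
    | base => simp
    | succ n hn ih =>
      have := convexSeq_step_mono h hn
      simp only at this
      push_cast
      nlinarith
  · obtain ⟨t, rfl⟩ := Nat.exists_eq_add_of_le hmn
    clear hmn
    induction t with
    | zero => simp
    | succ t ih =>
      have h1 : ∀ t, φ (n + t) ≤ φ n + t * (φ (n + t + 1) - φ (n + t)) := fun t => by
        induction t with
        | zero => simp
        | succ t ih2 =>
          have := convexSeq_step_mono h (Nat.le_succ (n + t))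
          simp only [Nat.succ_eq_add_one] at this
          push_cast
          rw [← add_assoc]
          have ht : (0 : ℝ) ≤ t := t.cast_nonneg
          nlinarith
      have := h1 (t + 1)
      push_cast at this ⊢
      linarith

lemma convexSeq_sum_le {φ : ℕ → ℝ} (h : ∀ n, 2 * φ (n + 1) ≤ φ (n + 2) + φ n) {ι : Type*}
    (s : Finset ι) (b : ι → ℕ) :
    ∑ k ∈ s, (φ (b k) - φ 0) ≤ φ (∑ k ∈ s, b k) - φ 0 := by
  classical
  induction s using Finset.induction_on with
  | empty => simp
  | insert i s hi ih =>
    rw [Finset.sum_insert hi, Finset.sum_insert hi]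
    linarith [convexSeq_superadditive h (b i) (∑ k ∈ s, b k)]

lemma convexSeq_le_sum {φ : ℕ → ℝ} (h : ∀ n, 2 * φ (n + 1) ≤ φ (n + 2) + φ n) {M m : ℕ}
    (b : Fin M → ℕ) (hb : ∑ k, b k = M * m) : ∑ _k : Fin M, φ m ≤ ∑ k, φ (b k) := by
  have h1 : ∑ k : Fin M, ((b k : ℝ) - m) = 0 := by
    rw [Finset.sum_sub_distrib, Finset.sum_const, Finset.card_univ, Fintype.card_fin, nsmul_eq_mul,
      ← Nat.cast_sum, hb]
    push_cast; ring
  calc ∑ _k : Fin M, φ m = ∑ k, (φ m + ((b k : ℝ) - m) * (φ (m + 1) - φ m)) := by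
        rw [Finset.sum_add_distrib, ← Finset.sum_mul, h1]; simp
    _ ≤ _ := Finset.sum_le_sum fun k _ => convexSeq_supporting_line h m (b k)

/-- All the probabilistic reductions are assembled here, with the doubling inequality left as the
hypothesis `hcore`. A reference pair `k₀, j₀` suffices, since every user has the same rate function.
-/
theorem optimal_sharing_of_core (M : ℕ) (hM : 2 ≤ M) (bbar : ℕ)
    (hcore : ∀ k j : Fin M, j ≠ k → ∀ r : ℝ, 0 < r → 2 * exponentRate k j (2 * r) ≤
      exponentRate k j r + exponentRate k j (4 * r)) :
    ∃ L : (Fin M → ℕ) → ℝ,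
      (∀ b : Fin M → ℕ,
        (∀ P : ℝ, 0 < P → ∀ k : Fin M, Integrable (fun ω => instRate P k ω) (outcomeLaw M b)) ∧
        Tendsto (fun P : ℝ => sumRate M P b) atTop (𝓝 (L b))) ∧
      ∀ b : Fin M → ℕ, ∑ k, b k = M * bbar →
        (∀ j : Fin M, L b ≤ L (Pi.single j (M * bbar))) ∧ L (fun _ => bbar) ≤ L b := by
  obtain ⟨k₀⟩ : Nonempty (Fin M) := ⟨⟨0, by omega⟩⟩
  obtain ⟨j₀, hj₀⟩ := exists_ne_of_two_le hM k₀
  have hexp : ∀ (b : Fin M → ℕ) (k : Fin M),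
      ∫⁻ ω, ENNReal.ofReal (limitRate k (ω.1 k) (quantized ω)) ∂(outcomeLaw M b)
        = bitsRate k₀ j₀ (b k) := fun b k => by
    obtain ⟨j, hj⟩ := exists_ne_of_two_le hM k
    rw [lintegral_limitRate_eq hM b hj]
    exact bitsRate_eq hM hj₀ hj (b k)
  have hfin : ∀ n, bitsRate k₀ j₀ n ≠ ∞ := fun n => by
    rw [← hexp (fun _ => n) k₀]; exact (lintegral_limitRate_lt_top hM _ k₀).ne
  set φ : ℕ → ℝ := fun n => (bitsRate k₀ j₀ n).toReal / Real.log 2 with hφ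
  have hl := Real.log_pos one_lt_two
  have hconv : ∀ n, 2 * φ (n + 1) ≤ φ (n + 2) + φ n := fun n => by
    have h1 := bitsRate_convex (hcore k₀ j₀ hj₀) n
    have h2 := ENNReal.toReal_mono (ENNReal.add_ne_top.2 ⟨hfin _, hfin _⟩) h1
    rw [ENNReal.toReal_add (hfin _) (hfin _), ENNReal.toReal_mul] at h2
    simp only [hφ]
    rw [← add_div, ← mul_div_assoc]
    exact div_le_div_of_nonneg_right (by simpa using h2) hl.le
  refine ⟨fun b => ∑ k, φ (b k), fun b => ⟨fun P hP k => integrable_instRate hM b hP k, ?_⟩,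
    fun b hb => ⟨fun j => ?_, convexSeq_le_sum hconv b hb⟩⟩
  · have h := tendsto_sumRate hM b
    have e : ∀ k, ∫ ω, limitRate k (ω.1 k) (quantized ω) ∂(outcomeLaw M b)
        = (bitsRate k₀ j₀ (b k)).toReal := fun k => by
      rw [integral_eq_lintegral_of_nonneg_ae (ae_of_all _ fun ω => limitRate_nonneg _ _ _)
        (measurable_limitRate_quantized k).aestronglyMeasurable, hexp]
    simp_rw [e] at h
    exact h
  · have h1 := convexSeq_sum_le hconv Finset.univ b
    rw [hb] at h1
    have h2 : ∑ k, (φ ((Pi.single j (M * bbar) : Fin M → ℕ) k) - φ 0) = φ (M * bbar) - φ 0 := by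
      rw [Finset.sum_eq_single j]
      · simp
      · intro k _ hk; simp [hk]
      · intro h; exact absurd (Finset.mem_univ j) h
    rw [← h2, Finset.sum_sub_distrib, Finset.sum_sub_distrib] at h1
    linarith

end

/-! ### The root from Jensen's formula, its convexity and its tangent. -/

section

open scoped ENNReal

/-- The larger root of `X² - (Q A₀ + A₁ + T) X + Q A₀ A₁`. -/
def largeRoot (Q A₀ A₁ T : ℝ) : ℝ :=
  (Q * A₀ + A₁ + T + √((Q * A₀ + A₁ + T) ^ 2 - 4 * (Q * A₀ * A₁))) / 2

section

variable {Q Q₂ A₀ A₁ T : ℝ}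

lemma largeRoot_eq (hQ : 0 ≤ Q) (h0 : 0 ≤ A₀) (h1 : 0 ≤ A₁) (hT : 0 ≤ T) :
    largeRoot Q A₀ A₁ T * (Q * A₀ + A₁ + T - largeRoot Q A₀ A₁ T) = Q * A₀ * A₁ := by
  have hq : 0 ≤ Q * A₀ := mul_nonneg hQ h0
  have hd : 0 ≤ (Q * A₀ + A₁ + T) ^ 2 - 4 * (Q * A₀ * A₁) := by
    nlinarith [sq_nonneg (Q * A₀ - A₁), mul_nonneg hT hq, mul_nonneg hT h1]
  have := Real.sq_sqrt hd
  rw [largeRoot]; nlinarith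

/-- The root at `Q = 0` is `A₁ + T`, and the root increases with `Q`. The bound keeps the
denominator `largeRoot - A₁` of the tangent shift at least `T`. -/
lemma add_le_largeRoot (hQ : 0 ≤ Q) (h0 : 0 ≤ A₀) (hT : 0 ≤ T) :
    A₁ + T ≤ largeRoot Q A₀ A₁ T := by
  have hq : 0 ≤ Q * A₀ := mul_nonneg hQ h0
  have : A₁ + T - Q * A₀ ≤ √((Q * A₀ + A₁ + T) ^ 2 - 4 * (Q * A₀ * A₁)) := by
    refine Real.le_sqrt_of_sq_le ?_
    nlinarith [mul_nonneg hT hq]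
  rw [largeRoot]; linarith

lemma half_le_largeRoot : (Q * A₀ + A₁ + T) / 2 ≤ largeRoot Q A₀ A₁ T := by
  have := Real.sqrt_nonneg ((Q * A₀ + A₁ + T) ^ 2 - 4 * (Q * A₀ * A₁))
  rw [largeRoot]; linarith

/-- The slope parameter of the tangent to `largeRoot` at `Q`. -/
def tangentShift (Q A₀ A₁ T : ℝ) : ℝ :=
  T / A₀ * (largeRoot Q A₀ A₁ T / (largeRoot Q A₀ A₁ T - A₁)) ^ 2

lemma le_tangentShift (hQ : 0 ≤ Q) (h0 : 0 < A₀) (h1 : 0 ≤ A₁) (hT : 0 < T) :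
    T / A₀ ≤ tangentShift Q A₀ A₁ T := by
  have hX := add_le_largeRoot (A₁ := A₁) hQ h0.le hT.le
  refine le_mul_of_one_le_right (by positivity) (one_le_pow₀ ?_)
  rw [le_div_iff₀ (by linarith)]; linarith

/-- With `X - A₁ ≥ T` the squared factor is at most `(1 + A₁ / T) ^ 2`; the right side is its
expansion. It no longer involves `Q`, so moments of the shift can be bounded uniformly. -/
lemma tangentShift_le (hQ : 0 ≤ Q) (h0 : 0 < A₀) (h1 : 0 ≤ A₁) (hT : 0 < T) :
    tangentShift Q A₀ A₁ T ≤ T / A₀ + 2 * (A₁ / A₀) + A₁ ^ 2 / (A₀ * T) := by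
  have hX := add_le_largeRoot (A₁ := A₁) hQ h0.le hT.le
  set X := largeRoot Q A₀ A₁ T
  have hD : 0 < X - A₁ := by linarith
  have h2 : X / (X - A₁) ≤ 1 + A₁ / T := by
    rw [div_le_iff₀ hD]
    have : A₁ ≤ A₁ / T * (X - A₁) := by
      rw [div_mul_eq_mul_div, le_div_iff₀ hT]; nlinarith
    linarith
  have h3 : 0 ≤ X / (X - A₁) := div_nonneg (by linarith) hD.le
  calc T / A₀ * (X / (X - A₁)) ^ 2 ≤ T / A₀ * (1 + A₁ / T) ^ 2 := by gcongr
    _ = _ := by field_simp; ring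

/-- The root is convex in `Q`, hence lies above its tangent at `Q₂`. That tangent is proportional to
`Q + tangentShift`, which gives the inequality in product form. -/
lemma largeRoot_tangent (hQ : 0 ≤ Q) (hQ₂ : 0 ≤ Q₂) (h0 : 0 < A₀) (h1 : 0 ≤ A₁) (hT : 0 < T) :
    largeRoot Q₂ A₀ A₁ T * (Q + tangentShift Q₂ A₀ A₁ T) ≤
      largeRoot Q A₀ A₁ T * (Q₂ + tangentShift Q₂ A₀ A₁ T) := by
  have e1 := largeRoot_eq hQ h0.le h1 hT.le
  have e2 := largeRoot_eq hQ₂ h0.le h1 hT.le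
  have g1 := add_le_largeRoot (A₁ := A₁) hQ h0.le hT.le
  have g2 := add_le_largeRoot (A₁ := A₁) hQ₂ h0.le hT.le
  rw [tangentShift]
  generalize largeRoot Q A₀ A₁ T = X at *
  generalize largeRoot Q₂ A₀ A₁ T = Y at *
  obtain ⟨D, rfl⟩ : ∃ D, X = D + A₁ := ⟨X - A₁, by ring⟩
  obtain ⟨E, rfl⟩ : ∃ E, Y = E + A₁ := ⟨Y - A₁, by ring⟩
  have hD : 0 < D := by linarith
  have hE : 0 < E := by linarith
  -- Solving the quadratic for `Q` in terms of `D = X - A₁` gives a concave function of `D`; this is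
  -- why `X` is convex in `Q`, and it makes the gap below an explicit square.
  have q1 : Q = (D + A₁ - T - T * A₁ / D) / A₀ := by
    field_simp; linarith
  have q2 : Q₂ = (E + A₁ - T - T * A₁ / E) / A₀ := by
    field_simp; linarith
  have key : (D + A₁) * (Q₂ + T / A₀ * ((E + A₁) / (E + A₁ - A₁)) ^ 2)
      - (E + A₁) * (Q + T / A₀ * ((E + A₁) / (E + A₁ - A₁)) ^ 2)
      = (E + A₁) * (T * A₁ * (D - E) ^ 2 / (D * E ^ 2)) / A₀ := by
    rw [q1, q2, add_sub_cancel_right]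
    field_simp
    ring
  have : 0 ≤ (E + A₁) * (T * A₁ * (D - E) ^ 2 / (D * E ^ 2)) / A₀ := by positivity
  linarith

end

lemma exists_phase (z : ℂ) : ∃ u : ℂ, ‖u‖ = 1 ∧ (‖z‖ : ℂ) * u = z := by
  by_cases h : z = 0
  · exact ⟨1, by simp, by simp [h]⟩
  · have : (‖z‖ : ℂ) ≠ 0 := by exact_mod_cast norm_ne_zero_iff.2 h
    refine ⟨z / ‖z‖, ?_, by field_simp⟩
    rw [norm_div, Complex.norm_real, norm_norm, div_self (norm_ne_zero_iff.2 h)]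

lemma norm_add_sq_complex (z w : ℂ) :
    ‖z + w‖ ^ 2 = ‖z‖ ^ 2 + ‖w‖ ^ 2 + 2 * (star z * w).re := by
  rw [← Complex.normSq_eq_norm_sq, ← Complex.normSq_eq_norm_sq, ← Complex.normSq_eq_norm_sq,
    Complex.normSq_add]
  simp [Complex.mul_re]

open Real in
/-- Jensen's formula for the phase average of the logarithm of a quadratic form. -/
theorem circleAverage_log_quadratic (α β : ℂ) {a b T : ℝ} (ha : 0 < a) (hb : 0 ≤ b) (hT : 0 < T) :
    circleAverage (fun ζ : ℂ => log (1 + ‖(√b : ℂ) * α + √a * (ζ * β)‖ ^ 2 / (a * T))) 0 1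
      = log (largeRoot (b / a) (‖α‖ ^ 2) (‖β‖ ^ 2) T / T) := by
  set X := largeRoot (b / a) (‖α‖ ^ 2) (‖β‖ ^ 2) T with hX
  set m := b / a * ‖α‖ ^ 2 + ‖β‖ ^ 2 + T with hm
  have hQ : 0 ≤ b / a := by positivity
  have hXe : X * (m - X) = b / a * ‖α‖ ^ 2 * ‖β‖ ^ 2 :=
    largeRoot_eq hQ (by positivity) (by positivity) hT.le
  have hXh : m / 2 ≤ X := half_le_largeRoot
  have hm0 : 0 < m := by positivity
  have hX0 : 0 < X := by linarith
  have hmX : 0 ≤ m - X := by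
    by_contra h
    have : X * (m - X) < 0 := mul_neg_of_pos_of_neg hX0 (not_le.1 h)
    rw [hXe] at this
    exact absurd this (not_lt.2 (by positivity))
  -- With `p ^ 2` and `q ^ 2` equal to `a` times the two roots `X` and `m - X`, the quadratic form
  -- plus `a * T` factors on the unit circle as `|p + q u ζ| ^ 2`.
  set p := √(a * X) with hp
  set q := √(a * (m - X)) with hq
  have hp2 : p ^ 2 = a * X := Real.sq_sqrt (by positivity)
  have hq2 : q ^ 2 = a * (m - X) := Real.sq_sqrt (by positivity)
  have hp0 : 0 < p := Real.sqrt_pos.2 (by positivity)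
  have hq0 : 0 ≤ q := Real.sqrt_nonneg _
  have hqp : q ≤ p := Real.sqrt_le_sqrt (by nlinarith)
  have hpq : p * q = √a * √b * (‖α‖ * ‖β‖) := by
    refine (sq_eq_sq₀ (by positivity) (by positivity)).1 ?_
    rw [mul_pow, hp2, hq2, mul_pow, mul_pow, mul_pow, Real.sq_sqrt ha.le, Real.sq_sqrt hb]
    have : a * X * (a * (m - X)) = a ^ 2 * (X * (m - X)) := by ring
    rw [this, hXe]; field_simp
  obtain ⟨u, hu, hu'⟩ := exists_phase (star α * β)
  have key : ∀ ζ : ℂ, ‖ζ‖ = 1 → 1 + ‖(√b : ℂ) * α + √a * (ζ * β)‖ ^ 2 / (a * T)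
      = ‖(p : ℂ) + q * u * ζ‖ ^ 2 / (a * T) := by
    intro ζ hζ
    have e1 : star ((√b : ℂ) * α) * (√a * (ζ * β)) = ((√a * √b * (‖α‖ * ‖β‖) : ℝ) : ℂ) * (u * ζ) := by
      have : ((‖star α * β‖ : ℝ) : ℂ) = (‖α‖ * ‖β‖ : ℝ) := by rw [norm_mul, norm_star]
      rw [this] at hu'
      simp only [star_mul, RCLike.star_def, Complex.conj_ofReal] at hu' ⊢
      push_cast at hu' ⊢
      linear_combination (-(√a : ℂ) * √b * ζ) * hu'
    have e2 : star (p : ℂ) * (q * u * ζ) = ((p * q : ℝ) : ℂ) * (u * ζ) := by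
      rw [RCLike.star_def, Complex.conj_ofReal]; push_cast; ring
    rw [norm_add_sq_complex, norm_add_sq_complex, e1, e2, hpq]
    simp only [norm_mul, Complex.norm_real, Real.norm_eq_abs, hζ, hu, abs_of_pos hp0,
      abs_of_nonneg hq0, abs_of_nonneg (Real.sqrt_nonneg _), mul_pow, Real.sq_sqrt ha.le,
      Real.sq_sqrt hb, hp2, mul_one, one_mul, hq2]
    rw [eq_div_iff (by positivity), add_mul, div_mul_cancel₀ _ (by positivity)]
    have : a * m = b * ‖α‖ ^ 2 + a * ‖β‖ ^ 2 + a * T := by rw [hm]; field_simp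
    nlinarith
  have hlog : log (X / T) = 2 * log p - log (a * T) := by
    rw [← Real.log_rpow hp0, ← Real.log_div (by positivity) (by positivity), Real.rpow_two, hp2,
      mul_div_mul_left _ _ ha.ne']
  rw [hlog]
  -- If `q = 0` there is no zero and the integrand is constant. Otherwise the zero `-p / (q u)` has
  -- modulus at least `1`, since `q ≤ p`, and the mean of `log ‖ζ - c‖` is `log ‖c‖`.
  by_cases hq00 : q = 0
  · rw [circleAverage_congr_sphere (f₂ := fun _ => 2 * log p - log (a * T)), circleAverage_const]
    intro ζ hζ
    have hζ' : ‖ζ‖ = 1 := by simpa using hζ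
    simp only
    rw [key ζ hζ', hq00]
    rw [Real.log_div (by simp [hp0.ne']) (by positivity)]
    simp [Real.log_pow]
  · have hqp0 : 0 < q := lt_of_le_of_ne hq0 (Ne.symm hq00)
    have hu0 : u ≠ 0 := norm_ne_zero_iff.1 (by rw [hu]; norm_num)
    have hqc : (q : ℂ) ≠ 0 := by exact_mod_cast hq00
    set c : ℂ := -(p / (q * u)) with hc
    have hcn : ‖c‖ = p / q := by
      rw [hc, norm_neg, norm_div, norm_mul, hu, mul_one, Complex.norm_real, Complex.norm_real,
        Real.norm_of_nonneg hp0.le, Real.norm_of_nonneg hq0]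
    have hfun : Set.EqOn (fun ζ : ℂ => log (1 + ‖(√b : ℂ) * α + √a * (ζ * β)‖ ^ 2 / (a * T)))
        (fun ζ => (2 * log q - log (a * T)) + (2 : ℝ) • log ‖ζ - c‖) (Metric.sphere 0 |1|) := by
      intro ζ hζ
      have hζ' : ‖ζ‖ = 1 := by simpa using hζ
      have hpos : (0 : ℝ) < 1 + ‖(√b : ℂ) * α + √a * (ζ * β)‖ ^ 2 / (a * T) := by positivity
      have hfac : (p : ℂ) + q * u * ζ = q * u * (ζ - c) := by rw [hc]; field_simp; ring
      have hnorm : ‖(p : ℂ) + q * u * ζ‖ = q * ‖ζ - c‖ := by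
        rw [hfac, norm_mul, norm_mul, hu, mul_one, Complex.norm_real, Real.norm_of_nonneg hq0]
      simp only [smul_eq_mul]
      rw [key ζ hζ', hnorm] at hpos ⊢
      have hne : ‖ζ - c‖ ≠ 0 := by
        intro h0; rw [h0] at hpos; simp at hpos
      rw [Real.log_div (by positivity) (by positivity), Real.log_pow, Real.log_mul hq00 hne]
      push_cast; ring
    have hci : CircleIntegrable (fun ζ => log ‖ζ - c‖) 0 1 := circleIntegrable_log_norm_sub_const 1
    have hci2 : CircleIntegrable (fun ζ => (2 : ℝ) • log ‖ζ - c‖) 0 1 := hci.const_fun_smul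
    have hval : circleAverage (fun ζ => log ‖ζ - c‖) 0 1 = log⁺ ‖c‖ :=
      circleAverage_log_norm_sub_const_eq_posLog
    rw [circleAverage_congr_sphere hfun, circleAverage_fun_add (circleIntegrable_const _ _ _) hci2,
      circleAverage_const, circleAverage_fun_smul, hval, hcn, posLog_eq_log
        (by rw [abs_of_nonneg (by positivity)]; exact (one_le_div hqp0).2 hqp),
      Real.log_div hp0.ne' hq00, smul_eq_mul]
    ring

end

/-! ### Frames in general position and the phase-averaged rate. -/

section

open scoped ENNReal

/-- The matrix whose rows are the conjugated vectors. -/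
def frameMatrix {M : ℕ} (w : Fin M → Fin M → ℂ) : Matrix (Fin M) (Fin M) ℂ :=
  Matrix.of fun j => star (w j)

lemma frameDet_eq {M : ℕ} (w : Fin M → Fin M → ℂ) : frameDet w = (frameMatrix w).det := rfl

/-- The finite moment of order `-1/2` rules out a zero gain outside a null set. -/
lemma gain_ae_ne_zero {M : ℕ} (hM : 2 ≤ M) (y : Fin M → ℂ) (hy : y ≠ 0) :
    ∀ᵐ x ∂(isotropicLaw M), gain x y ≠ 0 := by
  have h1 := l2norm_direction y hy
  have hlt := (lintegral_gain_rpow_lt_top hM _ h1).trans_lt ENNReal.ofReal_lt_top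
  filter_upwards [ae_lt_top (((measurable_gain measurable_id
      measurable_const).ennreal_ofReal).pow_const _) hlt.ne] with x h3 h0
  rw [id, gain_comm, gain_direction y x hy, gain_comm, h0, zero_div, ENNReal.ofReal_zero,
    ENNReal.zero_rpow_of_neg (by norm_num)] at h3
  exact lt_irrefl _ h3

/-- Cofactor expansion: the determinant is linear in row `i`. Replacing one row by an isotropic
vector therefore preserves invertibility almost surely. -/
lemma exists_frameDet_update {M : ℕ} (w : Fin M → Fin M → ℂ) (i : Fin M) :
    ∃ c : Fin M → ℂ, ∀ x, ‖frameDet (Function.update w i x)‖ ^ 2 = gain x c := by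
  refine ⟨fun m => (frameMatrix w)ᵀ.adjugate i m, fun x => ?_⟩
  have h1 : frameMatrix (Function.update w i x) = (frameMatrix w).updateRow i (star x) := by
    ext a b
    by_cases ha : a = i
    · subst ha; simp [frameMatrix]
    · simp [frameMatrix, ha]
  rw [frameDet_eq, h1, ← Matrix.cramer_transpose_apply, Matrix.cramer_eq_adjugate_mulVec, gain,
    Matrix.mulVec, dotProduct_comm]

/-- Replacing some basis vectors by independent isotropic vectors gives a basis almost surely. -/
lemma ae_frameDet_ne_zero_of_finset {M : ℕ} (hM : 2 ≤ M) (S : Finset (Fin M)) :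
    ∀ᵐ w ∂(Measure.pi fun _ : Fin M => isotropicLaw M),
      frameDet (fun j => if j ∈ S then w j else Pi.single j 1) ≠ 0 := by
  have hmeas : ∀ S : Finset (Fin M), Measurable fun w : Fin M → Fin M → ℂ =>
      frameDet (fun j => if j ∈ S then w j else Pi.single j 1) := fun S => by
    refine measurable_frameDet.comp (measurable_pi_lambda _ fun j => ?_)
    split_ifs
    · exact measurable_pi_apply j
    · exact measurable_const
  induction S using Finset.induction_on with
  | empty =>
    refine ae_of_all _ fun w => ?_
    have : frameMatrix (fun j : Fin M => (Pi.single j 1 : Fin M → ℂ)) = 1 := by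
      ext a b
      by_cases h : a = b
      · subst h; simp [frameMatrix]
      · simp [frameMatrix, h, Ne.symm h]
    simp [frameDet_eq, this]
  | insert i S hi ih =>
    set Z : Set (Fin M → Fin M → ℂ) :=
      {w | frameDet (fun j => if j ∈ insert i S then w j else Pi.single j 1) = 0} with hZ
    have hZm : MeasurableSet Z := hmeas _ (measurableSet_singleton 0)
    suffices h0 : (Measure.pi fun _ : Fin M => isotropicLaw M) Z = 0 by
      rw [ae_iff]; simp only [ne_eq, not_not]; exact h0
    rw [← lintegral_indicator_one hZm, lintegral_pi_update _ i _ (measurable_one.indicator hZm),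
      lintegral_eq_zero_iff' (Measurable.lintegral_prod_right' (f := fun p : (Fin M → Fin M → ℂ) ×
        (Fin M → ℂ) => Z.indicator 1 (Function.update p.1 i p.2)) ((measurable_one.indicator
          hZm).comp measurable_update')).aemeasurable]
    filter_upwards [ih] with w hw
    have hmx : Measurable fun x => Z.indicator (1 : (Fin M → Fin M → ℂ) → ℝ≥0∞)
        (Function.update w i x) :=
      (measurable_one.indicator hZm).comp (measurable_update w)
    rw [Pi.zero_apply, lintegral_eq_zero_iff' hmx.aemeasurable]
    set v : Fin M → Fin M → ℂ := fun j => if j ∈ S then w j else Pi.single j 1 with hv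
    have hupd : ∀ x, (fun j => if j ∈ insert i S then Function.update w i x j else Pi.single j 1)
        = Function.update v i x := fun x => by
      ext j : 1
      by_cases hj : j = i
      · subst hj; simp
      · simp [hj, hv]
    obtain ⟨c, hc⟩ := exists_frameDet_update v i
    have hc0 : c ≠ 0 := by
      rintro rfl
      have h1 := hc (v i)
      rw [Function.update_eq_self] at h1
      have : gain (v i) (0 : Fin M → ℂ) = 0 := by simp [gain]
      rw [this] at h1
      exact hw (norm_eq_zero.1 (pow_eq_zero_iff (two_ne_zero) |>.1 h1))
    filter_upwards [gain_ae_ne_zero hM c hc0] with x hx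
    rw [Pi.zero_apply, Set.indicator_of_notMem]
    simp only [hZ, Set.mem_ofPred_eq, hupd]
    intro h0
    rw [← hc, h0] at hx
    simp at hx

lemma ae_frameDet_ne_zero {M : ℕ} (hM : 2 ≤ M) :
    ∀ᵐ w ∂(Measure.pi fun _ : Fin M => isotropicLaw M), frameDet w ≠ 0 := by
  filter_upwards [ae_frameDet_ne_zero_of_finset hM Finset.univ] with w hw
  simpa using hw

lemma ae_frameDet_update_ne_zero {M : ℕ} (hM : 2 ≤ M) (k : Fin M) :
    ∀ᵐ w ∂(Measure.pi fun _ : Fin M => isotropicLaw M),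
      frameDet (Function.update w k (Pi.single k 1)) ≠ 0 := by
  filter_upwards [ae_frameDet_ne_zero_of_finset hM (Finset.univ.erase k)] with w hw
  convert hw using 2
  ext j : 1
  by_cases hj : j = k
  · subst hj; simp
  · simp [hj]

/-- The zero-forcing frame when the quantized channel of user `k` is the `k`th basis vector. -/
def frame {M : ℕ} (k : Fin M) (w : Fin M → Fin M → ℂ) (i : Fin M) : Fin M → ℂ :=
  zeroForcing (Function.update w k (Pi.single k 1)) i

lemma measurable_frame {M : ℕ} (k i : Fin M) :
    Measurable fun w : Fin M → Fin M → ℂ => frame k w i :=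
  (measurable_zeroForcing M i).comp measurable_update_left

lemma frame_apply_eq_zero {M : ℕ} {k i : Fin M} (hik : i ≠ k) (w : Fin M → Fin M → ℂ) :
    frame k w i k = 0 := by
  have := star_dotProduct_zeroForcing (Function.update w k (Pi.single k 1)) hik.symm
  rw [Function.update_self, ← Pi.single_star, star_one, single_one_dotProduct] at this
  exact this

/-- The signal coefficient along the quantized channel. -/
def sigPar {M : ℕ} (k : Fin M) (w : Fin M → Fin M → ℂ) : ℝ := ‖frame k w k k‖ ^ 2

/-- The signal coefficient along the quantization error. -/
def sigPerp {M : ℕ} (k j : Fin M) (w : Fin M → Fin M → ℂ) : ℝ := ‖frame k w k j‖ ^ 2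

/-- The interference coefficient along the quantization error. -/
def leak {M : ℕ} (k j : Fin M) (w : Fin M → Fin M → ℂ) : ℝ :=
  ∑ i ∈ Finset.univ.erase k, ‖frame k w i j‖ ^ 2

@[fun_prop]
lemma measurable_sigPar {M : ℕ} (k : Fin M) : Measurable (sigPar k) := by
  have := (measurable_pi_apply k).comp (measurable_frame k k)
  exact this.norm.pow_const 2

@[fun_prop]
lemma measurable_sigPerp {M : ℕ} (k j : Fin M) : Measurable (sigPerp k j) := by
  have := (measurable_pi_apply j).comp (measurable_frame k k)
  exact this.norm.pow_const 2

@[fun_prop]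
lemma measurable_leak {M : ℕ} (k j : Fin M) : Measurable (leak k j) :=
  Finset.measurable_fun_sum _ fun i _ =>
    ((measurable_pi_apply j).comp (measurable_frame k i)).norm.pow_const 2

lemma sigPar_nonneg {M : ℕ} (k : Fin M) (w : Fin M → Fin M → ℂ) : 0 ≤ sigPar k w := by
  unfold sigPar; positivity

lemma sigPerp_nonneg {M : ℕ} (k j : Fin M) (w : Fin M → Fin M → ℂ) : 0 ≤ sigPerp k j w := by
  unfold sigPerp; positivity

lemma leak_nonneg {M : ℕ} (k j : Fin M) (w : Fin M → Fin M → ℂ) : 0 ≤ leak k j w := by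
  unfold leak; positivity

lemma inv_apply_ne_zero_iff {M : ℕ} (w : Fin M → Fin M → ℂ) (i m : Fin M) (hd : frameDet w ≠ 0) :
    zeroForcing w i m = 0 ↔ (frameMatrix w)⁻¹ m i = 0 := by
  have hne : l2norm (fun m => (frameMatrix w)⁻¹ m i) ≠ 0 := by
    intro h0
    have h1 := l2norm_zeroForcing w i hd
    have h2 : zeroForcing w i = 0 := by
      ext m
      change _ / ((l2norm (fun m => (frameMatrix w)⁻¹ m i) : ℝ) : ℂ) = 0
      rw [h0]; simp
    rw [h2] at h1
    simp [l2norm] at h1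
  have hne' : ((l2norm (fun m => (frameMatrix w)⁻¹ m i) : ℝ) : ℂ) ≠ 0 := by exact_mod_cast hne
  change _ / ((l2norm (fun m => (frameMatrix w)⁻¹ m i) : ℝ) : ℂ) = 0 ↔ _
  rw [div_eq_zero_iff]
  simp only [hne', or_false]
  rfl

/-- Row `k` of the frame matrix is the basis vector `k`, so the `(k, k)` entry of the inverse is
`1`. -/
lemma sigPar_pos {M : ℕ} (k : Fin M) (w : Fin M → Fin M → ℂ)
    (hd : frameDet (Function.update w k (Pi.single k 1)) ≠ 0) : 0 < sigPar k w := by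
  have h : frame k w k k ≠ 0 := by
    rw [frame, Ne, inv_apply_ne_zero_iff _ _ _ hd]
    intro h0
    have h1 := Matrix.mul_nonsing_inv (frameMatrix (Function.update w k (Pi.single k 1)))
      (by simpa [frameDet_eq] using hd)
    have h2 := congrFun (congrFun h1 k) k
    rw [Matrix.mul_apply, Matrix.one_apply_eq, Finset.sum_eq_single k] at h2
    · rw [h0, mul_zero] at h2; exact zero_ne_one h2
    · intro b _ hb; simp [frameMatrix, hb]
    · intro hk; exact absurd (Finset.mem_univ k) hk
  unfold sigPar; positivity

/-- If no interfering beam had a `j` component, row `j` of the inverse would live in column `k`.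
Multiplying by the frame, whose row `k` vanishes at `j ≠ k`, would give `0 = 1`. -/
lemma leak_pos {M : ℕ} {k j : Fin M} (hjk : j ≠ k) (w : Fin M → Fin M → ℂ)
    (hd : frameDet (Function.update w k (Pi.single k 1)) ≠ 0) : 0 < leak k j w := by
  refine lt_of_le_of_ne (leak_nonneg k j w) fun h0 => ?_
  have hz : ∀ i, i ≠ k → frame k w i j = 0 := fun i hi => by
    have := (Finset.sum_eq_zero_iff_of_nonneg (fun i _ => by positivity)).1 h0.symm i
      (Finset.mem_erase.2 ⟨hi, Finset.mem_univ i⟩)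
    simpa using this
  set w' := Function.update w k (Pi.single k 1) with hw'
  set B := (frameMatrix w')⁻¹ with hB
  have hdet : IsUnit (frameMatrix w').det := by simpa [frameDet_eq] using hd
  have h1 : B * frameMatrix w' = 1 := Matrix.nonsing_inv_mul _ hdet
  have hBj : ∀ i, i ≠ k → B j i = 0 := fun i hi =>
    (inv_apply_ne_zero_iff w' i j hd).1 (hz i hi)
  have e1 := congrFun (congrFun h1 j) j
  rw [Matrix.mul_apply, Matrix.one_apply_eq, Finset.sum_eq_single k] at e1
  · have : frameMatrix w' k j = 0 := by simp [frameMatrix, hw', hjk]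
    rw [this, mul_zero] at e1
    exact zero_ne_one e1
  · intro b _ hb; rw [hBj b hb, zero_mul]
  · intro hk; exact absurd (Finset.mem_univ k) hk

/-- A unit vector with the squared sine `a` and a prescribed phase. -/
def phased {M : ℕ} (k j : Fin M) (a : ℝ) (ζ : ℂ) : Fin M → ℂ :=
  ((√(1 - a) : ℝ) : ℂ) • Pi.single k 1 + (((√a : ℝ) : ℂ) * star ζ) • Pi.single j 1

lemma star_phased_dotProduct {M : ℕ} (k j : Fin M) (a : ℝ) (ζ : ℂ) (v : Fin M → ℂ) :
    star (phased k j a ζ) ⬝ᵥ v = (√(1 - a) : ℝ) * v k + (√a : ℝ) * (ζ * v j) := by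
  simp only [phased, star_add, star_smul, ← Pi.single_star, star_one, add_dotProduct,
    smul_dotProduct, single_one_dotProduct, smul_eq_mul, star_mul, RCLike.star_def,
    Complex.conj_ofReal, Complex.conj_conj]
  ring

lemma phased_ne {M : ℕ} {k j : Fin M} (hjk : j ≠ k) {a : ℝ} (h0 : 0 ≤ a) (h1 : a ≤ 1) {ζ : ℂ}
    (hζ : ‖ζ‖ = 1) :
    l2norm (phased k j a ζ) = 1 ∧ gain (phased k j a ζ) (Pi.single k 1) = 1 - a := by
  have c1 : phased k j a ζ k = ((√(1 - a) : ℝ) : ℂ) := by simp [phased, hjk.symm]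
  have c2 : phased k j a ζ j = ((√a : ℝ) : ℂ) * star ζ := by simp [phased, hjk]
  have c3 : ∀ i, i ≠ k → i ≠ j → phased k j a ζ i = 0 := fun i hi hj => by simp [phased, hi, hj]
  have e1 : ‖phased k j a ζ k‖ ^ 2 = 1 - a := by
    rw [c1, Complex.norm_real, Real.norm_eq_abs, sq_abs, Real.sq_sqrt (by linarith)]
  have e2 : ‖phased k j a ζ j‖ ^ 2 = a := by
    rw [c2, norm_mul, norm_star, hζ, mul_one, Complex.norm_real, Real.norm_eq_abs, sq_abs,
      Real.sq_sqrt h0]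
  refine ⟨?_, by rw [gain_comm, gain_single_left, e1]⟩
  rw [l2norm, Real.sqrt_eq_one, ← Finset.add_sum_erase _ _ (Finset.mem_univ k),
    ← Finset.add_sum_erase _ _ (Finset.mem_erase.2 ⟨hjk, Finset.mem_univ j⟩), e1, e2,
    Finset.sum_eq_zero fun i hi => ?_]
  · ring
  · simp only [Finset.mem_erase] at hi
    rw [c3 i hi.2.1 hi.1]; simp

/-- The interfering beams have no `k` component, so interference is `a` times the leak and
insensitive to the phase; only the signal feels `ζ`. -/
lemma limitRate_phased {M : ℕ} {k j : Fin M} {a : ℝ} (h0 : 0 ≤ a) {ζ : ℂ}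
    (hζ : ‖ζ‖ = 1) (w : Fin M → Fin M → ℂ) :
    limitRate k (phased k j a ζ) (Function.update w k (Pi.single k 1)) =
      Real.log (1 + ‖((√(1 - a) : ℝ) : ℂ) * frame k w k k + ((√a : ℝ) : ℂ) * (ζ * frame k w k j)‖ ^ 2 /
        (a * leak k j w)) := by
  rw [limitRate, gain, star_phased_dotProduct]
  congr 3
  rw [interference, leak, Finset.mul_sum]
  refine Finset.sum_congr rfl fun i hi => ?_
  have := frame_apply_eq_zero (Finset.ne_of_mem_erase hi) w
  rw [frame] at this
  rw [gain, star_phased_dotProduct, this, mul_zero, zero_add, norm_mul, norm_mul, hζ, one_mul,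
    Complex.norm_real, Real.norm_eq_abs, mul_pow, sq_abs, Real.sq_sqrt h0, frame]

lemma lintegral_limitRate_phased {M : ℕ} {k j : Fin M} (hjk : j ≠ k) {a : ℝ} (h0 : 0 ≤ a)
    (h1 : a ≤ 1) {ζ : ℂ} (hζ : ‖ζ‖ = 1) :
    ∫⁻ w, ENNReal.ofReal (limitRate k (phased k j a ζ) (Function.update w k (Pi.single k 1)))
      ∂(Measure.pi fun _ : Fin M => isotropicLaw M) = errorRate k j a := by
  obtain ⟨hn, hg⟩ := phased_ne hjk h0 h1 hζ
  have hne : phased k j a ζ ≠ 0 := (l2norm_pos_iff _).1 (by rw [hn]; exact one_pos)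
  have h2 := lintegral_limitRate_update hjk (phased k j a ζ) (Pi.single k 1) hne (l2norm_single k)
  rwa [direction_of_l2norm _ hn, hg, sub_sub_cancel] at h2

/-- The phase average of the rate. -/
theorem errorRate_eq_lintegral_log {M : ℕ} (hM : 2 ≤ M) {k j : Fin M} (hjk : j ≠ k) {a : ℝ}
    (h0 : 0 < a) (h1 : a < 1) :
    errorRate k j a = ∫⁻ w, ENNReal.ofReal (Real.log
      (largeRoot ((1 - a) / a) (sigPar k w) (sigPerp k j w) (leak k j w) / leak k j w))
      ∂(Measure.pi fun _ : Fin M => isotropicLaw M) := by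
  set μ := Measure.pi fun _ : Fin M => isotropicLaw M
  have hm : Measurable fun p : (Fin M → Fin M → ℂ) × ℝ => ENNReal.ofReal (limitRate k
      (phased k j a (circleMap 0 1 p.2)) (Function.update p.1 k (Pi.single k 1))) := by
    refine (measurable_limitRate ?_ (measurable_update_pair measurable_fst
      measurable_const)).ennreal_ofReal
    have hc : Measurable fun p : (Fin M → Fin M → ℂ) × ℝ => circleMap 0 1 p.2 :=
      (continuous_circleMap 0 1).measurable.comp measurable_snd
    unfold phased
    refine measurable_pi_lambda _ fun i => ?_
    simp only [Pi.add_apply, Pi.smul_apply, smul_eq_mul]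
    fun_prop
  have hpi : 0 < 2 * Real.pi := by positivity
  -- The mean over frames does not depend on the phase, so it may be averaged over the circle at no
  -- cost; exchanging the integrals puts Jensen's formula inside.
  have e1 : ∫⁻ θ in Set.Ioc 0 (2 * Real.pi), ∫⁻ w, ENNReal.ofReal (limitRate k
      (phased k j a (circleMap 0 1 θ)) (Function.update w k (Pi.single k 1))) ∂μ
      = ENNReal.ofReal (2 * Real.pi) * errorRate k j a := by
    have : ∀ θ : ℝ, ∫⁻ w, ENNReal.ofReal (limitRate k
      (phased k j a (circleMap 0 1 θ)) (Function.update w k (Pi.single k 1))) ∂μ = errorRate k j a :=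
      fun θ => lintegral_limitRate_phased hjk h0.le h1.le (by simp [circleMap])
    simp_rw [this]
    rw [lintegral_const, Measure.restrict_apply_univ, Real.volume_Ioc, sub_zero, mul_comm]
  have e2 : ∀ᵐ w ∂μ, ∫⁻ θ in Set.Ioc 0 (2 * Real.pi), ENNReal.ofReal (limitRate k
      (phased k j a (circleMap 0 1 θ)) (Function.update w k (Pi.single k 1)))
      = ENNReal.ofReal (2 * Real.pi) * ENNReal.ofReal (Real.log
      (largeRoot ((1 - a) / a) (sigPar k w) (sigPerp k j w) (leak k j w) / leak k j w)) := by
    filter_upwards [ae_frameDet_update_ne_zero hM k] with w hw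
    have hT := leak_pos hjk w hw
    have hJ := circleAverage_log_quadratic (frame k w k k) (frame k w k j) h0 (sub_nonneg.2 h1.le) hT
    rw [Real.circleAverage_def, smul_eq_mul] at hJ
    have hcont : Continuous fun θ : ℝ => Real.log (1 + ‖((√(1 - a) : ℝ) : ℂ) * frame k w k k
        + ((√a : ℝ) : ℂ) * (circleMap 0 1 θ * frame k w k j)‖ ^ 2 / (a * leak k j w)) := by
      refine Continuous.log ?_ fun θ => by positivity
      have := continuous_circleMap 0 1
      fun_prop
    rw [sigPar, sigPerp, ← hJ, ← ENNReal.ofReal_mul hpi.le, mul_inv_cancel_left₀ hpi.ne',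
      intervalIntegral.integral_of_le hpi.le, ofReal_integral_eq_lintegral_ofReal
        (hcont.integrableOn_Icc.mono_set Set.Ioc_subset_Icc_self)
        (ae_of_all _ fun θ => Real.log_nonneg (le_add_of_nonneg_right (by positivity)))]
    refine lintegral_congr fun θ => ?_
    rw [limitRate_phased h0.le (by simp [circleMap])]
  have e3 : ∫⁻ θ in Set.Ioc 0 (2 * Real.pi), ∫⁻ w, ENNReal.ofReal (limitRate k
      (phased k j a (circleMap 0 1 θ)) (Function.update w k (Pi.single k 1))) ∂μ
      = ENNReal.ofReal (2 * Real.pi) * ∫⁻ w, ENNReal.ofReal (Real.log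
      (largeRoot ((1 - a) / a) (sigPar k w) (sigPerp k j w) (leak k j w) / leak k j w)) ∂μ := by
    have hm' : AEMeasurable (Function.uncurry fun (θ : ℝ) (w : Fin M → Fin M → ℂ) =>
        ENNReal.ofReal (limitRate k (phased k j a (circleMap 0 1 θ))
          (Function.update w k (Pi.single k 1))))
        ((volume.restrict (Set.Ioc 0 (2 * Real.pi))).prod μ) :=
      (hm.comp measurable_swap).aemeasurable
    rw [lintegral_lintegral_swap hm', lintegral_congr_ae e2,
      lintegral_const_mul]
    unfold largeRoot
    fun_prop
  have hne : ENNReal.ofReal (2 * Real.pi) ≠ 0 := by simpa using Real.pi_pos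
  exact (ENNReal.mul_right_inj hne ENNReal.ofReal_ne_top).1 (e1.symm.trans e3)

end

/-! ### From the doubling inequality to a moment inequality by differentiation. -/

section

open scoped ENNReal

section Antitone

variable {Ω : Type*} [MeasurableSpace Ω] {μ : Measure Ω} [IsProbabilityMeasure μ]

/-- Differentiation under the integral sign with a locally bounded derivative. -/
lemma antitoneOn_integral {F F' : ℝ → Ω → ℝ} {B : ℝ → ℝ} (hB : ContinuousOn B (Set.Ioi 0))
    (hF : ∀ x, 0 < x → Measurable (F x)) (hi : ∀ x, 0 < x → Integrable (F x) μ)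
    (hF' : ∀ x, 0 < x → Measurable (F' x))
    (hd : ∀ᵐ ω ∂μ, ∀ x, 0 < x → HasDerivAt (fun x => F x ω) (F' x ω) x)
    (hb : ∀ᵐ ω ∂μ, ∀ x, 0 < x → |F' x ω| ≤ B x) (hn : ∀ x, 0 < x → ∫ ω, F' x ω ∂μ ≤ 0) :
    AntitoneOn (fun x => ∫ ω, F x ω ∂μ) (Set.Ioi 0) := by
  have key : ∀ x, 0 < x → HasDerivAt (fun x => ∫ ω, F x ω ∂μ) (∫ ω, F' x ω ∂μ) x := by
    intro x hx
    obtain ⟨C, hC⟩ := (isCompact_Icc (a := x / 2) (b := 2 * x)).exists_bound_of_continuousOn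
      (hB.mono fun t ht => Set.mem_Ioi.2 (lt_of_lt_of_le (by linarith) ht.1))
    have hs : Set.Icc (x / 2) (2 * x) ∈ 𝓝 x := Icc_mem_nhds (by linarith) (by linarith)
    refine (hasDerivAt_integral_of_dominated_loc_of_deriv_le (bound := fun _ => C)
      (F := F) (F' := F') hs ?_ (hi x hx) (hF' x hx).aestronglyMeasurable ?_
      (integrable_const C) ?_).2
    · filter_upwards [hs] with t ht
      exact (hF t (lt_of_lt_of_le (by linarith) ht.1)).aestronglyMeasurable
    · filter_upwards [hb] with ω hω t ht
      exact (hω t (lt_of_lt_of_le (by linarith) ht.1)).trans ((le_abs_self _).trans (hC t ht))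
    · filter_upwards [hd] with ω hω t ht
      exact hω t (lt_of_lt_of_le (by linarith) ht.1)
  refine antitoneOn_of_deriv_nonpos (convex_Ioi 0)
    (fun x hx => (key x hx).continuousAt.continuousWithinAt) ?_ ?_
  · intro x hx
    rw [interior_Ioi] at hx
    exact (key x hx).differentiableAt.differentiableWithinAt
  · intro x hx
    rw [interior_Ioi] at hx
    rw [(key x hx).deriv]
    exact hn x hx

end Antitone

/-- `x / (eˣ - 1)`. -/
def bose (x : ℝ) : ℝ := x / (Real.exp x - 1)

/-- The factor `1 + d (eˣ - (eˣ - 1) / x)`. -/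
def growth (d : ℕ) (x : ℝ) : ℝ := 1 + d * (Real.exp x - (Real.exp x - 1) / x)

lemma exp_sub_one_pos {x : ℝ} (hx : 0 < x) : 0 < Real.exp x - 1 := by
  have := Real.add_one_lt_exp hx.ne'; linarith

lemma bose_pos {x : ℝ} (hx : 0 < x) : 0 < bose x := div_pos hx (exp_sub_one_pos hx)

lemma continuousOn_bose : ContinuousOn bose (Set.Ioi 0) := by
  refine continuousOn_id.div (by fun_prop) fun x hx => (exp_sub_one_pos hx).ne'

lemma continuousOn_growth (d : ℕ) : ContinuousOn (growth d) (Set.Ioi 0) := by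
  unfold growth
  refine continuousOn_const.add (continuousOn_const.mul (ContinuousOn.sub (by fun_prop)
    (ContinuousOn.div (by fun_prop) continuousOn_id fun x hx => (Set.mem_Ioi.1 hx).ne')))

lemma hasDerivAt_bose {d : ℕ} (hd : d ≠ 0) {x : ℝ} (hx : 0 < x) :
    HasDerivAt bose (-(bose x ^ 2 / (d * x)) * (growth d x - 1)) x := by
  have he := (exp_sub_one_pos hx).ne'
  have h := (hasDerivAt_id x).div ((Real.hasDerivAt_exp x).sub_const 1) he
  have hd' : (d : ℝ) ≠ 0 := by exact_mod_cast hd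
  refine h.congr_deriv ?_
  simp only [bose, growth, id]
  field_simp
  ring

/-- The logarithmic derivative of the error in `log x` is `bose x / d`, which is why `bose` appears.
-/
lemma hasDerivAt_errorOf {d : ℕ} (hd : d ≠ 0) {x : ℝ} (hx : 0 < x) :
    HasDerivAt (errorOf d) (errorOf d x * bose x / (d * x)) x := by
  have hu : 0 < 1 - Real.exp (-x) := by
    have : Real.exp (-x) < 1 := by simp [hx]
    linarith
  have h1 : HasDerivAt (fun x => 1 - Real.exp (-x)) (Real.exp (-x)) x := by
    have := ((hasDerivAt_neg x).exp).const_sub 1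
    simpa using this
  have h := h1.rpow_const (p := (1 : ℝ) / d) (Or.inl hu.ne')
  have hd' : (d : ℝ) ≠ 0 := by exact_mod_cast hd
  have he := (exp_sub_one_pos hx).ne'
  refine h.congr_deriv ?_
  rw [Real.rpow_sub_one hu.ne', errorOf, bose]
  have e1 : 1 - Real.exp (-x) = (Real.exp x - 1) * Real.exp (-x) := by
    rw [sub_mul, ← Real.exp_add]; simp
  set R := (1 - Real.exp (-x)) ^ ((1 : ℝ) / d)
  rw [e1]
  have := Real.exp_pos (-x)
  field_simp

/-- The weight `1 / (1 - a + a y)`. -/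
def weight (d : ℕ) (x y : ℝ) : ℝ := 1 / (1 - errorOf d x + errorOf d x * y)

lemma weight_den_pos {d : ℕ} (hd : d ≠ 0) {x y : ℝ} (hx : 0 < x) (hy : 0 ≤ y) :
    0 < 1 - errorOf d x + errorOf d x * y := by
  have h := errorOf_mem hx hd
  have := mul_nonneg h.1.le hy
  linarith [h.2]

lemma weight_pos {d : ℕ} (hd : d ≠ 0) {x y : ℝ} (hx : 0 < x) (hy : 0 ≤ y) :
    0 < weight d x y := one_div_pos.2 (weight_den_pos hd hx hy)

lemma weight_le {d : ℕ} (hd : d ≠ 0) {x y : ℝ} (hx : 0 < x) (hy : 0 ≤ y) :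
    weight d x y ≤ 1 / (1 - errorOf d x) := by
  have h := errorOf_mem hx hd
  have := mul_nonneg h.1.le hy
  exact one_div_le_one_div_of_le (by linarith [h.2]) (by linarith)

@[fun_prop]
lemma measurable_weight (d : ℕ) (x : ℝ) : Measurable (weight d x) := by
  unfold weight; fun_prop

lemma hasDerivAt_weight {d : ℕ} (hd : d ≠ 0) {x y : ℝ} (hx : 0 < x) (hy : 0 ≤ y) :
    HasDerivAt (fun x => weight d x y)
      (-(bose x / (d * x)) * (weight d x y - weight d x y ^ 2)) x := by
  have h := hasDerivAt_errorOf hd hx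
  have hD := (weight_den_pos hd hx hy).ne'
  have h2 := (((h.const_sub 1).add (h.mul_const y)).inv hD)
  have hd' : (d : ℝ) ≠ 0 := by exact_mod_cast hd
  have e : (fun x => weight d x y) =
      fun x => ((fun x => 1 - errorOf d x) + fun x => errorOf d x * y)⁻¹ x := by
    ext t; simp [weight]
  rw [e]
  refine h2.congr_deriv ?_
  simp only [Pi.add_apply, weight]
  field_simp
  ring

/-- Thus `x` times the derivative is `-(1 / d)` times `bose x * weight d x y`: convexity in `log x`
amounts to that product having a decreasing mean. -/
lemma hasDerivAt_log_weight {d : ℕ} (hd : d ≠ 0) {x y : ℝ} (hx : 0 < x) (hy : 0 ≤ y) :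
    HasDerivAt (fun x => Real.log ((1 - errorOf d x) / errorOf d x + y))
      (-(bose x * weight d x y / (d * x))) x := by
  have h := hasDerivAt_errorOf hd hx
  have ha := (errorOf_mem hx hd).1.ne'
  have hD := (weight_den_pos hd hx hy).ne'
  have e1 : (1 - errorOf d x) / errorOf d x + y
      = (1 - errorOf d x + errorOf d x * y) / errorOf d x := by field_simp
  have h2 := ((((h.const_sub 1).div h ha).add_const y).log (by
    simp only [Pi.div_apply]; rw [e1]; exact div_ne_zero hD ha))
  have hd' : (d : ℝ) ≠ 0 := by exact_mod_cast hd
  refine h2.congr_deriv ?_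
  simp only [Pi.div_apply, weight]
  rw [e1]
  field_simp
  ring

lemma continuousOn_errorOf {d : ℕ} (hd : d ≠ 0) : ContinuousOn (errorOf d) (Set.Ioi 0) :=
  fun _ hx => (hasDerivAt_errorOf hd hx).continuousAt.continuousWithinAt

/-- A common nonnegative shift brings logarithms closer. Differences are thus bounded even when the
logarithm of the shifted quantity is not integrable. -/
lemma abs_log_add_sub_le {p q y : ℝ} (hp : 0 < p) (hq : 0 < q) (hy : 0 ≤ y) :
    |Real.log (p + y) - Real.log (q + y)| ≤ |Real.log p - Real.log q| := by
  wlog h : p ≤ q generalizing p q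
  · rw [abs_sub_comm, abs_sub_comm (Real.log p)]
    exact this hq hp (le_of_not_ge h)
  have h1 := Real.log_le_log hp h
  have h2 := Real.log_le_log (by linarith) (add_le_add_left h y)
  rw [abs_of_nonpos (by linarith), abs_of_nonpos (by linarith), neg_sub, neg_sub,
    ← Real.log_div (by positivity) (by positivity), ← Real.log_div (by positivity) (by positivity)]
  refine Real.log_le_log (by positivity) ?_
  rw [div_le_div_iff₀ (by positivity) hp]
  nlinarith

lemma errorRatio_pos {d : ℕ} (hd : d ≠ 0) {x : ℝ} (hx : 0 < x) :
    0 < (1 - errorOf d x) / errorOf d x :=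
  div_pos (sub_pos.2 (errorOf_mem hx hd).2) (errorOf_mem hx hd).1

section Convexity

variable {Ω : Type*} [MeasurableSpace Ω] {μ : Measure Ω} [IsProbabilityMeasure μ] {y : Ω → ℝ}

/-- By the product rule the derivative is `-(bose x ^ 2 / (d x))` times `growth * weight - weight ^
2`; the factor `growth` was defined to make this so. -/
lemma antitoneOn_integral_bose_weight {d : ℕ} (hd : d ≠ 0) (hy : Measurable y)
    (hy0 : ∀ᵐ ω ∂μ, 0 ≤ y ω)
    (h : ∀ x, 0 < x → 0 ≤ ∫ ω, (growth d x * weight d x (y ω) - weight d x (y ω) ^ 2) ∂μ) :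
    AntitoneOn (fun x => ∫ ω, bose x * weight d x (y ω) ∂μ) (Set.Ioi 0) := by
  have hmem := fun x (hx : x ∈ Set.Ioi (0 : ℝ)) => errorOf_mem hx hd
  refine antitoneOn_integral (F' := fun x ω => -(bose x ^ 2 / (d * x)) *
    (growth d x * weight d x (y ω) - weight d x (y ω) ^ 2))
    (B := fun x => bose x ^ 2 / (d * x) * (|growth d x| * (1 / (1 - errorOf d x))
      + (1 / (1 - errorOf d x)) ^ 2)) ?_ ?_ ?_ ?_ ?_ ?_ ?_
  · have h1 : ContinuousOn (fun x => 1 / (1 - errorOf d x)) (Set.Ioi 0) :=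
      continuousOn_const.div (continuousOn_const.sub (continuousOn_errorOf hd))
        fun x hx => by have := (hmem x hx).2; exact (by linarith : 0 < 1 - errorOf d x).ne'
    refine ContinuousOn.mul (ContinuousOn.div (continuousOn_bose.pow 2) (by fun_prop)
      fun x hx => ?_) (((continuousOn_growth d).abs.mul h1).add (h1.pow 2))
    have hd' : (d : ℝ) ≠ 0 := by exact_mod_cast hd
    exact mul_ne_zero hd' (Set.mem_Ioi.1 hx).ne'
  · intro x _; fun_prop
  · intro x hx
    refine Integrable.of_bound (Measurable.aestronglyMeasurable (by fun_prop)) (bose x * (1 / (1 - errorOf d x))) ?_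
    filter_upwards [hy0] with ω hω
    have h1 := weight_pos hd hx hω
    have h2 := bose_pos hx
    rw [Real.norm_of_nonneg (by positivity)]
    gcongr
    exact weight_le hd hx hω
  · intro x _; fun_prop
  · filter_upwards [hy0] with ω hω x hx
    refine ((hasDerivAt_bose hd hx).mul (hasDerivAt_weight hd hx hω)).congr_deriv ?_
    ring
  · filter_upwards [hy0] with ω hω x hx
    have h1 := weight_pos hd hx hω
    have h2 := weight_le hd hx hω
    have hd0 : 0 < (d : ℝ) := by positivity
    rw [abs_mul, abs_neg, abs_of_nonneg (by positivity : 0 ≤ bose x ^ 2 / (d * x))]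
    gcongr
    refine (abs_sub _ _).trans ?_
    rw [abs_mul, abs_of_pos h1, abs_of_pos (pow_pos h1 2)]
    gcongr
  · intro x hx
    have hd0 : 0 < (d : ℝ) := by positivity
    rw [integral_const_mul]
    have := h x hx
    have : 0 ≤ bose x ^ 2 / (d * x) := by positivity
    nlinarith

/-- Doubling inequality for the expected logarithm. -/
theorem integral_log_doubling_nonneg {d : ℕ} (hd : d ≠ 0) (hy : Measurable y)
    (hy0 : ∀ᵐ ω ∂μ, 0 ≤ y ω)
    (h : ∀ x, 0 < x → 0 ≤ ∫ ω, (growth d x * weight d x (y ω) - weight d x (y ω) ^ 2) ∂μ)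
    {r : ℝ} (hr : 0 < r) :
    0 ≤ ∫ ω, (Real.log ((1 - errorOf d r) / errorOf d r + y ω)
      + Real.log ((1 - errorOf d (4 * r)) / errorOf d (4 * r) + y ω)
      - 2 * Real.log ((1 - errorOf d (2 * r)) / errorOf d (2 * r) + y ω)) ∂μ := by
  set Q : ℝ → ℝ := fun x => (1 - errorOf d x) / errorOf d x with hQ
  have hd0 : 0 < (d : ℝ) := by positivity
  have hJ := antitoneOn_integral_bose_weight hd hy hy0 h
  have hint : ∀ s t, 0 < s → 0 < t →
      Integrable (fun ω => Real.log (Q s + y ω) - Real.log (Q t + y ω)) μ := fun s t hs ht => by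
    refine Integrable.of_bound (by fun_prop) |Real.log (Q s) - Real.log (Q t)| ?_
    filter_upwards [hy0] with ω hω
    exact abs_log_add_sub_le (errorRatio_pos hd hs) (errorRatio_pos hd ht) hω
  have hwi : ∀ x, 0 < x → Integrable (fun ω => bose x * weight d x (y ω)) μ := fun x hx => by
    refine Integrable.of_bound (Measurable.aestronglyMeasurable (by fun_prop)) (bose x * (1 / (1 - errorOf d x))) ?_
    filter_upwards [hy0] with ω hω
    have h1 := weight_pos hd hx hω
    have h2 := bose_pos hx
    rw [Real.norm_of_nonneg (by positivity)]
    gcongr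
    exact weight_le hd hx hω
  -- The dyadic difference decreases because its derivative compares the mean of `bose * weight` at
  -- `x` and at `2 * x`. Comparing the difference at `r` and at `2 * r` is the doubling inequality.
  have hD : AntitoneOn (fun x => ∫ ω, (Real.log (Q x + y ω) - Real.log (Q (2 * x) + y ω)) ∂μ)
      (Set.Ioi 0) := by
    refine antitoneOn_integral (F' := fun x ω => -(1 / (d * x)) * (bose x * weight d x (y ω)
      - bose (2 * x) * weight d (2 * x) (y ω)))
      (B := fun x => 1 / (d * x) * (bose x * (1 / (1 - errorOf d x))
        + bose (2 * x) * (1 / (1 - errorOf d (2 * x))))) ?_ ?_ ?_ ?_ ?_ ?_ ?_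
    · have h1 : ContinuousOn (fun x => bose x * (1 / (1 - errorOf d x))) (Set.Ioi 0) :=
        continuousOn_bose.mul (continuousOn_const.div
          (continuousOn_const.sub (continuousOn_errorOf hd)) fun x hx =>
            (sub_pos.2 (errorOf_mem hx hd).2).ne')
      refine ContinuousOn.mul (ContinuousOn.div continuousOn_const (by fun_prop)
        fun x hx => mul_ne_zero hd0.ne' (Set.mem_Ioi.1 hx).ne') (h1.add ?_)
      exact h1.comp (by fun_prop : ContinuousOn (fun x : ℝ => 2 * x) (Set.Ioi 0))
        fun x hx => Set.mem_Ioi.2 (by have := Set.mem_Ioi.1 hx; linarith)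
    · intro x _; fun_prop
    · intro x hx; exact hint x (2 * x) hx (by linarith)
    · intro x _; fun_prop
    · filter_upwards [hy0] with ω hω x hx
      have h2 : HasDerivAt (fun x : ℝ => 2 * x) 2 x := by
        simpa using (hasDerivAt_id x).const_mul 2
      have h3 := (hasDerivAt_log_weight hd (x := 2 * x) (by linarith) hω).comp x h2
      refine ((hasDerivAt_log_weight hd hx hω).sub h3).congr_deriv ?_
      field_simp
      ring
    · filter_upwards [hy0] with ω hω x hx
      have hx2 : 0 < 2 * x := by linarith
      have := bose_pos hx
      have := bose_pos hx2
      have := weight_pos hd hx hω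
      have := weight_pos hd hx2 hω
      rw [abs_mul, abs_neg, abs_of_nonneg (by positivity : 0 ≤ 1 / (d * x))]
      gcongr
      refine (abs_sub _ _).trans ?_
      rw [abs_of_nonneg (by positivity), abs_of_nonneg (by positivity)]
      gcongr
      · exact weight_le hd hx hω
      · exact weight_le hd hx2 hω
    · intro x hx
      have hx2 : 0 < 2 * x := by linarith
      rw [integral_const_mul, integral_sub (hwi x hx) (hwi _ hx2)]
      have := hJ (Set.mem_Ioi.2 hx) (Set.mem_Ioi.2 hx2) (by linarith)
      have : 0 ≤ 1 / (d * x) := by positivity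
      simp only at *
      nlinarith
  have h1 := hD (Set.mem_Ioi.2 hr) (Set.mem_Ioi.2 (by linarith : 0 < 2 * r)) (by linarith)
  have i1 := hint r (2 * r) hr (by linarith)
  have i2 := hint (2 * r) (4 * r) (by linarith) (by linarith)
  have e4 : 2 * (2 * r) = 4 * r := by ring
  simp only [e4] at h1
  have h2 : 0 ≤ ∫ ω, ((Real.log (Q r + y ω) - Real.log (Q (2 * r) + y ω))
      - (Real.log (Q (2 * r) + y ω) - Real.log (Q (4 * r) + y ω))) ∂μ := by
    rw [integral_sub i1 i2]; linarith
  refine h2.trans_eq (integral_congr_ae (ae_of_all _ fun ω => ?_))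
  simp only [hQ]
  ring

/-- Convexity of the phase-averaged rate, given the key moment inequality. -/
theorem lintegral_log_largeRoot_doubling {d : ℕ} (hd : d ≠ 0) {A₀ A₁ T : Ω → ℝ}
    (m0 : Measurable A₀) (m1 : Measurable A₁) (mT : Measurable T)
    (h0 : ∀ᵐ ω ∂μ, 0 < A₀ ω ∧ 0 ≤ A₁ ω ∧ 0 < T ω)
    (h : ∀ x, 0 < x → ∀ y : Ω → ℝ, Measurable y → (∀ᵐ ω ∂μ, T ω / A₀ ω ≤ y ω ∧
      y ω ≤ T ω / A₀ ω + 2 * (A₁ ω / A₀ ω) + A₁ ω ^ 2 / (A₀ ω * T ω)) →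
      0 ≤ ∫ ω, (growth d x * weight d x (y ω) - weight d x (y ω) ^ 2) ∂μ)
    {r : ℝ} (hr : 0 < r) :
    2 * ∫⁻ ω, ENNReal.ofReal (Real.log (largeRoot ((1 - errorOf d (2 * r)) / errorOf d (2 * r))
        (A₀ ω) (A₁ ω) (T ω) / T ω)) ∂μ ≤
      ∫⁻ ω, ENNReal.ofReal (Real.log (largeRoot ((1 - errorOf d r) / errorOf d r)
        (A₀ ω) (A₁ ω) (T ω) / T ω)) ∂μ +
      ∫⁻ ω, ENNReal.ofReal (Real.log (largeRoot ((1 - errorOf d (4 * r)) / errorOf d (4 * r))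
        (A₀ ω) (A₁ ω) (T ω) / T ω)) ∂μ := by
  set Q : ℝ → ℝ := fun x => (1 - errorOf d x) / errorOf d x with hQ
  have hQp : ∀ x, 0 < x → 0 < Q x := fun x hx => errorRatio_pos hd hx
  have hr2 : 0 < 2 * r := by linarith
  have hr4 : 0 < 4 * r := by linarith
  set X : ℝ → Ω → ℝ := fun x ω => Real.log (largeRoot (Q x) (A₀ ω) (A₁ ω) (T ω) / T ω) with hX
  have mX : ∀ x, Measurable (X x) := fun x => by simp only [hX]; unfold largeRoot; fun_prop
  -- The tangent is taken at the middle point `2 * r`, where it is exact; at `r` and `4 * r` it lies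
  -- below the root. The shift is then frozen and no longer varies with `x`.
  set y : Ω → ℝ := fun ω => tangentShift (Q (2 * r)) (A₀ ω) (A₁ ω) (T ω) with hy
  have my : Measurable y := by simp only [hy]; unfold tangentShift largeRoot; fun_prop
  have hyb : ∀ᵐ ω ∂μ, T ω / A₀ ω ≤ y ω ∧
      y ω ≤ T ω / A₀ ω + 2 * (A₁ ω / A₀ ω) + A₁ ω ^ 2 / (A₀ ω * T ω) := by
    filter_upwards [h0] with ω ⟨h0, h1, hT⟩
    exact ⟨le_tangentShift (hQp _ hr2).le h0 h1 hT, tangentShift_le (hQp _ hr2).le h0 h1 hT⟩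
  have hy0 : ∀ᵐ ω ∂μ, 0 ≤ y ω := by
    filter_upwards [h0, hyb] with ω ⟨h0, h1, hT⟩ h2
    exact (div_pos hT h0).le.trans h2.1
  have hnn : ∀ x, 0 < x → ∀ᵐ ω ∂μ, 0 ≤ X x ω := fun x hx => by
    filter_upwards [h0] with ω ⟨h0, h1, hT⟩
    refine Real.log_nonneg ?_
    rw [le_div_iff₀ hT]
    linarith [add_le_largeRoot (A₁ := A₁ ω) (hQp x hx).le h0.le hT.le]
  have htan : ∀ x, 0 < x → ∀ᵐ ω ∂μ, Real.log (Q x + y ω) - Real.log (Q (2 * r) + y ω)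
      ≤ X x ω - X (2 * r) ω := fun x hx => by
    filter_upwards [h0, hy0] with ω ⟨h0, h1, hT⟩ hy0
    have p1 := hQp x hx
    have p2 := hQp _ hr2
    have g1 := add_le_largeRoot (A₁ := A₁ ω) p1.le h0.le hT.le
    have g2 := add_le_largeRoot (A₁ := A₁ ω) p2.le h0.le hT.le
    have q1 : 0 < largeRoot (Q x) (A₀ ω) (A₁ ω) (T ω) := by linarith
    have q2 : 0 < largeRoot (Q (2 * r)) (A₀ ω) (A₁ ω) (T ω) := by linarith
    have ht := largeRoot_tangent p1.le p2.le h0 h1 hT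
    simp only [hX]
    rw [Real.log_div q1.ne' hT.ne', Real.log_div q2.ne' hT.ne', sub_sub_sub_cancel_right,
      sub_le_sub_iff, ← Real.log_mul (by positivity) q2.ne', ← Real.log_mul q1.ne' (by positivity)]
    refine Real.log_le_log (by positivity) ?_
    rw [mul_comm (Q x + y ω)]
    exact ht
  -- Infinite right-hand terms make the claim trivial; integrability at the middle point follows
  -- from that at `r` by the tangent bound.
  rcases eq_or_ne (∫⁻ ω, ENNReal.ofReal (X r ω) ∂μ) ⊤ with hi1 | hi1
  · change _ ≤ (∫⁻ ω, ENNReal.ofReal (X r ω) ∂μ) + _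
    rw [hi1, top_add]; exact le_top
  have hI1 : Integrable (X r) μ :=
    (lintegral_ofReal_ne_top_iff_integrable (mX r).aestronglyMeasurable (hnn r hr)).1 hi1
  have hint : ∀ s t, 0 < s → 0 < t →
      Integrable (fun ω => Real.log (Q s + y ω) - Real.log (Q t + y ω)) μ := fun s t hs ht => by
    refine Integrable.of_bound (by fun_prop) |Real.log (Q s) - Real.log (Q t)| ?_
    filter_upwards [hy0] with ω hω
    exact abs_log_add_sub_le (errorRatio_pos hd hs) (errorRatio_pos hd ht) hω
  have hI2 : Integrable (X (2 * r)) μ := by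
    refine Integrable.mono' (hI1.sub (hint r (2 * r) hr hr2)) (mX _).aestronglyMeasurable ?_
    filter_upwards [hnn _ hr2, htan r hr] with ω h1 h2
    rw [Real.norm_of_nonneg h1, Pi.sub_apply]; linarith
  rcases eq_or_ne (∫⁻ ω, ENNReal.ofReal (X (4 * r) ω) ∂μ) ⊤ with hi4 | hi4
  · change _ ≤ _ + (∫⁻ ω, ENNReal.ofReal (X (4 * r) ω) ∂μ)
    rw [hi4, add_top]; exact le_top
  have hI4 : Integrable (X (4 * r)) μ :=
    (lintegral_ofReal_ne_top_iff_integrable (mX _).aestronglyMeasurable (hnn _ hr4)).1 hi4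
  have hmain := integral_log_doubling_nonneg hd my hy0 (fun x hx => h x hx y my hyb) hr
  have hle : ∫ ω, (Real.log (Q r + y ω) + Real.log (Q (4 * r) + y ω)
      - 2 * Real.log (Q (2 * r) + y ω)) ∂μ ≤ ∫ ω, (X r ω + X (4 * r) ω - 2 * X (2 * r) ω) ∂μ := by
    refine integral_mono_ae ?_ ((hI1.add hI4).sub (hI2.const_mul 2)) ?_
    · refine ((hint r (2 * r) hr hr2).add (hint (4 * r) (2 * r) hr4 hr2)).congr
        (ae_of_all _ fun ω => ?_)
      simp only [Pi.add_apply]; ring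
    · filter_upwards [htan r hr, htan _ hr4] with ω h1 h2
      linarith
  have hfin : 0 ≤ ∫ ω, (X r ω + X (4 * r) ω - 2 * X (2 * r) ω) ∂μ := hmain.trans hle
  have hsplit : ∫ ω, (X r ω + X (4 * r) ω - 2 * X (2 * r) ω) ∂μ
      = ∫ ω, X r ω ∂μ + ∫ ω, X (4 * r) ω ∂μ - 2 * ∫ ω, X (2 * r) ω ∂μ := by
    rw [← integral_const_mul, ← integral_add hI1 hI4]
    exact integral_sub (hI1.add hI4) (hI2.const_mul 2)
  rw [hsplit] at hfin
  change 2 * ∫⁻ ω, ENNReal.ofReal (X (2 * r) ω) ∂μ ≤ (∫⁻ ω, ENNReal.ofReal (X r ω) ∂μ)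
    + ∫⁻ ω, ENNReal.ofReal (X (4 * r) ω) ∂μ
  have n1 := integral_nonneg_of_ae (hnn _ hr)
  have n2 := integral_nonneg_of_ae (hnn _ hr2)
  have n4 := integral_nonneg_of_ae (hnn _ hr4)
  rw [← ofReal_integral_eq_lintegral_ofReal hI1 (hnn _ hr),
    ← ofReal_integral_eq_lintegral_ofReal hI2 (hnn _ hr2),
    ← ofReal_integral_eq_lintegral_ofReal hI4 (hnn _ hr4), ← ENNReal.ofReal_add n1 n4,
    ← ENNReal.ofReal_ofNat 2, ← ENNReal.ofReal_mul (by norm_num)]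
  exact ENNReal.ofReal_le_ofReal (by linarith)

end Convexity

end

/-! ### Gaussian rescaling and elementary improper integrals. -/

section

open scoped ENNReal

section GaussianScaling

/-- A Gaussian weight times the Gaussian density is a Gaussian density of variance `1 / (1 + ν)`, up
to the mass `1 / (1 + ν)`, the Jacobian of a real scaling of `ℂ`. -/
lemma lintegral_complexGaussian_mul_exp {ν : ℝ} (hν : 0 ≤ ν) (f : ℂ → ℝ≥0∞) (hf : Measurable f) :
    ∫⁻ z, f z * ENNReal.ofReal (Real.exp (-(ν * ‖z‖ ^ 2))) ∂complexGaussian =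
      ENNReal.ofReal (1 / (1 + ν)) *
        ∫⁻ z, f (((1 / √(1 + ν) : ℝ) : ℂ) * z) ∂complexGaussian := by
  set c : ℝ := 1 / √(1 + ν) with hc
  have hν1 : 0 < 1 + ν := by linarith
  have hc0 : 0 < c := by positivity
  have hc2 : c ^ 2 = 1 / (1 + ν) := by rw [hc, div_pow, Real.sq_sqrt hν1.le, one_pow]
  have hm : Measurable fun z : ℂ => ENNReal.ofReal (Real.pi⁻¹ * Real.exp (-‖z‖ ^ 2)) := by fun_prop
  have hsm : Measurable fun z : ℂ => f ((c : ℂ) * z) := by fun_prop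
  rw [complexGaussian_eq_withDensity, lintegral_withDensity_eq_lintegral_mul _ hm (by fun_prop),
    lintegral_withDensity_eq_lintegral_mul _ hm hsm]
  have hmap := Measure.map_addHaar_smul (volume : Measure ℂ) hc0.ne'
  rw [Complex.finrank_real_complex, abs_of_pos (by positivity), hc2, one_div, inv_inv] at hmap
  have key : ∫⁻ z, f z * ENNReal.ofReal (Real.pi⁻¹ * Real.exp (-((1 + ν) * ‖z‖ ^ 2)))
      ∂((volume : Measure ℂ).map (c • ·)) = ENNReal.ofReal (1 + ν) *
      ∫⁻ z, f z * ENNReal.ofReal (Real.pi⁻¹ * Real.exp (-((1 + ν) * ‖z‖ ^ 2))) := by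
    rw [hmap, lintegral_smul_measure, smul_eq_mul]
  rw [lintegral_map (by fun_prop) (by fun_prop)] at key
  have e1 : ∀ z : ℂ, f (c • z) * ENNReal.ofReal (Real.pi⁻¹ * Real.exp (-((1 + ν) * ‖c • z‖ ^ 2)))
      = ((fun z : ℂ => ENNReal.ofReal (Real.pi⁻¹ * Real.exp (-‖z‖ ^ 2))) *
        fun z => f ((c : ℂ) * z)) z := fun z => by
    have : (1 + ν) * ‖c • z‖ ^ 2 = ‖z‖ ^ 2 := by
      rw [norm_smul, mul_pow, Real.norm_eq_abs, sq_abs, hc2]; field_simp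
    rw [this, Pi.mul_apply, mul_comm, Complex.real_smul]
  simp_rw [e1] at key
  rw [key, ← mul_assoc, ← ENNReal.ofReal_mul (by positivity), one_div_mul_cancel hν1.ne',
    ENNReal.ofReal_one, one_mul]
  refine lintegral_congr fun z => ?_
  simp only [Pi.mul_apply]
  rw [mul_left_comm, ← ENNReal.ofReal_mul (by positivity), mul_assoc, ← Real.exp_add]
  congr 4; ring

/-- The product of a Gaussian density with a coordinatewise Gaussian weight is a rescaled
Gaussian density. -/
theorem lintegral_channelLaw_mul_exp {d : ℕ} (ν : Fin d → ℝ) (hν : ∀ i, 0 ≤ ν i)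
    (f : (Fin d → ℂ) → ℝ≥0∞) (hf : Measurable f) :
    ∫⁻ x, f x * ENNReal.ofReal (Real.exp (-∑ i, ν i * ‖x i‖ ^ 2)) ∂(channelLaw d) =
      ENNReal.ofReal (∏ i, (1 / (1 + ν i))) *
        ∫⁻ x, f (fun i => ((1 / √(1 + ν i) : ℝ) : ℂ) * x i) ∂(channelLaw d) := by
  set g : (Fin d → ℂ) → ℝ≥0∞ := fun x => ENNReal.ofReal (Real.exp (-∑ i, ν i * ‖x i‖ ^ 2)) with hg
  have hgm : Measurable g := by fun_prop
  have hsc : Measurable fun (x : Fin d → ℂ) i => ((1 / √(1 + ν i) : ℝ) : ℂ) * x i := by fun_prop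
  set κ : Fin d → Measure ℂ := fun i => complexGaussian.withDensity fun z =>
    ENNReal.ofReal (Real.exp (-(ν i * ‖z‖ ^ 2))) with hκ
  have hκs : ∀ i (s : Set ℂ), MeasurableSet s → κ i s = ENNReal.ofReal (1 / (1 + ν i)) *
      complexGaussian ((fun z => ((1 / √(1 + ν i) : ℝ) : ℂ) * z) ⁻¹' s) := fun i s hs => by
    have := lintegral_complexGaussian_mul_exp (hν i) (s.indicator 1) (measurable_one.indicator hs)
    rw [hκ, withDensity_apply _ hs, ← lintegral_indicator hs]
    have e : ∀ z, s.indicator (fun z => ENNReal.ofReal (Real.exp (-(ν i * ‖z‖ ^ 2)))) z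
        = s.indicator 1 z * ENNReal.ofReal (Real.exp (-(ν i * ‖z‖ ^ 2))) := fun z => by
      by_cases h : z ∈ s <;> simp [h]
    simp_rw [e]
    rw [this]
    congr 1
    rw [← lintegral_indicator_one (hs.preimage (by fun_prop))]
    rfl
  have : ∀ i, IsFiniteMeasure (κ i) := fun i => by
    constructor
    rw [hκs i _ MeasurableSet.univ]
    exact ENNReal.mul_lt_top ENNReal.ofReal_lt_top (measure_lt_top _ _)
  have h1 : Measure.pi κ = (channelLaw d).withDensity g := by
    refine Measure.pi_eq fun s hs => ?_
    have hbox : MeasurableSet (Set.univ.pi s) := MeasurableSet.univ_pi hs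
    rw [withDensity_apply _ hbox, ← lintegral_indicator hbox]
    have e : ∀ x, (Set.univ.pi s).indicator g x = ∏ i, (s i).indicator (fun z =>
        ENNReal.ofReal (Real.exp (-(ν i * ‖z‖ ^ 2)))) (x i) := fun x => by
      by_cases h : x ∈ Set.univ.pi s
      · rw [Set.indicator_of_mem h]
        have h' : ∀ i, x i ∈ s i := fun i => h i (Set.mem_univ i)
        simp only [hg, h', Set.indicator_of_mem]
        rw [← Finset.sum_neg_distrib, Real.exp_sum,
          ENNReal.ofReal_prod_of_nonneg fun i _ => (Real.exp_pos _).le]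
      · rw [Set.indicator_of_notMem h]
        simp only [Set.mem_pi, Set.mem_univ, true_imp_iff, not_forall] at h
        obtain ⟨i, hi⟩ := h
        exact (Finset.prod_eq_zero (Finset.mem_univ i) (Set.indicator_of_notMem hi _)).symm
    simp_rw [e]
    rw [channelLaw, lintegral_pi_prod _ (fun i z => (s i).indicator (fun z =>
      ENNReal.ofReal (Real.exp (-(ν i * ‖z‖ ^ 2)))) z)
      fun i => Measurable.indicator (by fun_prop) (hs i)]
    refine Finset.prod_congr rfl fun i _ => ?_
    rw [hκ, withDensity_apply _ (hs i), lintegral_indicator (hs i)]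
  have h2 : Measure.pi κ = ENNReal.ofReal (∏ i, (1 / (1 + ν i))) • (channelLaw d).map
      (fun x i => ((1 / √(1 + ν i) : ℝ) : ℂ) * x i) := by
    refine Measure.pi_eq fun s hs => ?_
    have hbox : MeasurableSet (Set.univ.pi s) := MeasurableSet.univ_pi hs
    rw [Measure.smul_apply, Measure.map_apply hsc hbox, smul_eq_mul]
    have e : (fun (x : Fin d → ℂ) i => ((1 / √(1 + ν i) : ℝ) : ℂ) * x i) ⁻¹' (Set.univ.pi s) =
      Set.univ.pi fun i => (fun z => ((1 / √(1 + ν i) : ℝ) : ℂ) * z) ⁻¹' s i := by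
      ext x; simp
    rw [e, channelLaw, Measure.pi_pi, ENNReal.ofReal_prod_of_nonneg
      fun i _ => by have := hν i; positivity, ← Finset.prod_mul_distrib]
    exact Finset.prod_congr rfl fun i _ => (hκs i _ (hs i)).symm
  calc ∫⁻ x, f x * g x ∂(channelLaw d) = ∫⁻ x, f x ∂((channelLaw d).withDensity g) := by
        rw [lintegral_withDensity_eq_lintegral_mul _ hgm hf]
        exact lintegral_congr fun x => mul_comm _ _
    _ = _ := by
        rw [← h1, h2, lintegral_smul_measure, smul_eq_mul, lintegral_map hf hsc]

end GaussianScaling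

section ImproperIntegrals

lemma lintegral_Ioi_of_hasDerivAt {g g' : ℝ → ℝ} {a l : ℝ}
    (hd : ∀ x ∈ Set.Ici a, HasDerivAt g (g' x) x) (hn : ∀ x ∈ Set.Ioi a, 0 ≤ g' x)
    (hl : Tendsto g atTop (𝓝 l)) :
    ∫⁻ x in Set.Ioi a, ENNReal.ofReal (g' x) = ENNReal.ofReal (l - g a) := by
  have hi := integrableOn_Ioi_deriv_of_nonneg' hd hn hl
  rw [← integral_Ioi_of_hasDerivAt_of_nonneg' hd hn hl, ofReal_integral_eq_lintegral_ofReal hi]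
  exact (ae_restrict_iff' measurableSet_Ioi).2 (ae_of_all _ hn)

lemma tendsto_inv_one_add_mul_pow {b : ℝ} (hb : 0 < b) {n : ℕ} (hn : n ≠ 0) :
    Tendsto (fun t : ℝ => 1 / (1 + b * t) ^ n) atTop (𝓝 0) := by
  have h1 : Tendsto (fun t : ℝ => 1 + b * t) atTop atTop :=
    tendsto_atTop_add_const_left _ _ (tendsto_id.const_mul_atTop hb)
  refine ((tendsto_pow_atTop hn).comp h1).inv_tendsto_atTop.congr fun t => ?_
  simp

lemma lintegral_Ioi_inv_pow {b : ℝ} (hb : 0 < b) {n : ℕ} (hn : n ≠ 0) {a : ℝ} (ha : 0 ≤ a) :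
    ∫⁻ t in Set.Ioi a, ENNReal.ofReal (1 / (1 + b * t) ^ (n + 1)) =
      ENNReal.ofReal (1 / (n * b * (1 + b * a) ^ n)) := by
  have hn' : (n : ℝ) ≠ 0 := by exact_mod_cast hn
  have h := lintegral_Ioi_of_hasDerivAt (g := fun t => -(1 / (n * b)) * (1 / (1 + b * t) ^ n))
    (g' := fun t => 1 / (1 + b * t) ^ (n + 1)) (a := a) (l := -(1 / (n * b)) * 0) ?_ ?_
    ((tendsto_inv_one_add_mul_pow hb hn).const_mul _)
  · rw [h]
    congr 1
    have : 0 < 1 + b * a := by positivity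
    field_simp
    ring
  · intro t ht
    have ht0 : 0 ≤ t := ha.trans ht
    have hp : 0 < 1 + b * t := by positivity
    have h1 : HasDerivAt (fun t : ℝ => 1 + b * t) b t := by
      simpa using ((hasDerivAt_id t).const_mul b).const_add 1
    have h2 := (((h1.pow n).inv (pow_ne_zero n hp.ne')).const_mul (-(1 / (n * b))))
    obtain ⟨m, rfl⟩ := Nat.exists_eq_succ_of_ne_zero hn
    refine (h2.congr_of_eventuallyEq (.of_forall fun t => by simp)).congr_deriv ?_
    simp only [Nat.succ_eq_add_one, Nat.add_sub_cancel, Pi.pow_apply]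
    field_simp
    try ring
  · intro t ht
    have : 0 ≤ t := ha.trans (Set.mem_Ioi.1 ht).le
    positivity

lemma lintegral_Ioi_mul_inv_pow {b : ℝ} (hb : 0 < b) {n : ℕ} (hn : n ≠ 0) :
    ∫⁻ t in Set.Ioi (0 : ℝ), ENNReal.ofReal (t * (1 / (1 + b * t) ^ (n + 2))) =
      ENNReal.ofReal (1 / (n * (n + 1) * b ^ 2)) := by
  have hn' : (n : ℝ) ≠ 0 := by exact_mod_cast hn
  have hn1 : (n : ℝ) + 1 ≠ 0 := by positivity
  have h := lintegral_Ioi_of_hasDerivAt (g := fun t => 1 / ((n + 1) * b ^ 2) *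
      (1 / (1 + b * t) ^ (n + 1)) - (1 / (n * b ^ 2)) * (1 / (1 + b * t) ^ n))
    (g' := fun t => t * (1 / (1 + b * t) ^ (n + 2))) (a := 0)
    (l := 1 / ((n + 1) * b ^ 2) * 0 - (1 / (n * b ^ 2)) * 0) ?_ ?_
    (((tendsto_inv_one_add_mul_pow hb n.succ_ne_zero).const_mul _).sub
      ((tendsto_inv_one_add_mul_pow hb hn).const_mul _))
  · rw [h]
    congr 1
    simp only [mul_zero, add_zero, one_pow]
    field_simp
    ring
  · intro t ht
    have ht0 : 0 ≤ t := ht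
    have hp : 0 < 1 + b * t := by positivity
    have h1 : HasDerivAt (fun t : ℝ => 1 + b * t) b t := by
      simpa using ((hasDerivAt_id t).const_mul b).const_add 1
    have h2 := ((((h1.pow (n + 1)).inv (pow_ne_zero _ hp.ne')).const_mul
      (1 / (((n : ℝ) + 1) * b ^ 2))).sub
      (((h1.pow n).inv (pow_ne_zero n hp.ne')).const_mul (1 / (n * b ^ 2))))
    obtain ⟨m, rfl⟩ := Nat.exists_eq_succ_of_ne_zero hn
    refine (h2.congr_of_eventuallyEq (.of_forall fun t => by simp)).congr_deriv ?_
    simp only [Nat.succ_eq_add_one, Nat.add_sub_cancel, Pi.pow_apply]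
    push_cast at hn1 ⊢
    field_simp
    ring
  · intro t ht
    have : 0 ≤ t := (Set.mem_Ioi.1 ht).le
    positivity

end ImproperIntegrals

end

/-! ### Scale-invariant statistics and diagonalized quadratic forms. -/

section

open scoped ENNReal

instance {d : ℕ} : IsProbabilityMeasure (channelLaw d) := by unfold channelLaw; infer_instance

section Radial

variable {d : ℕ}

lemma lintegral_mul_normSq_mul_exp (g : (Fin d → ℂ) → ℝ≥0∞) (hg : Measurable g)
    (hg0 : ∀ (c : ℝ) x, 0 < c → g ((c : ℂ) • x) = g x) {t : ℝ} (ht : 0 ≤ t) :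
    ∫⁻ x, g x * ENNReal.ofReal (l2norm x ^ 2 * Real.exp (-(t * l2norm x ^ 2))) ∂(channelLaw d) =
      ENNReal.ofReal (1 / (1 + t) ^ (d + 1)) *
        ∫⁻ x, g x * ENNReal.ofReal (l2norm x ^ 2) ∂(channelLaw d) := by
  have hm := measurable_l2norm d
  have h := lintegral_channelLaw_mul_exp (fun _ : Fin d => t) (fun _ => ht)
    (fun x => g x * ENNReal.ofReal (l2norm x ^ 2)) (by fun_prop)
  have ht1 : 0 < 1 + t := by linarith
  have e1 : ∀ x : Fin d → ℂ, g x * ENNReal.ofReal (l2norm x ^ 2) *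
      ENNReal.ofReal (Real.exp (-∑ i, t * ‖x i‖ ^ 2)) =
      g x * ENNReal.ofReal (l2norm x ^ 2 * Real.exp (-(t * l2norm x ^ 2))) := fun x => by
    rw [mul_assoc, ← ENNReal.ofReal_mul (by positivity), ← Finset.mul_sum, l2norm_sq]
  have e2 : ∀ x : Fin d → ℂ, g (fun i => ((1 / √(1 + t) : ℝ) : ℂ) * x i) *
      ENNReal.ofReal (l2norm (fun i => ((1 / √(1 + t) : ℝ) : ℂ) * x i) ^ 2) =
      ENNReal.ofReal (1 / (1 + t)) * (g x * ENNReal.ofReal (l2norm x ^ 2)) := fun x => by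
    have : (fun i => ((1 / √(1 + t) : ℝ) : ℂ) * x i) = ((1 / √(1 + t) : ℝ) : ℂ) • x := by
      ext i; simp
    rw [this, hg0 _ _ (by positivity), l2norm_sq, l2norm_sq, mul_left_comm,
      ← ENNReal.ofReal_mul (by positivity), Finset.mul_sum]
    congr 3
    ext i
    rw [Pi.smul_apply, smul_eq_mul, norm_mul, mul_pow, Complex.norm_real, Real.norm_eq_abs, sq_abs,
      div_pow, Real.sq_sqrt ht1.le, one_pow]
  simp_rw [e1, e2] at h
  rw [h, lintegral_const_mul _ (by fun_prop), ← mul_assoc, ← ENNReal.ofReal_mul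
    (by positivity), Finset.prod_const, Finset.card_univ, Fintype.card_fin]
  congr 2
  rw [one_div, one_div, inv_pow, pow_succ, mul_inv]

/-- A function of the direction is independent of the norm, whose square has mean `d`. Here this
comes from inserting `∫ ‖x‖² exp (-t ‖x‖²) dt = 1` and rescaling. -/
lemma lintegral_mul_normSq (hd : d ≠ 0) (g : (Fin d → ℂ) → ℝ≥0∞) (hg : Measurable g)
    (hg0 : ∀ (c : ℝ) x, 0 < c → g ((c : ℂ) • x) = g x) :
    ∫⁻ x, g x ∂(channelLaw d) = ENNReal.ofReal (1 / d) *
      ∫⁻ x, g x * ENNReal.ofReal (l2norm x ^ 2) ∂(channelLaw d) := by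
  have hm := measurable_l2norm d
  have e1 : ∀ᵐ x ∂(channelLaw d), g x = ∫⁻ t in Set.Ioi (0 : ℝ),
      g x * ENNReal.ofReal (l2norm x ^ 2 * Real.exp (-(t * l2norm x ^ 2))) := by
    filter_upwards [channelLaw_ae_ne_zero ⟨0, Nat.pos_of_ne_zero hd⟩] with x hx
    have hp : 0 < l2norm x ^ 2 := pow_pos ((l2norm_pos_iff x).2 hx) 2
    rw [lintegral_const_mul _ (by fun_prop)]
    have : ∀ t : ℝ, ENNReal.ofReal (l2norm x ^ 2 * Real.exp (-(t * l2norm x ^ 2))) =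
        ENNReal.ofReal (l2norm x ^ 2) * ENNReal.ofReal (Real.exp (-(l2norm x ^ 2 * t))) :=
      fun t => by rw [ENNReal.ofReal_mul hp.le, mul_comm t]
    simp_rw [this]
    rw [lintegral_const_mul _ (by fun_prop), lintegral_exp_neg_Ioi hp,
      ← ENNReal.ofReal_mul hp.le, mul_one_div_cancel hp.ne', ENNReal.ofReal_one, mul_one]
  rw [lintegral_congr_ae e1, lintegral_lintegral_swap
    (Measurable.aemeasurable (by fun_prop))]
  have e2 : ∀ t ∈ Set.Ioi (0 : ℝ), ∫⁻ x, g x * ENNReal.ofReal (l2norm x ^ 2 *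
      Real.exp (-(t * l2norm x ^ 2))) ∂(channelLaw d) = ENNReal.ofReal (1 / (1 + 1 * t) ^ (d + 1)) *
        ∫⁻ x, g x * ENNReal.ofReal (l2norm x ^ 2) ∂(channelLaw d) := fun t ht => by
    rw [one_mul, lintegral_mul_normSq_mul_exp g hg hg0 (Set.mem_Ioi.1 ht).le]
  rw [setLIntegral_congr_fun measurableSet_Ioi e2, lintegral_mul_const _ (by fun_prop),
    lintegral_Ioi_inv_pow one_pos hd le_rfl]
  simp

/-- The law of a scale-invariant statistic, through the Laplace transform of the associated
quadratic statistic. -/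
theorem lintegral_one_add_mul_pow (hd : d ≠ 0) (T : (Fin d → ℂ) → ℝ) (hT : Measurable T)
    (hTn : ∀ x, 0 ≤ T x) (hT0 : ∀ (c : ℝ) x, 0 < c → T ((c : ℂ) • x) = T x) {l : ℝ} (hl : 0 ≤ l) :
    ∫⁻ x, ENNReal.ofReal (1 / (1 + l * T x) ^ d) ∂(channelLaw d) =
      ∫⁻ x, ENNReal.ofReal (Real.exp (-(l * (T x * l2norm x ^ 2)))) ∂(channelLaw d) := by
  have hm := measurable_l2norm d
  -- The exponential is the tail integral of `‖x‖² exp (-t ‖x‖²)` beyond `l * T x`. For fixed `t`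
  -- this indicator is scale invariant, so the radial identities apply.
  set φ : ℝ → (Fin d → ℂ) → ℝ≥0∞ := fun t x => (Set.Ioi (l * T x)).indicator 1 t with hφ
  have hφm : Measurable fun p : ℝ × (Fin d → ℂ) => φ p.1 p.2 := by
    have : MeasurableSet {p : ℝ × (Fin d → ℂ) | l * T p.2 < p.1} :=
      measurableSet_lt (by fun_prop) measurable_fst
    exact measurable_one.indicator this
  have hφx : ∀ t, Measurable (φ t) := fun t => hφm.comp measurable_prodMk_left
  have e1 : ∀ᵐ x ∂(channelLaw d), ENNReal.ofReal (Real.exp (-(l * (T x * l2norm x ^ 2)))) =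
      ∫⁻ t in Set.Ioi (0 : ℝ), φ t x * ENNReal.ofReal (l2norm x ^ 2 *
        Real.exp (-(t * l2norm x ^ 2))) := by
    filter_upwards [channelLaw_ae_ne_zero ⟨0, Nat.pos_of_ne_zero hd⟩] with x hx
    have hp : 0 < l2norm x ^ 2 := pow_pos ((l2norm_pos_iff x).2 hx) 2
    have hlT : 0 ≤ l * T x := mul_nonneg hl (hTn x)
    have hd1 := lintegral_Ioi_of_hasDerivAt (g := fun t => -Real.exp (-(t * l2norm x ^ 2)))
      (g' := fun t => l2norm x ^ 2 * Real.exp (-(t * l2norm x ^ 2))) (a := l * T x) (l := 0)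
      (fun t _ => by
        have := ((((hasDerivAt_id t).mul_const (l2norm x ^ 2)).neg).exp).neg
        refine this.congr_deriv ?_
        simp only [id, Pi.neg_apply]; ring)
      (fun t _ => by positivity)
      (by
        rw [← neg_zero]
        exact (Real.tendsto_exp_neg_atTop_nhds_zero.comp (tendsto_id.atTop_mul_const hp)).neg)
    have : ∀ t, φ t x * ENNReal.ofReal (l2norm x ^ 2 * Real.exp (-(t * l2norm x ^ 2))) =
        (Set.Ioi (l * T x)).indicator (fun t => ENNReal.ofReal (l2norm x ^ 2 *
          Real.exp (-(t * l2norm x ^ 2)))) t := fun t => by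
      by_cases h : t ∈ Set.Ioi (l * T x) <;> simp [hφ, h]
    simp_rw [this]
    rw [setLIntegral_indicator measurableSet_Ioi, Set.Ioi_inter_Ioi, sup_of_le_left hlT, hd1,
      zero_sub, neg_neg, mul_assoc]
  have hgm : Measurable fun x => ENNReal.ofReal (1 / (1 + l * T x) ^ d) := by fun_prop
  rw [lintegral_congr_ae e1, lintegral_lintegral_swap (Measurable.aemeasurable (by
    refine Measurable.mul (hφm.comp measurable_swap) (by fun_prop)))]
  have e2 : ∀ t ∈ Set.Ioi (0 : ℝ), ∫⁻ x, φ t x * ENNReal.ofReal (l2norm x ^ 2 *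
      Real.exp (-(t * l2norm x ^ 2))) ∂(channelLaw d) = ∫⁻ x, ENNReal.ofReal (1 / (1 + 1 * t) ^
        (d + 1)) * (φ t x * ENNReal.ofReal (l2norm x ^ 2)) ∂(channelLaw d) := fun t ht => by
    rw [one_mul, lintegral_mul_normSq_mul_exp (φ t) (hφx t) (fun c x hc => by
      simp only [hφ, hT0 c x hc]) (Set.mem_Ioi.1 ht).le, lintegral_const_mul]
    exact (hφx t).mul (by fun_prop)
  have hm3 : Measurable (Function.uncurry fun (t : ℝ) (x : Fin d → ℂ) => ENNReal.ofReal
      (1 / (1 + 1 * t) ^ (d + 1)) * (φ t x * ENNReal.ofReal (l2norm x ^ 2))) := by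
    have h1 : Measurable fun p : ℝ × (Fin d → ℂ) =>
      ENNReal.ofReal (1 / (1 + 1 * p.1) ^ (d + 1)) := by fun_prop
    have h2 : Measurable fun p : ℝ × (Fin d → ℂ) => ENNReal.ofReal (l2norm p.2 ^ 2) := by fun_prop
    exact h1.mul (hφm.mul h2)
  rw [setLIntegral_congr_fun measurableSet_Ioi e2, lintegral_lintegral_swap hm3.aemeasurable,
    lintegral_mul_normSq hd _ hgm (fun c x hc => by rw [hT0 c x hc]), ← lintegral_const_mul]
  swap
  · exact hgm.mul (by fun_prop)
  refine lintegral_congr fun x => ?_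
  have hlT : 0 ≤ l * T x := mul_nonneg hl (hTn x)
  have : ∀ t : ℝ, ENNReal.ofReal (1 / (1 + 1 * t) ^ (d + 1)) * (φ t x * ENNReal.ofReal (l2norm x ^ 2))
      = (Set.Ioi (l * T x)).indicator (fun t => ENNReal.ofReal (1 / (1 + 1 * t) ^ (d + 1))) t *
        ENNReal.ofReal (l2norm x ^ 2) := fun t => by
    by_cases h : t ∈ Set.Ioi (l * T x) <;> simp [hφ, h]
  simp_rw [this]
  rw [lintegral_mul_const _ (Measurable.indicator (by fun_prop) measurableSet_Ioi),
    setLIntegral_indicator measurableSet_Ioi, Set.Ioi_inter_Ioi, sup_of_le_left hlT,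
    lintegral_Ioi_inv_pow one_pos hd hlT, ← mul_assoc, ← ENNReal.ofReal_mul (by positivity)]
  congr 2
  rw [one_mul, mul_one, div_mul_div_comm, one_mul]

end Radial

section QuadraticForms

/-- Keep the terms of degree at most two of the product; the quadratic coefficient is the second
elementary symmetric function, written through power sums. Its nonnegativity is carried along for
the induction. -/
lemma one_add_mul_le_prod {ι : Type*} (s : Finset ι) (μ : ι → ℝ) (hμ : ∀ i, 0 ≤ μ i) {t : ℝ}
    (ht : 0 ≤ t) :
    0 ≤ (∑ i ∈ s, μ i) ^ 2 - ∑ i ∈ s, μ i ^ 2 ∧ 1 + t * ∑ i ∈ s, μ i +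
      t ^ 2 * (((∑ i ∈ s, μ i) ^ 2 - ∑ i ∈ s, μ i ^ 2) / 2) ≤ ∏ i ∈ s, (1 + t * μ i) := by
  classical
  induction s using Finset.induction_on with
  | empty => simp
  | insert a s ha ih =>
    rw [Finset.sum_insert ha, Finset.sum_insert ha, Finset.prod_insert ha]
    obtain ⟨h1, h2⟩ := ih
    have hS : 0 ≤ ∑ i ∈ s, μ i := Finset.sum_nonneg fun i _ => hμ i
    have ha0 := hμ a
    refine ⟨by nlinarith [mul_nonneg ha0 hS], ?_⟩
    have h3 := mul_le_mul_of_nonneg_left h2 (by positivity : 0 ≤ 1 + t * μ a)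
    have h4 : 0 ≤ t ^ 3 * μ a * ((∑ i ∈ s, μ i) ^ 2 - ∑ i ∈ s, μ i ^ 2) := by positivity
    nlinarith

variable {d : ℕ} {ι : Type*} [Fintype ι]

/-- The quadratic form `∑ |x† vᵢ|²`. -/
def quadForm (v : ι → Fin d → ℂ) (x : Fin d → ℂ) : ℝ := ∑ i, gain x (v i)

lemma quadForm_nonneg (v : ι → Fin d → ℂ) (x : Fin d → ℂ) : 0 ≤ quadForm v x :=
  Finset.sum_nonneg fun _ _ => gain_nonneg _ _

@[fun_prop]
lemma measurable_quadForm (v : ι → Fin d → ℂ) : Measurable (quadForm v) := by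
  unfold quadForm; fun_prop

lemma gain_eq_re {d : ℕ} (x y : Fin d → ℂ) :
    ((gain x y : ℝ) : ℂ) = (star x ⬝ᵥ y) * (star y ⬝ᵥ x) := by
  have : star y ⬝ᵥ x = star (star x ⬝ᵥ y) := by
    rw [Matrix.star_dotProduct]
  rw [this, gain, RCLike.star_def, Complex.mul_conj, Complex.normSq_eq_norm_sq]

open scoped ComplexOrder in
/-- Diagonalization of a quadratic form. -/
theorem exists_diagonal_quadForm (v : ι → Fin d → ℂ) :
    ∃ (U : Matrix.unitaryGroup (Fin d) ℂ) (μ : Fin d → ℝ), (∀ m, 0 ≤ μ m) ∧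
      (∀ x, quadForm v (rot U x) = ∑ m, μ m * ‖x m‖ ^ 2) ∧
      ∑ m, μ m = ∑ i, l2norm (v i) ^ 2 ∧ ∑ m, μ m ^ 2 = ∑ i, ∑ i', gain (v i) (v i') := by
  classical
  set V : Matrix (Fin d) ι ℂ := Matrix.of fun a i => v i a with hV
  have hN := Matrix.posSemidef_self_mul_conjTranspose V
  set U := hN.1.eigenvectorUnitary with hU
  set μ := hN.1.eigenvalues with hμ
  set u : ι → Fin d → ℂ := fun i => rot U⁻¹ (v i) with hu
  have hru : ∀ i, rot U (u i) = v i := fun i => by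
    simp only [hu, rot, Matrix.mulVec_mulVec]
    have : (U : Matrix (Fin d) (Fin d) ℂ) * (U⁻¹ : Matrix.unitaryGroup (Fin d) ℂ) = 1 := by
      exact congrArg Subtype.val (mul_inv_cancel U)
    rw [this, Matrix.one_mulVec]
  have hdiag : ∀ a b, ∑ i, u i a * star (u i b) = if a = b then (μ a : ℂ) else 0 := by
    intro a b
    have h1 := hN.1.conjStarAlgAut_star_eigenvectorUnitary
    rw [Unitary.conjStarAlgAut_star_apply] at h1
    have h2 := congrFun (congrFun h1 a) b
    rw [Matrix.diagonal_apply] at h2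
    have h3 : (star (U : Matrix (Fin d) (Fin d) ℂ) * (V * Vᴴ) * (U : Matrix (Fin d) (Fin d) ℂ))
        = (star (U : Matrix (Fin d) (Fin d) ℂ) * V) * (star (U : Matrix (Fin d) (Fin d) ℂ) * V)ᴴ := by
      rw [Matrix.conjTranspose_mul, Matrix.star_eq_conjTranspose, Matrix.conjTranspose_conjTranspose]
      simp only [Matrix.mul_assoc]
    rw [← hU, h3, Matrix.mul_apply] at h2
    exact h2
  have hμd : ∀ a, ((μ a : ℝ) : ℂ) = ∑ i, u i a * star (u i a) := fun a => by
    rw [hdiag, if_pos rfl]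
  refine ⟨U, μ, hN.eigenvalues_nonneg, fun x => ?_, ?_, ?_⟩
  · have e1 : quadForm v (rot U x) = ∑ i, gain x (u i) :=
      Finset.sum_congr rfl fun i _ => by rw [← hru i, gain_rot]
    rw [e1]
    refine Complex.ofReal_injective ?_
    rw [Complex.ofReal_sum, Complex.ofReal_sum]
    simp_rw [gain_eq_re, dotProduct, Finset.sum_mul_sum, Pi.star_apply]
    rw [Finset.sum_comm]
    refine Finset.sum_congr rfl fun a _ => ?_
    rw [Finset.sum_comm]
    have e2 : ∀ b, ∑ i, star (x a) * u i a * (star (u i b) * x b) =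
        star (x a) * x b * (if a = b then (μ a : ℂ) else 0) := fun b => by
      rw [← hdiag, Finset.mul_sum]
      exact Finset.sum_congr rfl fun i _ => by ring
    simp_rw [e2]
    rw [Finset.sum_eq_single a (fun b _ hb => by rw [if_neg hb.symm, mul_zero]) (by simp),
      if_pos rfl, RCLike.star_def, ← Complex.normSq_eq_conj_mul_self, Complex.normSq_eq_norm_sq,
      Complex.ofReal_mul, mul_comm]
  · refine Complex.ofReal_injective ?_
    rw [Complex.ofReal_sum, Complex.ofReal_sum]
    simp_rw [hμd]
    rw [Finset.sum_comm]
    refine Finset.sum_congr rfl fun i _ => ?_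
    rw [← hru i, l2norm_rot, ← star_dotProduct_self, dotProduct]
    exact Finset.sum_congr rfl fun a _ => mul_comm _ _
  · have e1 : ∀ i i', gain (v i) (v i') = gain (u i) (u i') := fun i i' => by
      rw [← hru i, ← hru i', gain_rot]
    simp_rw [e1]
    refine Complex.ofReal_injective ?_
    simp only [Complex.ofReal_sum]
    simp_rw [gain_eq_re, dotProduct, Finset.sum_mul_sum, Pi.star_apply]
    have e2 : ∑ i, ∑ i', ∑ a, ∑ b, star (u i a) * u i' a * (star (u i' b) * u i b) =
        ∑ a, ∑ b, (∑ i, u i b * star (u i a)) * ∑ i', u i' a * star (u i' b) := by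
      simp_rw [Finset.sum_mul_sum]
      have e3 : ∀ i, ∑ i', ∑ a, ∑ b, star (u i a) * u i' a * (star (u i' b) * u i b) =
          ∑ a, ∑ b, ∑ i', u i b * star (u i a) * (u i' a * star (u i' b)) := fun i => by
        rw [Finset.sum_comm]
        refine Finset.sum_congr rfl fun a _ => ?_
        rw [Finset.sum_comm]
        exact Finset.sum_congr rfl fun b _ => Finset.sum_congr rfl fun i' _ => by ring
      simp_rw [e3]
      rw [Finset.sum_comm]
      refine Finset.sum_congr rfl fun a _ => ?_
      rw [Finset.sum_comm]
    rw [e2]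
    refine Finset.sum_congr rfl fun a _ => ?_
    simp_rw [hdiag]
    rw [Finset.sum_eq_single a (fun b _ hb => by rw [if_neg hb, zero_mul]) (by simp), if_pos rfl,
      Complex.ofReal_pow, sq]

end QuadraticForms

end

/-! ### Laplace bounds for Gaussian quadratic forms and inverse moments. -/

section

open scoped ENNReal

lemma lintegral_channelLaw_rot {d : ℕ} (U : Matrix.unitaryGroup (Fin d) ℂ)
    (f : (Fin d → ℂ) → ℝ≥0∞) (hf : Measurable f) :
    ∫⁻ x, f (rot U x) ∂(channelLaw d) = ∫⁻ x, f x ∂(channelLaw d) := by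
  conv_rhs => rw [← channelLaw_map_rot U]
  rw [lintegral_map hf (measurable_rot U)]

lemma lintegral_channelLaw_apply {d : ℕ} (k : Fin d) (f : ℂ → ℝ≥0∞) (hf : Measurable f) :
    ∫⁻ x, f (x k) ∂(channelLaw d) = ∫⁻ z, f z ∂complexGaussian :=
  (measurePreserving_eval (fun _ : Fin d => complexGaussian) k).lintegral_comp hf

lemma lintegral_normSq : ∫⁻ z, ENNReal.ofReal (‖z‖ ^ 2) ∂complexGaussian = 1 := by
  rw [lintegral_normSq_complexGaussian (fun t => ENNReal.ofReal t) (by fun_prop)]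
  have h := lintegral_Ioi_of_hasDerivAt (g := fun t => -((t + 1) * Real.exp (-t)))
    (g' := fun t => t * Real.exp (-t)) (a := 0) (l := -0) (fun t _ => by
      have := ((((hasDerivAt_id t).add_const 1).mul (hasDerivAt_neg t).exp)).neg
      refine this.congr_deriv ?_
      simp only [id]; ring) (fun t ht => mul_nonneg (Set.mem_Ioi.1 ht).le (Real.exp_pos _).le) (by
      refine Tendsto.neg ?_
      have h1 := Real.tendsto_pow_mul_exp_neg_atTop_nhds_zero 1
      have h2 := Real.tendsto_exp_neg_atTop_nhds_zero
      have h3 := h1.add h2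
      rw [add_zero] at h3
      refine h3.congr fun t => ?_
      ring)
  rw [show (1 : ℝ≥0∞) = ENNReal.ofReal (-0 - -((0 + 1) * Real.exp (-0))) by simp, ← h]
  refine setLIntegral_congr_fun measurableSet_Ioi fun t ht => ?_
  rw [← ENNReal.ofReal_mul (Set.mem_Ioi.1 ht).le]

lemma exists_rot_smul {d : ℕ} (k : Fin d) (c : Fin d → ℂ) :
    ∃ U : Matrix.unitaryGroup (Fin d) ℂ, c = (l2norm c : ℂ) • rot U (Pi.single k 1) := by
  by_cases hc : c = 0
  · exact ⟨1, by subst hc; simp [l2norm]⟩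
  · obtain ⟨U, hU⟩ := exists_rot_eq k (direction c) (l2norm_direction c hc)
    exact ⟨U, by rw [hU, smul_direction c hc]⟩

lemma lintegral_gain_channelLaw {d : ℕ} (c : Fin d → ℂ) :
    ∫⁻ x, ENNReal.ofReal (gain x c) ∂(channelLaw d) = ENNReal.ofReal (l2norm c ^ 2) := by
  rcases Nat.eq_zero_or_pos d with rfl | hd
  · simp [gain, l2norm, Subsingleton.elim c 0]
  obtain ⟨U, hU⟩ := exists_rot_smul ⟨0, hd⟩ c
  have hm : Measurable fun x : Fin d → ℂ => ENNReal.ofReal (gain x c) := by fun_prop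
  rw [← lintegral_channelLaw_rot U _ hm]
  have e : ∀ x, ENNReal.ofReal (gain (rot U x) c) =
      ENNReal.ofReal (l2norm c ^ 2) * ENNReal.ofReal (‖x ⟨0, hd⟩‖ ^ 2) := fun x => by
    conv_lhs => rw [hU]
    rw [gain_smul_right, gain_rot, gain_comm, gain_single_left, Complex.norm_real,
      Real.norm_eq_abs, sq_abs, ENNReal.ofReal_mul (by positivity)]
  simp_rw [e]
  rw [lintegral_const_mul _ (by fun_prop), lintegral_channelLaw_apply ⟨0, hd⟩
    (fun z => ENNReal.ofReal (‖z‖ ^ 2)) (by fun_prop), lintegral_normSq, mul_one]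

section LaplaceBounds

variable {d : ℕ} {ι : Type*} [Fintype ι] (v : ι → Fin d → ℂ)

/-- The trace of a quadratic form. -/
def formTrace : ℝ := ∑ i, l2norm (v i) ^ 2

/-- The second elementary symmetric function of the eigenvalues of a quadratic form. -/
def formMinor : ℝ := ((∑ i, l2norm (v i) ^ 2) ^ 2 - ∑ i, ∑ i', gain (v i) (v i')) / 2

lemma formTrace_nonneg : 0 ≤ formTrace v := Finset.sum_nonneg fun _ _ => by positivity

lemma formMinor_nonneg : 0 ≤ formMinor v := by
  obtain ⟨U, μ, hμ, -, h1, h2⟩ := exists_diagonal_quadForm v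
  have := (one_add_mul_le_prod Finset.univ μ hμ zero_le_one).1
  rw [h1, h2] at this
  exact div_nonneg this zero_le_two

lemma prod_inv_le {μ : Fin d → ℝ} (hμ : ∀ m, 0 ≤ μ m) (h1 : ∑ m, μ m = ∑ i, l2norm (v i) ^ 2)
    (h2 : ∑ m, μ m ^ 2 = ∑ i, ∑ i', gain (v i) (v i')) {t : ℝ} (ht : 0 ≤ t) :
    ∏ m, (1 / (1 + t * μ m)) ≤ 1 / (1 + t * formTrace v + t ^ 2 * formMinor v) := by
  have := (one_add_mul_le_prod Finset.univ μ hμ ht).2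
  rw [h1, h2] at this
  have h3 := formTrace_nonneg v
  have h4 := formMinor_nonneg v
  rw [Finset.prod_div_distrib, Finset.prod_const_one]
  exact one_div_le_one_div_of_le (by positivity) this

theorem lintegral_exp_neg_quadForm_le {t : ℝ} (ht : 0 ≤ t) :
    ∫⁻ x, ENNReal.ofReal (Real.exp (-(t * quadForm v x))) ∂(channelLaw d) ≤
      ENNReal.ofReal (1 / (1 + t * formTrace v + t ^ 2 * formMinor v)) := by
  obtain ⟨U, μ, hμ, hq, h1, h2⟩ := exists_diagonal_quadForm v
  have hm : Measurable fun x => ENNReal.ofReal (Real.exp (-(t * quadForm v x))) := by fun_prop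
  rw [← lintegral_channelLaw_rot U _ hm]
  simp_rw [hq, Finset.mul_sum, ← mul_assoc]
  rw [lintegral_exp_neg_sum_channelLaw _ fun m => mul_nonneg ht (hμ m)]
  exact ENNReal.ofReal_le_ofReal (prod_inv_le v hμ h1 h2 ht)

/-- In an eigenbasis the exponential weight contracts each coordinate by `1 / √(1 + t μ)`. The mean
gain along `c` can only shrink, and the mass is the Laplace transform already bounded. -/
theorem lintegral_gain_mul_exp_neg_quadForm_le (c : Fin d → ℂ) {t : ℝ} (ht : 0 ≤ t) :
    ∫⁻ x, ENNReal.ofReal (gain x c * Real.exp (-(t * quadForm v x))) ∂(channelLaw d) ≤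
      ENNReal.ofReal (l2norm c ^ 2 / (1 + t * formTrace v + t ^ 2 * formMinor v)) := by
  obtain ⟨U, μ, hμ, hq, h1, h2⟩ := exists_diagonal_quadForm v
  have hm : Measurable fun x => ENNReal.ofReal (gain x c * Real.exp (-(t * quadForm v x))) := by
    fun_prop
  rw [← lintegral_channelLaw_rot U _ hm]
  set c' := rot U⁻¹ c with hc'
  have hc : rot U c' = c := by
    simp only [hc', rot, Matrix.mulVec_mulVec]
    have : (U : Matrix (Fin d) (Fin d) ℂ) * (U⁻¹ : Matrix.unitaryGroup (Fin d) ℂ) = 1 :=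
      congrArg Subtype.val (mul_inv_cancel U)
    rw [this, Matrix.one_mulVec]
  have hn : ∀ m, 0 ≤ t * μ m := fun m => mul_nonneg ht (hμ m)
  have e1 : ∀ x, ENNReal.ofReal (gain (rot U x) c * Real.exp (-(t * quadForm v (rot U x)))) =
      ENNReal.ofReal (gain x c') * ENNReal.ofReal (Real.exp (-∑ m, t * μ m * ‖x m‖ ^ 2)) :=
    fun x => by
      rw [hq, ENNReal.ofReal_mul (gain_nonneg _ _)]
      conv_lhs => rw [← hc]
      rw [gain_rot]
      simp_rw [Finset.mul_sum, ← mul_assoc]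
  simp_rw [e1]
  rw [lintegral_channelLaw_mul_exp _ hn (fun x => ENNReal.ofReal (gain x c')) (by fun_prop)]
  set c'' : Fin d → ℂ := fun m => ((1 / √(1 + t * μ m) : ℝ) : ℂ) * c' m with hc''
  have e2 : ∀ x : Fin d → ℂ, gain (fun m => ((1 / √(1 + t * μ m) : ℝ) : ℂ) * x m) c' =
      gain x c'' := fun x => by
    rw [gain, gain]
    congr 2
    simp only [dotProduct, Pi.star_apply, hc'', star_mul, RCLike.star_def, Complex.conj_ofReal]
    exact Finset.sum_congr rfl fun m _ => by ring
  simp_rw [e2]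
  rw [lintegral_gain_channelLaw, ← ENNReal.ofReal_mul
    (Finset.prod_nonneg fun m _ => by have := hn m; positivity)]
  refine ENNReal.ofReal_le_ofReal ?_
  have e3 : l2norm c'' ^ 2 ≤ l2norm c ^ 2 := by
    rw [← hc, l2norm_rot, l2norm_sq, l2norm_sq]
    refine Finset.sum_le_sum fun m _ => ?_
    have h3 := hn m
    rw [hc'', norm_mul, mul_pow, Complex.norm_real, Real.norm_eq_abs, sq_abs, div_pow,
      Real.sq_sqrt (by linarith), one_pow]
    refine mul_le_of_le_one_left (by positivity) ?_
    rw [div_le_one (by linarith)]; linarith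
  rw [div_eq_mul_one_div, mul_comm (l2norm c ^ 2)]
  have h3 := formTrace_nonneg v
  have h4 := formMinor_nonneg v
  exact mul_le_mul (prod_inv_le v hμ h1 h2 ht) e3 (by positivity) (by positivity)

/-- The normalized quadratic form. -/
def ratioForm (x : Fin d → ℂ) : ℝ := quadForm v x / l2norm x ^ 2

lemma ratioForm_nonneg (x : Fin d → ℂ) : 0 ≤ ratioForm v x :=
  div_nonneg (quadForm_nonneg v x) (by positivity)

@[fun_prop]
lemma measurable_ratioForm : Measurable (ratioForm v) := by
  have := measurable_l2norm d
  unfold ratioForm; fun_prop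

lemma ratioForm_smul (c : ℝ) (x : Fin d → ℂ) (hc : 0 < c) :
    ratioForm v ((c : ℂ) • x) = ratioForm v x := by
  have e1 : quadForm v ((c : ℂ) • x) = c ^ 2 * quadForm v x := by
    simp only [quadForm, gain_smul_left, Complex.norm_real, Real.norm_eq_abs, sq_abs,
      Finset.mul_sum]
  have e2 : l2norm ((c : ℂ) • x) ^ 2 = c ^ 2 * l2norm x ^ 2 := by
    simp only [l2norm_sq, Pi.smul_apply, smul_eq_mul, norm_mul, mul_pow, Complex.norm_real,
      Real.norm_eq_abs, sq_abs, Finset.mul_sum]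
  rw [ratioForm, e1, e2, mul_div_mul_left _ _ (by positivity), ratioForm]

lemma ratioForm_mul (x : Fin d → ℂ) : ratioForm v x * l2norm x ^ 2 = quadForm v x := by
  by_cases hx : x = 0
  · subst hx; simp [l2norm, quadForm, gain]
  · have := (l2norm_pos_iff x).2 hx
    rw [ratioForm, div_mul_cancel₀ _ (by positivity)]

/-- The exponent must be exactly the dimension `d`; lower exponents are reached through `headShare`.
-/
lemma lintegral_one_add_ratioForm_pow (hd : d ≠ 0) {t : ℝ} (ht : 0 ≤ t) :
    ∫⁻ x, ENNReal.ofReal (1 / (1 + t * ratioForm v x) ^ d) ∂(channelLaw d) =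
      ∫⁻ x, ENNReal.ofReal (Real.exp (-(t * quadForm v x))) ∂(channelLaw d) := by
  rw [lintegral_one_add_mul_pow hd _ (measurable_ratioForm v) (ratioForm_nonneg v)
    (fun c x hc => ratioForm_smul v c x hc) ht]
  simp_rw [ratioForm_mul]

end LaplaceBounds

section Beta

variable {d : ℕ}

/-- The share of the first three coordinates in the squared norm. -/
def headShare (x : Fin d → ℂ) : ℝ :=
  ratioForm (fun m : {m : Fin d // m.val < 3} => (Pi.single m.1 1 : Fin d → ℂ)) x

/-- Averaging over this share lowers the exponent from `d` to `3`: only three eigenvalues of the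
coordinate form are nonzero. -/
lemma lintegral_headShare (hd : 3 ≤ d) {t : ℝ} (ht : 0 ≤ t) :
    ∫⁻ x : Fin d → ℂ, ENNReal.ofReal (1 / (1 + t * headShare x) ^ d) ∂(channelLaw d) =
      ENNReal.ofReal (1 / (1 + t) ^ 3) := by
  unfold headShare
  rw [lintegral_one_add_ratioForm_pow _ (by omega) ht]
  have e : ∀ x : Fin d → ℂ, t * quadForm (fun m : {m : Fin d // m.val < 3} =>
      (Pi.single m.1 1 : Fin d → ℂ)) x = ∑ m : Fin d, (if m.val < 3 then t else 0) * ‖x m‖ ^ 2 :=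
    fun x => by
      simp_rw [quadForm, gain_comm x, gain_single_left, ite_mul, zero_mul, ← Finset.sum_filter,
        Finset.mul_sum]
      rw [← Finset.sum_subtype_eq_sum_filter, Finset.subtype_univ]
  simp_rw [e]
  rw [lintegral_exp_neg_sum_channelLaw _ fun m => by split_ifs <;> simp [ht]]
  congr 1
  have : ∀ m : Fin d, 1 / (1 + if m.val < 3 then t else 0) = if m.val < 3 then 1 / (1 + t) else 1 :=
    fun m => by split_ifs <;> simp
  simp_rw [this]
  rw [Finset.prod_ite, Finset.prod_const, Finset.prod_const_one, mul_one, Fin.card_filter_val_lt,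
    min_eq_right hd, one_div_pow]

@[fun_prop]
lemma measurable_headShare : Measurable (headShare : (Fin d → ℂ) → ℝ) := measurable_ratioForm _

lemma ae_headShare_pos (hd : 3 ≤ d) : ∀ᵐ x : Fin d → ℂ ∂(channelLaw d), 0 < headShare x := by
  filter_upwards [channelLaw_ae_coord_ne_zero (⟨0, by omega⟩ : Fin d)] with x hx
  have hx0 : x ≠ 0 := fun h => hx (by simp [h])
  refine div_pos (Finset.sum_pos' (fun _ _ => gain_nonneg _ _)
    ⟨⟨⟨0, by omega⟩, by simp⟩, Finset.mem_univ _, ?_⟩) (pow_pos ((l2norm_pos_iff x).2 hx0) 2)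
  rw [gain_comm, gain_single_left]
  positivity

/-- Write `1 / s` as `(d - 1) ∫ (1 + s t) ^ (-d) dt` and use the previous identity under the
integral, so that no density of the share is needed. -/
lemma lintegral_inv_headShare (hd : 3 ≤ d) :
    ∫⁻ x : Fin d → ℂ, ENNReal.ofReal (1 / headShare x) ∂(channelLaw d) =
      ENNReal.ofReal ((d - 1) / 2) := by
  obtain ⟨n, rfl⟩ : ∃ n, d = n + 1 := ⟨d - 1, by omega⟩
  have hn : n ≠ 0 := by omega
  have hn' : (n : ℝ) ≠ 0 := by exact_mod_cast hn
  have e1 : ∀ᵐ x : Fin (n + 1) → ℂ ∂(channelLaw (n + 1)), ENNReal.ofReal (1 / headShare x) =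
      ENNReal.ofReal n * ∫⁻ t in Set.Ioi (0 : ℝ),
        ENNReal.ofReal (1 / (1 + headShare x * t) ^ (n + 1)) := by
    filter_upwards [ae_headShare_pos hd] with x hx
    rw [lintegral_Ioi_inv_pow hx hn le_rfl, ← ENNReal.ofReal_mul (by positivity)]
    congr 1
    rw [mul_zero, add_zero, one_pow, mul_one]
    field_simp
  rw [lintegral_congr_ae e1, lintegral_const_mul _ (Measurable.lintegral_prod_right'
    (f := fun p : (Fin (n + 1) → ℂ) × ℝ =>
      ENNReal.ofReal (1 / (1 + headShare p.1 * p.2) ^ (n + 1))) (by fun_prop)),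
    lintegral_lintegral_swap (Measurable.aemeasurable (by fun_prop))]
  have e2 : ∀ t ∈ Set.Ioi (0 : ℝ), ∫⁻ x : Fin (n + 1) → ℂ,
      ENNReal.ofReal (1 / (1 + headShare x * t) ^ (n + 1)) ∂(channelLaw (n + 1)) =
      ENNReal.ofReal (1 / (1 + 1 * t) ^ (2 + 1)) := fun t ht => by
    simp_rw [mul_comm _ t]
    rw [lintegral_headShare hd (Set.mem_Ioi.1 ht).le, mul_one]
  rw [setLIntegral_congr_fun measurableSet_Ioi e2, lintegral_Ioi_inv_pow one_pos two_ne_zero le_rfl,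
    ← ENNReal.ofReal_mul (by positivity)]
  congr 1
  push_cast
  ring

lemma lintegral_inv_headShare_sq (hd : 3 ≤ d) :
    ∫⁻ x : Fin d → ℂ, ENNReal.ofReal (1 / headShare x ^ 2) ∂(channelLaw d) =
      ENNReal.ofReal ((d - 1) * (d - 2) / 2) := by
  obtain ⟨n, rfl⟩ : ∃ n, d = n + 2 := ⟨d - 2, by omega⟩
  have hn : n ≠ 0 := by omega
  have hn' : (n : ℝ) ≠ 0 := by exact_mod_cast hn
  have e1 : ∀ᵐ x : Fin (n + 2) → ℂ ∂(channelLaw (n + 2)), ENNReal.ofReal (1 / headShare x ^ 2) =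
      ENNReal.ofReal (n * (n + 1)) * ∫⁻ t in Set.Ioi (0 : ℝ),
        ENNReal.ofReal (t * (1 / (1 + headShare x * t) ^ (n + 2))) := by
    filter_upwards [ae_headShare_pos hd] with x hx
    rw [lintegral_Ioi_mul_inv_pow hx hn, ← ENNReal.ofReal_mul (by positivity)]
    congr 1
    field_simp
  rw [lintegral_congr_ae e1, lintegral_const_mul _ (Measurable.lintegral_prod_right'
    (f := fun p : (Fin (n + 2) → ℂ) × ℝ =>
      ENNReal.ofReal (p.2 * (1 / (1 + headShare p.1 * p.2) ^ (n + 2)))) (by fun_prop)),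
    lintegral_lintegral_swap (Measurable.aemeasurable (by fun_prop))]
  have e2 : ∀ t ∈ Set.Ioi (0 : ℝ), ∫⁻ x : Fin (n + 2) → ℂ,
      ENNReal.ofReal (t * (1 / (1 + headShare x * t) ^ (n + 2))) ∂(channelLaw (n + 2)) =
      ENNReal.ofReal (t * (1 / (1 + 1 * t) ^ (1 + 2))) := fun t ht => by
    have ht0 := (Set.mem_Ioi.1 ht).le
    simp_rw [ENNReal.ofReal_mul ht0, mul_comm _ t]
    rw [lintegral_const_mul _ (by fun_prop), lintegral_headShare hd ht0, mul_one]
  rw [setLIntegral_congr_fun measurableSet_Ioi e2, lintegral_Ioi_mul_inv_pow one_pos one_ne_zero,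
    ← ENNReal.ofReal_mul (by positivity)]
  congr 1
  push_cast
  ring

lemma inv_add_le_weighted {p q θ : ℝ} (hp : 0 < p) (hq : 0 < q) :
    1 / (1 + p + q) ≤ θ ^ 2 / p + (1 - θ) ^ 2 / q := by
  rw [div_add_div _ _ hp.ne' hq.ne', div_le_div_iff₀ (by positivity) (by positivity)]
  have h1 : 0 ≤ θ ^ 2 * q + p * (1 - θ) ^ 2 := by positivity
  nlinarith [sq_nonneg (θ * q - (1 - θ) * p), mul_pos hp hq]

/-- Third inverse moment of an affine function of a normalized quadratic form. -/
theorem lintegral_one_add_ratioForm_cube_le {ι : Type*} [Fintype ι] (hd : 3 ≤ d)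
    (v : ι → Fin d → ℂ) (hS : 0 < formTrace v) (hE : 0 < formMinor v) {l : ℝ} (hl : 0 < l) (θ : ℝ) :
    ∫⁻ x, ENNReal.ofReal (1 / (1 + l * ratioForm v x) ^ 3) ∂(channelLaw d) ≤
      ENNReal.ofReal (θ ^ 2 * (d - 1) / (2 * formTrace v * l) +
        (1 - θ) ^ 2 * (d - 1) * (d - 2) / (2 * formMinor v * l ^ 2)) := by
  have hd1 : (3 : ℝ) ≤ d := by exact_mod_cast hd
  -- The third power is raised to the `d`th with an auxiliary independent Gaussian `z`; then the
  -- integral over `x` is a Laplace transform.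
  have e1 : ∀ x, ENNReal.ofReal (1 / (1 + l * ratioForm v x) ^ 3) = ∫⁻ z : Fin d → ℂ,
      ENNReal.ofReal (1 / (1 + l * ratioForm v x * headShare z) ^ d) ∂(channelLaw d) := fun x =>
    (lintegral_headShare hd (mul_nonneg hl.le (ratioForm_nonneg v x))).symm
  simp_rw [e1]
  rw [lintegral_lintegral_swap (Measurable.aemeasurable (by fun_prop))]
  calc _ ≤ ∫⁻ z : Fin d → ℂ, (ENNReal.ofReal (θ ^ 2 / (formTrace v * l)) *
        ENNReal.ofReal (1 / headShare z) + ENNReal.ofReal ((1 - θ) ^ 2 / (formMinor v * l ^ 2)) *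
        ENNReal.ofReal (1 / headShare z ^ 2)) ∂(channelLaw d) := by
        refine lintegral_mono_ae ?_
        filter_upwards [ae_headShare_pos hd] with z hz
        have e2 : ∀ x, l * ratioForm v x * headShare z = (l * headShare z) * ratioForm v x :=
          fun x => by ring
        simp_rw [e2]
        rw [lintegral_one_add_ratioForm_pow v (by omega) (by positivity),
          ← ENNReal.ofReal_mul (by positivity), ← ENNReal.ofReal_mul (by positivity),
          ← ENNReal.ofReal_add (by positivity) (by positivity)]
        refine (lintegral_exp_neg_quadForm_le v (by positivity)).trans
          (ENNReal.ofReal_le_ofReal ?_)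
        refine (inv_add_le_weighted (θ := θ) (by positivity) (by positivity)).trans_eq ?_
        field_simp
    _ = _ := by
        rw [lintegral_add_left (by fun_prop), lintegral_const_mul _ (by fun_prop),
          lintegral_const_mul _ (by fun_prop), lintegral_inv_headShare hd,
          lintegral_inv_headShare_sq hd, ← ENNReal.ofReal_mul (by positivity),
          ← ENNReal.ofReal_mul (by positivity), ← ENNReal.ofReal_add]
        · congr 1
          field_simp
        · have : (0 : ℝ) ≤ d - 1 := by linarith
          positivity
        · have : (0 : ℝ) ≤ d - 1 := by linarith
          have : (0 : ℝ) ≤ d - 2 := by linarith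
          positivity

end Beta

end

/-! ### Rotating frames, the law of the signal coefficient, and the error direction. -/

section

open scoped ENNReal

section Rotation

variable {M : ℕ}

/-- The law of `M` independent isotropic unit vectors. -/
abbrev framesLaw (M : ℕ) : Measure (Fin M → Fin M → ℂ) := Measure.pi fun _ => isotropicLaw M

lemma lintegral_framesLaw_rot (U : Matrix.unitaryGroup (Fin M) ℂ)
    (f : (Fin M → Fin M → ℂ) → ℝ≥0∞) (hf : Measurable f) :
    ∫⁻ w, f (fun i => rot U (w i)) ∂(framesLaw M) = ∫⁻ w, f w ∂(framesLaw M) := by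
  have hU : Measurable fun (w : Fin M → Fin M → ℂ) i => rot U (w i) :=
    measurable_pi_lambda _ fun i => (measurable_rot U).comp (measurable_pi_apply i)
  conv_rhs => rw [framesLaw, ← pi_isotropicLaw_map_rot U]
  rw [lintegral_map hf hU]

lemma lintegral_isotropicLaw_rot (U : Matrix.unitaryGroup (Fin M) ℂ)
    (f : (Fin M → ℂ) → ℝ≥0∞) (hf : Measurable f) :
    ∫⁻ x, f (rot U x) ∂(isotropicLaw M) = ∫⁻ x, f x ∂(isotropicLaw M) := by
  conv_rhs => rw [← isotropicLaw_map_rot U]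
  rw [lintegral_map hf (measurable_rot U)]

lemma rot_comp_update (U : Matrix.unitaryGroup (Fin M) ℂ) (w : Fin M → Fin M → ℂ) (k : Fin M)
    (x : Fin M → ℂ) : (fun i => rot U (Function.update w k x i)) =
      Function.update (fun i => rot U (w i)) k (rot U x) := by
  ext i : 1
  by_cases h : i = k
  · subst h; simp
  · simp [h]

lemma measurable_update_const (k : Fin M) (x : Fin M → ℂ) :
    Measurable fun w : Fin M → Fin M → ℂ => Function.update w k x :=
  measurable_update_pair measurable_id measurable_const

lemma measurable_comp_update {f : (Fin M → Fin M → ℂ) → ℝ≥0∞} (hf : Measurable f) (k : Fin M) :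
    Measurable fun p : (Fin M → Fin M → ℂ) × (Fin M → ℂ) => f (Function.update p.1 k p.2) :=
  hf.comp (measurable_update_pair measurable_fst measurable_snd)

lemma lintegral_update_rot (U : Matrix.unitaryGroup (Fin M) ℂ) (k : Fin M) (x : Fin M → ℂ)
    (f g : (Fin M → Fin M → ℂ) → ℝ≥0∞) (hf : Measurable f)
    (hfg : ∀ w, f (fun i => rot U (w i)) = g w) :
    ∫⁻ w, f (Function.update w k (rot U x)) ∂(framesLaw M) =
      ∫⁻ w, g (Function.update w k x) ∂(framesLaw M) := by
  rw [← lintegral_framesLaw_rot U (fun w => f (Function.update w k (rot U x)))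
    (hf.comp (measurable_update_const k _))]
  refine lintegral_congr fun w => ?_
  rw [← hfg, rot_comp_update]

/-- A rotation-invariant statistic may be computed with the `k`th vector fixed. -/
theorem lintegral_framesLaw_eq_update (k : Fin M) (f : (Fin M → Fin M → ℂ) → ℝ≥0∞)
    (hf : Measurable f)
    (hr : ∀ (U : Matrix.unitaryGroup (Fin M) ℂ) w, f (fun i => rot U (w i)) = f w) :
    ∫⁻ w, f w ∂(framesLaw M) =
      ∫⁻ w, f (Function.update w k (Pi.single k 1)) ∂(framesLaw M) := by
  have hm : Measurable (Function.uncurry fun (w : Fin M → Fin M → ℂ) (x : Fin M → ℂ) =>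
    f (Function.update w k x)) := measurable_comp_update hf k
  rw [framesLaw, lintegral_pi_update _ k f hf, lintegral_lintegral_swap hm.aemeasurable]
  have : ∀ᵐ x ∂(isotropicLaw M), ∫⁻ w, f (Function.update w k x) ∂(framesLaw M) =
      ∫⁻ w, f (Function.update w k (Pi.single k 1)) ∂(framesLaw M) := by
    filter_upwards [isotropicLaw_ae_l2norm k] with x hx
    obtain ⟨U, rfl⟩ := exists_rot_eq k x hx
    exact lintegral_update_rot U k _ f f hf (hr U)
  rw [lintegral_congr_ae this, lintegral_const, measure_univ, mul_one]

lemma ae_ae_update (k : Fin M) {p : (Fin M → Fin M → ℂ) → Prop} (hp : MeasurableSet {w | p w})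
    (h : ∀ᵐ w ∂(framesLaw M), p w) :
    ∀ᵐ w ∂(framesLaw M), ∀ᵐ x ∂(isotropicLaw M), p (Function.update w k x) := by
  have hm : Measurable ({w | p w}ᶜ.indicator (1 : (Fin M → Fin M → ℂ) → ℝ≥0∞)) :=
    measurable_one.indicator hp.compl
  have h0 : framesLaw M {w | p w}ᶜ = 0 := h
  rw [← lintegral_indicator_one hp.compl, framesLaw, lintegral_pi_update _ k _ hm,
    lintegral_eq_zero_iff (measurable_comp_update hm k).lintegral_prod_right'] at h0
  filter_upwards [h0] with w hw
  have hmx : Measurable fun x => {w | p w}ᶜ.indicator (1 : (Fin M → Fin M → ℂ) → ℝ≥0∞)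
      (Function.update w k x) := hm.comp (measurable_update w)
  rw [Pi.zero_apply, lintegral_eq_zero_iff hmx] at hw
  filter_upwards [hw] with x hx
  by_contra hc
  have : Function.update w k x ∈ {w | p w}ᶜ := hc
  rw [Pi.zero_apply, Set.indicator_of_mem this] at hx
  exact one_ne_zero hx

end Rotation

section ZeroForcing

variable {M : ℕ}

lemma l2norm_smul (c : ℂ) (x : Fin M → ℂ) : l2norm (c • x) = ‖c‖ * l2norm x := by
  rw [l2norm_eq_norm, l2norm_eq_norm, WithLp.toLp_smul, norm_smul]

/-- The expansion of a vector in the dual basis. -/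
lemma eq_sum_smul_inv (w : Fin M → Fin M → ℂ) (hd : frameDet w ≠ 0) (x : Fin M → ℂ) :
    x = ∑ m, (star (w m) ⬝ᵥ x) • fun a => (frameMatrix w)⁻¹ a m := by
  have h1 := Matrix.nonsing_inv_mul (frameMatrix w) (by simpa [frameDet_eq] using hd)
  have h2 : (frameMatrix w)⁻¹ *ᵥ (frameMatrix w *ᵥ x) = x := by
    rw [Matrix.mulVec_mulVec, h1, Matrix.one_mulVec]
  conv_lhs => rw [← h2]
  ext a
  simp only [Finset.sum_apply, Pi.smul_apply, smul_eq_mul]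
  rw [Matrix.mulVec, dotProduct]
  refine Finset.sum_congr rfl fun m _ => ?_
  rw [mul_comm]
  rfl

lemma inv_col_eq_smul (w : Fin M → Fin M → ℂ) (m : Fin M) :
    (fun a => (frameMatrix w)⁻¹ a m) =
      ((l2norm fun a => (frameMatrix w)⁻¹ a m : ℝ) : ℂ) • zeroForcing w m := by
  by_cases h : (fun a => (frameMatrix w)⁻¹ a m) = 0
  · rw [h]; simp [l2norm]
  · exact (smul_direction _ h).symm

lemma exists_eq_sum_smul_zeroForcing (w : Fin M → Fin M → ℂ) (hd : frameDet w ≠ 0)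
    (x : Fin M → ℂ) : ∃ c : Fin M → ℂ, (∀ m, star (w m) ⬝ᵥ x = 0 → c m = 0) ∧
      x = ∑ m, c m • zeroForcing w m := by
  refine ⟨fun m => (star (w m) ⬝ᵥ x) * (l2norm fun a => (frameMatrix w)⁻¹ a m : ℝ), fun m h => by
    simp [h], ?_⟩
  conv_lhs => rw [eq_sum_smul_inv w hd x]
  refine Finset.sum_congr rfl fun m _ => ?_
  conv_lhs => rw [inv_col_eq_smul w m]
  rw [smul_smul]

/-- The zero-forcing direction is determined up to a phase by its orthogonality relations. -/
lemma gain_zeroForcing_of_orthogonal (w : Fin M → Fin M → ℂ) (hd : frameDet w ≠ 0) (k : Fin M)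
    (v : Fin M → ℂ) (hv : l2norm v = 1) (h : ∀ m, m ≠ k → star (w m) ⬝ᵥ v = 0) (z : Fin M → ℂ) :
    gain z (zeroForcing w k) = gain z v := by
  obtain ⟨c, hc, hx⟩ := exists_eq_sum_smul_zeroForcing w hd v
  rw [Finset.sum_eq_single k (fun m _ hm => by rw [hc m (h m hm), zero_smul]) (by simp)] at hx
  have h1 : ‖c k‖ = 1 := by
    rw [hx, l2norm_smul, l2norm_zeroForcing w k hd, mul_one] at hv
    exact hv
  rw [hx, gain_smul_right, h1, one_pow, one_mul]

/-- The beam of user `k` depends, up to a phase, only on the other users' vectors. It is therefore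
independent of the vector of user `k`, and the gain between them has the one-vector law. -/
lemma gain_zeroForcing_update (w : Fin M → Fin M → ℂ) (k : Fin M) (y : Fin M → ℂ)
    (hd : frameDet w ≠ 0) (hd' : frameDet (Function.update w k y) ≠ 0) (z : Fin M → ℂ) :
    gain z (zeroForcing (Function.update w k y) k) = gain z (zeroForcing w k) :=
  gain_zeroForcing_of_orthogonal _ hd' k _ (l2norm_zeroForcing w k hd) (fun m hm => by
    rw [Function.update_of_ne hm, star_dotProduct_zeroForcing w hm]) z

lemma sigPar_eq_gain (k : Fin M) (w : Fin M → Fin M → ℂ) : sigPar k w =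
    gain (Function.update w k (Pi.single k 1) k)
      (zeroForcing (Function.update w k (Pi.single k 1)) k) := by
  rw [Function.update_self, gain_single_left]; rfl

lemma measurableSet_frameDet_ne_zero : MeasurableSet {w : Fin M → Fin M → ℂ | frameDet w ≠ 0} :=
  (measurable_frameDet (measurableSet_singleton 0)).compl

/-- The law of the signal coefficient. -/
theorem lintegral_sigPar (hM : 2 ≤ M) (k : Fin M) (f : ℝ → ℝ≥0∞) (hf : Measurable f) :
    ∫⁻ w, f (sigPar k w) ∂(framesLaw M) =
      ∫⁻ t in Set.Ioc (0 : ℝ) 1, f (1 - t) * ENNReal.ofReal ((M - 1 : ℕ) * t ^ (M - 1 - 1)) := by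
  have hm : Measurable fun w : Fin M → Fin M → ℂ => f (gain (w k) (zeroForcing w k)) :=
    hf.comp (measurable_gain (measurable_pi_apply k) (measurable_zeroForcing M k))
  simp_rw [sigPar_eq_gain]
  rw [← lintegral_framesLaw_eq_update k (fun w => f (gain (w k) (zeroForcing w k))) hm
    (fun U w => by simp_rw [zeroForcing_rot, gain_rot]), framesLaw,
    lintegral_pi_update _ k _ hm]
  have : ∀ᵐ w ∂(framesLaw M), ∫⁻ y, f (gain (Function.update w k y k)
      (zeroForcing (Function.update w k y) k)) ∂(isotropicLaw M) =
      ∫⁻ t in Set.Ioc (0 : ℝ) 1, f (1 - t) * ENNReal.ofReal ((M - 1 : ℕ) * t ^ (M - 1 - 1)) := by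
    filter_upwards [ae_frameDet_ne_zero hM,
      ae_ae_update k measurableSet_frameDet_ne_zero (ae_frameDet_ne_zero hM)] with w hw hw'
    rw [← lintegral_isotropicLaw_gain hM (zeroForcing w k) (l2norm_zeroForcing w k hw) f hf]
    refine lintegral_congr_ae ?_
    filter_upwards [hw'] with y hy
    rw [Function.update_self, gain_zeroForcing_update w k y hw hy, gain_comm]
  rw [lintegral_congr_ae this, lintegral_const, measure_univ, mul_one]

lemma lintegral_Ioc_of_hasDerivAt {g g' : ℝ → ℝ} (hd : ∀ x, HasDerivAt g (g' x) x)
    (hc : Continuous g') (hn : ∀ x ∈ Set.Ioc (0 : ℝ) 1, 0 ≤ g' x) :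
    ∫⁻ x in Set.Ioc (0 : ℝ) 1, ENNReal.ofReal (g' x) = ENNReal.ofReal (g 1 - g 0) := by
  rw [← intervalIntegral.integral_eq_sub_of_hasDerivAt (fun x _ => hd x)
    (hc.intervalIntegrable 0 1), intervalIntegral.integral_of_le zero_le_one,
    ofReal_integral_eq_lintegral_ofReal (hc.integrableOn_Icc.mono_set Set.Ioc_subset_Icc_self)]
  exact (ae_restrict_iff' measurableSet_Ioc).2 (ae_of_all _ hn)

/-- The beta moments. -/
lemma lintegral_beta (d p : ℕ) (hd : d ≠ 0) :
    ∫⁻ t in Set.Ioc (0 : ℝ) 1, ENNReal.ofReal ((1 - t) * t ^ p * (d * t ^ (d - 1))) =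
      ENNReal.ofReal (d / ((d + p) * (d + p + 1))) := by
  obtain ⟨n, rfl⟩ := Nat.exists_eq_succ_of_ne_zero hd
  rw [Nat.succ_eq_add_one, Nat.add_sub_cancel]
  have h := lintegral_Ioc_of_hasDerivAt
    (g := fun t => ((n + 1 : ℕ) : ℝ) * (t ^ (n + p + 1) / ((n + p + 1 : ℕ) : ℝ) -
      t ^ (n + p + 2) / ((n + p + 2 : ℕ) : ℝ)))
    (g' := fun t => (1 - t) * t ^ p * ((n + 1 : ℕ) * t ^ n)) (fun t => ?_) (by fun_prop)
    (fun t ht => by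
      have := ht.1; have : 0 ≤ 1 - t := by linarith [ht.2]
      positivity)
  · rw [h]
    congr 1
    push_cast
    simp only [one_pow, ne_eq, Nat.add_eq_zero_iff, one_ne_zero, OfNat.ofNat_ne_zero, and_false,
      not_false_eq_true, zero_pow, zero_div, sub_self, mul_zero, sub_zero]
    field_simp
    ring
  · have h1 := (hasDerivAt_pow (n + p + 1) t).div_const ((n + p + 1 : ℕ) : ℝ)
    have h2 := (hasDerivAt_pow (n + p + 2) t).div_const ((n + p + 2 : ℕ) : ℝ)
    refine ((h1.sub h2).const_mul ((n + 1 : ℕ) : ℝ)).congr_deriv ?_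
    have : ((n + p + 1 : ℕ) : ℝ) ≠ 0 := by positivity
    have : ((n + p + 2 : ℕ) : ℝ) ≠ 0 := by positivity
    simp only [Nat.add_sub_cancel, show n + p + 2 - 1 = n + p + 1 by omega]
    field_simp
    ring

lemma lintegral_beta_sq (d : ℕ) (hd : d ≠ 0) :
    ∫⁻ t in Set.Ioc (0 : ℝ) 1, ENNReal.ofReal ((1 - t) ^ 2 * (d * t ^ (d - 1))) =
      ENNReal.ofReal (2 / ((d + 1) * (d + 2))) := by
  have h0 := lintegral_beta d 0 hd
  have h1 := lintegral_beta d 1 hd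
  have h2 : ∫⁻ t in Set.Ioc (0 : ℝ) 1, (ENNReal.ofReal ((1 - t) ^ 2 * (d * t ^ (d - 1))) +
      ENNReal.ofReal ((1 - t) * t ^ 1 * (d * t ^ (d - 1)))) =
      ENNReal.ofReal (d / ((d + (0 : ℕ)) * (d + (0 : ℕ) + 1))) := by
    rw [← h0]
    refine setLIntegral_congr_fun measurableSet_Ioc fun t ht => ?_
    have := ht.1.le
    have h3 : 0 ≤ 1 - t := by linarith [ht.2]
    rw [← ENNReal.ofReal_add (by positivity) (by positivity)]
    congr 1; ring
  rw [lintegral_add_left (by fun_prop), h1] at h2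
  have hd' : (0 : ℝ) < d := by positivity
  rw [← ENNReal.add_left_inj (ENNReal.ofReal_ne_top (r := d / ((d + (1 : ℕ)) * (d + (1 : ℕ) + 1)))),
    h2, ← ENNReal.ofReal_add (by positivity) (by positivity)]
  congr 1
  push_cast
  field_simp
  ring

lemma lintegral_sigPar_beta {d : ℕ} (hd : d ≠ 0) (k : Fin (d + 1)) (p : ℕ) :
    ∫⁻ w, ENNReal.ofReal (sigPar k w * (1 - sigPar k w) ^ p) ∂(framesLaw (d + 1)) =
      ENNReal.ofReal (d / ((d + p) * (d + p + 1))) := by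
  rw [lintegral_sigPar (by omega) k (fun t => ENNReal.ofReal (t * (1 - t) ^ p)) (by fun_prop),
    ← lintegral_beta d p hd]
  refine setLIntegral_congr_fun measurableSet_Ioc fun t ht => ?_
  have := ht.1.le
  have h3 : 0 ≤ 1 - t := by linarith [ht.2]
  simp only [Nat.add_sub_cancel, sub_sub_cancel]
  rw [← ENNReal.ofReal_mul (by positivity)]

lemma lintegral_sigPar_sq {d : ℕ} (hd : d ≠ 0) (k : Fin (d + 1)) :
    ∫⁻ w, ENNReal.ofReal (sigPar k w ^ 2) ∂(framesLaw (d + 1)) =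
      ENNReal.ofReal (2 / ((d + 1) * (d + 2))) := by
  rw [lintegral_sigPar (by omega) k (fun t => ENNReal.ofReal (t ^ 2)) (by fun_prop),
    ← lintegral_beta_sq d hd]
  refine setLIntegral_congr_fun measurableSet_Ioc fun t ht => ?_
  have := ht.1.le
  simp only [Nat.add_sub_cancel]
  rw [← ENNReal.ofReal_mul (by positivity)]

end ZeroForcing

section ErrorDirection

variable {M : ℕ}

/-- The joint statistic of the signal and interference coefficients for the error direction `s`. -/
def errorStat (F : ℝ × ℝ × ℝ → ℝ≥0∞) (k : Fin M) (s : Fin M → ℂ) (w : Fin M → Fin M → ℂ) : ℝ≥0∞ :=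
  F (gain (w k) (zeroForcing w k), gain s (zeroForcing w k),
    ∑ i ∈ Finset.univ.erase k, gain s (zeroForcing w i))

lemma measurable_errorStat {α : Type*} [MeasurableSpace α] {F : ℝ × ℝ × ℝ → ℝ≥0∞}
    (hF : Measurable F) (k : Fin M) {s : α → Fin M → ℂ} {w : α → Fin M → Fin M → ℂ}
    (hs : Measurable s) (hw : Measurable w) : Measurable fun a => errorStat F k (s a) (w a) := by
  refine hF.comp (Measurable.prodMk ?_ (Measurable.prodMk ?_ ?_))
  · exact measurable_gain ((measurable_pi_apply k).comp hw) ((measurable_zeroForcing M k).comp hw)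
  · exact measurable_gain hs ((measurable_zeroForcing M k).comp hw)
  · exact Finset.measurable_fun_sum _ fun i _ =>
      measurable_gain hs ((measurable_zeroForcing M i).comp hw)

lemma errorStat_single (F : ℝ × ℝ × ℝ → ℝ≥0∞) (k j : Fin M) (w : Fin M → Fin M → ℂ) :
    errorStat F k (Pi.single j 1) (Function.update w k (Pi.single k 1)) =
      F (sigPar k w, sigPerp k j w, leak k j w) := by
  simp only [errorStat, Function.update_self, gain_single_left]
  rfl

/-- The error direction may be any unit vector orthogonal to the quantized channel. -/
theorem lintegral_errorStat {F : ℝ × ℝ × ℝ → ℝ≥0∞} (hF : Measurable F) {k j : Fin M}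
    (hjk : j ≠ k) (s : Fin M → ℂ) (hs : l2norm s = 1) (hsk : s k = 0) :
    ∫⁻ w, errorStat F k s (Function.update w k (Pi.single k 1)) ∂(framesLaw M) =
      ∫⁻ w, F (sigPar k w, sigPerp k j w, leak k j w) ∂(framesLaw M) := by
  -- A unitary map fixing basis vector `k` and carrying basis vector `j` to `s`; the frame law is
  -- invariant under it.
  obtain ⟨U, hUk, hUj⟩ := exists_rot_eq_pair k j hjk.symm (Pi.single k 1) s (l2norm_single k) hs
    (by rw [← Pi.single_star, star_one, single_one_dotProduct, hsk])
  have h := lintegral_update_rot U k (Pi.single k 1) (errorStat F k s)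
    (errorStat F k (Pi.single j 1)) (measurable_errorStat hF k measurable_const measurable_id)
    (fun w => by
      rw [← hUj]
      simp only [errorStat, zeroForcing_rot, gain_rot])
  rw [hUk] at h
  rw [h]
  simp_rw [errorStat_single]

end ErrorDirection

end

/-! ### A Gaussian error direction, and exact mixed moments. -/

section

open scoped ENNReal

section Subspace

variable {d : ℕ}

/-- The coordinates other than the `k`th. -/
def dropCoord (k : Fin (d + 1)) (v : Fin (d + 1) → ℂ) : Fin d → ℂ := fun m => v (k.succAbove m)

/-- The vector with `k`th coordinate zero and the prescribed other coordinates. -/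
def insertZero (k : Fin (d + 1)) (x : Fin d → ℂ) : Fin (d + 1) → ℂ := k.insertNth 0 x

lemma insertZero_apply (k : Fin (d + 1)) (x : Fin d → ℂ) : insertZero k x k = 0 := by
  simp [insertZero]

lemma l2norm_insertZero (k : Fin (d + 1)) (x : Fin d → ℂ) : l2norm (insertZero k x) = l2norm x := by
  rw [l2norm, l2norm, Fin.sum_univ_succAbove _ k]
  simp [insertZero]

lemma gain_insertZero (k : Fin (d + 1)) (x : Fin d → ℂ) (v : Fin (d + 1) → ℂ) :
    gain (insertZero k x) v = gain x (dropCoord k v) := by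
  rw [gain, gain, dotProduct, dotProduct, Fin.sum_univ_succAbove _ k]
  simp [insertZero, dropCoord]

lemma measurable_insertZero (k : Fin (d + 1)) : Measurable (insertZero k) := by
  refine measurable_pi_lambda _ fun i => ?_
  rcases Fin.eq_self_or_eq_succAbove k i with rfl | ⟨m, rfl⟩
  · simp [insertZero]
  · simpa [insertZero] using measurable_pi_apply m

lemma l2norm_dropCoord_sq (k : Fin (d + 1)) (v : Fin (d + 1) → ℂ) :
    l2norm (dropCoord k v) ^ 2 = l2norm v ^ 2 - ‖v k‖ ^ 2 := by
  rw [l2norm_sq, l2norm_sq, Fin.sum_univ_succAbove _ k]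
  simp [dropCoord]

lemma gain_dropCoord (k : Fin (d + 1)) {v : Fin (d + 1) → ℂ} (hv : v k = 0)
    (v' : Fin (d + 1) → ℂ) : gain (dropCoord k v) (dropCoord k v') = gain v v' := by
  rw [gain, gain, dotProduct, dotProduct, Fin.sum_univ_succAbove _ k]
  simp [dropCoord, hv]

lemma sum_erase_eq_sum_succAbove {A : Type*} [AddCommGroup A] (k : Fin (d + 1))
    (f : Fin (d + 1) → A) :
    ∑ i ∈ Finset.univ.erase k, f i = ∑ m : Fin d, f (k.succAbove m) := by
  have h1 := Finset.add_sum_erase Finset.univ f (Finset.mem_univ k)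
  rw [Fin.sum_univ_succAbove f k] at h1
  exact add_left_cancel h1

/-- The interfering beams, without their vanishing `k`th coordinate. -/
def subframe (k : Fin (d + 1)) (w : Fin (d + 1) → Fin (d + 1) → ℂ) (m : Fin d) : Fin d → ℂ :=
  dropCoord k (frame k w (k.succAbove m))

/-- The signal beam without its `k`th coordinate. -/
def subbeam (k : Fin (d + 1)) (w : Fin (d + 1) → Fin (d + 1) → ℂ) : Fin d → ℂ :=
  dropCoord k (frame k w k)

/-- Whether the frame is non-degenerate. -/
def IsFrame (k : Fin (d + 1)) (w : Fin (d + 1) → Fin (d + 1) → ℂ) : Prop :=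
  frameDet (Function.update w k (Pi.single k 1)) ≠ 0

lemma ae_isFrame (hd : d ≠ 0) (k : Fin (d + 1)) : ∀ᵐ w ∂(framesLaw (d + 1)), IsFrame k w :=
  ae_frameDet_update_ne_zero (by omega) k

lemma l2norm_frame {k : Fin (d + 1)} {w : Fin (d + 1) → Fin (d + 1) → ℂ} (h : IsFrame k w)
    (i : Fin (d + 1)) : l2norm (frame k w i) = 1 := l2norm_zeroForcing _ i h

lemma l2norm_subframe {k : Fin (d + 1)} {w : Fin (d + 1) → Fin (d + 1) → ℂ} (h : IsFrame k w)
    (m : Fin d) : l2norm (subframe k w m) ^ 2 = 1 := by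
  rw [subframe, l2norm_dropCoord_sq, l2norm_frame h, frame_apply_eq_zero (Fin.succAbove_ne k m)]
  simp

lemma l2norm_subbeam {k : Fin (d + 1)} {w : Fin (d + 1) → Fin (d + 1) → ℂ} (h : IsFrame k w) :
    l2norm (subbeam k w) ^ 2 = 1 - sigPar k w := by
  rw [subbeam, l2norm_dropCoord_sq, l2norm_frame h, one_pow, sigPar]

lemma sigPar_le_one {k : Fin (d + 1)} {w : Fin (d + 1) → Fin (d + 1) → ℂ} (h : IsFrame k w) :
    sigPar k w ≤ 1 := by
  have := l2norm_subbeam h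
  nlinarith [sq_nonneg (l2norm (subbeam k w))]

lemma formTrace_subframe {k : Fin (d + 1)} {w : Fin (d + 1) → Fin (d + 1) → ℂ} (h : IsFrame k w) :
    formTrace (subframe k w) = d := by
  simp [formTrace, l2norm_subframe h]

lemma formMinor_subframe {k : Fin (d + 1)} {w : Fin (d + 1) → Fin (d + 1) → ℂ} (h : IsFrame k w) :
    formMinor (subframe k w) = (∑ m : Fin d, ∑ m' : Fin d,
      (1 - gain (frame k w (k.succAbove m)) (frame k w (k.succAbove m')))) / 2 := by
  have e : ∀ m m' : Fin d, gain (subframe k w m) (subframe k w m') =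
      gain (frame k w (k.succAbove m)) (frame k w (k.succAbove m')) := fun m m' =>
    gain_dropCoord k (frame_apply_eq_zero (Fin.succAbove_ne k m) w) _
  simp only [formMinor, l2norm_subframe h, e, Finset.sum_sub_distrib, Finset.sum_const,
    Finset.card_univ, Fintype.card_fin, nsmul_eq_mul, mul_one]
  ring

/-- Averaging over a Gaussian error direction. -/
theorem lintegral_stat_eq_gaussian (hd : d ≠ 0) {F : ℝ × ℝ × ℝ → ℝ≥0∞} (hF : Measurable F)
    {k j : Fin (d + 1)} (hjk : j ≠ k) :
    ∫⁻ w, F (sigPar k w, sigPerp k j w, leak k j w) ∂(framesLaw (d + 1)) =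
      ∫⁻ w, ∫⁻ x, F (sigPar k w, gain x (subbeam k w) / l2norm x ^ 2,
        ratioForm (subframe k w) x) ∂(channelLaw d) ∂(framesLaw (d + 1)) := by
  have hdir : Measurable fun x : Fin d → ℂ => direction (insertZero k x) :=
    (measurable_direction _).comp (measurable_insertZero k)
  have e1 : ∀ w, ∫⁻ x, F (sigPar k w, gain x (subbeam k w) / l2norm x ^ 2,
      ratioForm (subframe k w) x) ∂(channelLaw d) = ∫⁻ x, errorStat F k (direction (insertZero k x))
        (Function.update w k (Pi.single k 1)) ∂(channelLaw d) := fun w => by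
    refine lintegral_congr_ae ?_
    filter_upwards [channelLaw_ae_ne_zero ⟨0, Nat.pos_of_ne_zero hd⟩] with x hx
    have hx' : insertZero k x ≠ 0 := by
      rw [← l2norm_pos_iff, l2norm_insertZero, l2norm_pos_iff]; exact hx
    have e2 : ∀ v, gain (direction (insertZero k x)) v = gain x (dropCoord k v) / l2norm x ^ 2 :=
      fun v => by rw [gain_direction _ _ hx', gain_insertZero, l2norm_insertZero]
    simp only [errorStat, e2, Function.update_self, gain_single_left]
    rw [← Finset.sum_div, sum_erase_eq_sum_succAbove]
    rfl
  simp_rw [e1]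
  have hm : Measurable (Function.uncurry fun (w : Fin (d + 1) → Fin (d + 1) → ℂ)
      (x : Fin d → ℂ) => errorStat F k (direction (insertZero k x))
        (Function.update w k (Pi.single k 1))) :=
    measurable_errorStat hF k (hdir.comp measurable_snd)
      ((measurable_update_const k _).comp measurable_fst)
  rw [lintegral_lintegral_swap hm.aemeasurable]
  have e3 : ∀ᵐ x ∂(channelLaw d), ∫⁻ w, errorStat F k (direction (insertZero k x))
      (Function.update w k (Pi.single k 1)) ∂(framesLaw (d + 1)) =
      ∫⁻ w, F (sigPar k w, sigPerp k j w, leak k j w) ∂(framesLaw (d + 1)) := by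
    filter_upwards [channelLaw_ae_ne_zero ⟨0, Nat.pos_of_ne_zero hd⟩] with x hx
    have hx' : insertZero k x ≠ 0 := by
      rw [← l2norm_pos_iff, l2norm_insertZero, l2norm_pos_iff]; exact hx
    refine lintegral_errorStat hF hjk _ (l2norm_direction _ hx') ?_
    rw [direction, insertZero_apply, zero_div]
  rw [lintegral_congr_ae e3, lintegral_const, measure_univ, mul_one]

lemma lintegral_stat_eq_of_ne {F : ℝ × ℝ × ℝ → ℝ≥0∞} (hF : Measurable F) {k j j' : Fin (d + 1)}
    (hjk : j ≠ k) (hjk' : j' ≠ k) :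
    ∫⁻ w, F (sigPar k w, sigPerp k j' w, leak k j' w) ∂(framesLaw (d + 1)) =
      ∫⁻ w, F (sigPar k w, sigPerp k j w, leak k j w) ∂(framesLaw (d + 1)) := by
  rw [← lintegral_errorStat hF hjk (Pi.single j' 1) (l2norm_single j')
    (by simp [hjk'.symm]), ← lintegral_errorStat hF hjk' (Pi.single j' 1) (l2norm_single j')
    (by simp [hjk'.symm])]

lemma eq_ofReal_of_nat_mul {d : ℕ} (hd : d ≠ 0) {x : ℝ≥0∞} {r : ℝ} (hr : d * x = ENNReal.ofReal r) :
    x = ENNReal.ofReal (r / d) := by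
  have hd' : (0 : ℝ) < d := by positivity
  rw [ENNReal.ofReal_div_of_pos hd', ENNReal.ofReal_natCast, ENNReal.eq_div_iff
    (by exact_mod_cast hd) (ENNReal.natCast_ne_top d), hr]

/-- All `d` error directions give the same mean, and their coefficients add up to `1 - sigPar`; only
a beta moment is needed. -/
lemma lintegral_sigPar_mul_sigPerp (hd : d ≠ 0) {k j : Fin (d + 1)} (hjk : j ≠ k) :
    ∫⁻ w, ENNReal.ofReal (sigPar k w * sigPerp k j w) ∂(framesLaw (d + 1)) =
      ENNReal.ofReal (1 / ((d + 1) * (d + 2))) := by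
  have hsum : ∑ m : Fin d, ∫⁻ w, ENNReal.ofReal (sigPar k w * sigPerp k (k.succAbove m) w)
      ∂(framesLaw (d + 1)) = ENNReal.ofReal (d / ((d + (1 : ℕ)) * (d + (1 : ℕ) + 1))) := by
    rw [← lintegral_finsetSum _ fun m _ => by fun_prop, ← lintegral_sigPar_beta hd k 1]
    refine lintegral_congr_ae ?_
    filter_upwards [ae_isFrame hd k] with w hw
    rw [← ENNReal.ofReal_sum_of_nonneg fun m _ =>
      mul_nonneg (sigPar_nonneg k w) (sigPerp_nonneg _ _ w), ← Finset.mul_sum, pow_one,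
      ← l2norm_subbeam hw, l2norm_sq]
    rfl
  have heq : ∀ m : Fin d, ∫⁻ w, ENNReal.ofReal (sigPar k w * sigPerp k (k.succAbove m) w)
      ∂(framesLaw (d + 1)) = ∫⁻ w, ENNReal.ofReal (sigPar k w * sigPerp k j w)
      ∂(framesLaw (d + 1)) := fun m =>
    lintegral_stat_eq_of_ne (F := fun p => ENNReal.ofReal (p.1 * p.2.1)) (by fun_prop) hjk
      (Fin.succAbove_ne k m)
  simp_rw [heq] at hsum
  rw [Finset.sum_const, Finset.card_univ, Fintype.card_fin, nsmul_eq_mul] at hsum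
  rw [eq_ofReal_of_nat_mul hd hsum]
  congr 1
  have hd' : (0 : ℝ) < d := by positivity
  push_cast
  field_simp
  ring

/-- The same symmetrization: summed over the error directions the leak is the total energy `d` of
the interfering unit beams. -/
lemma lintegral_sigPar_mul_leak (hd : d ≠ 0) {k j : Fin (d + 1)} (hjk : j ≠ k) :
    ∫⁻ w, ENNReal.ofReal (sigPar k w * leak k j w) ∂(framesLaw (d + 1)) =
      ENNReal.ofReal (1 / (d + 1)) := by
  have hd' : (0 : ℝ) < d := by positivity
  have hsum : ∑ m : Fin d, ∫⁻ w, ENNReal.ofReal (sigPar k w * leak k (k.succAbove m) w)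
      ∂(framesLaw (d + 1)) = ENNReal.ofReal (d * (1 / (d + 1))) := by
    rw [← lintegral_finsetSum _ fun m _ => by fun_prop, ENNReal.ofReal_mul hd'.le]
    have h0 := lintegral_sigPar_beta hd k 0
    simp only [pow_zero, mul_one] at h0
    have e : (d : ℝ) / ((d + (0 : ℕ)) * (d + (0 : ℕ) + 1)) = 1 / (d + 1) := by
      push_cast; field_simp; ring
    rw [e] at h0
    rw [← h0, ← lintegral_const_mul _ (by fun_prop)]
    refine lintegral_congr_ae ?_
    filter_upwards [ae_isFrame hd k] with w hw
    rw [← ENNReal.ofReal_sum_of_nonneg fun m _ =>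
      mul_nonneg (sigPar_nonneg k w) (leak_nonneg _ _ w), ← Finset.mul_sum,
      ← ENNReal.ofReal_mul hd'.le, mul_comm (d : ℝ)]
    congr 2
    simp_rw [leak]
    rw [Finset.sum_comm, sum_erase_eq_sum_succAbove, ← formTrace_subframe hw, formTrace]
    refine Finset.sum_congr rfl fun m _ => ?_
    rw [l2norm_sq]
    rfl
  have heq : ∀ m : Fin d, ∫⁻ w, ENNReal.ofReal (sigPar k w * leak k (k.succAbove m) w)
      ∂(framesLaw (d + 1)) = ∫⁻ w, ENNReal.ofReal (sigPar k w * leak k j w)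
      ∂(framesLaw (d + 1)) := fun m =>
    lintegral_stat_eq_of_ne (F := fun p => ENNReal.ofReal (p.1 * p.2.2)) (by fun_prop) hjk
      (Fin.succAbove_ne k m)
  simp_rw [heq] at hsum
  rw [Finset.sum_const, Finset.card_univ, Fintype.card_fin, nsmul_eq_mul] at hsum
  rw [eq_ofReal_of_nat_mul hd hsum]
  congr 1
  field_simp

end Subspace

end

/-! ### The signal gain against the angle between two interfering beams. -/

section

open scoped ENNReal

section PairBound

variable {M : ℕ}

/-- In a plane, the component of `Y` along the unit vector annihilated by `X` is `det (X, Y) / ‖X‖`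
in modulus. -/
lemma norm_sq_mul_eq_of_orthogonal {X₀ X₁ a b : ℂ} (h : X₀ * a + X₁ * b = 0)
    (hab : ‖a‖ ^ 2 + ‖b‖ ^ 2 = 1) (Y₀ Y₁ : ℂ) :
    ‖Y₀ * a + Y₁ * b‖ ^ 2 * (‖X₀‖ ^ 2 + ‖X₁‖ ^ 2) = ‖X₀ * Y₁ - X₁ * Y₀‖ ^ 2 := by
  have h1 : (Y₀ * a + Y₁ * b) * X₀ = b * (X₀ * Y₁ - X₁ * Y₀) := by linear_combination Y₀ * h
  have h2 : (Y₀ * a + Y₁ * b) * X₁ = -(a * (X₀ * Y₁ - X₁ * Y₀)) := by linear_combination Y₁ * h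
  have n1 := congrArg (‖·‖ ^ 2) h1
  have n2 := congrArg (‖·‖ ^ 2) h2
  simp only [norm_mul, norm_neg, mul_pow] at n1 n2
  linear_combination n1 + n2 + ‖X₀ * Y₁ - X₁ * Y₀‖ ^ 2 * hab

/-- Since `n` is orthogonal to `g`, it sees only the part of `f` orthogonal to `g`, whose squared
norm is the squared sine. -/
lemma gain_le_of_orthogonal (n f g : Fin M → ℂ) (hf : l2norm f = 1) (hg : l2norm g = 1)
    (h : star n ⬝ᵥ g = 0) : gain n f ≤ l2norm n ^ 2 * (1 - gain f g) := by
  set e := f - (star g ⬝ᵥ f) • g with he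
  have h1 : gain n f = gain n e := by
    rw [gain, gain, he, dotProduct_sub, dotProduct_smul, h, smul_zero, sub_zero]
  have h2 : l2norm e ^ 2 = 1 - gain f g := by
    refine Complex.ofReal_injective ?_
    have hfg : star f ⬝ᵥ g = star (star g ⬝ᵥ f) := by rw [Matrix.star_dotProduct]
    have c1 := star_dotProduct_self f
    have c2 := star_dotProduct_self g
    rw [hf] at c1; rw [hg] at c2
    rw [← star_dotProduct_self, he, star_sub, star_smul, sub_dotProduct, dotProduct_sub,
      dotProduct_sub, smul_dotProduct, smul_dotProduct, dotProduct_smul, dotProduct_smul, c1, c2,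
      Complex.ofReal_sub, gain_eq_re, hfg]
    simp only [smul_eq_mul, one_pow, Complex.ofReal_one]
    ring
  rw [h1, ← h2]
  exact gain_le_mul n e

lemma star_dotProduct_of_supp_pair {i k : Fin M} (hik : i ≠ k) {v : Fin M → ℂ}
    (hv : ∀ m, m ≠ i → m ≠ k → v m = 0) (x : Fin M → ℂ) :
    star x ⬝ᵥ v = star (x i) * v i + star (x k) * v k := by
  rw [dotProduct, Finset.sum_eq_add i k hik (fun m _ hm => by rw [hv m hm.1 hm.2, mul_zero])
    (by simp) (by simp)]
  rfl

/-- The vectors other than the `i`th and the `k`th force orthogonal vectors to be supported on the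
coordinates `i, k`, and on `i, j, k` if the `j`th is also excluded. -/
structure Adapted (i j k : Fin M) (w : Fin M → Fin M → ℂ) : Prop where
  pair : ∀ v : Fin M → ℂ, (∀ l, l ≠ i → l ≠ k → star (w l) ⬝ᵥ v = 0) →
    ∀ m, m ≠ i → m ≠ k → v m = 0
  triple : ∀ v : Fin M → ℂ, (∀ l, l ≠ i → l ≠ j → l ≠ k → star (w l) ⬝ᵥ v = 0) →
    ∀ m, m ≠ i → m ≠ j → m ≠ k → v m = 0

/-- The vector orthogonal to `x` in the coordinate plane `i, k`. -/
def planeDual (i k : Fin M) (x : Fin M → ℂ) : Fin M → ℂ :=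
  star (x k) • Pi.single i 1 - star (x i) • Pi.single k 1

/-- Beams `i` and `k` live in the coordinate plane `i, k`, so the two gains of users `i` and `k`
share one planar determinant. Beam `j` adds one coordinate, and its orthogonality to `w i` bounds
the gain of user `i` by the squared sine between beams `i` and `j`. -/
theorem Adapted.gain_le {i j k : Fin M} {w : Fin M → Fin M → ℂ} (hw : Adapted i j k w)
    (hij : i ≠ j) (hik : i ≠ k) (hjk : j ≠ k) (hd : frameDet w ≠ 0) :
    0 < ‖w i i‖ ^ 2 + ‖w i k‖ ^ 2 ∧
    gain (w k) (zeroForcing w k) * (‖w i i‖ ^ 2 + ‖w i k‖ ^ 2) = gain (w k) (planeDual i k (w i)) ∧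
    gain (w k) (planeDual i k (w i)) ≤ (‖w k i‖ ^ 2 + ‖w k k‖ ^ 2) *
      ((‖w i i‖ ^ 2 + ‖w i k‖ ^ 2 + ‖w i j‖ ^ 2) *
        (1 - gain (zeroForcing w i) (zeroForcing w j))) := by
  have hk := hw.pair (zeroForcing w k) fun l _ hlk => star_dotProduct_zeroForcing w hlk
  have hi := hw.pair (zeroForcing w i) fun l hli _ => star_dotProduct_zeroForcing w hli
  have hj := hw.triple (zeroForcing w j) fun l _ hlj _ => star_dotProduct_zeroForcing w hlj
  have norm_pair : ∀ v : Fin M → ℂ, (∀ m, m ≠ i → m ≠ k → v m = 0) → l2norm v = 1 →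
      ‖v i‖ ^ 2 + ‖v k‖ ^ 2 = 1 := fun v hv h1 => by
    have h2 := l2norm_sq v
    rw [h1, Finset.sum_eq_add i k hik (fun m _ hm => by rw [hv m hm.1 hm.2]; simp) (by simp)
      (by simp)] at h2
    linarith
  have nk := norm_pair _ hk (l2norm_zeroForcing w k hd)
  have ni := norm_pair _ hi (l2norm_zeroForcing w i hd)
  have ok := star_dotProduct_zeroForcing w hik
  have oi := star_dotProduct_zeroForcing w hik.symm
  rw [star_dotProduct_of_supp_pair hik hk] at ok
  rw [star_dotProduct_of_supp_pair hik hi] at oi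
  have ek := norm_sq_mul_eq_of_orthogonal ok nk (star (w k i)) (star (w k k))
  have ei := norm_sq_mul_eq_of_orthogonal oi ni (star (w i i)) (star (w i k))
  rw [← star_dotProduct_of_supp_pair hik hk] at ek
  rw [← star_dotProduct_of_supp_pair hik hi] at ei
  simp only [norm_star] at ek ei
  have hz : gain (w k) (planeDual i k (w i)) =
      ‖star (w i i) * star (w k k) - star (w i k) * star (w k i)‖ ^ 2 := by
    rw [gain, ← norm_neg, planeDual, dotProduct_sub, dotProduct_smul, dotProduct_smul,
      dotProduct_single, dotProduct_single]
    congr 2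
    simp only [Pi.star_apply, smul_eq_mul]
    ring
  have hz' : ‖star (w k i) * star (w i k) - star (w k k) * star (w i i)‖ ^ 2 =
      gain (w k) (planeDual i k (w i)) := by
    rw [hz, ← norm_neg]; congr 2; ring
  refine ⟨?_, by rw [hz]; exact ek, ?_⟩
  · by_contra hcon
    have h0 : ‖w i i‖ ^ 2 = 0 := le_antisymm (by nlinarith [sq_nonneg ‖w i k‖]) (sq_nonneg _)
    have h1 : ‖w i k‖ ^ 2 = 0 := le_antisymm (by nlinarith [sq_nonneg ‖w i i‖]) (sq_nonneg _)
    have h0' : w i i = 0 := by simpa using h0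
    have h1' : w i k = 0 := by simpa using h1
    have h2 : star (w i) ⬝ᵥ zeroForcing w i = 0 := by
      rw [star_dotProduct_of_supp_pair hik hi, h0', h1']; simp
    obtain ⟨c, hc, hx⟩ := exists_eq_sum_smul_zeroForcing w hd (zeroForcing w i)
    have h3 : zeroForcing w i = 0 := by
      rw [hx]
      refine Finset.sum_eq_zero fun m _ => ?_
      rw [hc m, zero_smul]
      by_cases hm : m = i
      · rw [hm]; exact h2
      · exact star_dotProduct_zeroForcing w hm
    have h4 := l2norm_zeroForcing w i hd
    rw [h3] at h4
    simp [l2norm] at h4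
  -- Truncating `w i` to the three relevant coordinates changes none of its products with beams `i`
  -- and `j`, but sharpens its norm in the Cauchy–Schwarz bound.
  · set n : Fin M → ℂ := fun m => if m = i ∨ m = j ∨ m = k then w i m else 0 with hn
    have hnv : ∀ v : Fin M → ℂ, (∀ m, m ≠ i → m ≠ j → m ≠ k → v m = 0) →
        star n ⬝ᵥ v = star (w i) ⬝ᵥ v := fun v hv => by
      refine Finset.sum_congr rfl fun m _ => ?_
      by_cases hm : m = i ∨ m = j ∨ m = k
      · simp [hn, hm]
      · push Not at hm
        rw [hv m hm.1 hm.2.1 hm.2.2, mul_zero, mul_zero]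
    have hn2 : l2norm n ^ 2 = ‖w i i‖ ^ 2 + ‖w i k‖ ^ 2 + ‖w i j‖ ^ 2 := by
      rw [l2norm_sq, ← Finset.add_sum_erase _ _ (Finset.mem_univ i),
        ← Finset.add_sum_erase _ _ (Finset.mem_erase.2 ⟨hik.symm, Finset.mem_univ k⟩),
        ← Finset.add_sum_erase _ _ (Finset.mem_erase.2 ⟨hjk, Finset.mem_erase.2
          ⟨hij.symm, Finset.mem_univ j⟩⟩), Finset.sum_eq_zero fun m hm => ?_]
      · simp [hn]; ring
      · simp only [Finset.mem_erase, Finset.mem_univ, and_true] at hm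
        simp [hn, hm]
    have h5 := gain_le_of_orthogonal n (zeroForcing w i) (zeroForcing w j)
      (l2norm_zeroForcing w i hd) (l2norm_zeroForcing w j hd)
      (by rw [hnv _ hj, star_dotProduct_zeroForcing w hij])
    rw [hn2, gain, hnv _ fun m h1 _ h3 => hi m h1 h3] at h5
    rw [← hz', ← ei, mul_comm]
    exact mul_le_mul_of_nonneg_left h5 (by positivity)

lemma rot_inv_rot (U : Matrix.unitaryGroup (Fin M) ℂ) (x : Fin M → ℂ) :
    rot U (rot U⁻¹ x) = x := by
  simp only [rot, Matrix.mulVec_mulVec]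
  have : (U : Matrix (Fin M) (Fin M) ℂ) * (U⁻¹ : Matrix.unitaryGroup (Fin M) ℂ) = 1 :=
    congrArg Subtype.val (mul_inv_cancel U)
  rw [this, Matrix.one_mulVec]

lemma rot_rot_inv (U : Matrix.unitaryGroup (Fin M) ℂ) (x : Fin M → ℂ) :
    rot U⁻¹ (rot U x) = x := by
  have := rot_inv_rot U⁻¹ x
  rwa [inv_inv] at this

/-- One step of orthonormalization. -/
lemma exists_orthonormal_step (e : Fin M → ℂ) (he : e ≠ 0) :
    ∃ u : Fin M → ℂ, ∃ r : ℂ, r ≠ 0 ∧ l2norm u = 1 ∧ e = r • u ∧ u = r⁻¹ • e := by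
  have h1 : ((l2norm e : ℝ) : ℂ) ≠ 0 := by exact_mod_cast ((l2norm_pos_iff e).2 he).ne'
  exact ⟨direction e, l2norm e, h1, l2norm_direction e he, (smul_direction e he).symm,
    direction_eq_smul e⟩

/-- Orthonormalize beams `i`, `k`, `j` in this order and carry the result to the basis vectors `i`,
`k`, `j`. A vector orthogonal to the remaining `w l` is a combination of these beams alone, by the
dual basis expansion. -/
theorem exists_rot_adapted {i j k : Fin M} (hij : i ≠ j) (hik : i ≠ k) (hjk : j ≠ k)
    (w : Fin M → Fin M → ℂ) (hd : frameDet w ≠ 0) :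
    ∃ U : Matrix.unitaryGroup (Fin M) ℂ, Adapted i j k fun l => rot U (w l) := by
  set v := zeroForcing w with hv
  have hvn : ∀ m, l2norm (v m) = 1 := fun m => l2norm_zeroForcing w m hd
  have hvo : ∀ {l m}, l ≠ m → star (w l) ⬝ᵥ v m = 0 := fun h => star_dotProduct_zeroForcing w h
  have hvd : ∀ m, star (w m) ⬝ᵥ v m ≠ 0 := fun m h0 => by
    obtain ⟨c, hc, hx⟩ := exists_eq_sum_smul_zeroForcing w hd (v m)
    have h3 : v m = 0 := by
      rw [hx]
      refine Finset.sum_eq_zero fun l _ => ?_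
      rw [hc l, zero_smul]
      by_cases hl : l = m
      · rw [hl]; exact h0
      · exact hvo hl
    have h4 := hvn m
    rw [h3] at h4
    simp [l2norm] at h4
  have self1 : ∀ u : Fin M → ℂ, l2norm u = 1 → star u ⬝ᵥ u = 1 := fun u hu => by
    rw [star_dotProduct_self, hu]; simp
  have symm0 : ∀ u u' : Fin M → ℂ, star u ⬝ᵥ u' = 0 → star u' ⬝ᵥ u = 0 := fun u u' h => by
    have : star u' ⬝ᵥ u = star (star u ⬝ᵥ u') := by rw [Matrix.star_dotProduct]
    rw [this, h, star_zero]
  set u₀ := v i with hu₀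
  have n0 := self1 u₀ (hvn i)
  obtain ⟨u₁, r₁, hr₁, hn₁, hE₁, hu₁⟩ := exists_orthonormal_step
    (v k - (star u₀ ⬝ᵥ v k) • u₀) (fun h => by
      have h1 := congrArg (star (w k) ⬝ᵥ ·) h
      simp only [dotProduct_sub, dotProduct_smul, dotProduct_zero, hu₀, hvo hik.symm, smul_zero,
        sub_zero] at h1
      exact hvd k h1)
  have o01 : star u₀ ⬝ᵥ u₁ = 0 := by
    rw [hu₁, dotProduct_smul, dotProduct_sub, dotProduct_smul, n0]; simp
  have n1 := self1 u₁ hn₁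
  have hw1 : ∀ l, l ≠ i → l ≠ k → star (w l) ⬝ᵥ u₁ = 0 := fun l h1 h2 => by
    rw [hu₁, dotProduct_smul, dotProduct_sub, dotProduct_smul, hu₀, hvo h1, hvo h2]; simp
  obtain ⟨u₂, r₂, hr₂, hn₂, hE₂, hu₂⟩ := exists_orthonormal_step
    (v j - (star u₀ ⬝ᵥ v j) • u₀ - (star u₁ ⬝ᵥ v j) • u₁) (fun h => by
      have h1 := congrArg (star (w j) ⬝ᵥ ·) h
      simp only [dotProduct_sub, dotProduct_smul, dotProduct_zero, hu₀, hvo hij.symm,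
        hw1 j hij.symm hjk, smul_zero, sub_zero] at h1
      exact hvd j h1)
  have o02 : star u₀ ⬝ᵥ u₂ = 0 := by
    rw [hu₂, dotProduct_smul, dotProduct_sub, dotProduct_sub, dotProduct_smul, dotProduct_smul, n0,
      o01]; simp
  have o12 : star u₁ ⬝ᵥ u₂ = 0 := by
    rw [hu₂, dotProduct_smul, dotProduct_sub, dotProduct_sub, dotProduct_smul, dotProduct_smul, n1,
      symm0 _ _ o01]; simp
  have n2 := self1 u₂ hn₂
  set x : Fin M → Fin M → ℂ := fun m => if m = i then u₀ else if m = k then u₁ else u₂ with hx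
  have xi : x i = u₀ := by simp [hx]
  have xk : x k = u₁ := by simp [hx, hik.symm]
  have xj : x j = u₂ := by simp [hx, hij.symm, hjk]
  obtain ⟨U, hU⟩ := exists_rot_eq_of_orthonormal {i, k, j} x (by
    intro a ha b hb
    rcases ha with rfl | rfl | rfl <;> rcases hb with rfl | rfl | rfl <;>
      simp only [xi, xk, xj, n0, n1, n2, o01, o02, o12, symm0 _ _ o01, symm0 _ _ o02,
        symm0 _ _ o12, hij, hik, hjk, hij.symm, hik.symm, hjk.symm, if_true, if_false])
  have Ui : rot U (Pi.single i 1) = u₀ := (hU i (by simp)).trans xi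
  have Uk : rot U (Pi.single k 1) = u₁ := (hU k (by simp)).trans xk
  have Uj : rot U (Pi.single j 1) = u₂ := (hU j (by simp)).trans xj
  have hvk : v k = (star u₀ ⬝ᵥ v k) • u₀ + r₁ • u₁ := by rw [← hE₁]; abel
  have hvj : v j = (star u₀ ⬝ᵥ v j) • u₀ + (star u₁ ⬝ᵥ v j) • u₁ + r₂ • u₂ := by
    rw [← hE₂]; abel
  have htr : ∀ (l : Fin M) (y : Fin M → ℂ), star (rot U⁻¹ (w l)) ⬝ᵥ y = star (w l) ⬝ᵥ rot U y :=
    fun l y => by rw [← star_rot_dotProduct_rot U, rot_inv_rot]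
  refine ⟨U⁻¹, fun y hy m hmi hmk => ?_, fun y hy m hmi hmj hmk => ?_⟩
  · obtain ⟨c, hc, hsum⟩ := exists_eq_sum_smul_zeroForcing w hd (rot U y)
    have h1 : rot U y = c i • v i + c k • v k := by
      rw [hsum, Finset.sum_eq_add i k hik (fun l _ hl => by
        rw [hc l (by rw [← htr]; exact hy l hl.1 hl.2), zero_smul]) (by simp) (by simp)]
    rw [hvk, ← hu₀, ← Ui, ← Uk, smul_add, smul_smul, smul_smul, ← rot_smul, ← rot_smul, ← rot_smul,
      ← rot_add, ← rot_add] at h1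
    have h2 := congrArg (rot U⁻¹) h1
    rw [rot_rot_inv, rot_rot_inv] at h2
    rw [h2]
    simp [hmi, hmk]
  · obtain ⟨c, hc, hsum⟩ := exists_eq_sum_smul_zeroForcing w hd (rot U y)
    have h1 : rot U y = c i • v i + (c k • v k + c j • v j) := by
      rw [hsum, ← Finset.add_sum_erase _ _ (Finset.mem_univ i),
        Finset.sum_eq_add k j hjk.symm (fun l hl hl' => by
          rw [hc l (by rw [← htr]; exact hy l (Finset.ne_of_mem_erase hl) hl'.2 hl'.1), zero_smul])
          (fun h => absurd (Finset.mem_erase.2 ⟨hik.symm, Finset.mem_univ k⟩) h)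
          (fun h => absurd (Finset.mem_erase.2 ⟨hij.symm, Finset.mem_univ j⟩) h)]
    rw [hvk, hvj, ← hu₀, ← Ui, ← Uk, ← Uj] at h1
    simp only [smul_add, smul_smul, ← rot_smul, ← rot_add] at h1
    have h2 := congrArg (rot U⁻¹) h1
    rw [rot_rot_inv, rot_rot_inv] at h2
    rw [h2]
    simp [hmi, hmk, hmj]

end PairBound

end

/-! ### Isotropic moments and resampling of two users. -/

section

open scoped ENNReal

/-- Only an inequality, because at `q = 0` the quotient is `0` by convention while the integral may
be infinite. -/
lemma ofReal_div_le_lintegral {g q : ℝ} (hg : 0 ≤ g) (hq : 0 ≤ q) :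
    ENNReal.ofReal (g / q) ≤ ∫⁻ t in Set.Ioi (0 : ℝ), ENNReal.ofReal (g * Real.exp (-(t * q))) := by
  rcases hq.eq_or_lt with rfl | hq
  · simp
  simp_rw [ENNReal.ofReal_mul hg, mul_comm _ q]
  rw [lintegral_const_mul _ (by fun_prop), lintegral_exp_neg_Ioi hq, ← ENNReal.ofReal_mul hg,
    mul_one_div]

section IsotropicMoments

variable {d : ℕ}

lemma lintegral_isotropicLaw_gain_pow_one (hd : d ≠ 0) (u : Fin (d + 1) → ℂ) (hu : l2norm u = 1) :
    ∫⁻ y, ENNReal.ofReal (gain u y) ∂(isotropicLaw (d + 1)) = ENNReal.ofReal (1 / (d + 1)) := by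
  rw [lintegral_isotropicLaw_gain (by omega) u hu (fun t => ENNReal.ofReal t) (by fun_prop)]
  have h := lintegral_beta d 0 hd
  have e : (d : ℝ) / ((d + (0 : ℕ)) * (d + (0 : ℕ) + 1)) = 1 / (d + 1) := by
    have hd' : (0 : ℝ) < d := by positivity
    push_cast; field_simp; ring
  rw [← e, ← h]
  refine setLIntegral_congr_fun measurableSet_Ioc fun t ht => ?_
  have h3 : 0 ≤ 1 - t := by linarith [ht.2]
  simp only [Nat.add_sub_cancel, pow_zero, mul_one]
  rw [← ENNReal.ofReal_mul (by positivity)]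

lemma lintegral_isotropicLaw_gain_sq (hd : d ≠ 0) (u : Fin (d + 1) → ℂ) (hu : l2norm u = 1) :
    ∫⁻ y, ENNReal.ofReal (gain u y ^ 2) ∂(isotropicLaw (d + 1)) =
      ENNReal.ofReal (2 / ((d + 1) * (d + 2))) := by
  rw [lintegral_isotropicLaw_gain (by omega) u hu (fun t => ENNReal.ofReal (t ^ 2)) (by fun_prop),
    ← lintegral_beta_sq d hd]
  refine setLIntegral_congr_fun measurableSet_Ioc fun t ht => ?_
  simp only [Nat.add_sub_cancel]
  rw [← ENNReal.ofReal_mul (by positivity)]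

lemma lintegral_isotropicLaw_gain_mul_gain (hd : d ≠ 0) (u u' : Fin (d + 1) → ℂ)
    (hu : l2norm u = 1) (hu' : l2norm u' = 1) (huu : star u ⬝ᵥ u' = 0) :
    ∫⁻ y, ENNReal.ofReal (gain u y * gain u' y) ∂(isotropicLaw (d + 1)) =
      ENNReal.ofReal (1 / ((d + 1) * (d + 2))) := by
  have hd' : (0 : ℝ) < d := by positivity
  set c := ∫⁻ y, ENNReal.ofReal (gain u y * gain u' y) ∂(isotropicLaw (d + 1)) with hc
  have heq : ∀ m : Fin d, ∫⁻ y : Fin (d + 1) → ℂ, ENNReal.ofReal (‖y 0‖ ^ 2 * ‖y m.succ‖ ^ 2)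
      ∂(isotropicLaw (d + 1)) = c := fun m => by
    obtain ⟨U, h0, h1⟩ := exists_rot_eq_pair 0 m.succ (Fin.succ_ne_zero m).symm u u' hu hu' huu
    rw [hc, ← lintegral_isotropicLaw_rot U (fun y => ENNReal.ofReal (gain u y * gain u' y))
      (by fun_prop), ← h0, ← h1]
    simp only [gain_rot, gain_single_left]
  have hsum : ∑ m : Fin d, ∫⁻ y : Fin (d + 1) → ℂ, ENNReal.ofReal (‖y 0‖ ^ 2 * ‖y m.succ‖ ^ 2)
      ∂(isotropicLaw (d + 1)) = ENNReal.ofReal (d / ((d + (1 : ℕ)) * (d + (1 : ℕ) + 1))) := by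
    rw [← lintegral_finsetSum _ fun m _ => by fun_prop]
    have h1 := lintegral_isotropicLaw_gain (M := d + 1) (by omega) (Pi.single 0 1) (l2norm_single 0)
      (fun t => ENNReal.ofReal (t * (1 - t))) (by fun_prop)
    have h2 : ∫⁻ t in Set.Ioc (0 : ℝ) 1, ENNReal.ofReal ((1 - t) * (1 - (1 - t))) *
        ENNReal.ofReal ((d + 1 - 1 : ℕ) * t ^ (d + 1 - 1 - 1)) =
        ENNReal.ofReal (d / ((d + (1 : ℕ)) * (d + (1 : ℕ) + 1))) := by
      rw [← lintegral_beta d 1 hd]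
      refine setLIntegral_congr_fun measurableSet_Ioc fun t ht => ?_
      have := ht.1.le
      have h3 : 0 ≤ 1 - t := by linarith [ht.2]
      simp only [Nat.add_sub_cancel, sub_sub_cancel, pow_one]
      rw [← ENNReal.ofReal_mul (by positivity)]
    rw [← h2, ← h1]
    refine lintegral_congr_ae ?_
    filter_upwards [isotropicLaw_ae_l2norm (0 : Fin (d + 1))] with y hy
    rw [← ENNReal.ofReal_sum_of_nonneg fun m _ => by positivity, ← Finset.mul_sum,
      gain_single_left]
    have h3 := l2norm_sq y
    rw [hy, Fin.sum_univ_succ] at h3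
    congr 2
    linarith
  simp_rw [heq] at hsum
  rw [Finset.sum_const, Finset.card_univ, Fintype.card_fin, nsmul_eq_mul] at hsum
  rw [eq_ofReal_of_nat_mul hd hsum]
  congr 1
  push_cast
  field_simp
  ring

/-- The moment of the plane share weighted by a gain in the same plane. -/
lemma lintegral_gain_planeDual (hd : d ≠ 0) {i k : Fin (d + 1)} (hik : i ≠ k)
    (x : Fin (d + 1) → ℂ) (hx : 0 < ‖x i‖ ^ 2 + ‖x k‖ ^ 2) :
    ∫⁻ y, ENNReal.ofReal (gain y (planeDual i k x) * (‖y i‖ ^ 2 + ‖y k‖ ^ 2))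
      ∂(isotropicLaw (d + 1)) =
      ENNReal.ofReal ((‖x i‖ ^ 2 + ‖x k‖ ^ 2) * (3 / ((d + 1) * (d + 2)))) := by
  set X := ‖x i‖ ^ 2 + ‖x k‖ ^ 2 with hX
  set r : ℝ := √X with hr
  have hr0 : 0 < r := Real.sqrt_pos.2 hx
  have hr2 : r ^ 2 = X := Real.sq_sqrt hx.le
  have hrc : (r : ℂ) ≠ 0 := by exact_mod_cast hr0.ne'
  set z := planeDual i k x with hz
  set z' : Fin (d + 1) → ℂ := x i • Pi.single i 1 + x k • Pi.single k 1 with hz'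
  have zi : z i = star (x k) := by simp [hz, planeDual, hik]
  have zk : z k = -star (x i) := by simp [hz, planeDual, hik.symm]
  have zo : ∀ m, m ≠ i → m ≠ k → z m = 0 := fun m h1 h2 => by simp [hz, planeDual, h1, h2]
  have zi' : z' i = x i := by simp [hz', hik]
  have zk' : z' k = x k := by simp [hz', hik.symm]
  have zo' : ∀ m, m ≠ i → m ≠ k → z' m = 0 := fun m h1 h2 => by simp [hz', h1, h2]
  have nz : l2norm z = r := by
    rw [l2norm, hr, Finset.sum_eq_add i k hik (fun m _ hm => by rw [zo m hm.1 hm.2]; simp)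
      (by simp) (by simp), zi, zk, norm_neg, norm_star, norm_star, add_comm]
  have nz' : l2norm z' = r := by
    rw [l2norm, hr, Finset.sum_eq_add i k hik (fun m _ hm => by rw [zo' m hm.1 hm.2]; simp)
      (by simp) (by simp), zi', zk']
  have ozz : star z ⬝ᵥ z' = 0 := by
    rw [star_dotProduct_of_supp_pair hik zo', zi, zk, zi', zk', star_neg, star_star, star_star]
    ring
  set u := (r : ℂ)⁻¹ • z with hu
  set u' := (r : ℂ)⁻¹ • z' with hu'
  have nr : ‖(r : ℂ)⁻¹‖ = r⁻¹ := by rw [norm_inv, Complex.norm_real, Real.norm_of_nonneg hr0.le]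
  have nu : l2norm u = 1 := by rw [hu, l2norm_smul, nz, nr, inv_mul_cancel₀ hr0.ne']
  have nu' : l2norm u' = 1 := by rw [hu', l2norm_smul, nz', nr, inv_mul_cancel₀ hr0.ne']
  have ou : star u ⬝ᵥ u' = 0 := by
    rw [hu, hu', star_smul, smul_dotProduct, dotProduct_smul, ozz]; simp
  have gz : ∀ y, gain y z = X * gain u y := fun y => by
    rw [gain_comm u, hu, gain_smul_right, nr, inv_pow, hr2, mul_inv_cancel_left₀ hx.ne']
  have gz' : ∀ y, gain y z' = X * gain u' y := fun y => by
    rw [gain_comm u', hu', gain_smul_right, nr, inv_pow, hr2, mul_inv_cancel_left₀ hx.ne']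
  have hplane : ∀ y : Fin (d + 1) → ℂ, ‖y i‖ ^ 2 + ‖y k‖ ^ 2 = gain u y + gain u' y := fun y => by
    have h1 : gain y z + gain y z' = X * (‖y i‖ ^ 2 + ‖y k‖ ^ 2) := by
      rw [gain, gain, star_dotProduct_of_supp_pair hik zo, star_dotProduct_of_supp_pair hik zo',
        zi, zk, zi', zk', hX]
      refine Complex.ofReal_injective ?_
      simp only [← Complex.normSq_eq_norm_sq, Complex.ofReal_add, Complex.ofReal_mul,
        ← Complex.mul_conj, map_add, map_mul, map_neg, RCLike.star_def, Complex.conj_conj]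
      ring
    rw [gz, gz', ← mul_add] at h1
    exact (mul_left_cancel₀ hx.ne' h1).symm
  have e : ∀ y, ENNReal.ofReal (gain y z * (‖y i‖ ^ 2 + ‖y k‖ ^ 2)) =
      ENNReal.ofReal X * (ENNReal.ofReal (gain u y ^ 2) + ENNReal.ofReal (gain u y * gain u' y)) :=
    fun y => by
      have := gain_nonneg u y
      have := gain_nonneg u' y
      rw [← ENNReal.ofReal_add (by positivity) (by positivity), ← ENNReal.ofReal_mul hx.le, gz,
        hplane]
      congr 1; ring
  simp_rw [e]
  rw [lintegral_const_mul _ (by fun_prop), lintegral_add_left (by fun_prop),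
    lintegral_isotropicLaw_gain_sq hd u nu, lintegral_isotropicLaw_gain_mul_gain hd u u' nu nu' ou,
    ← ENNReal.ofReal_add (by positivity) (by positivity), ← ENNReal.ofReal_mul hx.le]
  congr 2
  field_simp
  ring

lemma lintegral_plane_share (hd : d ≠ 0) (i k : Fin (d + 1)) :
    ∫⁻ y : Fin (d + 1) → ℂ, ENNReal.ofReal (‖y i‖ ^ 2 + ‖y k‖ ^ 2) ∂(isotropicLaw (d + 1)) =
      ENNReal.ofReal (2 / (d + 1)) := by
  have h : ∀ m : Fin (d + 1), ∫⁻ y : Fin (d + 1) → ℂ, ENNReal.ofReal (‖y m‖ ^ 2)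
      ∂(isotropicLaw (d + 1)) = ENNReal.ofReal (1 / (d + 1)) := fun m => by
    have := lintegral_isotropicLaw_gain_pow_one hd (Pi.single m 1) (l2norm_single m)
    simpa only [gain_single_left] using this
  simp_rw [ENNReal.ofReal_add (sq_nonneg _) (sq_nonneg _)]
  rw [lintegral_add_left (by fun_prop), h, h, ← ENNReal.ofReal_add (by positivity) (by positivity)]
  congr 1; ring

/-- The ratio of the squared norm in three coordinates to that in two of them. -/
def shareRatio {M : ℕ} (i j k : Fin M) (x : Fin M → ℂ) : ℝ :=
  (‖x i‖ ^ 2 + ‖x k‖ ^ 2 + ‖x j‖ ^ 2) / (‖x i‖ ^ 2 + ‖x k‖ ^ 2)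

@[fun_prop]
lemma measurable_shareRatio {M : ℕ} (i j k : Fin M) : Measurable (shareRatio i j k) := by
  unfold shareRatio; fun_prop

/-- In Gaussian coordinates the ratio is `1 + ‖x j‖² / (‖x i‖² + ‖x k‖²)`. The Laplace
representation of the quotient bounds its mean by `∫ (1 + t) ^ (-2) dt = 1`. -/
lemma lintegral_shareRatio_le {M : ℕ} {i j k : Fin M} (hik : i ≠ k) :
    ∫⁻ x, ENNReal.ofReal (shareRatio i j k x) ∂(isotropicLaw M) ≤ ENNReal.ofReal 2 := by
  rw [isotropicLaw, lintegral_map (by fun_prop) (measurable_direction M)]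
  set v : Bool → Fin M → ℂ := fun b => if b then Pi.single i 1 else Pi.single k 1 with hv
  have hq : ∀ x, quadForm v x = ‖x i‖ ^ 2 + ‖x k‖ ^ 2 := fun x => by
    rw [quadForm, Fintype.sum_bool]
    simp only [hv, if_true, Bool.false_eq_true, if_false, gain_comm x, gain_single_left]
  have hS : formTrace v = 2 := by
    rw [formTrace, Fintype.sum_bool]
    simp only [hv, if_true, Bool.false_eq_true, if_false, l2norm_single]
    norm_num
  have hE : formMinor v = 1 := by
    simp only [formMinor, Fintype.sum_bool]
    simp only [hv, if_true, Bool.false_eq_true, if_false, l2norm_single, gain_single_left]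
    simp [hik, hik.symm]
    norm_num
  have hb : ∀ᵐ x ∂(channelLaw M), ENNReal.ofReal (shareRatio i j k (direction x)) ≤
      1 + ∫⁻ t in Set.Ioi (0 : ℝ), ENNReal.ofReal (gain x (Pi.single j 1) *
        Real.exp (-(t * quadForm v x))) := by
    filter_upwards [channelLaw_ae_coord_ne_zero i] with x hx
    have hx0 : x ≠ 0 := fun h => hx (by simp [h])
    have hn := (l2norm_pos_iff x).2 hx0
    have e1 : ∀ m, ‖direction x m‖ ^ 2 = ‖x m‖ ^ 2 / l2norm x ^ 2 := fun m => by
      rw [direction, norm_div, Complex.norm_real, Real.norm_of_nonneg hn.le, div_pow]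
    have hp : 0 < ‖x i‖ ^ 2 + ‖x k‖ ^ 2 := by positivity
    have e2 : shareRatio i j k (direction x) = 1 + ‖x j‖ ^ 2 / (‖x i‖ ^ 2 + ‖x k‖ ^ 2) := by
      rw [shareRatio, e1, e1, e1]
      field_simp
    rw [e2, ENNReal.ofReal_add zero_le_one (by positivity), ENNReal.ofReal_one, hq, gain_comm,
      gain_single_left]
    exact add_le_add_right (ofReal_div_le_lintegral (sq_nonneg _) hp.le) 1
  refine (lintegral_mono_ae hb).trans ?_
  have hm : Measurable (Function.uncurry fun (x : Fin M → ℂ) (t : ℝ) =>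
    ENNReal.ofReal (gain x (Pi.single j 1) * Real.exp (-(t * quadForm v x)))) := by fun_prop
  rw [lintegral_add_left measurable_const, lintegral_const, measure_univ, mul_one,
    lintegral_lintegral_swap hm.aemeasurable]
  have h2 : ∫⁻ t in Set.Ioi (0 : ℝ), ∫⁻ x, ENNReal.ofReal (gain x (Pi.single j 1) *
      Real.exp (-(t * quadForm v x))) ∂(channelLaw M) ≤ 1 := by
    calc _ ≤ ∫⁻ t in Set.Ioi (0 : ℝ), ENNReal.ofReal (1 / (1 + 1 * t) ^ (1 + 1)) := by
          refine setLIntegral_mono (by fun_prop) fun t ht => ?_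
          refine (lintegral_gain_mul_exp_neg_quadForm_le v _ (Set.mem_Ioi.1 ht).le).trans_eq ?_
          rw [l2norm_single, hS, hE]
          congr 2 <;> ring
      _ = 1 := by
          rw [lintegral_Ioi_inv_pow one_pos one_ne_zero le_rfl]; simp
  calc _ ≤ (1 : ℝ≥0∞) + 1 := add_le_add_right h2 1
    _ = ENNReal.ofReal 2 := by rw [one_add_one_eq_two]; simp

end IsotropicMoments

section PairMoments

variable {d : ℕ}

/-- The signal gain of user `k` in a frame. -/
def ownGain {M : ℕ} (k : Fin M) (w : Fin M → Fin M → ℂ) : ℝ := gain (w k) (zeroForcing w k)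

/-- The squared sine between two beams. -/
def beamSin {M : ℕ} (i j : Fin M) (w : Fin M → Fin M → ℂ) : ℝ :=
  1 - gain (zeroForcing w i) (zeroForcing w j)

@[fun_prop]
lemma measurable_ownGain {M : ℕ} (k : Fin M) : Measurable (ownGain k) :=
  measurable_gain (measurable_pi_apply k) (measurable_zeroForcing M k)

@[fun_prop]
lemma measurable_beamSin {M : ℕ} (i j : Fin M) : Measurable (beamSin i j) :=
  measurable_const.sub (measurable_gain (measurable_zeroForcing M i) (measurable_zeroForcing M j))

lemma ownGain_rot {M : ℕ} (k : Fin M) (U : Matrix.unitaryGroup (Fin M) ℂ)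
    (w : Fin M → Fin M → ℂ) : ownGain k (fun l => rot U (w l)) = ownGain k w := by
  simp only [ownGain, zeroForcing_rot, gain_rot]

lemma beamSin_rot {M : ℕ} (i j : Fin M) (U : Matrix.unitaryGroup (Fin M) ℂ)
    (w : Fin M → Fin M → ℂ) : beamSin i j (fun l => rot U (w l)) = beamSin i j w := by
  simp only [beamSin, zeroForcing_rot, gain_rot]

lemma ownGain_of_frameDet_eq_zero {M : ℕ} (k : Fin M) (w : Fin M → Fin M → ℂ)
    (hd : frameDet w = 0) : ownGain k w = 0 := by
  rw [ownGain, zeroForcing_of_det_eq_zero w k hd]; simp [gain]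

lemma ownGain_nonneg {M : ℕ} (k : Fin M) (w : Fin M → Fin M → ℂ) : 0 ≤ ownGain k w :=
  gain_nonneg _ _

/-- In adapted coordinates a positive gain of user `k` is bounded by a multiple of this squared
sine, which therefore cannot vanish. -/
lemma beamSin_pos {M : ℕ} {i j k : Fin M} (hij : i ≠ j) (hik : i ≠ k) (hjk : j ≠ k)
    (w : Fin M → Fin M → ℂ) (hd : frameDet w ≠ 0) (hg : 0 < ownGain k w) : 0 < beamSin i j w := by
  obtain ⟨U, hU⟩ := exists_rot_adapted hij hik hjk w hd
  have hd' : frameDet (fun l => rot U (w l)) ≠ 0 := fun h0 => by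
    have := ownGain_of_frameDet_eq_zero k _ h0
    rw [ownGain_rot] at this
    exact hg.ne' this
  obtain ⟨h1, h2, h3⟩ := hU.gain_le hij hik hjk hd'
  rw [← ownGain_rot k U w] at hg
  rw [← beamSin_rot i j U w]
  rw [← h2] at h3
  by_contra hcon
  have h4 : 1 - gain (zeroForcing (fun l => rot U (w l)) i) (zeroForcing (fun l => rot U (w l)) j)
    ≤ 0 := not_lt.1 hcon
  have h5 := mul_pos hg h1
  rw [ownGain] at h5
  have h6 := mul_nonpos_of_nonneg_of_nonpos (by positivity : 0 ≤ (‖rot U (w k) i‖ ^ 2 +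
    ‖rot U (w k) k‖ ^ 2) * (‖rot U (w i) i‖ ^ 2 + ‖rot U (w i) k‖ ^ 2 + ‖rot U (w i) j‖ ^ 2)) h4
  nlinarith

lemma Adapted.update {M : ℕ} {i j k : Fin M} {w : Fin M → Fin M → ℂ} (h : Adapted i j k w)
    (x y : Fin M → ℂ) :
    Adapted i j k (Function.update (Function.update w i x) k y) where
  pair v hv := h.pair v fun l h1 h2 => by
    simpa [h1, h2] using hv l h1 h2
  triple v hv := h.triple v fun l h1 h2 h3 => by
    simpa [h1, h3] using hv l h1 h2 h3

/-- Being adapted does not involve the vectors `i` and `k`. One may fix the other users, rotate into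
adapted coordinates, and redraw these two as independent isotropic vectors. -/
lemma lintegral_resample_pair {M : ℕ} {i j k : Fin M} (hM : 2 ≤ M) (hij : i ≠ j) (hik : i ≠ k)
    (hjk : j ≠ k) (f : (Fin M → Fin M → ℂ) → ℝ≥0∞) (hf : Measurable f)
    (hr : ∀ (U : Matrix.unitaryGroup (Fin M) ℂ) w, f (fun l => rot U (w l)) = f w) {C : ℝ≥0∞}
    (h : ∀ w, Adapted i j k w → ∫⁻ x, ∫⁻ y, f (Function.update (Function.update w i x) k y)
      ∂(isotropicLaw M) ∂(isotropicLaw M) ≤ C) :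
    ∫⁻ w, f w ∂(framesLaw M) ≤ C := by
  have hm1 := measurable_comp_update hf k
  have hm2 : Measurable fun w => ∫⁻ y, f (Function.update w k y) ∂(isotropicLaw M) :=
    hm1.lintegral_prod_right'
  rw [framesLaw, lintegral_pi_update _ k f hf, lintegral_pi_update _ i _ hm2]
  have : ∀ᵐ w ∂(framesLaw M), ∫⁻ x, ∫⁻ y, f (Function.update (Function.update w i x) k y)
      ∂(isotropicLaw M) ∂(isotropicLaw M) ≤ C := by
    filter_upwards [ae_frameDet_ne_zero hM] with w hw
    obtain ⟨U, hU⟩ := exists_rot_adapted hij hik hjk w hw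
    refine le_trans (le_of_eq ?_) (h _ hU)
    rw [← lintegral_isotropicLaw_rot U (fun x => ∫⁻ y, f (Function.update (Function.update
      (fun l => rot U (w l)) i x) k y) ∂(isotropicLaw M)) (hm2.comp (measurable_update _))]
    refine lintegral_congr fun x => ?_
    rw [← lintegral_isotropicLaw_rot U (fun y => f (Function.update (Function.update
      (fun l => rot U (w l)) i (rot U x)) k y)) (hf.comp (measurable_update _))]
    refine lintegral_congr fun y => ?_
    rw [← hr U, rot_comp_update, rot_comp_update]
  refine (lintegral_mono_ae this).trans ?_
  rw [lintegral_const, measure_univ, mul_one]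

lemma Adapted.ownGain_div_le {M : ℕ} {i j k : Fin M} {w : Fin M → Fin M → ℂ}
    (hw : Adapted i j k w) (hij : i ≠ j) (hik : i ≠ k) (hjk : j ≠ k) :
    ownGain k w / beamSin i j w ≤ (‖w k i‖ ^ 2 + ‖w k k‖ ^ 2) * shareRatio i j k (w i) ∧
    ownGain k w ^ 2 / beamSin i j w ≤ gain (w k) (planeDual i k (w i)) *
      (‖w k i‖ ^ 2 + ‖w k k‖ ^ 2) * (shareRatio i j k (w i) / (‖w i i‖ ^ 2 + ‖w i k‖ ^ 2)) := by
  have hs : 0 ≤ shareRatio i j k (w i) := by unfold shareRatio; positivity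
  have hg0 := gain_nonneg (w k) (planeDual i k (w i))
  rcases eq_or_ne (frameDet w) 0 with hd | hd
  · rw [ownGain_of_frameDet_eq_zero k w hd]
    constructor
    · rw [zero_div]; positivity
    · rw [zero_pow two_ne_zero, zero_div]; positivity
  obtain ⟨h1, h2, h3⟩ := hw.gain_le hij hik hjk hd
  have hg := ownGain_nonneg k w
  rcases le_or_gt (beamSin i j w) 0 with hb | hb
  · have e1 : ownGain k w / beamSin i j w ≤ 0 := div_nonpos_of_nonneg_of_nonpos hg hb
    have e2 : ownGain k w ^ 2 / beamSin i j w ≤ 0 :=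
      div_nonpos_of_nonneg_of_nonpos (sq_nonneg _) hb
    exact ⟨e1.trans (by positivity), e2.trans (by positivity)⟩
  rw [← h2] at h3
  have h4 : ownGain k w / beamSin i j w ≤
      (‖w k i‖ ^ 2 + ‖w k k‖ ^ 2) * shareRatio i j k (w i) := by
    rw [div_le_iff₀ hb, shareRatio, mul_div_assoc', div_mul_eq_mul_div, le_div_iff₀ h1]
    rw [ownGain, beamSin]
    linarith
  refine ⟨h4, ?_⟩
  have e3 : gain (w k) (planeDual i k (w i)) * (‖w k i‖ ^ 2 + ‖w k k‖ ^ 2) *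
      (shareRatio i j k (w i) / (‖w i i‖ ^ 2 + ‖w i k‖ ^ 2)) =
      ownGain k w * ((‖w k i‖ ^ 2 + ‖w k k‖ ^ 2) * shareRatio i j k (w i)) := by
    rw [← h2, ownGain]
    field_simp
  rw [e3, sq, mul_div_assoc]
  exact mul_le_mul_of_nonneg_left h4 hg

/-- The pointwise bound is a product of a function of the redrawn `w k`, of mean `2 / (d + 1)`, and
of the share ratio of `w i`, of mean at most `2`. -/
theorem lintegral_ownGain_div_beamSin_le (hd : d ≠ 0) {i j k : Fin (d + 1)} (hij : i ≠ j)
    (hik : i ≠ k) (hjk : j ≠ k) :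
    ∫⁻ w, ENNReal.ofReal (ownGain k w / beamSin i j w) ∂(framesLaw (d + 1)) ≤
      ENNReal.ofReal (4 / (d + 1)) := by
  refine lintegral_resample_pair (by omega) hij hik hjk _ (by fun_prop)
    (fun U w => by rw [ownGain_rot, beamSin_rot]) fun w hw => ?_
  calc _ ≤ ∫⁻ x, ∫⁻ y : Fin (d + 1) → ℂ, ENNReal.ofReal (‖y i‖ ^ 2 + ‖y k‖ ^ 2) *
        ENNReal.ofReal (shareRatio i j k x) ∂(isotropicLaw (d + 1)) ∂(isotropicLaw (d + 1)) := by
        refine lintegral_mono fun x => lintegral_mono fun y => ?_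
        simp only
        rw [← ENNReal.ofReal_mul (by positivity)]
        refine ENNReal.ofReal_le_ofReal ?_
        have := ((hw.update x y).ownGain_div_le hij hik hjk).1
        simpa [hik] using this
    _ = ∫⁻ x, ENNReal.ofReal (2 / (d + 1)) * ENNReal.ofReal (shareRatio i j k x)
        ∂(isotropicLaw (d + 1)) := by
        refine lintegral_congr fun x => ?_
        rw [lintegral_mul_const _ (by fun_prop), lintegral_plane_share hd]
    _ ≤ ENNReal.ofReal (2 / (d + 1)) * ENNReal.ofReal 2 := by
        rw [lintegral_const_mul _ (by fun_prop)]
        gcongr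
        exact lintegral_shareRatio_le hik
    _ = _ := by
        rw [← ENNReal.ofReal_mul (by positivity)]
        congr 1; ring

theorem lintegral_ownGain_sq_div_beamSin_le (hd : d ≠ 0) {i j k : Fin (d + 1)} (hij : i ≠ j)
    (hik : i ≠ k) (hjk : j ≠ k) :
    ∫⁻ w, ENNReal.ofReal (ownGain k w ^ 2 / beamSin i j w) ∂(framesLaw (d + 1)) ≤
      ENNReal.ofReal (6 / ((d + 1) * (d + 2))) := by
  refine lintegral_resample_pair (by omega) hij hik hjk _ (by fun_prop)
    (fun U w => by rw [ownGain_rot, beamSin_rot]) fun w hw => ?_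
  calc _ ≤ ∫⁻ x, ∫⁻ y : Fin (d + 1) → ℂ, ENNReal.ofReal (gain y (planeDual i k x) *
        (‖y i‖ ^ 2 + ‖y k‖ ^ 2)) * ENNReal.ofReal (shareRatio i j k x / (‖x i‖ ^ 2 + ‖x k‖ ^ 2))
        ∂(isotropicLaw (d + 1)) ∂(isotropicLaw (d + 1)) := by
        refine lintegral_mono fun x => lintegral_mono fun y => ?_
        simp only
        rw [← ENNReal.ofReal_mul (mul_nonneg (gain_nonneg _ _) (by positivity))]
        refine ENNReal.ofReal_le_ofReal ?_
        have := ((hw.update x y).ownGain_div_le hij hik hjk).2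
        simpa [hik] using this
    _ ≤ ∫⁻ x, ENNReal.ofReal (3 / ((d + 1) * (d + 2))) * ENNReal.ofReal (shareRatio i j k x)
        ∂(isotropicLaw (d + 1)) := by
        refine lintegral_mono fun x => ?_
        simp only
        rw [lintegral_mul_const _ (by fun_prop)]
        rcases (by positivity : 0 ≤ ‖x i‖ ^ 2 + ‖x k‖ ^ 2).eq_or_lt with h0 | h0
        · rw [← h0, div_zero, ENNReal.ofReal_zero, mul_zero]; exact zero_le
        · rw [lintegral_gain_planeDual hd hik x h0, ← ENNReal.ofReal_mul (by positivity),
            ← ENNReal.ofReal_mul (by positivity)]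
          refine le_of_eq ?_
          congr 1
          field_simp
    _ ≤ ENNReal.ofReal (3 / ((d + 1) * (d + 2))) * ENNReal.ofReal 2 := by
        rw [lintegral_const_mul _ (by fun_prop)]
        gcongr
        exact lintegral_shareRatio_le hik
    _ = _ := by
        rw [← ENNReal.ofReal_mul (by positivity)]
        congr 1; ring

end PairMoments

end

/-! ### Moments involving the second symmetric function of the interference form. -/

section

open scoped ENNReal

section MinorMoments

variable {d : ℕ}

lemma ownGain_update {k : Fin (d + 1)} (w : Fin (d + 1) → Fin (d + 1) → ℂ) :
    ownGain k (Function.update w k (Pi.single k 1)) = sigPar k w := (sigPar_eq_gain k w).symm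

/-- The squared sine between two interfering beams. -/
def subSin (k : Fin (d + 1)) (w : Fin (d + 1) → Fin (d + 1) → ℂ) (p : Fin d × Fin d) : ℝ :=
  beamSin (k.succAbove p.1) (k.succAbove p.2) (Function.update w k (Pi.single k 1))

@[fun_prop]
lemma measurable_subSin (k : Fin (d + 1)) (p : Fin d × Fin d) :
    Measurable fun w => subSin k w p :=
  (measurable_beamSin _ _).comp (measurable_update_const k _)

lemma subSin_pos {k : Fin (d + 1)} {w : Fin (d + 1) → Fin (d + 1) → ℂ} (h : IsFrame k w)
    {p : Fin d × Fin d} (hp : p ∈ (Finset.univ : Finset (Fin d)).offDiag) : 0 < subSin k w p := by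
  simp only [Finset.mem_offDiag, Finset.mem_univ, true_and] at hp
  refine beamSin_pos (k := k) (fun h0 => hp (Fin.succAbove_right_injective h0))
    (Fin.succAbove_ne k _) (Fin.succAbove_ne k _) _ h ?_
  rw [ownGain_update]
  exact sigPar_pos k w h

lemma formMinor_eq_sum {k : Fin (d + 1)} {w : Fin (d + 1) → Fin (d + 1) → ℂ} (h : IsFrame k w) :
    formMinor (subframe k w) = (∑ p ∈ (Finset.univ : Finset (Fin d)).offDiag, subSin k w p) / 2 := by
  rw [formMinor_subframe h]
  congr 1
  rw [← Finset.sum_product' (f := fun m m' : Fin d =>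
    1 - gain (frame k w (k.succAbove m)) (frame k w (k.succAbove m')))]
  symm
  refine Finset.sum_subset (fun p _ => by simp) fun p _ hp => ?_
  simp only [Finset.mem_offDiag, Finset.mem_univ, true_and, not_not] at hp
  change 1 - gain (frame k w (k.succAbove p.1)) (frame k w (k.succAbove p.2)) = 0
  rw [← hp, gain, star_dotProduct_self, l2norm_frame h]
  simp

lemma card_offDiag : (((Finset.univ : Finset (Fin d)).offDiag.card : ℕ) : ℝ) = d * (d - 1) := by
  rw [Finset.offDiag_card, Finset.card_univ, Fintype.card_fin, Nat.cast_sub (Nat.le_mul_self d)]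
  push_cast; ring

/-- By Cauchy–Schwarz over the `d (d - 1)` ordered pairs, the reciprocal of a sum of squared sines
is bounded by the sum of their reciprocals. This reduces to one pair of beams at a time. -/
lemma formMinor_bounds (hd : 2 ≤ d) {k : Fin (d + 1)} {w : Fin (d + 1) → Fin (d + 1) → ℂ}
    (h : IsFrame k w) : 0 < formMinor (subframe k w) ∧ 1 / formMinor (subframe k w) ≤
      2 / (d * (d - 1)) ^ 2 * ∑ p ∈ (Finset.univ : Finset (Fin d)).offDiag, 1 / subSin k w p := by
  have hd' : (2 : ℝ) ≤ d := by exact_mod_cast hd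
  have hN : 0 < (d : ℝ) * (d - 1) := mul_pos (by linarith) (by linarith)
  have hne : ((Finset.univ : Finset (Fin d)).offDiag).Nonempty := by
    rw [← Finset.card_pos]
    have := card_offDiag (d := d)
    rw [← this] at hN
    exact_mod_cast hN
  have hpos : 0 < ∑ p ∈ (Finset.univ : Finset (Fin d)).offDiag, subSin k w p :=
    Finset.sum_pos (fun p hp => subSin_pos h hp) hne
  rw [formMinor_eq_sum h]
  refine ⟨by positivity, ?_⟩
  have hcs := Finset.sum_sq_le_sum_mul_sum_of_sq_le_mul (Finset.univ : Finset (Fin d)).offDiag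
    (r := fun _ => (1 : ℝ)) (f := fun p => subSin k w p) (g := fun p => 1 / subSin k w p)
    (fun p hp => (subSin_pos h hp).le) (fun p hp => (one_div_pos.2 (subSin_pos h hp)).le)
    (fun p hp => by
      have := (subSin_pos h hp).ne'
      refine le_of_eq ?_
      field_simp)
  rw [Finset.sum_const, nsmul_eq_mul, mul_one, card_offDiag] at hcs
  rw [div_mul_eq_mul_div, one_div_div, div_le_div_iff₀ hpos (by positivity)]
  linarith

lemma lintegral_sum_offDiag_le (hd : 2 ≤ d) (k : Fin (d + 1)) {f : ℝ → ℝ} (hf : Measurable f)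
    (hf0 : ∀ t, 0 ≤ t → 0 ≤ f t) {C : ℝ}
    (h : ∀ i j : Fin (d + 1), i ≠ j → i ≠ k → j ≠ k →
      ∫⁻ w, ENNReal.ofReal (f (ownGain k w) / beamSin i j w) ∂(framesLaw (d + 1)) ≤
        ENNReal.ofReal C) :
    ∫⁻ w, ENNReal.ofReal (f (sigPar k w) / formMinor (subframe k w)) ∂(framesLaw (d + 1)) ≤
      ENNReal.ofReal (2 / (d * (d - 1)) * C) := by
  have hd' : (2 : ℝ) ≤ d := by exact_mod_cast hd
  have hN : 0 < (d : ℝ) * (d - 1) := mul_pos (by linarith) (by linarith)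
  have hp : ∀ p ∈ (Finset.univ : Finset (Fin d)).offDiag, ∫⁻ w, ENNReal.ofReal
      (f (sigPar k w) / subSin k w p) ∂(framesLaw (d + 1)) ≤ ENNReal.ofReal C := fun p hp => by
    simp only [Finset.mem_offDiag, Finset.mem_univ, true_and] at hp
    refine le_trans (le_of_eq ?_) (h (k.succAbove p.1) (k.succAbove p.2)
      (fun h0 => hp (Fin.succAbove_right_injective h0)) (Fin.succAbove_ne k _)
      (Fin.succAbove_ne k _))
    rw [lintegral_framesLaw_eq_update k (fun w => ENNReal.ofReal (f (ownGain k w) /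
      beamSin (k.succAbove p.1) (k.succAbove p.2) w)) (by fun_prop)
      (fun U w => by rw [ownGain_rot, beamSin_rot])]
    simp_rw [ownGain_update]
    rfl
  calc _ ≤ ∫⁻ w, ENNReal.ofReal (2 / (d * (d - 1)) ^ 2) *
        ∑ p ∈ (Finset.univ : Finset (Fin d)).offDiag,
          ENNReal.ofReal (f (sigPar k w) / subSin k w p) ∂(framesLaw (d + 1)) := by
        refine lintegral_mono_ae ?_
        filter_upwards [ae_isFrame (by omega) k] with w hw
        have h0 := hf0 _ (sigPar_nonneg k w)
        rw [← ENNReal.ofReal_sum_of_nonneg fun p hp => div_nonneg h0 (subSin_pos hw hp).le,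
          ← ENNReal.ofReal_mul (by positivity)]
        refine ENNReal.ofReal_le_ofReal ?_
        have h1 := mul_le_mul_of_nonneg_left (formMinor_bounds hd hw).2 h0
        rw [mul_one_div] at h1
        refine h1.trans_eq ?_
        rw [mul_left_comm, Finset.mul_sum]
        simp_rw [mul_one_div]
    _ ≤ ENNReal.ofReal (2 / (d * (d - 1)) ^ 2) *
        ∑ p ∈ (Finset.univ : Finset (Fin d)).offDiag, ENNReal.ofReal C := by
        rw [lintegral_const_mul _ (by fun_prop), lintegral_finsetSum _ fun p _ => by fun_prop]
        gcongr with p hp'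
        exact hp p hp'
    _ = _ := by
        rw [Finset.sum_const, nsmul_eq_mul, ← ENNReal.ofReal_natCast, card_offDiag,
          ← ENNReal.ofReal_mul hN.le, ← ENNReal.ofReal_mul (by positivity)]
        congr 1
        field_simp

lemma lintegral_sigPar_div_formMinor_le (hd : 2 ≤ d) (k : Fin (d + 1)) :
    ∫⁻ w, ENNReal.ofReal (sigPar k w / formMinor (subframe k w)) ∂(framesLaw (d + 1)) ≤
      ENNReal.ofReal (8 / (d * (d - 1) * (d + 1))) := by
  have hd' : (2 : ℝ) ≤ d := by exact_mod_cast hd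
  have h1 : (0 : ℝ) < d - 1 := by linarith
  refine (lintegral_sum_offDiag_le hd k (f := fun t => t) measurable_id (fun _ h => h)
    fun i j h1 h2 h3 =>
      lintegral_ownGain_div_beamSin_le (by omega) h1 h2 h3).trans_eq ?_
  congr 1
  field_simp
  ring

lemma lintegral_sigPar_sq_div_formMinor_le (hd : 2 ≤ d) (k : Fin (d + 1)) :
    ∫⁻ w, ENNReal.ofReal (sigPar k w ^ 2 / formMinor (subframe k w)) ∂(framesLaw (d + 1)) ≤
      ENNReal.ofReal (12 / (d * (d - 1) * (d + 1) * (d + 2))) := by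
  have hd' : (2 : ℝ) ≤ d := by exact_mod_cast hd
  have h1 : (0 : ℝ) < d - 1 := by linarith
  refine (lintegral_sum_offDiag_le hd k (f := fun t => t ^ 2) (by fun_prop) (fun _ _ => sq_nonneg _)
    fun i j h1 h2 h3 =>
      lintegral_ownGain_sq_div_beamSin_le (by omega) h1 h2 h3).trans_eq ?_
  congr 1
  field_simp
  ring

end MinorMoments

/-- Cut at `τ / D`: below it the quadratic term is dropped, above it the constant. Both remaining
integrals are logarithms, and `τ` stays free. -/
lemma lintegral_inv_quadratic_le {D e τ : ℝ} (hD : 0 < D) (he : 0 < e) (hτ : 0 < τ) :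
    ∫⁻ t in Set.Ioi (0 : ℝ), ENNReal.ofReal (1 / (1 + t * D + t ^ 2 * e)) ≤
      ENNReal.ofReal (1 / D * (Real.log (1 + τ) + Real.log (1 + D ^ 2 / (e * τ)))) := by
  set c := τ / D with hc
  have hc0 : 0 < c := by positivity
  have hl1 : 0 ≤ Real.log (1 + τ) := Real.log_nonneg (by linarith)
  have hl2 : 0 ≤ Real.log (1 + D ^ 2 / (e * τ)) :=
    Real.log_nonneg (le_add_of_nonneg_right (by positivity))
  have h1 : ∫⁻ t in Set.Ioc (0 : ℝ) c, ENNReal.ofReal (1 / (1 + t * D + t ^ 2 * e)) ≤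
      ENNReal.ofReal (1 / D * Real.log (1 + τ)) := by
    have hci : IntervalIntegrable (fun t => 1 / (1 + D * t)) volume 0 c := by
      refine ContinuousOn.intervalIntegrable ?_
      rw [Set.uIcc_of_le hc0.le]
      refine ContinuousOn.div continuousOn_const (by fun_prop) fun t ht => ?_
      have := ht.1
      positivity
    have hft := intervalIntegral.integral_eq_sub_of_hasDerivAt
      (f := fun t => 1 / D * Real.log (1 + D * t)) (f' := fun t => 1 / (1 + D * t)) (a := 0) (b := c)
      (fun t ht => by
        rw [Set.uIcc_of_le hc0.le] at ht
        have h0 := ht.1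
        have hp : 0 < 1 + D * t := by positivity
        have h2 : HasDerivAt (fun t : ℝ => 1 + D * t) D t := by
          simpa using ((hasDerivAt_id t).const_mul D).const_add 1
        refine ((h2.log hp.ne').const_mul (1 / D)).congr_deriv ?_
        field_simp) hci
    have e1 : 1 / D * Real.log (1 + τ) = 1 / D * Real.log (1 + D * c) -
        1 / D * Real.log (1 + D * 0) := by
      rw [hc, mul_div_cancel₀ _ hD.ne']; simp
    rw [e1, ← hft, intervalIntegral.integral_of_le hc0.le, ofReal_integral_eq_lintegral_ofReal
      ((intervalIntegrable_iff_integrableOn_Ioc_of_le hc0.le).1 hci)]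
    · refine setLIntegral_mono (by fun_prop) fun t ht => ENNReal.ofReal_le_ofReal ?_
      have := ht.1
      refine one_div_le_one_div_of_le (by positivity) ?_
      nlinarith [mul_pos (pow_pos this 2) he]
    · refine (ae_restrict_iff' measurableSet_Ioc).2 (ae_of_all _ fun t ht => ?_)
      have := ht.1
      simp only [Pi.zero_apply]
      positivity
  have h2 : ∫⁻ t in Set.Ioi c, ENNReal.ofReal (1 / (1 + t * D + t ^ 2 * e)) ≤
      ENNReal.ofReal (1 / D * Real.log (1 + D ^ 2 / (e * τ))) := by
    have h := lintegral_Ioi_of_hasDerivAt (g := fun t => -(1 / D * Real.log (1 + D / e * t⁻¹)))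
      (g' := fun t => 1 / (t * D + t ^ 2 * e)) (a := c) (l := -(1 / D * Real.log (1 + D / e * 0)))
      (fun t ht => by
        have h0 : 0 < t := hc0.trans_le ht
        have hp : 0 < 1 + D / e * t⁻¹ := by positivity
        have h3 := ((((hasDerivAt_inv h0.ne').const_mul (D / e)).const_add 1).log hp.ne')
        refine ((h3.const_mul (1 / D)).neg).congr_deriv ?_
        field_simp
        ring)
      (fun t ht => by
        have h0 : 0 < t := hc0.trans ht
        positivity)
      (by
        have h3 : Tendsto (fun t : ℝ => 1 + D / e * t⁻¹) atTop (𝓝 (1 + D / e * 0)) :=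
          (tendsto_inv_atTop_zero.const_mul _).const_add 1
        exact ((h3.log (by simp)).const_mul _).neg)
    have e1 : 1 / D * Real.log (1 + D ^ 2 / (e * τ)) = -(1 / D * Real.log (1 + D / e * 0)) -
        -(1 / D * Real.log (1 + D / e * c⁻¹)) := by
      have : D / e * c⁻¹ = D ^ 2 / (e * τ) := by rw [hc]; field_simp
      rw [this]; simp
    rw [e1, ← h]
    refine setLIntegral_mono (by fun_prop) fun t ht => ENNReal.ofReal_le_ofReal ?_
    have h0 : 0 < t := hc0.trans ht
    exact one_div_le_one_div_of_le (by positivity) (by linarith)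
  have hU : Set.Ioi (0 : ℝ) = Set.Ioc 0 c ∪ Set.Ioi c := (Set.Ioc_union_Ioi_eq_Ioi hc0.le).symm
  rw [hU]
  refine (lintegral_union_le _ _ _).trans ?_
  rw [mul_add, ENNReal.ofReal_add (by positivity) (by positivity)]
  exact add_le_add h1 h2

section StatMoments

variable {d : ℕ}

lemma sigPerp_le {k j : Fin (d + 1)} (hjk : j ≠ k) {w : Fin (d + 1) → Fin (d + 1) → ℂ}
    (h : IsFrame k w) : sigPerp k j w ≤ 1 - sigPar k w := by
  have h1 := l2norm_sq (frame k w k)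
  rw [l2norm_frame h, ← Finset.add_sum_erase _ _ (Finset.mem_univ k), ← Finset.add_sum_erase _ _
    (Finset.mem_erase.2 ⟨hjk, Finset.mem_univ j⟩)] at h1
  have h2 : 0 ≤ ∑ i ∈ (Finset.univ.erase k).erase j, ‖frame k w k i‖ ^ 2 :=
    Finset.sum_nonneg fun _ _ => by positivity
  rw [sigPerp, sigPar]
  linarith

lemma lintegral_gain_div_quadForm_le (hd : 2 ≤ d) {k : Fin (d + 1)}
    {w : Fin (d + 1) → Fin (d + 1) → ℂ} (h : IsFrame k w) {τ : ℝ} (hτ : 0 < τ) :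
    ∫⁻ x, ENNReal.ofReal (gain x (subbeam k w) / quadForm (subframe k w) x) ∂(channelLaw d) ≤
      ENNReal.ofReal ((1 - sigPar k w) / d * (Real.log (1 + τ) +
        Real.log (1 + d ^ 2 / (formMinor (subframe k w) * τ)))) := by
  have hd0 : (0 : ℝ) < d := by positivity
  have hE := (formMinor_bounds hd h).1
  have hs : 0 ≤ 1 - sigPar k w := by linarith [sigPar_le_one h]
  have hm : Measurable (Function.uncurry fun (x : Fin d → ℂ) (t : ℝ) => ENNReal.ofReal
    (gain x (subbeam k w) * Real.exp (-(t * quadForm (subframe k w) x)))) := by fun_prop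
  calc _ ≤ ∫⁻ x, (∫⁻ t in Set.Ioi (0 : ℝ), ENNReal.ofReal (gain x (subbeam k w) *
        Real.exp (-(t * quadForm (subframe k w) x)))) ∂(channelLaw d) :=
        lintegral_mono fun x => ofReal_div_le_lintegral (gain_nonneg _ _) (quadForm_nonneg _ _)
    _ = ∫⁻ t in Set.Ioi (0 : ℝ), (∫⁻ x, ENNReal.ofReal (gain x (subbeam k w) *
        Real.exp (-(t * quadForm (subframe k w) x))) ∂(channelLaw d)) :=
        lintegral_lintegral_swap hm.aemeasurable
    _ ≤ ∫⁻ t in Set.Ioi (0 : ℝ), ENNReal.ofReal (1 - sigPar k w) *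
        ENNReal.ofReal (1 / (1 + t * d + t ^ 2 * formMinor (subframe k w))) := by
        refine setLIntegral_mono (by fun_prop) fun t ht => ?_
        refine (lintegral_gain_mul_exp_neg_quadForm_le _ _ (Set.mem_Ioi.1 ht).le).trans_eq ?_
        rw [← ENNReal.ofReal_mul hs, l2norm_subbeam h, formTrace_subframe h, mul_one_div]
    _ ≤ _ := by
        rw [lintegral_const_mul _ (by fun_prop)]
        refine (mul_le_mul_right (lintegral_inv_quadratic_le hd0 hE hτ) _).trans_eq ?_
        rw [← ENNReal.ofReal_mul hs, ← mul_assoc, mul_one_div]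

/-- The tangent of the logarithm at `y = τ ^ 2`. It makes the bound linear in the reciprocal of
`formMinor`, whose mean against `sigPar` is under control. -/
lemma log_one_add_div_le {y τ : ℝ} (hy : 0 ≤ y) (hτ : 0 < τ) :
    Real.log (1 + y / τ) ≤ Real.log (1 + τ) + (y - τ ^ 2) / (τ * (1 + τ)) := by
  have h1 : 0 < 1 + y / τ := by positivity
  have h2 : 0 < 1 + τ := by linarith
  have h := Real.log_le_sub_one_of_pos (div_pos h1 h2)
  rw [Real.log_div h1.ne' h2.ne'] at h
  have e : (1 + y / τ) / (1 + τ) - 1 = (y - τ ^ 2) / (τ * (1 + τ)) := by field_simp; ring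
  linarith

/-- One factor `sigPerp` is replaced by its bound `1 - sigPar`; the other, over the leak, becomes a
ratio of Gaussian quadratic forms integrated by its Laplace transform. -/
lemma lintegral_sigPerp_sq_div_leak_le (hd : 2 ≤ d) {k j : Fin (d + 1)} (hjk : j ≠ k) {τ : ℝ}
    (hτ : 0 < τ) :
    ∫⁻ w, ENNReal.ofReal (sigPar k w * sigPerp k j w ^ 2 / leak k j w) ∂(framesLaw (d + 1)) ≤
      ENNReal.ofReal ((2 * Real.log (1 + τ) - τ / (1 + τ)) / ((d + 2) * (d + 3)) +
        8 / (τ * (1 + τ) * ((d - 1) * (d + 1)))) := by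
  have hd' : (2 : ℝ) ≤ d := by exact_mod_cast hd
  have hd1 : (0 : ℝ) < d - 1 := by linarith
  have hd0 : (0 : ℝ) < d := by linarith
  have hL : 0 ≤ 2 * Real.log (1 + τ) - τ / (1 + τ) := by
    have h := Real.one_sub_inv_le_log_of_pos (by linarith : 0 < 1 + τ)
    have e : 1 - (1 + τ)⁻¹ = τ / (1 + τ) := by field_simp; ring
    have h2 : 0 ≤ Real.log (1 + τ) := Real.log_nonneg (by linarith)
    linarith
  set F : ℝ × ℝ × ℝ → ℝ≥0∞ := fun p => ENNReal.ofReal (p.1 * (1 - p.1) * (p.2.1 / p.2.2)) with hF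
  have hFm : Measurable F := by fun_prop
  calc _ ≤ ∫⁻ w, F (sigPar k w, sigPerp k j w, leak k j w) ∂(framesLaw (d + 1)) := by
        refine lintegral_mono_ae ?_
        filter_upwards [ae_isFrame (by omega) k] with w hw
        refine ENNReal.ofReal_le_ofReal ?_
        have h1 := sigPar_nonneg k w
        have h2 := sigPerp_nonneg k j w
        have h3 := leak_nonneg k j w
        rw [sq, mul_div_assoc, mul_assoc, mul_div_assoc]
        exact mul_le_mul_of_nonneg_left (mul_le_mul_of_nonneg_right (sigPerp_le hjk hw)
          (by positivity)) h1
    _ = ∫⁻ w, ∫⁻ x, F (sigPar k w, gain x (subbeam k w) / l2norm x ^ 2,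
        ratioForm (subframe k w) x) ∂(channelLaw d) ∂(framesLaw (d + 1)) :=
        lintegral_stat_eq_gaussian (by omega) hFm hjk
    _ ≤ ∫⁻ w, (ENNReal.ofReal ((2 * Real.log (1 + τ) - τ / (1 + τ)) / d) *
        ENNReal.ofReal (sigPar k w * (1 - sigPar k w) ^ 2) +
        ENNReal.ofReal (d / (τ * (1 + τ))) *
          ENNReal.ofReal (sigPar k w / formMinor (subframe k w))) ∂(framesLaw (d + 1)) := by
        refine lintegral_mono_ae ?_
        filter_upwards [ae_isFrame (by omega) k] with w hw
        have h1 := sigPar_nonneg k w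
        have h2 : 0 ≤ 1 - sigPar k w := by linarith [sigPar_le_one hw]
        have hE := (formMinor_bounds hd hw).1
        have e1 : ∀ x, F (sigPar k w, gain x (subbeam k w) / l2norm x ^ 2,
            ratioForm (subframe k w) x) = ENNReal.ofReal (sigPar k w * (1 - sigPar k w)) *
            ENNReal.ofReal (gain x (subbeam k w) / quadForm (subframe k w) x) := fun x => by
          rw [← ENNReal.ofReal_mul (by positivity)]
          simp only [hF, ratioForm]
          congr 2
          by_cases hx : x = 0
          · subst hx; simp [gain, quadForm]
          · exact div_div_div_cancel_right₀ (pow_pos ((l2norm_pos_iff x).2 hx) 2).ne' _ _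
        simp_rw [e1]
        have hmx : Measurable fun x => ENNReal.ofReal
          (gain x (subbeam k w) / quadForm (subframe k w) x) := by fun_prop
        rw [lintegral_const_mul _ hmx]
        refine (mul_le_mul_right (lintegral_gain_div_quadForm_le hd hw hτ) _).trans ?_
        rw [← ENNReal.ofReal_mul (by positivity), ← ENNReal.ofReal_mul (by positivity),
          ← ENNReal.ofReal_mul (by positivity), ← ENNReal.ofReal_add (by positivity)
          (by positivity)]
        refine ENNReal.ofReal_le_ofReal ?_
        set A := sigPar k w
        set E := formMinor (subframe k w)
        have h3 := log_one_add_div_le (y := d ^ 2 / E) (by positivity) hτ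
        rw [div_div] at h3
        have h4 : A * (1 - A) ^ 2 ≤ A := by
          have : (1 - A) ^ 2 ≤ 1 := pow_le_one₀ h2 (by linarith)
          nlinarith
        calc _ = A * (1 - A) ^ 2 / d * (Real.log (1 + τ) + Real.log (1 + d ^ 2 / (E * τ))) := by
              ring
          _ ≤ A * (1 - A) ^ 2 / d * (Real.log (1 + τ) + (Real.log (1 + τ) +
              (d ^ 2 / E - τ ^ 2) / (τ * (1 + τ)))) := by
              gcongr
          _ = (2 * Real.log (1 + τ) - τ / (1 + τ)) / d * (A * (1 - A) ^ 2) +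
              d / (τ * (1 + τ)) * (A * (1 - A) ^ 2 / E) := by
              field_simp
              ring
          _ ≤ _ := by gcongr
    _ ≤ _ := by
        rw [lintegral_add_left (by fun_prop), lintegral_const_mul _ (by fun_prop),
          lintegral_const_mul' _ _ ENNReal.ofReal_ne_top, lintegral_sigPar_beta (by omega) k 2]
        refine (add_le_add_right (mul_le_mul_right
          (lintegral_sigPar_div_formMinor_le hd k) _) _).trans_eq ?_
        rw [← ENNReal.ofReal_mul (by positivity), ← ENNReal.ofReal_mul (by positivity),
          ← ENNReal.ofReal_add (by positivity) (by positivity)]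
        congr 1
        push_cast
        field_simp
        ring

end StatMoments

end

/-! ### Numerical moment bounds and the harmonic-mean lower bound. -/

section

open scoped ENNReal

section MomentBounds

variable {d : ℕ}

lemma lintegral_sigPerp_sq_div_leak_le_three (hd : 2 ≤ d) {k j : Fin (d + 1)} (hjk : j ≠ k) :
    ∫⁻ w, ENNReal.ofReal (sigPar k w * sigPerp k j w ^ 2 / leak k j w) ∂(framesLaw (d + 1)) ≤
      ENNReal.ofReal (3 / ((d + 1) * (d + 2))) := by
  have hl2 := Real.log_two_lt_d9
  have hd' : (2 : ℝ) ≤ d := by exact_mod_cast hd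
  have e8 : Real.log (1 + 7) = 3 * Real.log 2 := by
    rw [show (1 + 7 : ℝ) = 2 ^ 3 by norm_num, Real.log_pow]; norm_num
  have e4 : Real.log (1 + 3) = 2 * Real.log 2 := by
    rw [show (1 + 3 : ℝ) = 2 ^ 2 by norm_num, Real.log_pow]; norm_num
  rcases (by omega : d = 2 ∨ d = 3 ∨ 4 ≤ d) with rfl | rfl | h4
  -- The free parameters `7` and `3` make `1 + τ` a power of two, so only a decimal bound on `log 2`
  -- is needed.
  · refine (lintegral_sigPerp_sq_div_leak_le hd hjk (τ := 7) (by norm_num)).trans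
      (ENNReal.ofReal_le_ofReal ?_)
    rw [e8]
    norm_num
    linarith
  · refine (lintegral_sigPerp_sq_div_leak_le hd hjk (τ := 7) (by norm_num)).trans
      (ENNReal.ofReal_le_ofReal ?_)
    rw [e8]
    norm_num
    linarith
  · refine (lintegral_sigPerp_sq_div_leak_le hd hjk (τ := 3) (by norm_num)).trans
      (ENNReal.ofReal_le_ofReal ?_)
    have h4' : (4 : ℝ) ≤ d := by exact_mod_cast h4
    obtain ⟨e, he, hde⟩ : ∃ e : ℝ, 0 ≤ e ∧ (d : ℝ) = 4 + e := ⟨d - 4, by linarith, by ring⟩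
    rw [e4, hde]
    calc _ ≤ (2.0226 : ℝ) / ((4 + e + 2) * (4 + e + 3)) +
          8 / (3 * (1 + 3) * ((4 + e - 1) * (4 + e + 1))) := by
          gcongr
          linarith
      _ ≤ _ := by
          have : (0 : ℝ) < 4 + e - 1 := by linarith
          rw [div_add_div _ _ (by positivity) (by positivity),
            div_le_div_iff₀ (by positivity) (by positivity), ← sub_nonneg]
          ring_nf
          positivity

/-- Third inverse moment of the interference-to-signal form. -/
lemma lintegral_inv_cube_le (hd : 3 ≤ d) {k j : Fin (d + 1)} (hjk : j ≠ k) {a : ℝ} (h0 : 0 < a)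
    (h1 : a < 1) (θ : ℝ) :
    ∫⁻ w, ENNReal.ofReal (1 / (1 - a + a * (leak k j w / sigPar k w)) ^ 3) ∂(framesLaw (d + 1)) ≤
      ENNReal.ofReal (θ ^ 2 * ((d - 1) / (2 * d * (d + 1) * a * (1 - a) ^ 2)) +
        (1 - θ) ^ 2 * (6 * (d - 2) / (d * (d + 1) * (d + 2) * a ^ 2 * (1 - a)))) := by
  obtain ⟨b, hb⟩ : ∃ b, b = 1 - a := ⟨_, rfl⟩
  have hb0 : 0 < b := by linarith
  rw [← hb]
  have hd' : (3 : ℝ) ≤ d := by exact_mod_cast hd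
  have hd1 : (0 : ℝ) < d - 1 := by linarith
  have hd2 : (0 : ℝ) < d - 2 := by linarith
  have hd0 : (0 : ℝ) < d := by linarith
  set F : ℝ × ℝ × ℝ → ℝ≥0∞ := fun p => ENNReal.ofReal (1 / (b + a * (p.2.2 / p.1)) ^ 3) with hF
  have hFm : Measurable F := by fun_prop
  calc _ = ∫⁻ w, ∫⁻ x, F (sigPar k w, gain x (subbeam k w) / l2norm x ^ 2,
        ratioForm (subframe k w) x) ∂(channelLaw d) ∂(framesLaw (d + 1)) :=
        lintegral_stat_eq_gaussian (by omega) hFm hjk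
    _ ≤ ∫⁻ w, (ENNReal.ofReal (θ ^ 2 * (d - 1) / (2 * d * a * b ^ 2)) *
          ENNReal.ofReal (sigPar k w) +
        ENNReal.ofReal ((1 - θ) ^ 2 * (d - 1) * (d - 2) / (2 * a ^ 2 * b)) *
          ENNReal.ofReal (sigPar k w ^ 2 / formMinor (subframe k w))) ∂(framesLaw (d + 1)) := by
        refine lintegral_mono_ae ?_
        filter_upwards [ae_isFrame (by omega) k] with w hw
        have hA := sigPar_pos k w hw
        have hE := (formMinor_bounds (by omega) hw).1
        have hS : formTrace (subframe k w) = d := formTrace_subframe hw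
        have e1 : ∀ x, F (sigPar k w, gain x (subbeam k w) / l2norm x ^ 2,
            ratioForm (subframe k w) x) = ENNReal.ofReal (1 / b ^ 3) *
            ENNReal.ofReal (1 / (1 + a / (b * sigPar k w) * ratioForm (subframe k w) x) ^ 3) :=
          fun x => by
            have := ratioForm_nonneg (subframe k w) x
            rw [← ENNReal.ofReal_mul (by positivity), one_div_mul_one_div, ← mul_pow]
            simp only [hF]
            congr 3
            field_simp
        simp_rw [e1]
        rw [lintegral_const_mul _ (by fun_prop)]
        refine (mul_le_mul_right (lintegral_one_add_ratioForm_cube_le hd _ (hS ▸ hd0) hE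
          (by positivity) θ) _).trans_eq ?_
        rw [hS, ← ENNReal.ofReal_mul (by positivity), ← ENNReal.ofReal_mul (by positivity),
          ← ENNReal.ofReal_mul (by positivity), ← ENNReal.ofReal_add (by positivity)
          (by positivity)]
        congr 1
        field_simp
    _ ≤ _ := by
        have hE0 := lintegral_sigPar_beta (d := d) (by omega) k 0
        simp only [pow_zero, mul_one, Nat.cast_zero, add_zero] at hE0
        rw [lintegral_add_left (by fun_prop), lintegral_const_mul _ (by fun_prop),
          lintegral_const_mul' _ _ ENNReal.ofReal_ne_top, hE0]
        refine (add_le_add_right (mul_le_mul_right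
          (lintegral_sigPar_sq_div_formMinor_le (by omega) k) _) _).trans_eq ?_
        rw [← ENNReal.ofReal_mul (by positivity), ← ENNReal.ofReal_mul (by positivity),
          ← ENNReal.ofReal_add (by positivity) (by positivity)]
        congr 1
        field_simp
        ring

lemma inv_add_add_le {X Y Z p q r : ℝ} (hX : 0 < X) (hY : 0 < Y) (hZ : 0 < Z)
    (h : p + q + r = 1) : 1 / (X + Y + Z) ≤ p ^ 2 / X + q ^ 2 / Y + r ^ 2 / Z := by
  obtain ⟨s, hs⟩ : ∃ s, s = 1 / (X + Y + Z) := ⟨_, rfl⟩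
  have key : ∀ {u x : ℝ}, 0 < x → 2 * u * s - s ^ 2 * x ≤ u ^ 2 / x := fun {u x} hx => by
    rw [le_div_iff₀ hx]
    nlinarith [sq_nonneg (u - s * x)]
  have h1 : s * (X + Y + Z) = 1 := by rw [hs]; exact one_div_mul_cancel (by positivity)
  rw [← hs]
  have := key (u := p) hX
  have := key (u := q) hY
  have := key (u := r) hZ
  have e : 2 * p * s - s ^ 2 * X + (2 * q * s - s ^ 2 * Y) + (2 * r * s - s ^ 2 * Z) =
    2 * s * (p + q + r) - s * (s * (X + Y + Z)) := by ring
  rw [h, h1] at e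
  linarith

/-- Second inverse moment of the interference-to-signal form for three antennas. -/
lemma lintegral_inv_sq_le {k j : Fin (2 + 1)} (hjk : j ≠ k) {θ : ℝ} (hθ : 0 < θ) :
    ∫⁻ w, ENNReal.ofReal (1 / (θ + leak k j w / sigPar k w) ^ 2) ∂(framesLaw (2 + 1)) ≤
      ENNReal.ofReal (1 / (θ ^ 2 + 6 * θ + 2)) := by
  set F : ℝ × ℝ × ℝ → ℝ≥0∞ := fun p => ENNReal.ofReal (1 / (θ + p.2.2 / p.1) ^ 2) with hF
  have hFm : Measurable F := by fun_prop
  obtain ⟨D, hD⟩ : ∃ D, D = θ ^ 2 + 6 * θ + 2 := ⟨_, rfl⟩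
  have hD0 : 0 < D := by rw [hD]; positivity
  rw [← hD]
  calc _ = ∫⁻ w, ∫⁻ x, F (sigPar k w, gain x (subbeam k w) / l2norm x ^ 2,
        ratioForm (subframe k w) x) ∂(channelLaw 2) ∂(framesLaw (2 + 1)) :=
        lintegral_stat_eq_gaussian (by omega) hFm hjk
    _ ≤ ∫⁻ w, (ENNReal.ofReal (θ ^ 2 / D ^ 2) + (ENNReal.ofReal (18 * θ / D ^ 2) *
          ENNReal.ofReal (sigPar k w) + ENNReal.ofReal (4 / D ^ 2) *
          ENNReal.ofReal (sigPar k w ^ 2 / formMinor (subframe k w)))) ∂(framesLaw (2 + 1)) := by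
        refine lintegral_mono_ae ?_
        filter_upwards [ae_isFrame (by omega) k] with w hw
        have hA := sigPar_pos k w hw
        have hE := (formMinor_bounds (by omega) hw).1
        have hS : formTrace (subframe k w) = 2 := by simpa using formTrace_subframe hw
        have e1 : ∀ x, F (sigPar k w, gain x (subbeam k w) / l2norm x ^ 2,
            ratioForm (subframe k w) x) = ENNReal.ofReal (1 / θ ^ 2) *
            ENNReal.ofReal (1 / (1 + 1 / (θ * sigPar k w) * ratioForm (subframe k w) x) ^ 2) :=
          fun x => by
            have := ratioForm_nonneg (subframe k w) x
            rw [← ENNReal.ofReal_mul (by positivity), one_div_mul_one_div, ← mul_pow]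
            simp only [hF]
            congr 3
            field_simp
        simp_rw [e1]
        rw [lintegral_const_mul _ (by fun_prop), lintegral_one_add_ratioForm_pow (d := 2)
          (v := subframe k w) (by omega) (by positivity)]
        refine (mul_le_mul_right (lintegral_exp_neg_quadForm_le _ (by positivity)) _).trans ?_
        rw [hS, ← ENNReal.ofReal_mul (by positivity), ← ENNReal.ofReal_mul (by positivity),
          ← ENNReal.ofReal_mul (by positivity), ← ENNReal.ofReal_add (by positivity)
          (by positivity), ← ENNReal.ofReal_add (by positivity) (by positivity)]
        refine ENNReal.ofReal_le_ofReal ?_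
        set A := sigPar k w
        set E := formMinor (subframe k w)
        -- Weights proportional to `θ ^ 2`, `6 θ` and `2` make the three averaged terms combine to
        -- exactly `D / D ^ 2`.
        have h := inv_add_add_le (X := θ ^ 2) (Y := 2 * θ / A) (Z := E / A ^ 2) (p := θ ^ 2 / D)
          (q := 6 * θ / D) (r := 2 / D) (by positivity) (by positivity) (by positivity)
          (by rw [← add_div, ← add_div, ← hD, div_self hD0.ne'])
        refine le_trans (le_of_eq ?_) (h.trans_eq ?_)
        · field_simp
        · field_simp
          ring
    _ ≤ _ := by
        have hE0 := lintegral_sigPar_beta (d := 2) (by omega) k 0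
        simp only [pow_zero, mul_one, Nat.cast_zero, add_zero] at hE0
        rw [lintegral_add_left (by fun_prop), lintegral_add_left (by fun_prop),
          lintegral_const_mul _ (by fun_prop),
          lintegral_const_mul' _ _ ENNReal.ofReal_ne_top, hE0, lintegral_const, measure_univ,
          mul_one]
        refine (add_le_add_right (add_le_add_right (mul_le_mul_right
          (lintegral_sigPar_sq_div_formMinor_le (by omega) k) _) _) _).trans_eq ?_
        rw [← ENNReal.ofReal_mul (by positivity), ← ENNReal.ofReal_mul (by positivity),
          ← ENNReal.ofReal_add (by positivity) (by norm_num; positivity), ← ENNReal.ofReal_add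
          (by positivity) (by norm_num; positivity)]
        congr 1
        norm_num
        field_simp
        rw [hD]
        ring

/-- Monotone convergence along `θ = 1 / (n + 1)`. -/
lemma lintegral_inv_sq_le_half {k j : Fin (2 + 1)} (hjk : j ≠ k) :
    ∫⁻ w, ENNReal.ofReal (1 / (leak k j w / sigPar k w) ^ 2) ∂(framesLaw (2 + 1)) ≤
      ENNReal.ofReal (1 / 2) := by
  refine le_of_tendsto' (lintegral_tendsto_of_tendsto_of_monotone (f := fun n w =>
    ENNReal.ofReal (1 / (1 / ((n : ℝ) + 1) + leak k j w / sigPar k w) ^ 2))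
    (fun n => Measurable.aemeasurable (by fun_prop)) ?_ ?_) fun n =>
      (lintegral_inv_sq_le hjk (by positivity)).trans (ENNReal.ofReal_le_ofReal ?_)
  · refine ae_of_all _ fun w m n hmn => ENNReal.ofReal_le_ofReal ?_
    have := leak_nonneg k j w
    have := sigPar_nonneg k w
    have : (m : ℝ) ≤ n := by exact_mod_cast hmn
    gcongr
  · filter_upwards [ae_isFrame (by omega) k] with w hw
    have h1 := div_pos (leak_pos hjk w hw) (sigPar_pos k w hw)
    refine ENNReal.tendsto_ofReal ?_
    have h := (tendsto_one_div_add_atTop_nhds_zero_nat (𝕜 := ℝ)).add_const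
      (leak k j w / sigPar k w)
    rw [zero_add] at h
    exact tendsto_const_nhds.div (h.pow 2) (by positivity)
  · have : 0 < 1 / ((n : ℝ) + 1) := by positivity
    exact one_div_le_one_div_of_le (by norm_num) (by nlinarith)

end MomentBounds

lemma integrable_and_integral_le {Ω : Type*} [MeasurableSpace Ω] {μ : Measure Ω} {f : Ω → ℝ}
    (hf : Measurable f) (h0 : 0 ≤ᵐ[μ] f) {C : ℝ} (hC : 0 ≤ C)
    (h : ∫⁻ ω, ENNReal.ofReal (f ω) ∂μ ≤ ENNReal.ofReal C) :
    Integrable f μ ∧ ∫ ω, f ω ∂μ ≤ C := by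
  refine ⟨⟨hf.aestronglyMeasurable, ?_⟩, ?_⟩
  · rw [hasFiniteIntegral_iff_ofReal h0]
    exact h.trans_lt ENNReal.ofReal_lt_top
  · rw [integral_eq_lintegral_of_nonneg_ae h0 hf.aestronglyMeasurable]
    exact ENNReal.toReal_le_of_le_ofReal hC h

section Harmonic

variable {d : ℕ}

/-- A harmonic-mean lower bound for the reciprocal of an affine function of the shift. -/
theorem le_integral_inv_affine (hd : 2 ≤ d) {k j : Fin (d + 1)} (hjk : j ≠ k) {p q : ℝ}
    (hp : 0 < p) (hq : 0 < q) {y : (Fin (d + 1) → Fin (d + 1) → ℂ) → ℝ} (hy : Measurable y)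
    (hyb : ∀ᵐ w ∂(framesLaw (d + 1)), leak k j w / sigPar k w ≤ y w ∧ y w ≤
      leak k j w / sigPar k w + 2 * (sigPerp k j w / sigPar k w) +
        sigPerp k j w ^ 2 / (sigPar k w * leak k j w)) :
    (d + 2) / ((d + 1) * (2 * p + q * (d + 7))) ≤
      ∫ w, 1 / (p + q * y w) ∂(framesLaw (d + 1)) := by
  have hd0 : (0 : ℝ) < d := by positivity
  have hd0' : d ≠ 0 := by omega
  set μ := framesLaw (d + 1)
  have hE0 := lintegral_sigPar_beta hd0' k 0
  simp only [pow_zero, mul_one, Nat.cast_zero, add_zero] at hE0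
  have i0 := integrable_and_integral_le (μ := μ) (measurable_sigPar k)
    (ae_of_all _ (sigPar_nonneg k)) (by positivity) hE0.le
  have v0 : ∫ w, sigPar k w ∂μ = 1 / (d + 1) := by
    rw [integral_eq_lintegral_of_nonneg_ae (ae_of_all _ (sigPar_nonneg k))
      (measurable_sigPar k).aestronglyMeasurable, hE0, ENNReal.toReal_ofReal (by positivity)]
    field_simp
  have i1 := integrable_and_integral_le (μ := μ) (f := fun w => sigPar k w ^ 2) (by fun_prop)
    (ae_of_all _ fun _ => sq_nonneg _) (by positivity) (lintegral_sigPar_sq hd0' k).le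
  have i2 := integrable_and_integral_le (μ := μ) (f := fun w => sigPar k w * leak k j w)
    (by fun_prop) (ae_of_all _ fun w => mul_nonneg (sigPar_nonneg k w) (leak_nonneg k j w))
    (by positivity) (lintegral_sigPar_mul_leak hd0' hjk).le
  have i3 := integrable_and_integral_le (μ := μ) (f := fun w => sigPar k w * sigPerp k j w)
    (by fun_prop) (ae_of_all _ fun w => mul_nonneg (sigPar_nonneg k w) (sigPerp_nonneg k j w))
    (by positivity) (lintegral_sigPar_mul_sigPerp hd0' hjk).le
  have i4 := integrable_and_integral_le (μ := μ)
    (f := fun w => sigPar k w * sigPerp k j w ^ 2 / leak k j w)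
    (by fun_prop) (ae_of_all _ fun w => div_nonneg (mul_nonneg (sigPar_nonneg k w) (sq_nonneg _))
      (leak_nonneg k j w)) (by positivity) (lintegral_sigPerp_sq_div_leak_le_three hd hjk)
  obtain ⟨S, hS⟩ : ∃ S : ℝ, S = (2 * p + q * (d + 7)) / ((d + 1) * (d + 2)) := ⟨_, rfl⟩
  have hS0 : 0 < S := by rw [hS]; positivity
  -- Pointwise `1 / s ≥ 2 t A - t² A² s`. With mean `1 / (d + 1)` for `A = sigPar` and bound `S` for
  -- the mean of `A² s`, this `t` optimizes the integrated bound.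
  obtain ⟨t, ht⟩ : ∃ t : ℝ, t = 1 / ((d + 1) * S) := ⟨_, rfl⟩
  have ht0 : 0 < t := by rw [ht]; positivity
  set G : (Fin (d + 1) → Fin (d + 1) → ℂ) → ℝ := fun w => 2 * t * sigPar k w -
    t ^ 2 * (p * sigPar k w ^ 2 + q * (sigPar k w * leak k j w +
      2 * (sigPar k w * sigPerp k j w) + sigPar k w * sigPerp k j w ^ 2 / leak k j w)) with hG
  have iq : Integrable (fun w => sigPar k w * leak k j w +
      2 * (sigPar k w * sigPerp k j w) + sigPar k w * sigPerp k j w ^ 2 / leak k j w) μ :=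
    (i2.1.add (i3.1.const_mul 2)).add i4.1
  have iS : Integrable (fun w => p * sigPar k w ^ 2 + q * (sigPar k w * leak k j w +
      2 * (sigPar k w * sigPerp k j w) + sigPar k w * sigPerp k j w ^ 2 / leak k j w)) μ :=
    (i1.1.const_mul p).add (iq.const_mul q)
  have iG : Integrable G μ := (i0.1.const_mul _).sub (iS.const_mul _)
  have vG : (d + 2) / ((d + 1) * (2 * p + q * (d + 7))) ≤ ∫ w, G w ∂μ := by
    have e : ∫ w, G w ∂μ = 2 * t * (1 / (d + 1)) - t ^ 2 * (p * ∫ w, sigPar k w ^ 2 ∂μ +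
        q * (∫ w, sigPar k w * leak k j w ∂μ + 2 * ∫ w, sigPar k w * sigPerp k j w ∂μ +
          ∫ w, sigPar k w * sigPerp k j w ^ 2 / leak k j w ∂μ)) := by
      simp only [hG]
      rw [integral_sub (i0.1.const_mul _) (iS.const_mul _),
        integral_const_mul, v0, integral_const_mul, integral_add (i1.1.const_mul p)
        (iq.const_mul q), integral_const_mul, integral_const_mul,
        integral_add (f := fun w => sigPar k w * leak k j w +
          2 * (sigPar k w * sigPerp k j w)) (i2.1.add (i3.1.const_mul 2)) i4.1, integral_add i2.1 (i3.1.const_mul 2),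
        integral_const_mul]
    have hb : p * ∫ w, sigPar k w ^ 2 ∂μ +
        q * (∫ w, sigPar k w * leak k j w ∂μ + 2 * ∫ w, sigPar k w * sigPerp k j w ∂μ +
          ∫ w, sigPar k w * sigPerp k j w ^ 2 / leak k j w ∂μ) ≤ S := by
      calc _ ≤ p * (2 / ((d + 1) * (d + 2))) + q * (1 / (d + 1) + 2 * (1 / ((d + 1) * (d + 2))) +
            3 / ((d + 1) * (d + 2))) := by
            gcongr
            exacts [i1.2, i2.2, i3.2, i4.2]
        _ = S := by rw [hS]; field_simp; ring
    rw [e]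
    have h2 := mul_le_mul_of_nonneg_left hb (sq_nonneg t)
    have h3 : (d + 2) / ((d + 1) * (2 * p + q * (d + 7))) = 2 * t * (1 / (d + 1)) - t ^ 2 * S := by
      rw [ht, hS]
      field_simp
      ring
    linarith
  refine vG.trans (integral_mono_ae iG ?_ ?_)
  · refine Integrable.of_bound (C := 1 / p) (Measurable.aestronglyMeasurable (by fun_prop)) ?_
    filter_upwards [hyb, ae_isFrame hd0' k] with w hw hf
    have h1 := div_pos (leak_pos hjk w hf) (sigPar_pos k w hf)
    have h2 : 0 ≤ y w := h1.le.trans hw.1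
    rw [Real.norm_of_nonneg (by positivity)]
    exact one_div_le_one_div_of_le hp (le_add_of_nonneg_right (by positivity))
  · filter_upwards [hyb, ae_isFrame hd0' k] with w hw hf
    have hA := sigPar_pos k w hf
    have hT := leak_pos hjk w hf
    have h1 := div_pos hT hA
    have h2 : 0 ≤ y w := h1.le.trans hw.1
    have hs : 0 < p + q * y w := by positivity
    set A := sigPar k w
    have h3 : A ^ 2 * y w ≤ A * leak k j w + 2 * (A * sigPerp k j w) +
        A * sigPerp k j w ^ 2 / leak k j w := by
      refine (mul_le_mul_of_nonneg_left hw.2 (sq_nonneg A)).trans_eq ?_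
      field_simp
    have h4 : 2 * t * A - t ^ 2 * (A ^ 2 * (p + q * y w)) ≤ 1 / (p + q * y w) := by
      rw [le_div_iff₀ hs]
      nlinarith [sq_nonneg (t * A * (p + q * y w) - 1)]
    refine le_trans ?_ h4
    simp only [hG]
    have h5 := mul_le_mul_of_nonneg_left h3 hq.le
    have h6 : A ^ 2 * (p + q * y w) = p * A ^ 2 + q * (A ^ 2 * y w) := by ring
    rw [h6]
    gcongr

end Harmonic

end

/-! ### The polynomial inequality for at least four antennas. -/

section

open scoped ENNReal

section Numerics

/-- The numerical condition under which the signal term dominates the cubic remainder. -/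
def CubicMargin (d a κ : ℝ) : Prop :=
  33 / 16 * (d - 1) * (d - 2) * (4 + κ * (2 + a * (d + 5))) ≤
    κ ^ 3 * (d + 2) * a * (1 - a) * d * (12 * (d - 2) * (1 - a) + (d - 1) * (d + 2) * a)

/-- The quotient `κ ^ 3 / (4 + κ c)` increases with `κ`, so any lower bound for the growth factor
may be inserted. -/
lemma CubicMargin.mono {d a κ κ' : ℝ} (hd : 3 ≤ d) (h0 : 0 < a) (h1 : a < 1) (hκ : 0 < κ)
    (hle : κ ≤ κ') (h : CubicMargin d a κ) : CubicMargin d a κ' := by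
  unfold CubicMargin at *
  have hd1 : 0 < d - 1 := by linarith
  have hd2 : 0 < d - 2 := by linarith
  have hb : 0 < 1 - a := by linarith
  obtain ⟨L, hL⟩ : ∃ L, L = (d + 2) * a * (1 - a) * d *
    (12 * (d - 2) * (1 - a) + (d - 1) * (d + 2) * a) := ⟨_, rfl⟩
  obtain ⟨R, hR⟩ : ∃ R, R = 33 / 16 * (d - 1) * (d - 2) := ⟨_, rfl⟩
  obtain ⟨c, hc⟩ : ∃ c, c = 2 + a * (d + 5) := ⟨_, rfl⟩
  have hR0 : 0 < R := by rw [hR]; positivity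
  have hc0 : 0 < c := by rw [hc]; positivity
  have hκ' : 0 < κ' := hκ.trans_le hle
  have h' : R * (4 + κ * c) ≤ κ ^ 3 * L := by rw [hR, hc, hL]; linarith
  suffices R * (4 + κ' * c) ≤ κ' ^ 3 * L by rw [hR, hc, hL] at this; linarith
  have h3 : κ ^ 3 ≤ κ' ^ 3 := pow_le_pow_left₀ hκ.le hle 3
  have h4 : κ ^ 3 * κ' ≤ κ' ^ 3 * κ := by
    have : κ ^ 2 ≤ κ' ^ 2 := pow_le_pow_left₀ hκ.le hle 2
    nlinarith [mul_le_mul_of_nonneg_left this (mul_pos hκ hκ').le]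
  have h5 : κ ^ 3 * (R * (4 + κ' * c)) ≤ κ' ^ 3 * (R * (4 + κ * c)) := by
    nlinarith [mul_le_mul_of_nonneg_left h3 hR0.le, mul_le_mul_of_nonneg_left h4 (mul_pos hR0 hc0).le]
  have h6 := mul_le_mul_of_nonneg_left h' (pow_pos hκ' 3).le
  have h7 : κ ^ 3 * (R * (4 + κ' * c)) ≤ κ ^ 3 * (κ' ^ 3 * L) := by linarith
  exact le_of_mul_le_mul_left h7 (pow_pos hκ 3)

/-- Clears denominators after a rational parametrization of `a` and of the lower bound for `κ`,
leaving a polynomial inequality. -/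
lemma cubicMargin_of_homogeneous {d a κ A B D N Q : ℝ} (hd : 3 ≤ d) (ha : a = A / D)
    (hb : 1 - a = B / D) (hA : 0 < A) (hB : 0 < B) (hD : 0 < D) (hN : 0 < N) (hQ : 0 < Q)
    (hκ : N / Q ≤ κ)
    (h : 33 / 16 * (d - 1) * (d - 2) * (4 * D * Q + N * (2 * D + A * (d + 5))) * Q ^ 2 * D ^ 2 ≤
      N ^ 3 * (d + 2) * A * B * d * (12 * (d - 2) * B + (d - 1) * (d + 2) * A)) :
    CubicMargin d a κ := by
  have h0 : 0 < a := by rw [ha]; positivity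
  have h1 : 0 < 1 - a := by rw [hb]; positivity
  refine CubicMargin.mono hd h0 (by linarith) (div_pos hN hQ) hκ ?_
  unfold CubicMargin
  rw [hb, ha]
  have e1 : 33 / 16 * (d - 1) * (d - 2) * (4 + N / Q * (2 + A / D * (d + 5))) =
      (33 / 16 * (d - 1) * (d - 2) * (4 * D * Q + N * (2 * D + A * (d + 5))) * Q ^ 2 * D ^ 2) /
        (Q ^ 3 * D ^ 3) := by field_simp
  have e2 : (N / Q) ^ 3 * (d + 2) * (A / D) * (B / D) * d * (12 * (d - 2) * (B / D) +
      (d - 1) * (d + 2) * (A / D)) = (N ^ 3 * (d + 2) * A * B * d * (12 * (d - 2) * B +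
        (d - 1) * (d + 2) * A)) / (Q ^ 3 * D ^ 3) := by field_simp
  rw [e1, e2]
  gcongr

lemma cubicMargin_base {d : ℝ} (hd : 3 ≤ d) : CubicMargin d (3 / 10) 1 := by
  unfold CubicMargin
  obtain ⟨e, rfl⟩ : ∃ e, d = 3 + e := ⟨d - 3, by ring⟩
  have he : 0 ≤ e := by linarith
  have h2 : 0 ≤ (e - 1 / 4) ^ 2 := sq_nonneg _
  rw [← sub_nonneg]
  ring_nf
  nlinarith [pow_nonneg he 3, pow_nonneg he 4]

lemma cubicMargin_small {n : ℕ} (hn : n = 3 ∨ n = 4 ∨ n = 5) {a κ : ℝ} (h0 : 3 / 10 ≤ a)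
    (h1 : a < 1) (hκ : 1 + n / 2 * (a ^ n / (1 - a ^ n)) ≤ κ) : CubicMargin n a κ := by
  have hb : 0 < 1 - a := by linarith
  -- This maps `[3/10, 1)` to `[0, ∞)`, so that the cleared inequality can be closed by positivity.
  obtain ⟨s, hs⟩ : ∃ s, s = (a - 3 / 10) / (1 - a) := ⟨_, rfl⟩
  have hs0 : 0 ≤ s := by rw [hs]; exact div_nonneg (by linarith) hb.le
  have hsa : a = (3 / 10 + s) / (1 + s) := by rw [hs]; field_simp; ring
  have hsb : 1 - a = (7 / 10) / (1 + s) := by rw [hsa]; field_simp; ring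
  have hn3 : (3 : ℝ) ≤ n := by exact_mod_cast (by omega : 3 ≤ n)
  have hV : 0 < (1 + s) ^ n - (3 / 10 + s) ^ n :=
    sub_pos.2 (pow_lt_pow_left₀ (by linarith) (by linarith) (by omega))
  have hκ' : (2 * ((1 + s) ^ n - (3 / 10 + s) ^ n) + n * (3 / 10 + s) ^ n) /
      (2 * ((1 + s) ^ n - (3 / 10 + s) ^ n)) ≤ κ := by
    refine le_trans (le_of_eq ?_) hκ
    have hp : 0 < (1 + s) ^ n := by positivity
    rw [hsa, div_pow]
    generalize (3 / 10 + s) ^ n = U at *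
    generalize (1 + s) ^ n = V at *
    field_simp
  refine cubicMargin_of_homogeneous hn3 hsa hsb (by positivity) (by norm_num) (by positivity)
    (by positivity) (by positivity) hκ' ?_
  rcases hn with rfl | rfl | rfl <;>
  · rw [← sub_nonneg]
    simp only [Nat.cast_ofNat]
    ring_nf
    positivity

lemma cubicMargin_of_lt {d a κ : ℝ} (hd : 6 ≤ d) (h0 : 3 / 10 ≤ a) (h1 : a < 1 - 3 / d)
    (hκ : 1 ≤ κ) : CubicMargin d a κ := by
  obtain ⟨e, he⟩ : ∃ e, d = 6 + e := ⟨d - 6, by ring⟩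
  have he0 : 0 ≤ e := by linarith
  have hd0 : 0 < d := by linarith
  have hc : 0 < 1 - 3 / d - a := by linarith
  obtain ⟨s, hs⟩ : ∃ s, s = (a - 3 / 10) / (1 - 3 / d - a) := ⟨_, rfl⟩
  have hs0 : 0 ≤ s := by rw [hs]; exact div_nonneg (by linarith) hc.le
  have hsa : a = (3 / 10 * d + s * (d - 3)) / (d * (1 + s)) := by
    have h : s * (1 - 3 / d - a) = a - 3 / 10 := by rw [hs]; exact div_mul_cancel₀ _ hc.ne'
    have h2 : s * (d - 3 - a * d) = a * d - 3 / 10 * d := by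
      calc s * (d - 3 - a * d) = s * (1 - 3 / d - a) * d := by field_simp
        _ = _ := by rw [h]; ring
    rw [eq_div_iff (by positivity)]
    linarith
  have h3 : 0 < d - 3 := by linarith
  refine cubicMargin_of_homogeneous (A := 3 / 10 * d + s * (d - 3)) (B := 7 / 10 * d + s * 3)
    (D := d * (1 + s)) (N := 1) (Q := 1) (by linarith) hsa ?_ (by positivity) (by positivity)
    (by positivity) one_pos one_pos (by simpa using hκ) ?_
  · rw [hsa]; field_simp; ring
  · rw [← sub_nonneg, he]
    ring_nf
    positivity

lemma cubicMargin_of_ge {n : ℕ} (hn : 6 ≤ n) {a κ : ℝ} (h0 : 1 - 4 / (n : ℝ) < a)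
    (h1 : a < 1) (hκ : 1 + n / 2 * (a ^ n / (1 - a ^ n)) ≤ κ) : CubicMargin n a κ := by
  have hn' : (6 : ℝ) ≤ n := by exact_mod_cast hn
  obtain ⟨e, he⟩ : ∃ e : ℝ, (n : ℝ) = 6 + e := ⟨n - 6, by ring⟩
  have he0 : 0 ≤ e := by linarith
  have hd0 : (0 : ℝ) < n := by linarith
  -- Near `a = 1` the growth factor is needed. In the scale `1 - a = z / n`, Bernoulli with exponent
  -- `n / 4` gives `a ^ n ≥ (1 - z / 4) ^ 4`, and `r = z / (4 - z)` maps `(0, 4)` to the half-line.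
  obtain ⟨z, hz⟩ : ∃ z : ℝ, z = n * (1 - a) := ⟨_, rfl⟩
  have hz0 : 0 < z := by rw [hz]; exact mul_pos hd0 (by linarith)
  have hz4 : z < 4 := by
    have h := mul_lt_mul_of_pos_left h0 hd0
    rw [mul_sub, mul_div_cancel₀ _ hd0.ne'] at h
    rw [hz]; linarith
  have haz : a = 1 - z / n := by rw [hz]; field_simp; ring
  obtain ⟨r, hr⟩ : ∃ r, r = z / (4 - z) := ⟨_, rfl⟩
  have h4z : 0 < 4 - z := by linarith
  have hr0 : 0 < r := by rw [hr]; positivity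
  have hzr : z = 4 * r / (1 + r) := by rw [hr]; field_simp; ring
  have hv : (1 / (1 + r)) ^ 4 ≤ a ^ n := by
    have hzn : z / n ≤ 1 := by rw [div_le_one hd0]; linarith
    have h := one_add_mul_self_le_rpow_one_add (s := -(z / n)) (by linarith) (p := n / 4)
      (by linarith)
    have e1 : 1 + (n : ℝ) / 4 * -(z / n) = 1 / (1 + r) := by
      rw [hzr]; field_simp; ring
    rw [e1, ← sub_eq_add_neg, ← haz] at h
    have ha0 : 0 ≤ a := by rw [haz]; linarith
    calc (1 / (1 + r)) ^ 4 ≤ (a ^ ((n : ℝ) / 4)) ^ 4 := pow_le_pow_left₀ (by positivity) h 4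
      _ = a ^ n := by
        rw [← Real.rpow_natCast, ← Real.rpow_mul ha0, ← Real.rpow_natCast]
        congr 1
        push_cast; ring
  have hun : a ^ n < 1 := pow_lt_one₀ (by rw [haz]; rw [sub_nonneg, div_le_one hd0]; linarith) h1
    (by omega)
  have hV : 0 < (1 + r) ^ 4 - 1 := sub_pos.2 (one_lt_pow₀ (by linarith) (by norm_num))
  have hκ' : (2 * ((1 + r) ^ 4 - 1) + n) / (2 * ((1 + r) ^ 4 - 1)) ≤ κ := by
    refine le_trans ?_ hκ
    have hu0 : 0 ≤ a ^ n := le_trans (by positivity) hv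
    have h2 : (1 / (1 + r)) ^ 4 / (1 - (1 / (1 + r)) ^ 4) ≤ a ^ n / (1 - a ^ n) := by
      have : 0 < 1 - a ^ n := by linarith
      gcongr
    have h3 : (1 / (1 + r)) ^ 4 / (1 - (1 / (1 + r)) ^ 4) = 1 / ((1 + r) ^ 4 - 1) := by
      rw [one_div_pow, one_sub_div (by positivity)]
      field_simp
    rw [h3] at h2
    refine le_trans (le_of_eq ?_) (add_le_add_right (mul_le_mul_of_nonneg_left h2
      (by positivity : (0 : ℝ) ≤ n / 2)) 1)
    field_simp
  refine cubicMargin_of_homogeneous (A := n * (1 + r) - 4 * r) (B := 4 * r) (D := n * (1 + r))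
    (by linarith) ?_ ?_ (by nlinarith) (by positivity) (by positivity) (by positivity)
    (by positivity) hκ' ?_
  · rw [haz, hzr]; field_simp
  · rw [haz, hzr]; field_simp; ring
  · rw [← sub_nonneg, he]
    ring_nf
    positivity

/-- Three regimes: small `n` directly; for `n ≥ 6` away from `1`, where `κ ≥ 1` is enough; and near
`1`, where the growth of `κ` takes over. The last two overlap, and the cut is at `1 - 3 / n`. -/
lemma cubicMargin_of_growth {n : ℕ} (hn : 3 ≤ n) {a κ : ℝ} (h0 : 3 / 10 ≤ a)
    (h1 : a < 1) (hκ : 1 + n / 2 * (a ^ n / (1 - a ^ n)) ≤ κ) : CubicMargin n a κ := by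
  rcases (by omega : (n = 3 ∨ n = 4 ∨ n = 5) ∨ 6 ≤ n) with h | h
  · exact cubicMargin_small h h0 h1 hκ
  have hn' : (6 : ℝ) ≤ n := by exact_mod_cast h
  rcases lt_or_ge a (1 - 3 / n) with h2 | h2
  · refine cubicMargin_of_lt hn' h0 h2 (le_trans (le_add_of_nonneg_right ?_) hκ)
    have : 0 < 1 - a ^ n := sub_pos.2 (pow_lt_one₀ (by linarith) h1 (by omega))
    have : 0 ≤ a := by linarith
    positivity
  · refine cubicMargin_of_ge h (lt_of_lt_of_le ?_ h2) h1 hκ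
    gcongr
    norm_num

end Numerics

end

/-! ### The moment inequality for a shift. -/

section

open scoped ENNReal

section AffineWeight

variable {Ω : Type*} [MeasurableSpace Ω] {μ : Measure Ω} [IsProbabilityMeasure μ]

lemma integrable_inv_affine {p q : ℝ} (hp : 0 < p) (hq : 0 ≤ q) {y : Ω → ℝ} (hy : Measurable y)
    (h0 : ∀ᵐ ω ∂μ, 0 ≤ y ω) (n : ℕ) : Integrable (fun ω => (1 / (p + q * y ω)) ^ n) μ := by
  refine Integrable.of_bound (C := (1 / p) ^ n) (Measurable.aestronglyMeasurable (by fun_prop)) ?_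
  filter_upwards [h0] with ω h
  rw [Real.norm_of_nonneg (by positivity)]
  gcongr
  exact le_add_of_nonneg_right (by positivity)

lemma integrable_weight_moment {a : ℝ} (κ : ℝ) (h0 : 0 < a) (h1 : a < 1) {y : Ω → ℝ}
    (hy : Measurable y) (hy0 : ∀ᵐ ω ∂μ, 0 ≤ y ω) :
    Integrable (fun ω => κ * (1 / (1 - a + a * y ω)) - (1 / (1 - a + a * y ω)) ^ 2) μ := by
  have h := integrable_inv_affine (p := 1 - a) (by linarith) h0.le hy hy0
  have h1 := h 1
  simp only [pow_one] at h1
  exact (h1.const_mul κ).sub (h 2)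

/-- The difference of the weight and its square is `a (y - 1) / (1 - a + a y) ^ 2`, and divided by
`a` it decreases in `a` on either side of `y = 1`. Nonnegativity of the mean at `a₀` with `κ = 1`
thus settles all smaller `a`. -/
lemma weight_moment_le {a a₀ κ y : ℝ} (h0 : 0 < a) (ha : a ≤ a₀) (h1 : a₀ < 1) (hκ : 1 ≤ κ)
    (hy : 0 ≤ y) : a / a₀ * (1 / (1 - a₀ + a₀ * y) - (1 / (1 - a₀ + a₀ * y)) ^ 2) ≤
      κ * (1 / (1 - a + a * y)) - (1 / (1 - a + a * y)) ^ 2 := by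
  have ha0 : 0 < a₀ := h0.trans_le ha
  have hb0 : 0 < 1 - a₀ := by linarith
  have hb : 0 < 1 - a := by linarith
  have hD0 : 0 < 1 - a₀ + a₀ * y := by positivity
  have hD : 0 < 1 - a + a * y := by positivity
  have e : ∀ {t : ℝ}, 0 < 1 - t + t * y → 1 / (1 - t + t * y) - (1 / (1 - t + t * y)) ^ 2 =
      t * ((y - 1) / (1 - t + t * y) ^ 2) := fun {t} ht => by field_simp; ring
  have hle : 1 / (1 - a + a * y) ≤ κ * (1 / (1 - a + a * y)) :=
    le_mul_of_one_le_left (by positivity) hκ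
  refine le_trans ?_ (sub_le_sub_right hle _)
  rw [e hD0, e hD, ← mul_assoc, div_mul_cancel₀ _ ha0.ne']
  refine mul_le_mul_of_nonneg_left ?_ h0.le
  rcases le_total 1 y with h | h
  · exact div_le_div_of_nonneg_left (by linarith) (by positivity)
      (pow_le_pow_left₀ hD.le (by nlinarith) 2)
  · rw [div_le_div_iff₀ (by positivity) (by positivity)]
    exact mul_le_mul_of_nonpos_left (pow_le_pow_left₀ hD0.le (by nlinarith) 2) (by linarith)

lemma integral_weight_moment_nonneg_of_base {a a₀ κ : ℝ} (h0 : 0 < a) (ha : a ≤ a₀) (h1 : a₀ < 1)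
    (hκ : 1 ≤ κ) {y : Ω → ℝ} (hy : Measurable y) (hy0 : ∀ᵐ ω ∂μ, 0 ≤ y ω)
    (h : 0 ≤ ∫ ω, (1 * (1 / (1 - a₀ + a₀ * y ω)) - (1 / (1 - a₀ + a₀ * y ω)) ^ 2) ∂μ) :
    0 ≤ ∫ ω, (κ * (1 / (1 - a + a * y ω)) - (1 / (1 - a + a * y ω)) ^ 2) ∂μ := by
  have ha0 : 0 < a₀ := h0.trans_le ha
  refine (mul_nonneg (div_nonneg h0.le ha0.le) h).trans ?_
  rw [← integral_const_mul]
  refine integral_mono_ae ((integrable_weight_moment 1 ha0 h1 hy hy0).const_mul _)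
    (integrable_weight_moment κ h0 (ha.trans_lt h1) hy hy0) ?_
  filter_upwards [hy0] with ω hω
  simpa using weight_moment_le h0 ha h1 hκ hω

end AffineWeight

/-- The shift lies between the interference-to-signal form and its
phase-averaged majorant. -/
def IsShift {d : ℕ} (k j : Fin (d + 1)) (y : (Fin (d + 1) → Fin (d + 1) → ℂ) → ℝ) : Prop :=
  ∀ᵐ w ∂(framesLaw (d + 1)), leak k j w / sigPar k w ≤ y w ∧ y w ≤
    leak k j w / sigPar k w + 2 * (sigPerp k j w / sigPar k w) +
      sigPerp k j w ^ 2 / (sigPar k w * leak k j w)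

section Moment

variable {d : ℕ} {k j : Fin (d + 1)} {y : (Fin (d + 1) → Fin (d + 1) → ℂ) → ℝ}

lemma IsShift.nonneg (h : IsShift k j y) : ∀ᵐ w ∂(framesLaw (d + 1)), 0 ≤ y w := by
  filter_upwards [h] with w hw
  exact (div_nonneg (leak_nonneg k j w) (sigPar_nonneg k w)).trans hw.1

/-- The common scheme. Only the harmonic term keeps the shift itself; the remainder is evaluated at
its lower bound `leak / sigPar`, whose inverse moments are known. -/
lemma integral_weight_moment_nonneg_of_lower (hd : 2 ≤ d) (hjk : j ≠ k) (hy : Measurable y)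
    (hs : IsShift k j y) {a κ m p q K N : ℝ} (h0 : 0 < a) (h1 : a < 1) (hm : 0 ≤ m) (hp : 0 < p)
    (hq : 0 < q) (hK : 0 ≤ K) (hN : 0 ≤ N) {R : ℝ → ℝ} (hR : Measurable R)
    (hR0 : ∀ c, 0 < c → 0 ≤ R c)
    (hpt : ∀ c t, 0 < c → c ≤ t → m * (1 / (p + q * t)) - K * R c ≤
      κ * (1 / (1 - a + a * t)) - (1 / (1 - a + a * t)) ^ 2)
    (hRN : ∫⁻ w, ENNReal.ofReal (R (leak k j w / sigPar k w)) ∂(framesLaw (d + 1)) ≤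
      ENNReal.ofReal N)
    (hmar : K * N ≤ m * ((d + 2) / ((d + 1) * (2 * p + q * (d + 7))))) :
    0 ≤ ∫ w, (κ * (1 / (1 - a + a * y w)) - (1 / (1 - a + a * y w)) ^ 2)
      ∂(framesLaw (d + 1)) := by
  have hpos : ∀ᵐ w ∂(framesLaw (d + 1)), 0 < leak k j w / sigPar k w := by
    filter_upwards [ae_isFrame (by omega) k] with w hw
    exact div_pos (leak_pos hjk w hw) (sigPar_pos k w hw)
  have hi := integrable_and_integral_le (μ := framesLaw (d + 1))
    (f := fun w => R (leak k j w / sigPar k w)) (by fun_prop)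
    (hpos.mono fun w hw => hR0 _ hw) hN hRN
  have hi1 := integrable_inv_affine hp hq.le hy hs.nonneg 1
  simp only [pow_one] at hi1
  have hl := le_integral_inv_affine hd hjk hp hq hy hs
  have hle : ∫ w, (m * (1 / (p + q * y w)) - K * R (leak k j w / sigPar k w))
      ∂(framesLaw (d + 1)) ≤ ∫ w, (κ * (1 / (1 - a + a * y w)) - (1 / (1 - a + a * y w)) ^ 2)
        ∂(framesLaw (d + 1)) := by
    refine integral_mono_ae ((hi1.const_mul m).sub (hi.1.const_mul K))
      (integrable_weight_moment κ h0 h1 hy hs.nonneg) ?_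
    filter_upwards [hs, hpos] with w hw hc
    exact hpt _ _ hc hw.1
  refine le_trans ?_ hle
  rw [integral_sub (hi1.const_mul m) (hi.1.const_mul K), integral_const_mul, integral_const_mul]
  have h2 := mul_le_mul_of_nonneg_left hl hm
  have h3 := mul_le_mul_of_nonneg_left hi.2 hK
  linarith

lemma integral_weight_moment_nonneg_of_cubicMargin (hd : 3 ≤ d) (hjk : j ≠ k) (hy : Measurable y)
    (hs : IsShift k j y) {a κ : ℝ} (h0 : 0 < a) (h1 : a < 1) (hκ : 1 ≤ κ)
    (hmar : CubicMargin d a κ) :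
    0 ≤ ∫ w, (κ * (1 / (1 - a + a * y w)) - (1 / (1 - a + a * y w)) ^ 2)
      ∂(framesLaw (d + 1)) := by
  obtain ⟨b, hb⟩ : ∃ b, b = 1 - a := ⟨_, rfl⟩
  have hb0 : 0 < b := by linarith
  have hκ0 : 0 < κ := by linarith
  have hd' : (3 : ℝ) ≤ d := by exact_mod_cast hd
  have hd1 : (0 : ℝ) < d - 1 := by linarith
  have hd2 : (0 : ℝ) < d - 2 := by linarith
  have hd0 : (0 : ℝ) < d := by linarith
  obtain ⟨L, hL⟩ : ∃ L : ℝ, L = 12 * (d - 2) * b + (d - 1) * (d + 2) * a := ⟨_, rfl⟩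
  have hL0 : 0 < L := by rw [hL]; positivity
  -- The weight minimizing the two-term bound, proportional to the coefficient of the other term.
  have hN := lintegral_inv_cube_le hd hjk h0 h1 (12 * (d - 2) * b / L)
  have e : (12 * (d - 2) * b / L) ^ 2 * ((d - 1) / (2 * d * (d + 1) * a * (1 - a) ^ 2)) +
        (1 - 12 * (d - 2) * b / L) ^ 2 * (6 * (d - 2) / (d * (d + 1) * (d + 2) * a ^ 2 * (1 - a))) =
      6 * (d - 1) * (d - 2) / (a * b * d * (d + 1) * L) := by
    have h2 : 1 - 12 * (d - 2) * b / L = (d - 1) * (d + 2) * a / L := by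
      rw [one_sub_div hL0.ne']; congr 1; rw [hL]; ring
    rw [h2, ← hb]
    field_simp
    rw [hL]
    ring
  rw [e] at hN
  refine integral_weight_moment_nonneg_of_lower (by omega) hjk hy hs (m := κ ^ 2)
    (p := κ * b + 2) (q := κ * a) (K := 11 / 32 / κ)
    (R := fun c => 1 / (1 - a + a * c) ^ 3) h0 h1 (by positivity) (by positivity) (by positivity)
    (by positivity) (by positivity) (by fun_prop)
    (fun c hc => by rw [← hb]; positivity) ?_ hN ?_
  · intro c t hc ht
    rw [← hb]
    have ht0 : 0 < t := hc.trans_le ht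
    have hv : 0 < b + a * t := by positivity
    have hle : 1 / (b + a * t) ^ 3 ≤ 1 / (b + a * c) ^ 3 := by gcongr
    have h2 : κ ^ 2 * (1 / (κ * b + 2 + κ * a * t)) - 11 / 32 / κ * (1 / (b + a * t) ^ 3) ≤
        κ * (1 / (b + a * t)) - (1 / (b + a * t)) ^ 2 := by
      have e1 : κ * b + 2 + κ * a * t = κ * (b + a * t) + 2 := by ring
      rw [e1]
      obtain ⟨v, hv'⟩ : ∃ v, v = b + a * t := ⟨_, rfl⟩
      rw [← hv'] at hv ⊢
      -- The discriminant condition `(2 - c) ^ 2 ≤ 8 c` holds from `c = 6 - 4 √2` on; `11 / 32` lies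
      -- just above.
      have hq : 0 ≤ κ ^ 2 * v ^ 2 - (2 - 11 / 32) * (κ * v) + 2 * (11 / 32) := by
        nlinarith [sq_nonneg (κ * v - (2 - 11 / 32) / 2)]
      rw [← sub_nonneg]
      have e2 : κ * (1 / v) - (1 / v) ^ 2 - (κ ^ 2 * (1 / (κ * v + 2)) - 11 / 32 / κ * (1 / v ^ 3)) =
          (κ ^ 2 * v ^ 2 - (2 - 11 / 32) * (κ * v) + 2 * (11 / 32)) /
            (κ * v ^ 3 * (κ * v + 2)) := by
        field_simp
        ring
      rw [e2]
      positivity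
    have h3 := mul_le_mul_of_nonneg_left hle (by positivity : 0 ≤ 11 / 32 / κ)
    linarith
  · unfold CubicMargin at hmar
    rw [← hb, ← hL] at hmar
    have e1 : 2 * (κ * b + 2) + κ * a * ((d : ℝ) + 7) = 4 + κ * (2 + a * (d + 5)) := by
      rw [hb]; ring
    rw [e1, div_mul_div_comm, mul_div_assoc', div_le_div_iff₀ (by positivity) (by positivity)]
    have h2 := mul_le_mul_of_nonneg_left hmar (by positivity : (0 : ℝ) ≤ d + 1)
    linarith

end Moment

section ThreeAntennas

variable {k j : Fin (2 + 1)} {y : (Fin (2 + 1) → Fin (2 + 1) → ℂ) → ℝ}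

/-- The cubic remainder needs `d ≥ 3`, so for `d = 2` a squared one is used, offset by `3 / 10`. The
base error is `2 / 5`, and the final numerical margin is small. -/
lemma integral_weight_moment_nonneg_two_base (hjk : j ≠ k) (hy : Measurable y)
    (hs : IsShift k j y) :
    0 ≤ ∫ w, (1 * (1 / (1 - 2 / 5 + 2 / 5 * y w)) - (1 / (1 - 2 / 5 + 2 / 5 * y w)) ^ 2)
      ∂(framesLaw (2 + 1)) := by
  refine integral_weight_moment_nonneg_of_lower le_rfl hjk hy hs (m := 1)
    (p := 18 / 5) (q := 2 / 5) (K := 12 / 25) (R := fun c => 1 / (3 / 10 + c) ^ 2)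
    (by norm_num) (by norm_num) (by norm_num) (by norm_num) (by norm_num)
    (by norm_num) (by norm_num) (by fun_prop) (fun c hc => by positivity) ?_
    (lintegral_inv_sq_le hjk (by norm_num)) (by norm_num)
  intro c t hc ht
  have ht0 : 0 < t := hc.trans_le ht
  have hle : 1 / (3 / 10 + t) ^ 2 ≤ 1 / (3 / 10 + c) ^ 2 := by gcongr
  refine le_trans (sub_le_sub_left (mul_le_mul_of_nonneg_left hle (by norm_num)) _) ?_
  rw [← sub_nonneg]
  have e : 1 * (1 / (1 - 2 / 5 + 2 / 5 * t)) - (1 / (1 - 2 / 5 + 2 / 5 * t)) ^ 2 -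
      (1 * (1 / (18 / 5 + 2 / 5 * t)) - 12 / 25 * (1 / (3 / 10 + t) ^ 2)) =
      (12 / 25 * ((3 + 2 * t) ^ 2 * (18 + 2 * t)) - 25 * (9 - 4 * t) * (3 / 10 + t) ^ 2) /
        ((3 / 10 + t) ^ 2 * ((3 + 2 * t) ^ 2 * (18 + 2 * t))) := by
    have : 1 - 2 / 5 + 2 / 5 * t = (3 + 2 * t) / 5 := by ring
    rw [this]
    field_simp
    ring
  rw [e]
  refine div_nonneg ?_ (by positivity)
  nlinarith [mul_nonneg ht0.le (sq_nonneg (t - 4 / 5)), sq_nonneg (t - 4 / 5)]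

/-- In the variable `s = κ v / 2`, with `v` the affine form, the pointwise bound becomes the
one-variable inequality `hK`; here `g` bounds `κ (1 - a) / 2` from below, the least value of `s`. -/
lemma integral_weight_moment_nonneg_two_of_bound (hjk : j ≠ k) (hy : Measurable y)
    (hs : IsShift k j y) {a κ g K : ℝ} (h0 : 0 < a) (h1 : a < 1) (hκ : 1 ≤ κ * (1 - a ^ 2))
    (hg : g * (2 * (1 + a)) ≤ 1) (hK0 : 0 ≤ K)
    (hK : ∀ t, g ≤ t → (1 - t) * (t - g) ^ 2 ≤ K * (t ^ 2 * (1 + t)))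
    (hmar : K / 2 * (4 * (1 - a ^ 2) ^ 2 + (1 - a ^ 2) * (2 + 7 * a)) ≤ 4 / 3 * a ^ 2) :
    0 ≤ ∫ w, (κ * (1 / (1 - a + a * y w)) - (1 / (1 - a + a * y w)) ^ 2)
      ∂(framesLaw (2 + 1)) := by
  obtain ⟨b, hb⟩ : ∃ b, b = 1 - a := ⟨_, rfl⟩
  have hb0 : 0 < b := by linarith
  have hm0 : 0 < 1 - a ^ 2 := by nlinarith
  have hκ0 : 0 < κ := by
    by_contra h
    nlinarith [mul_nonneg (by linarith : 0 ≤ -κ) hm0.le]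
  have hgb : 2 * g ≤ κ * b := by
    have e : κ * (1 - a ^ 2) = κ * b * (1 + a) := by rw [hb]; ring
    rw [e] at hκ
    have : 0 < 1 + a := by linarith
    nlinarith
  refine integral_weight_moment_nonneg_of_lower le_rfl hjk hy hs (m := κ)
    (p := b + 2 / κ) (q := a) (K := K / a ^ 2) (N := 1 / 2) (R := fun c => 1 / c ^ 2)
    h0 h1 hκ0.le (by positivity) h0 (by positivity) (by norm_num) (by fun_prop)
    (fun c hc => by positivity) ?_ (lintegral_inv_sq_le_half hjk) ?_
  · intro c t hc ht
    have ht0 : 0 < t := hc.trans_le ht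
    have hle : 1 / t ^ 2 ≤ 1 / c ^ 2 := by gcongr
    refine le_trans (sub_le_sub_left (mul_le_mul_of_nonneg_left hle (by positivity)) _) ?_
    rw [← hb]
    obtain ⟨v, hv⟩ : ∃ v, v = b + a * t := ⟨_, rfl⟩
    have hv0 : 0 < v := by rw [hv]; positivity
    have hvb : 0 < v - b := by rw [hv]; simpa using mul_pos h0 ht0
    have ht' : t = (v - b) / a := by rw [hv]; field_simp; ring
    have e1 : b + 2 / κ + a * t = (κ * v + 2) / κ := by rw [hv]; field_simp; ring
    have e2 : K / a ^ 2 * (1 / t ^ 2) = K / (v - b) ^ 2 := by rw [ht']; field_simp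
    rw [e1, e2, ← hv, ← sub_nonneg]
    have e3 : κ * (1 / v) - (1 / v) ^ 2 - (κ * (1 / ((κ * v + 2) / κ)) - K / (v - b) ^ 2) =
        (K * (v ^ 2 * (κ * v + 2)) - (2 - κ * v) * (v - b) ^ 2) /
          (v ^ 2 * (κ * v + 2) * (v - b) ^ 2) := by
      field_simp
      ring
    rw [e3]
    refine div_nonneg (sub_nonneg.2 ?_) (by positivity)
    obtain ⟨s, hs⟩ : ∃ s, s = κ * v / 2 := ⟨_, rfl⟩
    have hgs : g ≤ s := by rw [hs]; nlinarith
    rcases le_total 1 s with h | h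
    · have h2 : (2 - κ * v) * (v - b) ^ 2 ≤ 0 :=
        mul_nonpos_of_nonpos_of_nonneg (by linarith) (sq_nonneg _)
      exact h2.trans (by positivity)
    have hle2 : (2 - κ * v) * (κ * (v - b)) ^ 2 ≤ 8 * ((1 - s) * (s - g) ^ 2) := by
      have h3 : κ * (v - b) ≤ 2 * (s - g) := by rw [hs]; linarith
      have h4 : (κ * (v - b)) ^ 2 ≤ (2 * (s - g)) ^ 2 :=
        pow_le_pow_left₀ (by positivity) h3 2
      have h5 : 2 - κ * v = 2 * (1 - s) := by rw [hs]; ring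
      rw [h5]
      nlinarith [mul_le_mul_of_nonneg_left h4 (by linarith : 0 ≤ 2 * (1 - s))]
    have h6 := hK s hgs
    have h7 : κ ^ 2 * ((2 - κ * v) * (v - b) ^ 2) ≤ κ ^ 2 * (K * (v ^ 2 * (κ * v + 2))) := by
      calc _ = (2 - κ * v) * (κ * (v - b)) ^ 2 := by ring
        _ ≤ 8 * (K * (s ^ 2 * (1 + s))) := by linarith
        _ = _ := by rw [hs]; ring
    exact le_of_mul_le_mul_left h7 (by positivity)
  · have e1 : 2 * (b + 2 / κ) + a * (((2 : ℕ) : ℝ) + 7) = (4 + κ * (2 + 7 * a)) / κ := by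
      rw [hb]; push_cast; field_simp; ring
    rw [e1]
    have h2 : K / 2 * (4 + κ * (2 + 7 * a)) ≤ κ ^ 2 * (4 / 3 * a ^ 2) := by
      refine le_trans ?_ (mul_le_mul_of_nonneg_left hmar (sq_nonneg κ))
      have h3 : 1 ≤ (κ * (1 - a ^ 2)) ^ 2 := one_le_pow₀ hκ
      have h4 : κ * (2 + 7 * a) ≤ κ * (κ * (1 - a ^ 2)) * (2 + 7 * a) :=
        mul_le_mul_of_nonneg_right (le_mul_of_one_le_right hκ0.le hκ) (by linarith)
      have h5 : 4 + κ * (2 + 7 * a) ≤ κ ^ 2 * (4 * (1 - a ^ 2) ^ 2 + (1 - a ^ 2) * (2 + 7 * a)) := by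
        linarith
      have := mul_le_mul_of_nonneg_left h5 (by linarith : 0 ≤ K / 2)
      linarith
    push_cast
    rw [div_mul_div_comm, mul_div_assoc', div_le_div_iff₀ (by positivity) (by positivity)]
    have hκa : 0 < 4 + κ * (2 + 7 * a) := by positivity
    field_simp
    nlinarith

lemma integral_weight_moment_nonneg_two (hjk : j ≠ k) (hy : Measurable y)
    (hs : IsShift k j y) {a κ : ℝ} (h0 : 0 < a) (h1 : a < 1)
    (hκ : 1 + (2 : ℕ) / 2 * (a ^ 2 / (1 - a ^ 2)) ≤ κ) :
    0 ≤ ∫ w, (κ * (1 / (1 - a + a * y w)) - (1 / (1 - a + a * y w)) ^ 2)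
      ∂(framesLaw (2 + 1)) := by
  have hm0 : 0 < 1 - a ^ 2 := by nlinarith
  have e : 1 + ((2 : ℕ) : ℝ) / 2 * (a ^ 2 / (1 - a ^ 2)) = 1 / (1 - a ^ 2) := by
    push_cast; field_simp; ring
  rw [e, div_le_iff₀ hm0] at hκ
  rcases le_total a (2 / 5) with h | h
  · refine integral_weight_moment_nonneg_of_base h0 h (by norm_num) ?_ hy hs.nonneg
      (integral_weight_moment_nonneg_two_base hjk hy hs)
    nlinarith
  -- One may take `g = 1 / (2 (1 + a))`; `1 / 3` and `1 / 4` are its values at the right ends of the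
  -- two ranges, and `K` is fitted to each.
  rcases le_total a (1 / 2) with h2 | h2
  · refine integral_weight_moment_nonneg_two_of_bound hjk hy hs (g := 1 / 3) (K := 13 / 250) h0 h1 hκ
      (by linarith) (by norm_num) (fun t ht => ?_) ?_
    · nlinarith [mul_nonneg (sub_nonneg.2 ht) (sq_nonneg (t - 16 / 25)), sq_nonneg (t - 16 / 25)]
    · nlinarith [mul_nonneg (sub_nonneg.2 h) (sub_nonneg.2 h2), pow_nonneg h0.le 3, pow_nonneg h0.le 4]
  · refine integral_weight_moment_nonneg_two_of_bound hjk hy hs (g := 1 / 4) (K := 9 / 100) h0 h1 hκ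
      (by linarith) (by norm_num) (fun t ht => ?_) ?_
    · nlinarith [mul_nonneg (sub_nonneg.2 ht) (sq_nonneg (t - 14 / 25)), sq_nonneg (t - 14 / 25)]
    · nlinarith [mul_nonneg (sub_nonneg.2 h1.le) (sub_nonneg.2 h2), pow_nonneg h0.le 3, pow_nonneg h0.le 4]

end ThreeAntennas

end

/-! ### The growth factor, the case of two antennas, and the doubling inequality. -/

section

open scoped ENNReal

lemma two_mul_exp_sub_one_le {x : ℝ} (hx : 0 ≤ x) :
    2 * (Real.exp x - 1) ≤ x * (Real.exp x + 1) := by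
  have hm : MonotoneOn (fun x : ℝ => x * (Real.exp x + 1) - 2 * (Real.exp x - 1)) (Set.Ici 0) := by
    refine monotoneOn_of_hasDerivWithinAt_nonneg (convex_Ici 0) (by fun_prop)
      (f' := fun x => 1 + (x - 1) * Real.exp x) (fun x _ => ?_) fun x _ => ?_
    · refine HasDerivAt.hasDerivWithinAt ?_
      have h1 := Real.hasDerivAt_exp x
      refine (((hasDerivAt_id x).mul (h1.add_const 1)).sub ((h1.sub_const 1).const_mul 2)).congr_deriv
        ?_
      simp only [id]
      ring
    · have h1 := Real.add_one_le_exp (-x)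
      have h2 : Real.exp (-x) * Real.exp x = 1 := by rw [← Real.exp_add]; simp
      nlinarith [mul_le_mul_of_nonneg_right h1 (Real.exp_pos x).le]
  have h := hm (Set.mem_Ici.2 le_rfl) (Set.mem_Ici.2 hx) hx
  simp only [Real.exp_zero] at h
  linarith

/-- Here `a ^ d / (1 - a ^ d)` is `exp x - 1`, and the trapezoidal bound for the mean of `exp` over
`[0, x]` gives the factor `1 / 2`. This makes the growth factor rational in `a`. -/
lemma growth_ge {d : ℕ} (hd : d ≠ 0) {x : ℝ} (hx : 0 < x) :
    1 + d / 2 * (errorOf d x ^ d / (1 - errorOf d x ^ d)) ≤ growth d x := by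
  have hu : 0 ≤ 1 - Real.exp (-x) := by
    rw [sub_nonneg, Real.exp_le_one_iff]; linarith
  have e1 : errorOf d x ^ d = 1 - Real.exp (-x) := by
    rw [errorOf, one_div, Real.rpow_inv_natCast_pow hu hd]
  have e2 : (1 - Real.exp (-x)) / (1 - (1 - Real.exp (-x))) = Real.exp x - 1 := by
    rw [sub_sub_cancel, Real.exp_neg]
    field_simp
  rw [e1, e2, growth, div_mul_eq_mul_div, mul_div_assoc]
  have h := two_mul_exp_sub_one_le hx.le
  have h3 : (Real.exp x - 1) / x ≤ (Real.exp x + 1) / 2 := by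
    rw [div_le_div_iff₀ hx two_pos]; linarith
  gcongr
  linarith

/-- With two antennas the only interfering beam is a unit vector without `k` component. -/
lemma leak_eq_one {k j : Fin (1 + 1)} (hjk : j ≠ k) {w : Fin (1 + 1) → Fin (1 + 1) → ℂ}
    (h : IsFrame k w) : leak k j w = 1 := by
  have hu : ∀ f : Fin (1 + 1) → ℝ, ∑ i, f i = f k + f j := fun f => by
    rw [← Finset.add_sum_erase _ _ (Finset.mem_univ k)]
    congr 1
    have : (Finset.univ.erase k : Finset (Fin (1 + 1))) = {j} := by
      ext i; simp only [Finset.mem_erase, Finset.mem_univ, and_true, Finset.mem_singleton]; omega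
    rw [this, Finset.sum_singleton]
  have h1 : leak k j w = ‖frame k w j j‖ ^ 2 := by
    have := Finset.add_sum_erase _ (fun i => ‖frame k w i j‖ ^ 2) (Finset.mem_univ k)
    rw [hu] at this
    rw [leak]
    linarith
  have h2 := l2norm_sq (frame k w j)
  rw [l2norm_frame h, hu, frame_apply_eq_zero hjk] at h2
  rw [h1]
  simpa using h2.symm

/-- The moment inequality behind the convexity of the user rate in the number of codewords. -/
theorem integral_growth_mul_weight_sub_nonneg {d : ℕ} (hd : d ≠ 0) {k j : Fin (d + 1)} (hjk : j ≠ k)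
    {x : ℝ} (hx : 0 < x) {y : (Fin (d + 1) → Fin (d + 1) → ℂ) → ℝ} (hy : Measurable y)
    (hs : IsShift k j y) :
    0 ≤ ∫ w, (growth d x * weight d x (y w) - weight d x (y w) ^ 2) ∂(framesLaw (d + 1)) := by
  obtain ⟨h0, h1⟩ := errorOf_mem hx hd
  have hg := growth_ge hd hx
  unfold weight
  generalize growth d x = κ at *
  generalize errorOf d x = a at *
  have hu : 0 < 1 - a ^ d := sub_pos.2 (pow_lt_one₀ h0.le h1 hd)
  have hκ : 1 ≤ κ := le_trans (le_add_of_nonneg_right (by positivity)) hg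
  rcases (by omega : d = 1 ∨ d = 2 ∨ 3 ≤ d) with rfl | rfl | h3
  -- For `d = 1` the shift is at least `1 / sigPar ≥ 1`, so the weight is at most `1` and the
  -- integrand is nonnegative pointwise.
  · refine integral_nonneg_of_ae ?_
    filter_upwards [hs, ae_isFrame hd k] with w hw hf
    rw [leak_eq_one hjk hf] at hw
    have hA := sigPar_pos k w hf
    have h2 : 1 ≤ y w := (one_le_one_div hA (sigPar_le_one hf)).trans hw.1
    have h3 : 1 ≤ 1 - a + a * y w := by nlinarith
    have h4 : 1 / (1 - a + a * y w) ≤ 1 := by rw [div_le_one (by linarith)]; exact h3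
    have h5 : 0 < 1 / (1 - a + a * y w) := by positivity
    simp only [Pi.zero_apply]
    nlinarith
  · exact integral_weight_moment_nonneg_two hjk hy hs h0 h1 hg
  · have h3' : (3 : ℝ) ≤ d := by exact_mod_cast h3
    rcases le_total a (3 / 10) with h | h
    · exact integral_weight_moment_nonneg_of_base h0 h (by norm_num) hκ hy hs.nonneg
        (integral_weight_moment_nonneg_of_cubicMargin h3 hjk hy hs (by norm_num) (by norm_num) le_rfl
          (cubicMargin_base h3'))
    · exact integral_weight_moment_nonneg_of_cubicMargin h3 hjk hy hs h0 h1 hκ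
        (cubicMargin_of_growth h3 h h1 hg)

/-- Doubling convexity of the limiting user rate in the error exponent. -/
theorem exponentRate_doubling {M : ℕ} (hM : 2 ≤ M) {k j : Fin M} (hjk : j ≠ k) {r : ℝ}
    (hr : 0 < r) :
    2 * exponentRate k j (2 * r) ≤ exponentRate k j r + exponentRate k j (4 * r) := by
  obtain ⟨d, rfl⟩ : ∃ d, M = d + 1 := ⟨M - 1, by omega⟩
  have hd : d ≠ 0 := by omega
  have e : ∀ x, 0 < x → exponentRate k j x = ∫⁻ w, ENNReal.ofReal (Real.log
      (largeRoot ((1 - errorOf d x) / errorOf d x) (sigPar k w) (sigPerp k j w) (leak k j w) /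
        leak k j w)) ∂(framesLaw (d + 1)) := fun x hx => by
    obtain ⟨h0, h1⟩ := errorOf_mem hx hd
    exact errorRate_eq_lintegral_log hM hjk h0 h1
  rw [e _ hr, e _ (by linarith), e _ (by linarith)]
  refine lintegral_log_largeRoot_doubling hd (measurable_sigPar k) (measurable_sigPerp k j)
    (measurable_leak k j) ?_ (fun x hx y hy hs =>
      integral_growth_mul_weight_sub_nonneg hd hjk hx hy hs) hr
  filter_upwards [ae_isFrame hd k] with w hw
  exact ⟨sigPar_pos k w hw, sigPerp_nonneg k j w, leak_pos hjk w hw⟩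

end

end FeedbackSharing

end

theorem corollary2 (M : ℕ) (hM : 2 ≤ M) (bbar : ℕ) :
    ∃ L : (Fin M → ℕ) → ℝ,
      (∀ b : Fin M → ℕ,
        (∀ P : ℝ, 0 < P → ∀ k : Fin M,
          Integrable (fun ω => FeedbackSharing.instRate P k ω)
            (FeedbackSharing.outcomeLaw M b)) ∧
        Tendsto (fun P : ℝ => FeedbackSharing.sumRate M P b) atTop (𝓝 (L b))) ∧
      ∀ b : Fin M → ℕ, ∑ k, b k = M * bbar →
        (∀ j : Fin M, L b ≤ L (Pi.single j (M * bbar))) ∧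
        L (fun _ => bbar) ≤ L b := by
  exact FeedbackSharing.optimal_sharing_of_core M hM bbar fun k j hjk r hr =>
    FeedbackSharing.exponentRate_doubling hM hjk hr
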